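/- Let $d\ge 4$. In Minkowski spacetime $(\mathbb R^d,\eta)$ with inertial coordinates $(t,x)$, let $r=|x|$, $u=t-r$, let $x^A$ denote coordinates on the unit sphere $S^{d-2}$ with round metric $q_{AB}$, derivative operator $\mathcal D_A$ and Laplacian $\mathcal D^2$. A superscript $(n)$ denotes the coefficient of $1/r^n$ in the asymptotic expansion as $r\to\infty$ at fixed $(u,x^A)$ of components in a Cartesian (or normalized) basis. Let $g=\eta+h$ be a Lorentzian metric, smooth near future null infinity, that satisfies the full Einstein equation $G_{ab}=8\pi T_{ab}$, where * $h_{ab}\sim\sum_n r^{-n}h^{(n)}_{ab}(u,x^A)$, $n$ running over $d/2-1,d/2,d/2+1,\dots$ and, when $d$ is odd, also over the integers $\ge d-3$ (derivatives of the remainder in $u$, $x^A$ have the same fall-off, and each derivative in $r$ improves it by a power of $1/r$); * $T_{ab}\sim\sum_{n\ge d-2}r^{-n}T^{(n)}_{ab}(u,x^A)$ obeys the dominant energy condition, and $T^{(d-2)}_{ab}\to0$ as $u\to-\infty$; * $\partial_u h^{(n)}_{\mu\nu}\to0$ as $u\to\pm\infty$ for all $n\le d-3$, smoothly on the sphere.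 Let $$\Delta_{\mu\nu}=-\int_{-\infty}^{\infty}du'\int_{-\infty}^{u'}du''\,C^{(d-3)}_{u\nu u\mu}$$ be the Coulombic order memory tensor, where $C_{abcd}$ is the Weyl tensor of $g$ (the improper integrals being assumed to converge smoothly on the sphere). Decompose $\Delta=\Delta^{\rm S}+\Delta^{\rm V}+\Delta^{\rm T}$ into its scalar, vector and tensor parts, all with vanishing $u$-components: $$\Delta^{\rm S}_{rr}=-U,\quad \Delta^{\rm S}_{rA}=\mathcal D_AR,\quad \Delta^{\rm S}_{AB}=\Big(\mathcal D_A\mathcal D_B-\tfrac1{d-2}q_{AB}\mathcal D^2\Big)\Theta+\tfrac1{d-2}q_{AB}U;$$ $$\Delta^{\rm V}_{rr}=0,\quad \Delta^{\rm V}_{rA}=R_A,\quad \Delta^{\rm V}_{AB}=\mathcal D_{(A}S_{B)};\qquad \Delta^{\rm T}_{rr}=\Delta^{\rm T}_{rA}=0,\quad \Delta^{\rm T}_{AB}=S_{AB},$$ with $U,R,\Theta$ smooth functions, $R_A,S_A$ smooth and divergence-free, and $S_{AB}$ smooth, symmetric, trace-free and divergence-free on $S^{d-2}$. Then the following hold ($\nabla$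 is the flat derivative operator). 1. (Scalar memory.) There is a covector field $\xi_\mu$ of the form $$\xi^{(n)}_\mu=0\ (n<d-4),\qquad \xi^{(d-4)}_\mu=J_\mu(x^A),\qquad \xi^{(d-3)}_\mu=u\,B_\mu(x^A)$$ (with no half-integer order in between) such that $[\nabla_{(\mu}\xi_{\nu)}]^{(n)}=0$ for $n<d-3$ and $[\nabla_{(\mu}\xi_{\nu)}]^{(d-3)}=\Delta^{\rm S}_{\mu\nu}$. If $d=4$, then $\xi$ can moreover be taken to be a supertranslation, i.e. $\xi^a=\alpha(\partial_u)^a+\tfrac12\mathcal D^2\alpha\,(\partial_r)^a-\tfrac1r\mathcal D^C\alpha\,(\partial_C)^a+o(1)$ as $r\to\infty$ for a smooth function $\alpha$ on $S^2$. If $d>4$, then $\xi$ can moreover be taken to be pure gauge: $\nabla_{(a}\xi_{b)}$ satisfies the above ansatz for perturbations, and its symplectic product at null infinity, $\int du\int_{S^{d-2}}\lim_{r\to\infty}r^{d-2}w_u$, where $w^a$ is the symplectic current of linearized general relativity on Minkowski spacetime, vanishes with every symmetric perturbation $\gamma_{ab}$ that satisfies the ansatz. 2. (Vector and tensor memory.)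 If $\Delta^{\rm V}\ne0$, then no smooth covector field $\xi_\mu$ with an asymptotic expansion in powers of $r^{-1/2}$, starting at any order, satisfies $[\nabla_{(\mu}\xi_{\nu)}]^{(d-3)}=\Delta_{\mu\nu}$, and none satisfies $[\nabla_{(\mu}\xi_{\nu)}]^{(d-3)}=\Delta^{\rm V}_{\mu\nu}$. If $\Delta^{\rm T}\ne0$, then none satisfies $[\nabla_{(\mu}\xi_{\nu)}]^{(d-3)}=\Delta_{\mu\nu}$, and none satisfies $[\nabla_{(\mu}\xi_{\nu)}]^{(d-3)}=\Delta^{\rm T}_{\mu\nu}$. -/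

import Mathlib

open Filter Topology MeasureTheory Asymptotics
open scoped ContDiff

namespace NullMemory

noncomputable section

/- Throughout, `m` is the number of space dimensions, so that spacetime has dimension `d = m + 1`.
Spacetime tensors are given by their components in the global inertial coordinates
`(t, x¹, …, xᵐ)`, the index `0` being the time index. -/

/-- Euclidean space of dimension `m`; its unit sphere is the sphere of directions, of
dimension `d - 2 = m - 1`. -/
abbrev Space (m : ℕ) := EuclideanSpace ℝ (Fin m)

/-- The points of spacetime, in global inertial coordinates. -/
abbrev Event (m : ℕ) := Fin (m + 1) → ℝ

/-- The round unit sphere of directions. -/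
def unitSphere (m : ℕ) : Set (Space m) := Metric.sphere 0 1

/-- The event with retarded time `u = t - r`, radius `r` and direction `θ`. -/
def event {m : ℕ} (u r : ℝ) (θ : Space m) : Event m :=
  Fin.cons (u + r) (fun i => r * θ i)

/-! ### Calculus on the round unit sphere

A function on the sphere is given by its values at the unit vectors. It is differentiated through
its extension to `y ≠ 0` that is constant along rays. Tensor fields on the sphere are given by their
Cartesian components, and their covariant derivative is the tangential projection of the
componentwise derivative. -/

/-- The direction `y / |y|`. -/
def dir {m : ℕ} (y : Space m) : Space m := ‖y‖⁻¹ • y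

/-- The extension of a function on the sphere that is constant along rays. -/
def radialExt {m : ℕ} {F : Type*} (f : Space m → F) : Space m → F := fun y => f (dir y)

/-- Smooth functions on the sphere. -/
def SmoothOnSphere {m : ℕ} (f : Space m → ℝ) : Prop :=
  ContDiffOn ℝ ∞ (radialExt f) {y | y ≠ 0}

/-- Convergence in `C^∞` of the sphere: uniform convergence together with all derivatives. -/
def TendstoSmoothly {m : ℕ} {ι : Type*} (F : ι → Space m → ℝ) (l : Filter ι)
    (f : Space m → ℝ) : Prop :=
  SmoothOnSphere f ∧
    ∀ a : ℕ, TendstoUniformlyOn (fun s => iteratedFDeriv ℝ a (radialExt (F s)))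
      (iteratedFDeriv ℝ a (radialExt f)) l (unitSphere m)

/-- Partial derivative of a function on Euclidean space. -/
def spatialDeriv {m : ℕ} (i : Fin m) (f : Space m → ℝ) (y : Space m) : ℝ :=
  fderiv ℝ f y (EuclideanSpace.single i 1)

/-- The metric of the sphere, i.e. the projection onto the tangent space. -/
def sphereMetric {m : ℕ} (θ : Space m) (i j : Fin m) : ℝ :=
  (if i = j then 1 else 0) - θ i * θ j

/-- `D_i f`. -/
def gradS {m : ℕ} (f : Space m → ℝ) (θ : Space m) (i : Fin m) : ℝ :=
  spatialDeriv i (radialExt f) θ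

/-- `D_i v_j` for a covector field on the sphere. -/
def covDerivS {m : ℕ} (v : Space m → Fin m → ℝ) (θ : Space m) (i j : Fin m) : ℝ :=
  ∑ k, sphereMetric θ j k * spatialDeriv i (radialExt fun y => v y k) θ

/-- `D_i t_{jk}` for a rank two tensor field on the sphere. -/
def covDerivS₂ {m : ℕ} (t : Space m → Fin m → Fin m → ℝ) (θ : Space m) (i j k : Fin m) : ℝ :=
  ∑ a, ∑ b, sphereMetric θ j a * sphereMetric θ k b *
    spatialDeriv i (radialExt fun y => t y a b) θ

/-- The Hessian `D_i D_j f`. -/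
def hessS {m : ℕ} (f : Space m → ℝ) : Space m → Fin m → Fin m → ℝ := covDerivS (gradS f)

/-- The Laplacian `D² f`. -/
def laplacianS {m : ℕ} (f : Space m → ℝ) (θ : Space m) : ℝ := ∑ i, hessS f θ i i

/-- The divergence `D^i v_i`. -/
def divS {m : ℕ} (v : Space m → Fin m → ℝ) (θ : Space m) : ℝ := ∑ i, covDerivS v θ i i

/-- The divergence `D^i t_{ij}`. -/
def divS₂ {m : ℕ} (t : Space m → Fin m → Fin m → ℝ) (θ : Space m) (j : Fin m) : ℝ :=
  ∑ i, covDerivS₂ t θ i i j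

/-- `D_{(i} v_{j)}`. -/
def symCovDerivS {m : ℕ} (v : Space m → Fin m → ℝ) (θ : Space m) (i j : Fin m) : ℝ :=
  (covDerivS v θ i j + covDerivS v θ j i) / 2

/-- `(D_i D_j - q_{ij} D² / (d - 2)) f`. -/
def traceFreeHessS {m : ℕ} (f : Space m → ℝ) (θ : Space m) (i j : Fin m) : ℝ :=
  hessS f θ i j - sphereMetric θ i j * laplacianS f θ / ((m : ℝ) - 1)

/-- A smooth, divergence-free tangent covector field on the sphere. -/
structure IsVectorType {m : ℕ} (v : Space m → Fin m → ℝ) : Prop where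
  smooth : ∀ i, SmoothOnSphere fun θ => v θ i
  tangent : ∀ θ ∈ unitSphere m, ∑ i, θ i * v θ i = 0
  divergenceFree : ∀ θ ∈ unitSphere m, divS v θ = 0

/-- A smooth, symmetric, trace-free, divergence-free tangent tensor field on the sphere. -/
structure IsTensorType {m : ℕ} (t : Space m → Fin m → Fin m → ℝ) : Prop where
  smooth : ∀ i j, SmoothOnSphere fun θ => t θ i j
  symm : ∀ θ ∈ unitSphere m, ∀ i j, t θ i j = t θ j i
  tangent : ∀ θ ∈ unitSphere m, ∀ j, ∑ i, θ i * t θ i j = 0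
  traceFree : ∀ θ ∈ unitSphere m, ∑ i, t θ i i = 0
  divergenceFree : ∀ θ ∈ unitSphere m, ∀ j, divS₂ t θ j = 0

/-! ### Asymptotic expansions at future null infinity -/

/-- Open sets that contain, for all `u` and `θ`, all points with large enough `r`. -/
def IsScriNbhd {m : ℕ} (Ω : Set (Event m)) : Prop :=
  IsOpen Ω ∧ ∀ u : ℝ, ∀ θ ∈ unitSphere m, ∀ᶠ r in atTop, event u r θ ∈ Ω

/-- Smooth functions of `(u, θ)`. -/
def SmoothCoeff {m : ℕ} (c : ℝ → Space m → ℝ) : Prop :=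
  ContDiffOn ℝ ∞ (fun p : ℝ × Space m => c p.1 (dir p.2)) {p | p.2 ≠ 0}

/-- The remainder `f - ∑_{k₀ ≤ k ≤ N} r^{-k/2} c_k`, in the coordinates `(u, r, y / |y|)`. -/
def remainder {m : ℕ} (f : Event m → ℝ) (c : ℤ → ℝ → Space m → ℝ) (k₀ N : ℤ)
    (u r : ℝ) (y : Space m) : ℝ :=
  f (event u r (dir y)) - ∑ k ∈ Finset.Icc k₀ N, r ^ (-(k : ℝ) / 2) * c k u (dir y)

/-- `f` is smooth near null infinity and `f ∼ ∑_k r^{-k/2} c_k(u, θ)` as `r → ∞` at fixed `u, θ`,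
with finitely many terms `k < 0`. So the coefficient at order `1/r^n` is `c (2 n)`, for `n` integer or
half-integer. All derivatives of the remainder in `u` and in the angles fall off as the remainder,
and every derivative in `r` improves the fall-off by one power. -/
def HasExpansion {m : ℕ} (f : Event m → ℝ) (c : ℤ → ℝ → Space m → ℝ) : Prop :=
  (∃ Ω, IsScriNbhd Ω ∧ ContDiffOn ℝ ∞ f Ω) ∧
  (∀ k, SmoothCoeff (c k)) ∧
  ∃ k₀ : ℤ, (∀ k < k₀, ∀ u, ∀ θ ∈ unitSphere m, c k u θ = 0) ∧
    ∀ (N : ℤ) (a b : ℕ) (u : ℝ), ∀ θ ∈ unitSphere m,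
      (fun r : ℝ => iteratedFDeriv ℝ a
        (fun p : ℝ × Space m => iteratedDeriv b (fun s => remainder f c k₀ N p.1 s p.2) r) (u, θ))
      =O[atTop] fun r : ℝ => r ^ (-((N : ℝ) + 1) / 2 - b)

/-- Twice the Coulombic order `d - 3`. -/
def coulombic (m : ℕ) : ℤ := 2 * ((m : ℤ) - 2)

/-- The orders `k / 2` that occur in the ansatz for metric perturbations: `k / 2 ∈ d/2 - 1 + ℕ`,
and also the integers `≥ d - 3` (which are new only when `d` is odd). -/
def InAnsatz (m : ℕ) (k : ℤ) : Prop :=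
  ((m : ℤ) - 1 ≤ k ∧ Even (k - ((m : ℤ) - 1))) ∨ (coulombic m ≤ k ∧ Even k)

/-! ### Curvature in coordinates -/

/-- Partial derivative in the inertial coordinate `x^μ`. -/
def pd {m : ℕ} (μ : Fin (m + 1)) (f : Event m → ℝ) (X : Event m) : ℝ :=
  fderiv ℝ f X (Pi.single μ 1)

/-- Rank two tensor fields on spacetime. -/
abbrev TensorField (m : ℕ) := Event m → Matrix (Fin (m + 1)) (Fin (m + 1)) ℝ

/-- The Minkowski metric `diag(-1, 1, …, 1)`. -/
def minkowski (m : ℕ) : Matrix (Fin (m + 1)) (Fin (m + 1)) ℝ :=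
  Matrix.diagonal (Fin.cons (-1) fun _ => 1)

/-- Symmetric matrices of signature `(-, +, …, +)`. -/
def IsLorentzian {m : ℕ} (A : Matrix (Fin (m + 1)) (Fin (m + 1)) ℝ) : Prop :=
  ∃ P : Matrix (Fin (m + 1)) (Fin (m + 1)) ℝ, IsUnit P.det ∧ A = P.transpose * minkowski m * P

/-- `Γ^ρ_{μν}`. -/
def christoffel {m : ℕ} (g : TensorField m) (ρ μ ν : Fin (m + 1)) (X : Event m) : ℝ :=
  (1 / 2) * ∑ σ, (g X)⁻¹ ρ σ *
    (pd μ (fun Y => g Y σ ν) X + pd ν (fun Y => g Y σ μ) X - pd σ (fun Y => g Y μ ν) X)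

/-- `R^ρ_{σμν}`. -/
def riemannUp {m : ℕ} (g : TensorField m) (ρ σ μ ν : Fin (m + 1)) (X : Event m) : ℝ :=
  pd μ (christoffel g ρ ν σ) X - pd ν (christoffel g ρ μ σ) X +
    ∑ l, (christoffel g ρ μ l X * christoffel g l ν σ X -
      christoffel g ρ ν l X * christoffel g l μ σ X)

/-- `R_{ρσμν}`. -/
def riemann {m : ℕ} (g : TensorField m) (ρ σ μ ν : Fin (m + 1)) (X : Event m) : ℝ :=
  ∑ l, g X ρ l * riemannUp g l σ μ ν X

/-- `R_{μν}`. -/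
def ricci {m : ℕ} (g : TensorField m) (μ ν : Fin (m + 1)) (X : Event m) : ℝ :=
  ∑ l, riemannUp g l μ l ν X

/-- The scalar curvature. -/
def scalarCurvature {m : ℕ} (g : TensorField m) (X : Event m) : ℝ :=
  ∑ μ, ∑ ν, (g X)⁻¹ μ ν * ricci g μ ν X

/-- `G_{μν}`. -/
def einsteinTensor {m : ℕ} (g : TensorField m) (μ ν : Fin (m + 1)) (X : Event m) : ℝ :=
  ricci g μ ν X - (1 / 2) * scalarCurvature g X * g X μ ν

/-- The Weyl tensor `C_{abcd}` in spacetime dimension `d = m + 1`. -/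
def weyl {m : ℕ} (g : TensorField m) (a b c e : Fin (m + 1)) (X : Event m) : ℝ :=
  riemann g a b c e X
    - (1 / ((m : ℝ) - 1)) * (g X a c * ricci g b e X - g X a e * ricci g b c X
        - g X b c * ricci g a e X + g X b e * ricci g a c X)
    + (scalarCurvature g X / ((m : ℝ) * ((m : ℝ) - 1))) * (g X a c * g X b e - g X a e * g X b c)

/-- `E_{μν} = C_{uνuμ}`. At fixed `r` and angles, `∂/∂u = ∂/∂t`. -/
def electricWeyl {m : ℕ} (g : TensorField m) (μ ν : Fin (m + 1)) (X : Event m) : ℝ :=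
  weyl g 0 ν 0 μ X

/-- The dominant energy condition at a point: for timelike `v`, the vector `-T^a_b v^b` is causal
and does not point into the opposite half of the light cone. -/
def DominantEnergy {m : ℕ} (g T : Matrix (Fin (m + 1)) (Fin (m + 1)) ℝ) : Prop :=
  ∀ v : Fin (m + 1) → ℝ, v ⬝ᵥ g.mulVec v < 0 →
    0 ≤ v ⬝ᵥ T.mulVec v ∧ T.mulVec v ⬝ᵥ g⁻¹.mulVec (T.mulVec v) ≤ 0

/-! ### Spacetimes with radiation, and their memory -/

/-- The coefficients in the expansion of a rank two tensor. -/
abbrev TensorCoeff (m : ℕ) := Fin (m + 1) → Fin (m + 1) → ℤ → ℝ → Space m → ℝ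

/-- A solution `g = η + h` of the Einstein equation with stress-energy `T` near future null infinity,
where `h ∼ ∑ r^{-k/2} h_k` obeys the ansatz, `T = O(1/r^{d-2})` satisfies the dominant energy
condition, and the metric is stationary at early and at late retarded times at Coulombic order
and slower fall-off. -/
structure IsRadiatingSpacetime {m : ℕ} (Ω : Set (Event m)) (g T : TensorField m)
    (h τ : TensorCoeff m) : Prop where
  nbhd : IsScriNbhd Ω
  smooth : ∀ μ ν, ContDiffOn ℝ ∞ (fun X => g X μ ν) Ω
  lorentzian : ∀ X ∈ Ω, IsLorentzian (g X)
  einstein : ∀ X ∈ Ω, ∀ μ ν, einsteinTensor g μ ν X = 8 * Real.pi * T X μ ν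
  dominantEnergy : ∀ X ∈ Ω, DominantEnergy (g X) (T X)
  metric_expansion : ∀ μ ν, HasExpansion (fun X => g X μ ν - minkowski m μ ν) (h μ ν)
  metric_ansatz : ∀ μ ν k, ¬ InAnsatz m k → ∀ u, ∀ θ ∈ unitSphere m, h μ ν k u θ = 0
  stress_expansion : ∀ μ ν, HasExpansion (fun X => T X μ ν) (τ μ ν)
  stress_ansatz : ∀ μ ν, ∀ k < 2 * ((m : ℤ) - 1), ∀ u, ∀ θ ∈ unitSphere m, τ μ ν k u θ = 0
  stress_early : ∀ μ ν, ∀ θ ∈ unitSphere m,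
    Tendsto (fun u => τ μ ν (2 * ((m : ℤ) - 1)) u θ) atBot (𝓝 0)
  stationary_early : ∀ μ ν, ∀ k ≤ coulombic m,
    TendstoSmoothly (fun u θ => deriv (fun s => h μ ν k s θ) u) atBot fun _ => 0
  stationary_late : ∀ μ ν, ∀ k ≤ coulombic m,
    TendstoSmoothly (fun u θ => deriv (fun s => h μ ν k s θ) u) atTop fun _ => 0

/-- `Δ` is the Coulombic order memory tensor
`Δ_{μν}(θ) = - ∫_{-∞}^∞ du' ∫_{-∞}^{u'} du'' C^{(d-3)}_{uνuμ}(u'', θ)`. -/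
def IsMemoryTensor {m : ℕ} (g : TensorField m)
    (Δ : Space m → Matrix (Fin (m + 1)) (Fin (m + 1)) ℝ) : Prop :=
  ∃ (c : TensorCoeff m) (V : Fin (m + 1) → Fin (m + 1) → ℝ → Space m → ℝ),
    (∀ μ ν, HasExpansion (electricWeyl g μ ν) (c μ ν)) ∧
    (∀ μ ν u, TendstoSmoothly (fun a θ => ∫ s in a..u, c μ ν (coulombic m) s θ) atBot (V μ ν u)) ∧
    ∀ μ ν, TendstoSmoothly (fun (p : ℝ × ℝ) θ => -∫ u in p.1..p.2, V μ ν u θ) (atBot ×ˢ atTop)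
      fun θ => Δ θ μ ν

/-! ### Scalar, vector and tensor memory -/

/-- The spacetime tensor on the sphere of directions, with vanishing `u`-components, whose `rr`, `rA`
and `AB` components (in a normalized frame) are `a`, `b_A` and `t_{AB}`. -/
def assemble {m : ℕ} (a : Space m → ℝ) (b : Space m → Fin m → ℝ)
    (t : Space m → Fin m → Fin m → ℝ) (θ : Space m) : Matrix (Fin (m + 1)) (Fin (m + 1)) ℝ :=
  Matrix.of (Fin.cons (fun _ => 0) fun i =>
    Fin.cons 0 fun j => a θ * θ i * θ j + θ i * b θ j + b θ i * θ j + t θ i j)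

/-- Scalar memory: `Δ_{rr} = -U`, `Δ_{rA} = D_A R`,
`Δ_{AB} = (D_A D_B - q_{AB} D² / (d-2)) Θ + q_{AB} U / (d-2)`. -/
def scalarMemory {m : ℕ} (U R Θ : Space m → ℝ) :
    Space m → Matrix (Fin (m + 1)) (Fin (m + 1)) ℝ :=
  assemble (fun θ => -U θ) (gradS R)
    fun θ i j => traceFreeHessS Θ θ i j + sphereMetric θ i j * U θ / ((m : ℝ) - 1)

/-- Vector memory: `Δ_{rA} = R_A`, `Δ_{AB} = D_{(A} S_{B)}`. -/
def vectorMemory {m : ℕ} (Rv Sv : Space m → Fin m → ℝ) :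
    Space m → Matrix (Fin (m + 1)) (Fin (m + 1)) ℝ :=
  assemble (fun _ => 0) Rv (symCovDerivS Sv)

/-- Tensor memory: `Δ_{AB} = S_{AB}`. -/
def tensorMemory {m : ℕ} (St : Space m → Fin m → Fin m → ℝ) :
    Space m → Matrix (Fin (m + 1)) (Fin (m + 1)) ℝ :=
  assemble (fun _ => 0) (fun _ _ => 0) St

/-- The decomposition of a memory tensor into its scalar, vector and tensor parts. -/
structure IsMemoryDecomposition {m : ℕ} (Δ : Space m → Matrix (Fin (m + 1)) (Fin (m + 1)) ℝ)
    (U R Θ : Space m → ℝ) (Rv Sv : Space m → Fin m → ℝ) (St : Space m → Fin m → Fin m → ℝ) :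
    Prop where
  smooth_U : SmoothOnSphere U
  smooth_R : SmoothOnSphere R
  smooth_Θ : SmoothOnSphere Θ
  vector_R : IsVectorType Rv
  vector_S : IsVectorType Sv
  tensor_S : IsTensorType St
  eq_sum : ∀ θ ∈ unitSphere m,
    Δ θ = scalarMemory U R Θ θ + vectorMemory Rv Sv θ + tensorMemory St θ

/-! ### Infinitesimal diffeomorphisms -/

/-- Covector fields `ξ_μ` on spacetime. -/
abbrev CovectorField (m : ℕ) := Event m → Fin (m + 1) → ℝ

/-- `∇_{(μ} ξ_{ν)}`, with the flat derivative operator. -/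
def symGrad {m : ℕ} (ξ : CovectorField m) : TensorField m := fun X =>
  Matrix.of fun μ ν => (pd μ (fun Y => ξ Y ν) X + pd ν (fun Y => ξ Y μ) X) / 2

/-- `ξ` has an expansion in powers of `r^{-1/2}`, starting at any order. -/
def HasCovectorExpansion {m : ℕ} (ξ : CovectorField m) : Prop :=
  ∀ μ, ∃ c, HasExpansion (fun X => ξ X μ) c

/-- `ξ^{(n)} = 0` for `n < d - 4`, `ξ^{(d-4)}_μ = J_μ(θ)` and `ξ^{(d-3)}_μ = u B_μ(θ)`
(and there is no half-integer order in between). -/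
def HasMemoryForm {m : ℕ} (ξ : CovectorField m) : Prop :=
  ∃ J B : Fin (m + 1) → Space m → ℝ, ∀ μ, SmoothOnSphere (J μ) ∧ SmoothOnSphere (B μ) ∧
    ∃ c, HasExpansion (fun X => ξ X μ) c ∧ ∀ u, ∀ θ ∈ unitSphere m,
      (∀ k < coulombic m, k ≠ coulombic m - 2 → c k u θ = 0) ∧
      c (coulombic m - 2) u θ = J μ θ ∧
      c (coulombic m) u θ = u * B μ θ

/-- `[∇_{(μ} ξ_{ν)}]^{(d-3)} = Δ_{μν}`. -/
def CoulombicGradEq {m : ℕ} (ξ : CovectorField m)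
    (Δ : Space m → Matrix (Fin (m + 1)) (Fin (m + 1)) ℝ) : Prop :=
  ∀ μ ν, ∃ c, HasExpansion (fun X => symGrad ξ X μ ν) c ∧
    ∀ u, ∀ θ ∈ unitSphere m, c (coulombic m) u θ = Δ θ μ ν

/-- `[∇_{(μ} ξ_{ν)}]^{(n)} = 0` for all `n < d - 3`. -/
def SlowGradVanishes {m : ℕ} (ξ : CovectorField m) : Prop :=
  ∀ μ ν, ∃ c, HasExpansion (fun X => symGrad ξ X μ ν) c ∧
    ∀ k < coulombic m, ∀ u, ∀ θ ∈ unitSphere m, c k u θ = 0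

/-- `ξ^a = η^{ab} ξ_b` is a supertranslation of four-dimensional spacetime:
`ξ^a = α (∂/∂u)^a + ½ D²α (∂/∂r)^a - (1/r) D^C α (∂/∂x^C)^a + o(1)` for a function `α` on the sphere.
In inertial coordinates `∂/∂u = (1, 0)`, `∂/∂r = (1, θ)`. -/
def IsSupertranslation {m : ℕ} (ξ : CovectorField m) : Prop :=
  ∃ α : Space m → ℝ, SmoothOnSphere α ∧ ∀ u, ∀ θ ∈ unitSphere m,
    Tendsto (fun r => -ξ (event u r θ) 0) atTop (𝓝 (α θ + laplacianS α θ / 2)) ∧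
    ∀ i : Fin m, Tendsto (fun r => ξ (event u r θ) i.succ) atTop
      (𝓝 (laplacianS α θ / 2 * θ i - gradS α θ i))

/-- The tensor `P^{abcdef}` in the symplectic current of general relativity, in the Minkowski
background. -/
def sympP {m : ℕ} (a b c d e f : Fin (m + 1)) : ℝ :=
  minkowski m a e * minkowski m f b * minkowski m c d
    - minkowski m a d * minkowski m b e * minkowski m f c / 2
    - minkowski m a b * minkowski m c d * minkowski m e f / 2
    - minkowski m b c * minkowski m a e * minkowski m f d / 2
    + minkowski m b c * minkowski m a d * minkowski m e f / 2

/-- The symplectic current `w^a = (1/16π) P^{abcdef} (γ'_{bc} ∂_d γ_{ef} - γ_{bc} ∂_d γ'_{ef})`. -/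
def sympCurrent {m : ℕ} (γ γ' : TensorField m) (a : Fin (m + 1)) (X : Event m) : ℝ :=
  (1 / (16 * Real.pi)) * ∑ b, ∑ c, ∑ d, ∑ e, ∑ f, sympP a b c d e f *
    (γ' X b c * pd d (fun Y => γ Y e f) X - γ X b c * pd d (fun Y => γ' Y e f) X)

/-- The symplectic product at null infinity is defined and equals `s`: the density
`w_u^{(d-2)} = lim r^{d-2} w_u` exists and is integrable over null infinity, with integral `s`. -/
def HasSymplecticProduct {m : ℕ} (γ γ' : TensorField m) (s : ℝ) : Prop :=
  ∃ w : ℝ → Space m → ℝ,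
    (∀ u, ∀ θ ∈ unitSphere m, Tendsto
      (fun r : ℝ => r ^ (m - 1) * -sympCurrent γ γ' 0 (event u r θ)) atTop (𝓝 (w u θ))) ∧
    Integrable (fun p : ℝ × Metric.sphere (0 : Space m) 1 => w p.1 p.2)
      (volume.prod (volume : Measure (Space m)).toSphere) ∧
    ∫ p : ℝ × Metric.sphere (0 : Space m) 1, w p.1 p.2
      ∂(volume.prod (volume : Measure (Space m)).toSphere) = s

/-- Asymptotically flat perturbations: symmetric tensor fields that obey the ansatz. -/
def IsAsymptoticallyFlatPerturbation {m : ℕ} (γ : TensorField m) : Prop :=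
  (∀ X μ ν, γ X μ ν = γ X ν μ) ∧
  ∀ μ ν, ∃ c, HasExpansion (fun X => γ X μ ν) c ∧
    ∀ k, ¬ InAnsatz m k → ∀ u, ∀ θ ∈ unitSphere m, c k u θ = 0

/-- `ξ` is pure gauge: the perturbation `∇_{(μ} ξ_{ν)}` is asymptotically flat and its symplectic
product with every asymptotically flat perturbation vanishes. -/
def IsPureGauge {m : ℕ} (ξ : CovectorField m) : Prop :=
  IsAsymptoticallyFlatPerturbation (symGrad ξ) ∧
  ∀ γ : TensorField m, IsAsymptoticallyFlatPerturbation γ → HasSymplecticProduct (symGrad ξ) γ 0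

end

end NullMemory

open NullMemory

/-! ### Smooth functions of retarded time and direction, with angular derivations -/

namespace NullMemory

noncomputable section

variable {m : ℕ}

/-! Smooth functions of retarded time and direction form a ring `ScriFun m`, on which `dU` and the
Cartesian components `D i` of the angular gradient are derivations. A tensor at null infinity is an
array of ring elements, and differentiating an expansion termwise becomes a family of commuting
operators `dC μ` on coefficient sequences. The field equations turn into identities between
coefficients.

Since `h` starts at order d/2 - 1, terms of the curvature quadratic in `h` first enter at order d -
2, one power beyond Coulombic order d - 3. Hence the Coulombic coefficient of the Weyl tensor is
that of the linearized tidal tensor (`weyl_coeff`). The linearized divergence identity at order d -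
3 and the wave equation at order d - 2 both couple the tidal coefficients at orders d - 3 and d - 4.
Eliminating the latter expresses the `u`-derivative of a second order operator `constraint`, applied
to the Coulombic tidal tensor, through the source at order d - 2 (`dU_constraint`).

That source is harmless. For matter, the contracted Bianchi identity and the vanishing at early
times make the leading stress transverse to the null direction `L`; the dominant energy condition
then makes it null dust, a multiple of `L L`, which the tidal operator does not see. The quadratic
part of the Ricci tensor is, up to terms containing a factor `L`, the null component of `h` times a
second `u`-derivative of `h` (`quadRic_eq`), and that null component is stationary. So the source is
a third `u`-derivative of a potential that tends to zero at both ends. Passing to a double primitive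
leaves a quadratic polynomial in `u` with convergent increments, so its total increment is zero
(`limit_increment_eq_zero`) and `constraint` annihilates the memory (`constraint_memory`).

On the scalar part the constraint forces the trace-free Hessian of U - 2(d-4)R - (d-4)(d-3)Θ to
vanish. For d > 4 this is the solvability condition of the algebraic system for a generating
covector field (`exists_gauge_data`), whose perturbation decays too fast to have a symplectic
product. In d = 4 the divergence identity alone makes the memory tangential, so U = 0 and R is
constant, and the generator is a supertranslation.

Conversely, when a symmetrized gradient has no time components at Coulombic order, its spatial
components there depend only on the order d - 4 coefficients of the covector. Testing it in L² of
the sphere against the deformation tensor of S + 2R/(d-3), with S and R the vector potentials, shows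
that this combination is Killing (`sg_eq_zero_of_gauge`). The constraint then becomes a negative
definite equation for the vector R, so R = 0, S is Killing and the vector memory vanishes. Tensor
memory is orthogonal to the relevant part of every such gradient, hence to itself if it is one
(`ten_eq_zero_of_gauge`). -/

lemma norm_dir {y : Space m} (hy : y ≠ 0) : ‖dir y‖ = 1 := by
  have : ‖y‖ ≠ 0 := norm_ne_zero_iff.2 hy
  simp [dir, norm_smul, this]

lemma dir_of_norm_one {y : Space m} (hy : ‖y‖ = 1) : dir y = y := by simp [dir, hy]

lemma ne_zero_of_norm_one {y : Space m} (hy : ‖y‖ = 1) : y ≠ 0 := by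
  intro h
  simp [h] at hy

lemma mem_unitSphere {y : Space m} : y ∈ unitSphere m ↔ ‖y‖ = 1 := by simp [unitSphere]

lemma dir_smul {t : ℝ} (ht : 0 < t) (y : Space m) : dir (t • y) = dir y := by
  simp only [dir, norm_smul, Real.norm_of_nonneg ht.le, smul_smul, mul_inv]
  congr 1
  field_simp

lemma contDiffOn_dir : ContDiffOn ℝ ∞ (dir : Space m → Space m) {y | y ≠ 0} := by
  intro y hy
  have hy' : y ≠ 0 := hy
  unfold dir
  exact (((contDiffAt_norm ℝ hy').inv (norm_ne_zero_iff.2 hy')).smul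
    contDiffAt_id).contDiffWithinAt

lemma isOpen_punctured : IsOpen {p : ℝ × Space m | p.2 ≠ 0} :=
  isOpen_ne.preimage continuous_snd

lemma sum_sq_of_norm_one {θ : Space m} (hθ : ‖θ‖ = 1) : ∑ i, θ i * θ i = 1 := by
  have := EuclideanSpace.norm_sq_eq θ
  rw [hθ] at this
  simp only [Real.norm_eq_abs, sq_abs] at this
  simp only [← pow_two]
  linarith

lemma hasFDerivAt_norm_of_ne {y : Space m} (hy : y ≠ 0) :
    HasFDerivAt (fun y : Space m => ‖y‖) (innerSL ℝ (dir y)) y := by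
  have hn : 0 < ‖y‖ := norm_pos_iff.2 hy
  have h1 : HasFDerivAt (fun y : Space m => ‖y‖ ^ 2) (2 • (innerSL ℝ y)) y :=
    (hasStrictFDerivAt_norm_sq y).hasFDerivAt
  have h2 := h1.sqrt (by simp [hy])
  have h3 : (fun y : Space m => √(‖y‖ ^ 2)) = fun y => ‖y‖ := by
    funext y
    exact Real.sqrt_sq (norm_nonneg y)
  rw [h3, Real.sqrt_sq hn.le] at h2
  refine h2.congr_fderiv ?_
  ext w
  simp only [_root_.smul_apply, innerSL_apply_apply, dir, inner_smul_left, smul_eq_mul,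
    nsmul_eq_mul]
  simp
  field_simp

lemma hasFDerivAt_norm_of_norm_one {θ : Space m} (hθ : ‖θ‖ = 1) :
    HasFDerivAt (fun y : Space m => ‖y‖) (innerSL ℝ θ) θ := by
  have := hasFDerivAt_norm_of_ne (ne_zero_of_norm_one hθ)
  rwa [dir_of_norm_one hθ] at this

variable [NeZero m]

/-- The projection to the unit sphere, with an arbitrary value at the origin. -/
def pt (y : Space m) : Space m := if y = 0 then EuclideanSpace.single 0 1 else dir y

lemma pt_of_ne {y : Space m} (hy : y ≠ 0) : pt y = dir y := if_neg hy

lemma norm_pt (y : Space m) : ‖pt y‖ = 1 := by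
  unfold pt
  split_ifs with h
  · simp
  · exact norm_dir h

lemma pt_ne_zero (y : Space m) : pt y ≠ 0 := by
  intro h
  have := norm_pt y
  simp [h] at this

lemma pt_of_norm_one {y : Space m} (hy : ‖y‖ = 1) : pt y = y := by
  rw [pt_of_ne (ne_zero_of_norm_one hy), dir_of_norm_one hy]

@[simp] lemma pt_pt (y : Space m) : pt (pt y) = pt y := pt_of_norm_one (norm_pt y)

lemma pt_smul {t : ℝ} (ht : 0 < t) (y : Space m) : pt (t • y) = pt y := by
  unfold pt
  simp [ht.ne', dir_smul ht]

/-- Smooth functions of retarded time and of the direction. -/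
def ScriFun (m : ℕ) [NeZero m] : Subalgebra ℝ (ℝ × Space m → ℝ) where
  carrier := {c | (∀ u y, c (u, pt y) = c (u, y)) ∧ ContDiffOn ℝ ∞ c {p | p.2 ≠ 0}}
  mul_mem' := fun {a b} ha hb => ⟨fun u y => by simp [ha.1, hb.1], ha.2.mul hb.2⟩
  add_mem' := fun {a b} ha hb => ⟨fun u y => by simp [ha.1, hb.1], ha.2.add hb.2⟩
  algebraMap_mem' := fun r => ⟨fun u y => rfl, contDiffOn_const⟩

namespace ScriFun

instance : CoeFun (ScriFun m) (fun _ => ℝ × Space m → ℝ) := ⟨fun c => c.1⟩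

lemma apply_pt (c : ScriFun m) (u : ℝ) (y : Space m) : c (u, pt y) = c (u, y) := c.2.1 u y

lemma contDiffOn (c : ScriFun m) : ContDiffOn ℝ ∞ c {p | p.2 ≠ 0} := c.2.2

lemma contDiffAt (c : ScriFun m) {p : ℝ × Space m} (hp : p.2 ≠ 0) : ContDiffAt ℝ ∞ c p :=
  (ScriFun.contDiffOn c).contDiffAt (isOpen_punctured.mem_nhds hp)

lemma differentiableAt (c : ScriFun m) {p : ℝ × Space m} (hp : p.2 ≠ 0) :
    DifferentiableAt ℝ c p := ((ScriFun.contDiffAt c) hp).differentiableAt (by simp)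

/-- Invariance under `pt` ties every value, including the one at the origin, to a value at a unit
vector. This is what lets identities in the ring be checked only on the sphere. -/
lemma ext_sphere {c e : ScriFun m} (h : ∀ u, ∀ θ : Space m, ‖θ‖ = 1 → c (u, θ) = e (u, θ)) :
    c = e := by
  apply Subtype.ext
  funext p
  obtain ⟨u, y⟩ := p
  rw [← apply_pt, ← apply_pt e]
  exact h u _ (norm_pt y)

@[simp] lemma add_apply (c e : ScriFun m) (p) : (c + e) p = c p + e p := rfl
@[simp] lemma sub_apply (c e : ScriFun m) (p) : (c - e) p = c p - e p := rfl
@[simp] lemma neg_apply (c : ScriFun m) (p) : (-c) p = -c p := rfl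
@[simp] lemma mul_apply (c e : ScriFun m) (p) : (c * e) p = c p * e p := rfl
@[simp] lemma smul_apply (a : ℝ) (c : ScriFun m) (p) : (a • c) p = a * c p := rfl
@[simp] lemma one_apply (p) : (1 : ScriFun m) p = 1 := rfl
@[simp] lemma zero_apply (p) : (0 : ScriFun m) p = 0 := rfl
@[simp] lemma algebraMap_apply' (a : ℝ) (p) : (algebraMap ℝ (ScriFun m) a) p = a := rfl
@[simp] lemma natCast_apply (n : ℕ) (p) : (n : ScriFun m) p = n := rfl
@[simp] lemma ofNat_apply (n : ℕ) [n.AtLeastTwo] (p) :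
    (OfNat.ofNat n : ScriFun m) p = OfNat.ofNat n := rfl

/-- Evaluation at a point. -/
def evalAt (p : ℝ × Space m) : ScriFun m →ₐ[ℝ] ℝ :=
  (Pi.evalAlgHom ℝ (fun _ : ℝ × Space m => ℝ) p).comp (ScriFun m).val

lemma evalAt_apply (p : ℝ × Space m) (c : ScriFun m) : evalAt p c = c p := rfl

@[simp] lemma sum_apply {ι : Type*} (s : Finset ι) (f : ι → ScriFun m) (p) :
    (∑ i ∈ s, f i) p = ∑ i ∈ s, f i p := by
  simpa only [evalAt_apply] using map_sum (evalAt p) f s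

lemma contDiffOn_fderiv_pt (c : ScriFun m) (v : ℝ × Space m) :
    ContDiffOn ℝ ∞ (fun p : ℝ × Space m => fderiv ℝ c (p.1, pt p.2) v) {p | p.2 ≠ 0} := by
  have h1 : ContDiffOn ℝ ∞ (fderiv ℝ c) {p : ℝ × Space m | p.2 ≠ 0} :=
    (ScriFun.contDiffOn c).fderiv_of_isOpen isOpen_punctured (by simp)
  have h2 : ContDiffOn ℝ ∞ (fun p : ℝ × Space m => (p.1, dir p.2)) {p | p.2 ≠ 0} :=
    contDiffOn_fst.prodMk (contDiffOn_dir.comp contDiffOn_snd fun p hp => hp)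
  have h3 : ContDiffOn ℝ ∞ (fun p : ℝ × Space m => fderiv ℝ c (p.1, dir p.2)) {p | p.2 ≠ 0} :=
    h1.comp h2 fun p hp => by
      have := norm_dir (y := p.2) hp
      exact ne_zero_of_norm_one this
  refine (h3.clm_apply (contDiffOn_const (c := v))).congr fun p hp => ?_
  rw [pt_of_ne hp]

/-- The derivation of `ScriFun m` along a fixed vector, evaluated at the unit vectors. -/
def along (v : ℝ × Space m) : Derivation ℝ (ScriFun m) (ScriFun m) :=
  Derivation.mk'
    { toFun := fun c => ⟨fun p => fderiv ℝ c (p.1, pt p.2) v,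
        fun u y => by simp, contDiffOn_fderiv_pt c v⟩
      map_add' := fun a b => by
        apply Subtype.ext
        funext p
        have ha := ScriFun.differentiableAt a (p := (p.1, pt p.2)) (pt_ne_zero _)
        have hb := ScriFun.differentiableAt b (p := (p.1, pt p.2)) (pt_ne_zero _)
        change fderiv ℝ (a.1 + b.1) _ v = fderiv ℝ a _ v + fderiv ℝ b _ v
        rw [fderiv_add ha hb]; rfl
      map_smul' := fun r a => by
        apply Subtype.ext
        funext p
        have ha := ScriFun.differentiableAt a (p := (p.1, pt p.2)) (pt_ne_zero _)
        change fderiv ℝ (r • (a : ℝ × Space m → ℝ)) _ v = r • fderiv ℝ a _ v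
        rw [fderiv_const_smul ha]; rfl }
    (fun a b => by
        apply Subtype.ext
        funext p
        have ha := ScriFun.differentiableAt a (p := (p.1, pt p.2)) (pt_ne_zero _)
        have hb := ScriFun.differentiableAt b (p := (p.1, pt p.2)) (pt_ne_zero _)
        change fderiv ℝ (a.1 * b.1) _ v = a p * fderiv ℝ b _ v + b p * fderiv ℝ a _ v
        rw [fderiv_mul ha hb]
        simp [apply_pt])

lemma along_apply (v : ℝ × Space m) (c : ScriFun m) (p : ℝ × Space m) :
    along v c p = fderiv ℝ c (p.1, pt p.2) v := rfl

/-- The derivative in retarded time. -/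
def dU : Derivation ℝ (ScriFun m) (ScriFun m) := along (1, 0)

/-- The Cartesian components of the gradient on the sphere. -/
def D (i : Fin m) : Derivation ℝ (ScriFun m) (ScriFun m) :=
  along (0, EuclideanSpace.single i 1)

/-- Differentiate the homogeneity relation `c (u, y) = c (u, t⁻¹ • y)`. -/
lemma fderiv_smul_snd (c : ScriFun m) {t : ℝ} (ht : 0 < t) (u : ℝ) {y : Space m} (hy : y ≠ 0)
    (a : ℝ) (w : Space m) :
    fderiv ℝ c (u, t • y) (a, w) = fderiv ℝ c (u, y) (a, t⁻¹ • w) := by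
  have hc : (c : ℝ × Space m → ℝ) = fun p => c (p.1, t⁻¹ • p.2) := by
    funext p
    rw [← apply_pt c p.1 p.2, ← apply_pt c p.1 (t⁻¹ • p.2), pt_smul (inv_pos.2 ht)]
  have h1 : HasFDerivAt (fun p : ℝ × Space m => (p.1, t⁻¹ • p.2))
      ((ContinuousLinearMap.fst ℝ ℝ (Space m)).prod
        (t⁻¹ • ContinuousLinearMap.snd ℝ ℝ (Space m))) (u, t • y) :=
    hasFDerivAt_fst.prodMk (hasFDerivAt_snd.const_smul t⁻¹)
  have h2 : HasFDerivAt c (fderiv ℝ c (u, y)) (u, t⁻¹ • t • y) := by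
    rw [inv_smul_smul₀ ht.ne']
    exact ((ScriFun.differentiableAt c) hy).hasFDerivAt
  have h3 := HasFDerivAt.comp (u, t • y) h2 h1
  have h4 : (c : ℝ × Space m → ℝ) = c ∘ fun p : ℝ × Space m => (p.1, t⁻¹ • p.2) := hc
  rw [← h4] at h3
  rw [h3.fderiv]
  simp

/-- Homogeneity of degree zero: the gradient at distance `‖y‖` is the one on the sphere divided by
`‖y‖`. It converts analytic derivatives into the derivations of the ring. -/
lemma fderiv_apply (c : ScriFun m) (u : ℝ) {y : Space m} (hy : y ≠ 0) (v : ℝ × Space m) :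
    fderiv ℝ c (u, y) v = v.1 * dU c (u, y) + ‖y‖⁻¹ * ∑ i, v.2 i * D i c (u, y) := by
  have hn : 0 < ‖y‖ := norm_pos_iff.2 hy
  have h : y = ‖y‖ • pt y := by
    rw [pt_of_ne hy, dir, smul_inv_smul₀ hn.ne']
  have e1 : fderiv ℝ c (u, y) v = fderiv ℝ c (u, pt y) (v.1, ‖y‖⁻¹ • v.2) := by
    conv_lhs => rw [h]
    exact fderiv_smul_snd c hn u (pt_ne_zero y) v.1 v.2
  rw [e1]
  have e2 : (v.1, ‖y‖⁻¹ • v.2) = v.1 • ((1, 0) : ℝ × Space m) +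
      ‖y‖⁻¹ • ∑ i, v.2 i • ((0, EuclideanSpace.single i 1) : ℝ × Space m) := by
    ext
    · simp [Prod.fst_sum]
    · simp [Prod.snd_sum, Pi.single_apply, EuclideanSpace.single]
  rw [e2, map_add, map_smul, map_smul, map_sum]
  simp only [map_smul, smul_eq_mul]
  rfl

/-- Functions of retarded time and direction from their values on the sphere. -/
def ofCoeff (c : ℝ → Space m → ℝ) (hc : SmoothCoeff c) : ScriFun m :=
  ⟨fun p => c p.1 (pt p.2), fun u y => by simp, hc.congr fun p hp => by rw [pt_of_ne hp]⟩

lemma ofCoeff_apply (c : ℝ → Space m → ℝ) (hc : SmoothCoeff c) (u : ℝ) {θ : Space m}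
    (hθ : ‖θ‖ = 1) : ofCoeff c hc (u, θ) = c u θ := by
  change c u (pt θ) = _
  rw [pt_of_norm_one hθ]

/-- A function on the sphere, as a function that does not depend on retarded time. -/
def ofSphere (f : Space m → ℝ) (hf : SmoothOnSphere f) : ScriFun m :=
  ofCoeff (fun _ => f) (by
    have : ContDiffOn ℝ ∞ (fun p : ℝ × Space m => radialExt f p.2) {p | p.2 ≠ 0} :=
      ContDiffOn.comp (g := radialExt f) hf contDiffOn_snd fun p hp => hp
    exact this)

lemma ofSphere_apply (f : Space m → ℝ) (hf : SmoothOnSphere f) (u : ℝ) {θ : Space m}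
    (hθ : ‖θ‖ = 1) : ofSphere f hf (u, θ) = f θ := ofCoeff_apply _ _ u hθ

/-- The components of the direction. -/
def th (i : Fin m) : ScriFun m :=
  ⟨fun p => pt p.2 i, fun u y => by simp, by
    have h : ContDiffOn ℝ ∞ (fun p : ℝ × Space m => (dir p.2) i) {p | p.2 ≠ 0} := by
      have := contDiffOn_dir (m := m).comp (contDiffOn_snd (E := ℝ)) (fun p hp => hp)
      exact (EuclideanSpace.proj (𝕜 := ℝ) i).contDiff.comp_contDiffOn this
    exact h.congr fun p hp => by rw [pt_of_ne hp]⟩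

lemma th_apply (i : Fin m) (u : ℝ) {θ : Space m} (hθ : ‖θ‖ = 1) : th i (u, θ) = θ i := by
  change pt θ i = _
  rw [pt_of_norm_one hθ]

lemma sum_th_th : ∑ i, th i * th i = (1 : ScriFun m) := by
  refine ext_sphere fun u θ hθ => ?_
  simp [th_apply _ _ hθ, sum_sq_of_norm_one hθ]

lemma dU_th (i : Fin m) : dU (th i) = (0 : ScriFun m) := by
  refine ext_sphere fun u θ hθ => ?_
  change fderiv ℝ (th i) (u, pt θ) (1, 0) = 0
  have hd : DifferentiableAt ℝ (th i) (u, pt θ) := differentiableAt _ (pt_ne_zero θ)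
  have h1 : HasFDerivAt (fun s : ℝ => (s, pt θ)) (ContinuousLinearMap.inl ℝ ℝ (Space m)) u :=
    hasFDerivAt_prodMk_left u (pt θ)
  have h2 := HasFDerivAt.comp u hd.hasFDerivAt h1
  have h3 : (th i : ℝ × Space m → ℝ) ∘ (fun s : ℝ => (s, pt θ)) = fun _ => pt (pt θ) i := rfl
  rw [h3] at h2
  have := h2.unique (hasFDerivAt_const _ _)
  have := congrArg (fun L => L 1) this
  simpa using this

/-- Off the sphere, `D i` is `‖y‖` times the flat partial derivative. In this form it can be
differentiated once more without differentiating `pt`. -/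
lemma along_eq (c : ScriFun m) (v : ℝ × Space m) (u : ℝ) {y : Space m} (hy : y ≠ 0) :
    along v c (u, y) = fderiv ℝ c (u, y) (v.1, ‖y‖ • v.2) := by
  have hn : 0 < ‖y‖ := norm_pos_iff.2 hy
  have h := fderiv_smul_snd c (inv_pos.2 hn) u hy v.1 v.2
  rw [inv_inv] at h
  rw [along_apply, pt_of_ne hy]
  exact h

/-- The inner product term is the derivative of the weight `‖y‖` in `along_eq`. -/
lemma fderiv_along (c : ScriFun m) (v w : ℝ × Space m) (u : ℝ) {θ : Space m} (hθ : ‖θ‖ = 1) :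
    along w (along v c) (u, θ) = fderiv ℝ (fderiv ℝ c) (u, θ) w v +
      inner ℝ θ w.2 * along (0, v.2) c (u, θ) := by
  have h0 : θ ≠ 0 := ne_zero_of_norm_one hθ
  have h1 : ContDiffOn ℝ ∞ (fderiv ℝ c) {p : ℝ × Space m | p.2 ≠ 0} :=
    (ScriFun.contDiffOn c).fderiv_of_isOpen isOpen_punctured (by simp)
  have h2 : HasFDerivAt (fderiv ℝ c) (fderiv ℝ (fderiv ℝ c) (u, θ)) (u, θ) :=
    ((h1.contDiffAt (isOpen_punctured.mem_nhds h0)).differentiableAt (by simp)).hasFDerivAt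
  have h3 : HasFDerivAt (fun p : ℝ × Space m => ‖p.2‖)
      ((innerSL ℝ θ).comp (ContinuousLinearMap.snd ℝ ℝ (Space m))) (u, θ) :=
    HasFDerivAt.comp (u, θ) (g := fun y : Space m => ‖y‖) (f := Prod.snd)
      (hasFDerivAt_norm_of_norm_one hθ) hasFDerivAt_snd
  have h4 : HasFDerivAt (fun p : ℝ × Space m => ((v.1, ‖p.2‖ • v.2) : ℝ × Space m)) _ (u, θ) :=
    (hasFDerivAt_const v.1 (u, θ)).prodMk (h3.smul_const v.2)
  have h5 := h2.clm_apply h4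
  have h6 : (along v c : ℝ × Space m → ℝ) =ᶠ[𝓝 (u, θ)]
      fun p => fderiv ℝ c p (v.1, ‖p.2‖ • v.2) := by
    filter_upwards [isOpen_punctured.mem_nhds h0] with p hp
    exact along_eq c v p.1 hp
  rw [along_apply, pt_of_norm_one hθ, h6.fderiv_eq, h5.fderiv]
  simp only [_root_.add_apply, ContinuousLinearMap.comp_apply,
    ContinuousLinearMap.flip_apply, along_apply, pt_of_norm_one hθ, hθ, one_smul]
  have e : ((0 : ℝ), inner ℝ θ w.2 • v.2) = inner ℝ θ w.2 • ((0, v.2) : ℝ × Space m) := by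
    simp
  rw [add_comm]
  congr 1
  have e' : fderiv ℝ c (u, θ) ((0 : ℝ), inner ℝ θ w.2 • v.2) =
      inner ℝ θ w.2 * fderiv ℝ c (u, θ) (0, v.2) := by
    rw [e, map_smul, smul_eq_mul]
  rw [← e']
  rfl

lemma along_comm (c : ScriFun m) (v w : ℝ × Space m) (u : ℝ) {θ : Space m} (hθ : ‖θ‖ = 1) :
    along w (along v c) (u, θ) - along v (along w c) (u, θ) =
      inner ℝ θ w.2 * along (0, v.2) c (u, θ) - inner ℝ θ v.2 * along (0, w.2) c (u, θ) := by
  have hs : IsSymmSndFDerivAt ℝ c (u, θ) :=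
    (ScriFun.contDiffAt c (p := (u, θ)) (ne_zero_of_norm_one hθ)).isSymmSndFDerivAt
      (by simp only [minSmoothness_of_isRCLikeNormedField]; exact ENat.LEInfty.out)
  rw [fderiv_along c v w u hθ, fderiv_along c w v u hθ, hs w v]
  ring

lemma dU_D (i : Fin m) (c : ScriFun m) : dU (D i c) = D i (dU c) := by
  refine ext_sphere fun u θ hθ => ?_
  have := along_comm c (0, EuclideanSpace.single i 1) (1, 0) u hθ
  have h0 : along ((0 : ℝ), (0 : Space m)) c (u, θ) = 0 := by
    simp [along_apply, show ((0 : ℝ), (0 : Space m)) = 0 from rfl]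
  simp only [inner_zero_right, zero_mul, h0, mul_zero, sub_zero] at this
  exact sub_eq_zero.1 this

/-- Flat second derivatives are symmetric, so only the derivatives of the radial weight survive. The
commutator reflects that `D i` is a Cartesian component of the tangential gradient rather than a
coordinate derivative. -/
lemma D_comm (i j : Fin m) (c : ScriFun m) :
    D i (D j c) = D j (D i c) + th i * D j c - th j * D i c := by
  refine ext_sphere fun u θ hθ => ?_
  have := along_comm c (0, EuclideanSpace.single j 1) (0, EuclideanSpace.single i 1) u hθ
  simp only [EuclideanSpace.inner_single_right] at this
  simp only [sub_apply, add_apply, mul_apply, th_apply _ _ hθ]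
  simp only [D] at this ⊢
  simp at this
  linarith

lemma fderiv_sum (c : ScriFun m) (u : ℝ) (θ w : Space m) :
    ∑ i, w i * D i c (u, θ) = fderiv ℝ c (u, pt θ) (0, w) := by
  have := fderiv_apply c u (pt_ne_zero θ) (0, w)
  simp [norm_pt, apply_pt] at this
  exact this.symm

/-- Euler's identity for functions that are constant along rays. -/
lemma sum_th_D (c : ScriFun m) : ∑ i, th i * D i c = 0 := by
  refine ext_sphere fun u θ hθ => ?_
  simp only [sum_apply, mul_apply, th_apply _ _ hθ, zero_apply]
  rw [fderiv_sum, pt_of_norm_one hθ]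
  have h0 : θ ≠ 0 := ne_zero_of_norm_one hθ
  have h1 : HasDerivAt (fun t : ℝ => ((u, t • θ) : ℝ × Space m)) (0, θ) 1 := by
    simpa using (hasDerivAt_const (1 : ℝ) u).prodMk ((hasDerivAt_id (1 : ℝ)).smul_const θ)
  have h2 : HasFDerivAt c (fderiv ℝ c (u, θ)) (u, (1 : ℝ) • θ) := by
    rw [one_smul]
    exact (ScriFun.differentiableAt c (p := (u, θ)) h0).hasFDerivAt
  have h3 := HasFDerivAt.comp_hasDerivAt (1 : ℝ) h2 h1
  have h4 : (c : ℝ × Space m → ℝ) ∘ (fun t : ℝ => ((u, t • θ) : ℝ × Space m)) =ᶠ[𝓝 1]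
      fun _ => c (u, θ) := by
    filter_upwards [lt_mem_nhds (show (0 : ℝ) < 1 by norm_num)] with t ht
    simp only [Function.comp]
    rw [← apply_pt, pt_smul ht, apply_pt]
  have h5 := h3.congr_of_eventuallyEq h4.symm
  exact h5.unique (hasDerivAt_const _ _)

/-- The derivative of `y / |y|` is the projection onto the tangent space. For this reason `D i (th
j)` plays the role of the round metric in the sphere calculus below. -/
lemma D_th (i j : Fin m) :
    D i (th j) = algebraMap ℝ (ScriFun m) (if i = j then 1 else 0) - th i * th j := by
  refine ext_sphere fun u θ hθ => ?_
  have h0 : θ ≠ 0 := ne_zero_of_norm_one hθ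
  have h3 : HasFDerivAt (fun p : ℝ × Space m => ‖p.2‖)
      ((innerSL ℝ θ).comp (ContinuousLinearMap.snd ℝ ℝ (Space m))) (u, θ) :=
    HasFDerivAt.comp (u, θ) (g := fun y : Space m => ‖y‖) (f := Prod.snd)
      (hasFDerivAt_norm_of_norm_one hθ) hasFDerivAt_snd
  have h4 : HasFDerivAt (fun p : ℝ × Space m => p.2 j)
      ((EuclideanSpace.proj j).comp (ContinuousLinearMap.snd ℝ ℝ (Space m))) (u, θ) :=
    ((EuclideanSpace.proj (𝕜 := ℝ) j).comp
      (ContinuousLinearMap.snd ℝ ℝ (Space m))).hasFDerivAt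
  have hinv : HasFDerivAt (fun p : ℝ × Space m => ‖p.2‖⁻¹) _ (u, θ) :=
    HasDerivAt.comp_hasFDerivAt (u, θ) (hasDerivAt_inv (by simp [hθ])) h3
  have h5 := hinv.mul h4
  have h6 : (th j : ℝ × Space m → ℝ) =ᶠ[𝓝 (u, θ)] fun p => ‖p.2‖⁻¹ * p.2 j := by
    filter_upwards [isOpen_punctured.mem_nhds h0] with p hp
    change pt p.2 j = _
    rw [pt_of_ne hp]
    simp [dir]
  change fderiv ℝ (th j) (u, pt θ) _ = _
  rw [pt_of_norm_one hθ, h6.fderiv_eq]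
  erw [h5.fderiv]
  simp [hθ, th_apply _ _ hθ, EuclideanSpace.inner_single_right]
  by_cases h : i = j
  · subst h; simp; ring
  · simp [h, Ne.symm h]; ring

lemma hasDerivAt_dU (c : ScriFun m) (u : ℝ) (θ : Space m) :
    HasDerivAt (fun s => c (s, θ)) (dU c (u, θ)) u := by
  have h1 : HasDerivAt (fun s : ℝ => ((s, pt θ) : ℝ × Space m)) (1, 0) u :=
    (hasDerivAt_id u).prodMk (hasDerivAt_const u (pt θ))
  have h2 := HasFDerivAt.comp_hasDerivAt u
    (ScriFun.differentiableAt c (p := (u, pt θ)) (pt_ne_zero θ)).hasFDerivAt h1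
  have h3 : (c : ℝ × Space m → ℝ) ∘ (fun s : ℝ => ((s, pt θ) : ℝ × Space m)) =
      fun s => c (s, θ) := by
    funext s
    simp [apply_pt]
  rw [h3] at h2
  exact h2

lemma dU_ofSphere (f : Space m → ℝ) (hf : SmoothOnSphere f) : dU (ofSphere f hf) = 0 := by
  refine ext_sphere fun u θ hθ => ?_
  exact (hasDerivAt_dU (ofSphere f hf) u θ).unique (hasDerivAt_const u (f (pt θ)))

end ScriFun

end

end NullMemory

/-! ### Terms of an expansion and formal differentiation of coefficients -/

namespace NullMemory

noncomputable section

variable {m : ℕ}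

/-- The spatial position of an event. -/
def sp : Event m →L[ℝ] Space m :=
  ((EuclideanSpace.equiv (Fin m) ℝ).symm : (Fin m → ℝ) →L[ℝ] Space m).comp
    (ContinuousLinearMap.pi fun i => ContinuousLinearMap.proj i.succ)

@[simp] lemma sp_apply (X : Event m) (i : Fin m) : sp X i = X i.succ := rfl

lemma sp_event (u r : ℝ) (θ : Space m) : sp (event u r θ) = r • θ := by
  ext i
  simp [event]

@[simp] lemma event_zero (u r : ℝ) (θ : Space m) : event u r θ 0 = u + r := rfl

@[simp] lemma event_succ (u r : ℝ) (θ : Space m) (i : Fin m) :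
    event u r θ i.succ = r * θ i := rfl

lemma norm_sp_event (u : ℝ) {r : ℝ} (hr : 0 ≤ r) {θ : Space m} (hθ : ‖θ‖ = 1) :
    ‖sp (event u r θ)‖ = r := by
  rw [sp_event, norm_smul, hθ, Real.norm_of_nonneg hr, mul_one]

lemma sp_event_ne_zero (u : ℝ) {r : ℝ} (hr : 0 < r) {θ : Space m} (hθ : ‖θ‖ = 1) :
    sp (event u r θ) ≠ 0 := by
  rw [← norm_pos_iff, norm_sp_event u hr.le hθ]
  exact hr

lemma event_of_sp (X : Event m) (hX : sp X ≠ 0) :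
    event (X 0 - ‖sp X‖) ‖sp X‖ (dir (sp X)) = X := by
  have : ‖sp X‖ ≠ 0 := norm_ne_zero_iff.2 hX
  funext μ
  refine Fin.cases ?_ (fun i => ?_) μ
  · simp
  · simp [dir, this]

lemma isOpen_sp_ne : IsOpen {X : Event m | sp X ≠ 0} := isOpen_ne.preimage sp.continuous

variable [NeZero m]

open ScriFun

/-- The components of the gradient of retarded time. -/
def Lc : Fin (m + 1) → ScriFun m := Fin.cons 1 fun i => -th i

/-- The components of the gradient of the radius. -/
def nc : Fin (m + 1) → ScriFun m := Fin.cons 0 th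

/-- The components of the angular gradient. -/
def Dx : Fin (m + 1) → Derivation ℝ (ScriFun m) (ScriFun m) := Fin.cons 0 D

@[simp] lemma Lc_zero : Lc (m := m) 0 = 1 := rfl
@[simp] lemma Lc_succ (i : Fin m) : Lc i.succ = -th i := rfl
@[simp] lemma nc_zero : nc (m := m) 0 = 0 := rfl
@[simp] lemma nc_succ (i : Fin m) : nc i.succ = th i := rfl
@[simp] lemma Dx_zero : Dx (m := m) 0 = 0 := rfl
@[simp] lemma Dx_succ (i : Fin m) : Dx i.succ = D i := rfl

/-- The function `r^{-k/2} c(u, θ)`. -/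
def term (k : ℤ) (c : ScriFun m) : Event m → ℝ :=
  fun X => ‖sp X‖ ^ (-(k : ℝ) / 2) * c (X 0 - ‖sp X‖, sp X)

lemma term_event (k : ℤ) (c : ScriFun m) (u : ℝ) {r : ℝ} (hr : 0 < r) {θ : Space m}
    (hθ : ‖θ‖ = 1) : term k c (event u r θ) = r ^ (-(k : ℝ) / 2) * c (u, θ) := by
  unfold term
  rw [norm_sp_event u hr.le hθ, sp_event, ← apply_pt, pt_smul hr, apply_pt]
  simp

lemma term_add (k : ℤ) (c e : ScriFun m) : term k (c + e) = term k c + term k e := by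
  funext X
  simp [term, mul_add]

lemma term_smul (k : ℤ) (a : ℝ) (c : ScriFun m) : term k (a • c) = a • term k c := by
  funext X
  simp [term]
  ring

omit [NeZero m] in
lemma hasFDerivAt_retarded {X : Event m} (hX : sp X ≠ 0) :
    HasFDerivAt (fun Y : Event m => ((Y 0 - ‖sp Y‖, sp Y) : ℝ × Space m))
      ((ContinuousLinearMap.proj 0 - (innerSL ℝ (dir (sp X))).comp sp).prod sp) X := by
  have h1 : HasFDerivAt (fun Y : Event m => ‖sp Y‖) ((innerSL ℝ (dir (sp X))).comp sp) X :=
    HasFDerivAt.comp X (g := fun y : Space m => ‖y‖) (hasFDerivAt_norm_of_ne hX) sp.hasFDerivAt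
  have h0 : HasFDerivAt (fun Y : Event m => Y 0)
      (ContinuousLinearMap.proj (R := ℝ) (φ := fun _ : Fin (m + 1) => ℝ) 0) X :=
    (ContinuousLinearMap.proj (R := ℝ) (φ := fun _ : Fin (m + 1) => ℝ) 0).hasFDerivAt
  exact (h0.sub h1).prodMk sp.hasFDerivAt

lemma contDiffAt_term (k : ℤ) (c : ScriFun m) {X : Event m} (hX : sp X ≠ 0) :
    ContDiffAt ℝ ∞ (term k c) X := by
  have hn : ContDiffAt ℝ ∞ (fun Y : Event m => ‖sp Y‖) X :=
    (contDiffAt_norm ℝ hX).comp X sp.contDiff.contDiffAt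
  have h0 : ContDiffAt ℝ ∞ (fun Y : Event m => Y 0) X :=
    (ContinuousLinearMap.proj (R := ℝ) (φ := fun _ : Fin (m + 1) => ℝ) 0).contDiff.contDiffAt
  refine (hn.rpow_const_of_ne (norm_ne_zero_iff.2 hX)).mul ?_
  exact ContDiffAt.comp X (g := c) (ScriFun.contDiffAt c (p := (X 0 - ‖sp X‖, sp X)) hX)
    ((h0.sub hn).prodMk sp.contDiff.contDiffAt)

omit [NeZero m] in
lemma sp_single_zero (a : ℝ) : sp (Pi.single 0 a : Event m) = 0 := by
  ext i
  simp [Fin.succ_ne_zero]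

omit [NeZero m] in
lemma sp_single_succ (i : Fin m) (a : ℝ) :
    sp (Pi.single i.succ a : Event m) = EuclideanSpace.single i a := by
  ext j
  simp [Pi.single_apply]

/-- With `∂_μ u = L_μ` and `∂_μ r = n_μ`, the retarded derivative keeps the order, while the angular
and radial derivatives gain one power of `1/r`, that is two steps of `k`. -/
lemma pd_term (k : ℤ) (c : ScriFun m) (μ : Fin (m + 1)) {X : Event m} (hX : sp X ≠ 0) :
    pd μ (term k c) X = term k (Lc μ * dU c) X +
      term (k + 2) (Dx μ c - ((k : ℝ) / 2) • (nc μ * c)) X := by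
  have hn : 0 < ‖sp X‖ := norm_pos_iff.2 hX
  have h1 : HasFDerivAt (fun Y : Event m => ‖sp Y‖) ((innerSL ℝ (dir (sp X))).comp sp) X :=
    HasFDerivAt.comp X (g := fun y : Space m => ‖y‖) (hasFDerivAt_norm_of_ne hX) sp.hasFDerivAt
  have h2 := h1.rpow_const (p := -(k : ℝ) / 2) (Or.inl hn.ne')
  have h3 := HasFDerivAt.comp X (g := c) (f := fun Y : Event m => ((Y 0 - ‖sp Y‖, sp Y) : ℝ × Space m))
    (ScriFun.differentiableAt c (p := (X 0 - ‖sp X‖, sp X)) hX).hasFDerivAt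
    (hasFDerivAt_retarded hX)
  have h4 : HasFDerivAt (term k c) _ X := h2.mul h3
  have e1 : ‖sp X‖ ^ (-((k + 2 : ℤ) : ℝ) / 2) = ‖sp X‖ ^ (-(k : ℝ) / 2) * ‖sp X‖⁻¹ := by
    rw [← Real.rpow_neg_one, ← Real.rpow_add hn]
    congr 1
    push_cast
    ring
  have e2 : ‖sp X‖ ^ (-(k : ℝ) / 2 - 1) = ‖sp X‖ ^ (-(k : ℝ) / 2) * ‖sp X‖⁻¹ := by
    rw [← Real.rpow_neg_one, ← Real.rpow_add hn]
    rfl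
  unfold pd
  rw [h4.fderiv]
  simp only [term, e1, e2, _root_.add_apply, _root_.smul_apply, ContinuousLinearMap.comp_apply,
    ContinuousLinearMap.prod_apply, smul_eq_mul]
  rw [fderiv_apply c _ hX]
  simp only [ScriFun.sub_apply, ScriFun.mul_apply, ScriFun.smul_apply, _root_.sub_apply,
    ContinuousLinearMap.comp_apply, innerSL_apply_apply, ContinuousLinearMap.proj_apply]
  have hth : ∀ i, (th i : ScriFun m) (X 0 - ‖sp X‖, sp X) = dir (sp X) i := by
    intro i
    change pt (sp X) i = _
    rw [pt_of_ne hX]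
  refine Fin.cases ?_ (fun i => ?_) μ
  · simp [sp_single_zero]
  · simp only [sp_single_succ, Lc_succ, Dx_succ, nc_succ, ScriFun.neg_apply, hth]
    simp [EuclideanSpace.inner_single_right, Fin.succ_ne_zero]
    ring

/-! ### Formal expansions -/

/-- The coefficients of the partial derivatives of an expansion. -/
def dC (μ : Fin (m + 1)) : Module.End ℝ (ℤ → ScriFun m) where
  toFun c k := Lc μ * dU (c k) + (Dx μ (c (k - 2)) - (((k : ℝ) - 2) / 2) • (nc μ * c (k - 2)))
  map_add' a b := by
    funext k
    simp only [Pi.add_apply, map_add, mul_add, smul_add]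
    abel
  map_smul' r a := by
    funext k
    simp only [Pi.smul_apply, Derivation.map_smul, mul_smul_comm, smul_sub, smul_add,
      RingHom.id_apply, smul_comm r]

lemma dC_apply (μ : Fin (m + 1)) (c : ℤ → ScriFun m) (k : ℤ) :
    dC μ c k = Lc μ * dU (c k) +
      (Dx μ (c (k - 2)) - (((k : ℝ) - 2) / 2) • (nc μ * c (k - 2))) := rfl

lemma dU_Lc (μ : Fin (m + 1)) : dU (Lc μ : ScriFun m) = 0 := by
  refine Fin.cases ?_ (fun i => ?_) μ
  · simp
  · simp [dU_th]

lemma dU_nc (μ : Fin (m + 1)) : dU (nc μ : ScriFun m) = 0 := by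
  refine Fin.cases ?_ (fun i => ?_) μ
  · simp
  · simp [dU_th]

lemma dU_Dx (μ : Fin (m + 1)) (c : ScriFun m) : dU (Dx μ c) = Dx μ (dU c) := by
  refine Fin.cases ?_ (fun i => ?_) μ
  · simp
  · simp [dU_D]

lemma Dx_comm (μ ν : Fin (m + 1)) (c : ScriFun m) :
    Dx μ (Dx ν c) = Dx ν (Dx μ c) + nc μ * Dx ν c - nc ν * Dx μ c := by
  refine Fin.cases ?_ (fun i => ?_) μ
  · simp
  · refine Fin.cases ?_ (fun j => ?_) ν
    · simp
    · simpa using D_comm i j c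

lemma Dx_nc_comm (μ ν : Fin (m + 1)) : Dx μ (nc ν : ScriFun m) = Dx ν (nc μ) := by
  refine Fin.cases ?_ (fun i => ?_) μ
  · simp
  · refine Fin.cases ?_ (fun j => ?_) ν
    · simp
    · simp only [Dx_succ, nc_succ, D_th, mul_comm (th i), eq_comm (a := i)]

lemma Dx_Lc_comm (μ ν : Fin (m + 1)) : Dx μ (Lc ν : ScriFun m) = Dx ν (Lc μ) := by
  refine Fin.cases ?_ (fun i => ?_) μ
  · refine Fin.cases ?_ (fun j => ?_) ν <;> simp
  · refine Fin.cases ?_ (fun j => ?_) ν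
    · simp
    · simp only [Dx_succ, Lc_succ, map_neg, D_th, mul_comm (th i), eq_comm (a := i)]

/-- The commutator of the angular gradients cancels against the shift by one in the radial
exponents. The identity holds for arbitrary sequences, with no function behind them, so linearized
gravity can be done purely formally. -/
lemma dC_comm (μ ν : Fin (m + 1)) (c : ℤ → ScriFun m) : dC μ (dC ν c) = dC ν (dC μ c) := by
  funext k
  simp only [dC_apply, map_add, map_sub, Derivation.leibniz, Derivation.map_smul, dU_Lc, dU_nc,
    dU_Dx, smul_eq_mul, mul_zero, add_zero]
  rw [Dx_comm μ ν (c (k - 2 - 2)), Dx_nc_comm μ ν, Dx_Lc_comm μ ν]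
  push_cast
  apply ext_sphere
  intro u θ hθ
  simp only [ScriFun.add_apply, ScriFun.sub_apply, ScriFun.mul_apply, ScriFun.smul_apply]
  ring

end

end NullMemory

namespace NullMemory

noncomputable section

variable {m : ℕ}

/-! ### Integration over the sphere -/

/-- A bump function supported away from the origin. -/
def annulusBump : ContDiffBump (2 : ℝ) := ⟨1 / 4, 1 / 2, by norm_num, by norm_num⟩

/-- Multiplication by a smooth radial cut-off that is supported in an annulus. -/
def cutoff (f : Space m → ℝ) (y : Space m) : ℝ := annulusBump (‖y‖ ^ 2) * f y

lemma annulusBump_eq_zero {x : ℝ} (h : x ≤ 3 / 2 ∨ 5 / 2 ≤ x) : annulusBump x = 0 := by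
  apply annulusBump.zero_of_le_dist
  change 1 / 2 ≤ |x - 2|
  rcases h with h | h
  · rw [abs_of_neg (by linarith)]; linarith
  · rw [abs_of_pos (by linarith)]; linarith

lemma cutoff_eventuallyEq_zero (f : Space m → ℝ) : cutoff f =ᶠ[𝓝 0] fun _ => 0 := by
  have : ∀ᶠ y : Space m in 𝓝 0, ‖y‖ ^ 2 < 1 := by
    have hc : Continuous fun y : Space m => ‖y‖ ^ 2 := by fun_prop
    have := hc.tendsto 0
    simp only [norm_zero] at this
    exact this.eventually (gt_mem_nhds (by norm_num))
  filter_upwards [this] with y hy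
  rw [cutoff, annulusBump_eq_zero (Or.inl (by linarith)), zero_mul]

lemma contDiff_cutoff {f : Space m → ℝ} (hf : ContDiffOn ℝ ∞ f {y | y ≠ 0}) :
    ContDiff ℝ ∞ (cutoff f) := by
  rw [contDiff_iff_contDiffAt]
  intro y
  by_cases hy : y = 0
  · subst hy
    exact contDiffAt_const.congr_of_eventuallyEq (cutoff_eventuallyEq_zero f)
  · refine ContDiffAt.mul ?_ (hf.contDiffAt (isOpen_ne.mem_nhds hy))
    exact annulusBump.contDiff.contDiffAt.comp y (contDiff_norm_sq ℝ).contDiffAt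

lemma hasCompactSupport_cutoff (f : Space m → ℝ) : HasCompactSupport (cutoff f) := by
  refine HasCompactSupport.intro (isCompact_closedBall 0 2) fun y hy => ?_
  have : 2 < ‖y‖ := by simpa using hy
  rw [cutoff, annulusBump_eq_zero (Or.inr (by nlinarith)), zero_mul]

lemma integrable_cutoff {f : Space m → ℝ} (hf : ContDiffOn ℝ ∞ f {y | y ≠ 0}) :
    Integrable (cutoff f) :=
  (contDiff_cutoff hf).continuous.integrable_of_hasCompactSupport (hasCompactSupport_cutoff f)

lemma integral_fderiv_of_hasCompactSupport {G : Space m → ℝ} (hG : ContDiff ℝ ∞ G)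
    (hc : HasCompactSupport G) (v : Space m) : ∫ y, fderiv ℝ G y v = 0 := by
  have h1 : Integrable fun y => fderiv ℝ G y v := by
    refine Continuous.integrable_of_hasCompactSupport ?_ (hc.fderiv_apply ℝ v)
    exact (hG.continuous_fderiv (by simp)).clm_apply continuous_const
  have h2 := hG.continuous.integrable_of_hasCompactSupport hc (μ := volume)
  have := integral_mul_fderiv_eq_neg_fderiv_mul_of_integrable (μ := volume)
    (f := fun _ : Space m => (1 : ℝ)) (g := G) (v := v) (by simp) (by simpa using h1)
    (by simpa using h2) (fun _ _ => differentiableAt_const _)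
    (fun y _ => hG.differentiable (by simp) y)
  simpa using this

lemma cutoff_nonneg (f : Space m → ℝ) (hf : ∀ y, 0 ≤ f y) (y : Space m) : 0 ≤ cutoff f y :=
  mul_nonneg annulusBump.nonneg (hf y)

variable [NeZero m]

open ScriFun

lemma contDiffOn_slice (c : ScriFun m) : ContDiffOn ℝ ∞ (fun y => c (0, y)) {y | y ≠ 0} :=
  (ScriFun.contDiffOn c).comp (contDiffOn_const.prodMk contDiffOn_id) fun _ hy => hy

/-- Integration over the sphere, up to a constant factor. -/
def sphereInt : ScriFun m →ₗ[ℝ] ℝ where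
  toFun c := ∫ y, cutoff (fun y => c (0, y)) y
  map_add' a b := by
    rw [← integral_add (integrable_cutoff (contDiffOn_slice a))
      (integrable_cutoff (contDiffOn_slice b))]
    congr 1
    funext y
    simp [cutoff, mul_add]
  map_smul' r a := by
    simp only [RingHom.id_apply, smul_eq_mul]
    rw [← integral_const_mul]
    congr 1
    funext y
    simp [cutoff]
    ring

lemma sphereInt_apply (c : ScriFun m) : sphereInt c = ∫ y, cutoff (fun y => c (0, y)) y := rfl

lemma fderiv_coord_mul_cutoff (c : ScriFun m) (i j : Fin m) (y : Space m) :
    fderiv ℝ (fun y => y i * cutoff (fun y => c (0, y)) y) y (EuclideanSpace.single j 1) =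
      (if i = j then 1 else 0) * cutoff (fun y => c (0, y)) y +
      y i * fderiv ℝ (cutoff fun y => c (0, y)) y (EuclideanSpace.single j 1) := by
  have h1 : HasFDerivAt (fun y : Space m => y i) (EuclideanSpace.proj (𝕜 := ℝ) i :
      Space m →L[ℝ] ℝ) y :=
    (EuclideanSpace.proj (𝕜 := ℝ) i).hasFDerivAt
  have h2 : HasFDerivAt (cutoff fun y => c (0, y)) (fderiv ℝ (cutoff fun y => c (0, y)) y) y :=
    ((contDiff_cutoff (contDiffOn_slice c)).differentiable (by simp) y).hasFDerivAt
  have h3 : HasFDerivAt (fun y => y i * cutoff (fun y => c (0, y)) y) _ y := h1.mul h2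
  rw [h3.fderiv]
  simp [mul_comm]
  ring

/-- The rotation field `y_i ∂_j - y_j ∂_i` annihilates the radial cut-off, so it acts on `c` alone.
-/
lemma fderiv_cutoff (c : ScriFun m) (i j : Fin m) (y : Space m) :
    y i * fderiv ℝ (cutoff fun y => c (0, y)) y (EuclideanSpace.single j 1) -
      y j * fderiv ℝ (cutoff fun y => c (0, y)) y (EuclideanSpace.single i 1) =
    cutoff (fun y => (th i * D j c - th j * D i c : ScriFun m) (0, y)) y := by
  by_cases hy : y = 0
  · subst hy
    simp [cutoff, annulusBump_eq_zero (x := 0) (by norm_num)]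
  · have hn : ‖y‖ ≠ 0 := norm_ne_zero_iff.2 hy
    have h1 : HasFDerivAt (fun y : Space m => ‖y‖ ^ 2) (2 • (innerSL ℝ y)) y :=
      (hasStrictFDerivAt_norm_sq y).hasFDerivAt
    have h2 : DifferentiableAt ℝ annulusBump (‖y‖ ^ 2) :=
      (annulusBump.contDiff (n := 1)).differentiable (by simp) _
    have h3 : HasFDerivAt (fun y : Space m => annulusBump (‖y‖ ^ 2)) _ y :=
      HasDerivAt.comp_hasFDerivAt y (h₂ := annulusBump) h2.hasDerivAt h1
    have h4 : HasFDerivAt (fun y : Space m => c (0, y)) _ y :=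
      HasFDerivAt.comp y (g := c) (ScriFun.differentiableAt c (p := (0, y)) hy).hasFDerivAt
        ((hasFDerivAt_const (0 : ℝ) y).prodMk (hasFDerivAt_id y))
    have h5 : HasFDerivAt (cutoff fun y => c (0, y)) _ y := h3.mul h4
    have hth : ∀ i, (th i : ScriFun m) (0, y) = ‖y‖⁻¹ * y i := by
      intro i
      change pt y i = _
      rw [pt_of_ne hy]
      rfl
    rw [h5.fderiv]
    simp [fderiv_apply c 0 hy, cutoff, hth, EuclideanSpace.inner_single_right,
      EuclideanSpace.single]
    ring

/-- Rotation fields are divergence-free, so the integral of a rotational derivative of a compactly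
supported function vanishes. -/
lemma sphereInt_rotation (i j : Fin m) (c : ScriFun m) :
    sphereInt (th i * D j c) = sphereInt (th j * D i c) := by
  rw [← sub_eq_zero, ← map_sub, sphereInt_apply]
  have hF := contDiff_cutoff (contDiffOn_slice c)
  have hc := hasCompactSupport_cutoff fun y => c (0, y)
  have hG : ∀ i : Fin m, ContDiff ℝ ∞ fun y : Space m => y i * cutoff (fun y => c (0, y)) y :=
    fun i => (EuclideanSpace.proj (𝕜 := ℝ) i).contDiff.mul hF
  have hGc : ∀ i : Fin m, HasCompactSupport fun y : Space m => y i * cutoff (fun y => c (0, y)) y :=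
    fun i => hc.mul_left
  have hi : ∀ i j : Fin m, Integrable fun y => fderiv ℝ
      (fun y : Space m => y i * cutoff (fun y => c (0, y)) y) y (EuclideanSpace.single j 1) := by
    intro i j
    refine Continuous.integrable_of_hasCompactSupport ?_ ((hGc i).fderiv_apply ℝ _)
    exact ((hG i).continuous_fderiv (by simp)).clm_apply continuous_const
  have h1 := integral_fderiv_of_hasCompactSupport (hG i) (hGc i) (EuclideanSpace.single j 1)
  have h2 := integral_fderiv_of_hasCompactSupport (hG j) (hGc j) (EuclideanSpace.single i 1)
  have h3 := integral_sub (hi i j) (hi j i)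
  rw [h1, h2, sub_zero] at h3
  refine Eq.trans ?_ h3
  congr 1
  funext y
  rw [fderiv_coord_mul_cutoff, fderiv_coord_mul_cutoff, ← fderiv_cutoff]
  simp only [eq_comm (a := i)]
  ring

lemma sum_th_D_th (j : Fin m) : ∑ i, th i * D j (th i) = (0 : ScriFun m) := by
  have h := congrArg (D j) (sum_th_th (m := m))
  rw [map_sum] at h
  simp only [Derivation.leibniz, smul_eq_mul, Derivation.map_one_eq_zero] at h
  apply ext_sphere
  intro u θ hθ
  have h' := congrArg (fun c : ScriFun m => c (u, θ)) h
  simp only [ScriFun.sum_apply, ScriFun.add_apply, ScriFun.mul_apply, Finset.sum_add_distrib,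
    ScriFun.zero_apply] at h' ⊢
  linarith

lemma sum_D_th : ∑ i, D i (th i) = algebraMap ℝ (ScriFun m) ((m : ℝ) - 1) := by
  simp only [D_th, if_true, Finset.sum_sub_distrib, sum_th_th]
  simp

/-- Integration by parts on the sphere: `D j c` is `∑ th i * D j (th i * c)`, rotation invariance
exchanges `i` and `j`, and the divergence of the direction field gives the factor `m - 1`, its mean
curvature. -/
lemma sphereInt_D (j : Fin m) (c : ScriFun m) :
    sphereInt (D j c) = ((m : ℝ) - 1) * sphereInt (th j * c) := by
  have h1 : D j c = ∑ i, th i * D j (th i * c) := by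
    simp only [Derivation.leibniz, smul_eq_mul, mul_add, Finset.sum_add_distrib]
    have e1 : ∑ i, th i * (th i * D j c) = D j c := by
      simp only [← mul_assoc, ← Finset.sum_mul, sum_th_th, one_mul]
    have e2 : ∑ i, th i * (c * D j (th i)) = 0 := by
      have : ∀ i, th i * (c * D j (th i)) = c * (th i * D j (th i)) := fun i => by ring
      simp only [this, ← Finset.mul_sum, sum_th_D_th, mul_zero]
    rw [e1, e2, add_zero]
  have h2 : ∑ i, th j * D i (th i * c) = ((m : ℝ) - 1) • (th j * c) := by
    simp only [← Finset.mul_sum, Derivation.leibniz, smul_eq_mul, Finset.sum_add_distrib,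
      sum_th_D, sum_D_th, zero_add]
    rw [Algebra.algebraMap_eq_smul_one]
    simp
  conv_lhs => rw [h1]
  rw [map_sum]
  simp only [sphereInt_rotation _ j]
  rw [← map_sum, h2, map_smul, smul_eq_mul]

lemma sphereInt_nonneg (c : ScriFun m) : 0 ≤ sphereInt (c * c) :=
  integral_nonneg (cutoff_nonneg _ fun _ => mul_self_nonneg _)

lemma eq_zero_of_sphereInt_eq_zero {c : ScriFun m} (h : sphereInt (c * c) = 0) {θ : Space m}
    (hθ : ‖θ‖ = 1) : c (0, θ) = 0 := by
  have h1 := (contDiff_cutoff (contDiffOn_slice (c * c))).continuous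
  have h2 : cutoff (fun y => (c * c) (0, y)) = 0 := by
    rw [← h1.ae_eq_iff_eq volume continuous_zero]
    exact (integral_eq_zero_iff_of_nonneg (cutoff_nonneg _ fun _ => mul_self_nonneg _)
      (integrable_cutoff (contDiffOn_slice (c * c)))).1 h
  -- At radius `√2` the squared norm is `2`, the centre of the bump, where the cut-off equals one.
  have h3 := congrFun h2 (√2 • θ)
  have hs : (0 : ℝ) < √2 := by positivity
  rw [Pi.zero_apply, cutoff, norm_smul, hθ, mul_one, Real.norm_of_nonneg hs.le,
    Real.sq_sqrt (by norm_num), annulusBump.one_of_mem_closedBall (by simp [annulusBump]),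
    one_mul, ← apply_pt, pt_smul hs, apply_pt, mul_apply] at h3
  exact mul_self_eq_zero.1 h3

lemma apply_of_dU {c : ScriFun m} (h : dU c = 0) (u v : ℝ) (θ : Space m) :
    c (u, θ) = c (v, θ) := by
  refine is_const_of_deriv_eq_zero (f := fun s => c (s, θ))
    (fun s => (hasDerivAt_dU c s θ).differentiableAt) (fun s => ?_) u v
  rw [(hasDerivAt_dU c s θ).deriv, h]
  rfl

lemma eq_zero_of_sphereInt {c : ScriFun m} (hu : dU c = 0) (h : sphereInt (c * c) = 0) :
    c = 0 := by
  refine ext_sphere fun u θ hθ => ?_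
  rw [apply_of_dU hu u 0, eq_zero_of_sphereInt_eq_zero h hθ]
  rfl

lemma eq_zero_of_sphereInt_sum {ι : Type*} {s : Finset ι} {c : ι → ScriFun m}
    (hu : ∀ i ∈ s, dU (c i) = 0) (h : sphereInt (∑ i ∈ s, c i * c i) = 0) :
    ∀ i ∈ s, c i = 0 := by
  rw [map_sum, Finset.sum_eq_zero_iff_of_nonneg fun i _ => sphereInt_nonneg (c i)] at h
  exact fun i hi => eq_zero_of_sphereInt (hu i hi) (h i hi)

end

end NullMemory

namespace NullMemory

noncomputable section

variable {m : ℕ} [NeZero m]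

open ScriFun

/-! ### Calculus in the ring of functions on the sphere -/

/-- Constants. -/
abbrev cst (a : ℝ) : ScriFun m := algebraMap ℝ (ScriFun m) a

lemma cst_add_ofNat (a : ℝ) : (cst (a + 2) : ScriFun m) = cst a + 2 := map_add _ _ _

lemma cst_add_one (a : ℝ) : (cst (a + 1) : ScriFun m) = cst a + 1 := by
  rw [← map_one (algebraMap ℝ (ScriFun m))]
  exact map_add _ _ _

lemma two_apply (p : ℝ × Space m) : (2 : ScriFun m) p = 2 := rfl

/-- The Kronecker delta. -/
def kd (i j : Fin m) : ScriFun m := if i = j then 1 else 0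

lemma kd_comm (i j : Fin m) : (kd i j : ScriFun m) = kd j i := by simp [kd, eq_comm]

lemma sum_kd_mul (j : Fin m) (x : Fin m → ScriFun m) : ∑ i, kd i j * x i = x j := by simp [kd]

@[simp] lemma D_kd (k i j : Fin m) : D k (kd i j : ScriFun m) = 0 := by
  unfold kd; split_ifs <;> simp

@[simp] lemma D_cst (i : Fin m) (a : ℝ) : D i (cst a : ScriFun m) = 0 :=
  Derivation.map_algebraMap _ _

@[simp] lemma dU_cst (a : ℝ) : dU (cst a : ScriFun m) = 0 := Derivation.map_algebraMap _ _

lemma D_th' (i j : Fin m) : D i (th j) = kd i j - th i * th j := by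
  rw [D_th, kd]; split_ifs <;> simp

lemma sum_th_mul_th (x : ScriFun m) : ∑ i, th i * (th i * x) = x := by
  simp only [← mul_assoc, ← Finset.sum_mul, sum_th_th, one_mul]

lemma sum_th_mul_D (x c : ScriFun m) : ∑ i, th i * (x * D i c) = 0 := by
  have : ∀ i, th i * (x * D i c) = x * (th i * D i c) := fun i => by ring
  simp only [this, ← Finset.mul_sum, sum_th_D, mul_zero]

lemma sum_D_th' : ∑ i, D i (th i) = (cst ((m : ℝ) - 1) : ScriFun m) := sum_D_th

/-- The projected derivative of the direction. -/
lemma sum_D_th_mul (j : Fin m) (x : Fin m → ScriFun m) :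
    ∑ i, D i (th j) * x i = x j - th j * ∑ i, th i * x i := by
  simp only [D_th', sub_mul, Finset.sum_sub_distrib, sum_kd_mul, Finset.mul_sum]
  congr 1
  exact Finset.sum_congr rfl fun i _ => by ring

lemma sum_D_th_mul' (j : Fin m) (x : Fin m → ScriFun m) :
    ∑ i, D j (th i) * x i = x j - th j * ∑ i, th i * x i := by
  rw [← sum_D_th_mul]
  exact Finset.sum_congr rfl fun i _ => by rw [D_th', D_th', kd_comm, mul_comm (th j)]

/-- The Laplacian of the sphere. -/
def lap : ScriFun m →ₗ[ℝ] ScriFun m :=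
  ∑ i, (D i).toLinearMap ∘ₗ (D i).toLinearMap

lemma lap_apply (c : ScriFun m) : lap c = ∑ i, D i (D i c) := by simp [lap]

lemma lap_mul (a b : ScriFun m) :
    lap (a * b) = a * lap b + 2 * ∑ i, D i a * D i b + b * lap a := by
  simp only [lap_apply, Derivation.leibniz, map_add, smul_eq_mul, Finset.sum_add_distrib,
    Finset.mul_sum]
  have : ∑ i, D i b * D i a = ∑ i, D i a * D i b := Finset.sum_congr rfl fun i _ => by ring
  rw [this]
  have : ∑ i, 2 * (D i a * D i b) = 2 * ∑ i, D i a * D i b := (Finset.mul_sum ..).symm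
  rw [this]
  ring

lemma lap_cst_mul (a : ℝ) (b : ScriFun m) : lap (cst a * b) = cst a * lap b := by
  rw [lap_mul]; simp [lap_apply]

lemma dU_lap (c : ScriFun m) : dU (lap c) = lap (dU c) := by
  simp only [lap_apply, map_sum, dU_D]

lemma lap_th (j : Fin m) : lap (th j : ScriFun m) = -cst ((m : ℝ) - 1) * th j := by
  have h1 : ∀ i, D i (D i (th j)) = -(th j * D i (th i) + th i * D i (th j)) := by
    intro i
    conv_lhs => rw [D_th' i j, map_sub, D_kd, Derivation.leibniz]
    simp only [smul_eq_mul]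
    ring
  rw [lap_apply]
  simp only [h1, Finset.sum_neg_distrib, Finset.sum_add_distrib, sum_th_D, ← Finset.mul_sum,
    sum_D_th']
  ring

lemma lap_th_mul (j : Fin m) (c : ScriFun m) :
    lap (th j * c) = th j * lap c + 2 * D j c - cst ((m : ℝ) - 1) * (th j * c) := by
  rw [lap_mul, lap_th, sum_D_th_mul j fun i => D i c, sum_th_D]
  ring

/-- Commute `D j` past `D i` twice and sum. The term with `th j` is a normal component that arises
because `lap` acts on Cartesian components; the remaining terms in `D j c` collect to `m - 3`. -/
lemma lap_D (j : Fin m) (c : ScriFun m) :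
    lap (D j c) = D j (lap c) - 2 * (th j * lap c) + cst ((m : ℝ) - 3) * D j c := by
  have h1 : ∀ i, D i (D i (D j c)) = D j (D i (D i c)) + th i * D j (D i c) - th j * D i (D i c)
      + D i (th i) * D j c + th i * D i (D j c) - D i (th j) * D i c - th j * D i (D i c) := by
    intro i
    conv_lhs => rw [D_comm i j c]
    simp only [map_add, map_sub, Derivation.leibniz, smul_eq_mul]
    conv_lhs => rw [D_comm i j (D i c)]
    ring
  have h2 : ∑ i, th i * D j (D i c) = -D j c := by
    have h := congrArg (D j) (sum_th_D c)
    rw [map_sum, map_zero] at h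
    simp only [Derivation.leibniz, smul_eq_mul, Finset.sum_add_distrib] at h
    have h3 := sum_D_th_mul' j fun i => D i c
    rw [sum_th_D] at h3
    have h4 : ∑ i, D i c * D j (th i) = ∑ i, D j (th i) * D i c :=
      Finset.sum_congr rfl fun i _ => by ring
    rw [h4, h3] at h
    linear_combination h
  rw [lap_apply]
  simp only [h1, Finset.sum_add_distrib, Finset.sum_sub_distrib, h2, sum_th_D,
    ← Finset.mul_sum, ← Finset.sum_mul, sum_D_th', sum_D_th_mul j fun i => D i c, ← map_sum,
    ← lap_apply]
  have : (cst ((m : ℝ) - 1) : ScriFun m) = cst ((m : ℝ) - 3) + 2 := by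
    rw [← cst_add_ofNat, show (m : ℝ) - 1 = ((m : ℝ) - 3) + 2 by ring]
  rw [this]
  ring

lemma sum_th_mul_lap (v : Fin m → ScriFun m) :
    ∑ j, th j * lap (v j) = lap (∑ j, th j * v j) + cst ((m : ℝ) - 1) * ∑ j, th j * v j
      - 2 * ∑ j, D j (v j) := by
  rw [map_sum]
  simp only [lap_th_mul, Finset.sum_add_distrib, Finset.sum_sub_distrib, ← Finset.mul_sum]
  ring

lemma sum_D_lap (v : Fin m → ScriFun m) :
    ∑ j, D j (lap (v j)) = lap (∑ j, D j (v j)) + 2 * ∑ j, th j * lap (v j)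
      - cst ((m : ℝ) - 3) * ∑ j, D j (v j) := by
  rw [map_sum]
  simp only [lap_D, Finset.sum_add_distrib, Finset.sum_sub_distrib, ← Finset.mul_sum]
  ring

/-- Differentiating tangency gives the second fundamental form of the sphere. It is the normal part
that must be projected out of a componentwise derivative to obtain the covariant one. -/
lemma sum_th_mul_D_of_tangent {v : Fin m → ScriFun m} (hv : ∑ i, th i * v i = 0) (j : Fin m) :
    ∑ i, th i * D j (v i) = -v j := by
  have h := congrArg (D j) hv
  rw [map_sum, map_zero] at h
  simp only [Derivation.leibniz, smul_eq_mul, Finset.sum_add_distrib] at h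
  have h3 := sum_D_th_mul' j v
  have h4 : ∑ i, v i * D j (th i) = ∑ i, D j (th i) * v i :=
    Finset.sum_congr rfl fun i _ => by ring
  rw [h4, h3, hv] at h
  linear_combination h

/-- Stationary divergence-free tangent vector fields. -/
structure IsVec (v : Fin m → ScriFun m) : Prop where
  tangent : ∑ i, th i * v i = 0
  div : ∑ i, D i (v i) = 0
  stationary : ∀ i, dU (v i) = 0

/-- Stationary, symmetric, trace-free, divergence-free tangent tensor fields. -/
structure IsTen (t : Fin m → Fin m → ScriFun m) : Prop where
  symm : ∀ i j, t i j = t j i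
  tangent : ∀ j, ∑ i, th i * t i j = 0
  trace : ∑ i, t i i = 0
  div : ∀ j, ∑ i, D i (t i j) = 0
  stationary : ∀ i j, dU (t i j) = 0

/-- The Hessian. -/
def hs (f : ScriFun m) (i j : Fin m) : ScriFun m := D i (D j f) + th j * D i f

/-- The trace-free part of the Hessian. -/
def tf (f : ScriFun m) (i j : Fin m) : ScriFun m :=
  hs f i j - D i (th j) * (cst (1 / ((m : ℝ) - 1)) * lap f)

/-- The symmetrized covariant derivative. -/
def sg (v : Fin m → ScriFun m) (i j : Fin m) : ScriFun m :=
  cst (1 / 2) * (D i (v j) + th j * v i + D j (v i) + th i * v j)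

lemma hs_comm (f : ScriFun m) (i j : Fin m) : hs f i j = hs f j i := by
  rw [hs, hs, D_comm i j]; ring

lemma tf_comm (f : ScriFun m) (i j : Fin m) : tf f i j = tf f j i := by
  rw [tf, tf, hs_comm, D_th', D_th', kd_comm, mul_comm (th i)]

lemma sum_th_hs (f : ScriFun m) (j : Fin m) : ∑ i, th i * hs f i j = 0 := by
  simp only [hs, mul_add, Finset.sum_add_distrib, sum_th_D, sum_th_mul_D, add_zero]

lemma sum_th_mul_q (x : ScriFun m) (j : Fin m) : ∑ i, th i * (D i (th j) * x) = 0 := by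
  simp only [← mul_assoc, ← Finset.sum_mul, sum_th_D, zero_mul]

lemma sum_th_tf (f : ScriFun m) (j : Fin m) : ∑ i, th i * tf f i j = 0 := by
  simp only [tf, mul_sub, Finset.sum_sub_distrib, sum_th_hs, sum_th_mul_q, sub_zero]

lemma sum_hs (f : ScriFun m) : ∑ i, hs f i i = lap f := by
  simp only [hs, Finset.sum_add_distrib, sum_th_D, add_zero, lap_apply]

lemma cst_mul_inv {a : ℝ} (ha : a ≠ 0) : (cst a * cst (1 / a) : ScriFun m) = 1 := by
  rw [← map_mul, mul_one_div_cancel ha, map_one]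

lemma sum_tf (hm : 2 ≤ m) (f : ScriFun m) : ∑ i, tf f i i = 0 := by
  have h : (m : ℝ) - 1 ≠ 0 := by
    have : (2 : ℝ) ≤ m := by exact_mod_cast hm
    linarith
  simp only [tf, Finset.sum_sub_distrib, sum_hs, ← Finset.sum_mul, sum_D_th', ← mul_assoc,
    cst_mul_inv h]
  ring

lemma sum_D_hs (f : ScriFun m) (j : Fin m) :
    ∑ i, D i (hs f i j) = D j (lap f) - th j * lap f + cst ((m : ℝ) - 2) * D j f := by
  have h : ∑ i, D i f * D i (th j) = D j f := by
    have := sum_D_th_mul j fun i => D i f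
    rw [sum_th_D] at this
    rw [← sub_zero (D j f), ← mul_zero (th j), ← this]
    exact Finset.sum_congr rfl fun i _ => by ring
  simp only [hs, map_add, Derivation.leibniz, smul_eq_mul, Finset.sum_add_distrib,
    ← Finset.mul_sum, ← lap_apply, lap_D, h]
  have : (cst ((m : ℝ) - 2) : ScriFun m) = cst ((m : ℝ) - 3) + 1 := by
    rw [← cst_add_one, show (m : ℝ) - 2 = ((m : ℝ) - 3) + 1 by ring]
  rw [this]
  ring

lemma sum_D_q_mul (x : ScriFun m) (j : Fin m) :
    ∑ i, D i (D i (th j) * x) = D j x - cst ((m : ℝ) - 1) * (th j * x) := by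
  simp only [Derivation.leibniz, smul_eq_mul, Finset.sum_add_distrib, ← Finset.mul_sum]
  rw [sum_D_th_mul j fun i => D i x, sum_th_D, ← lap_apply, lap_th]
  ring

/-- The contracted Ricci identity on the sphere. The componentwise divergence of a tangent tensor
has normal part minus its trace, so for this trace-free tensor it is already tangential. -/
lemma sum_D_tf (hm : 2 ≤ m) (f : ScriFun m) (j : Fin m) :
    ∑ i, D i (tf f i j) =
      cst (((m : ℝ) - 2) / ((m : ℝ) - 1)) * D j (lap f + cst ((m : ℝ) - 1) * f) := by
  have h : (m : ℝ) - 1 ≠ 0 := by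
    have : (2 : ℝ) ≤ m := by exact_mod_cast hm
    linarith
  simp only [tf, map_sub, Finset.sum_sub_distrib, sum_D_hs, sum_D_q_mul]
  simp only [Derivation.leibniz, map_add, D_cst, smul_eq_mul, mul_zero, add_zero]
  refine ext_sphere fun u θ _ => ?_
  simp
  field_simp
  ring

lemma sg_comm (v : Fin m → ScriFun m) (i j : Fin m) : sg v i j = sg v j i := by
  rw [sg, sg]; ring

lemma sum_th_sg {v : Fin m → ScriFun m} (hv : ∑ i, th i * v i = 0) (j : Fin m) :
    ∑ i, th i * sg v i j = 0 := by
  have h : ∀ i, th i * sg v i j = cst (1 / 2) * (th i * D i (v j) + th j * (th i * v i)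
      + th i * D j (v i) + th i * (th i * v j)) := fun i => by rw [sg]; ring
  simp only [h, ← Finset.mul_sum, Finset.sum_add_distrib, sum_th_D, sum_th_mul_th, hv,
    sum_th_mul_D_of_tangent hv]
  ring

lemma two_eq_cst : (2 : ScriFun m) = cst 2 := rfl

lemma half_mul_two : (cst (1 / 2) * 2 : ScriFun m) = 1 := by
  rw [two_eq_cst, ← map_mul]; norm_num

lemma sum_sg {v : Fin m → ScriFun m} (hv : IsVec v) : ∑ i, sg v i i = 0 := by
  simp only [sg, ← Finset.mul_sum, Finset.sum_add_distrib, hv.tangent, hv.div]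
  ring

lemma sum_D_sg {v : Fin m → ScriFun m} (hv : IsVec v) (j : Fin m) :
    ∑ i, D i (sg v i j) = cst (1 / 2) * (lap (v j) + cst ((m : ℝ) - 1) * v j) := by
  have h1 : ∀ i, D i (sg v i j) = cst (1 / 2) * (D i (D i (v j)) + th j * D i (v i)
      + D i (th j) * v i + (D j (D i (v i)) + th i * D j (v i) - th j * D i (v i))
      + D i (th i) * v j + th i * D i (v j)) := by
    intro i
    rw [sg]
    simp only [map_add, Derivation.leibniz, D_cst, smul_eq_mul]
    rw [D_comm i j]
    ring
  simp only [h1, ← Finset.mul_sum, Finset.sum_add_distrib, Finset.sum_sub_distrib, ← lap_apply,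
    hv.div, sum_D_th_mul j v, hv.tangent, ← Finset.sum_mul, sum_D_th', sum_th_D,
    sum_th_mul_D_of_tangent hv.tangent, ← map_sum, map_zero]
  ring

/-- The spatial components of a memory tensor. -/
def memTensor (U R Θ : ScriFun m) (r S : Fin m → ScriFun m) (t : Fin m → Fin m → ScriFun m)
    (i j : Fin m) : ScriFun m :=
  -U * (th i * th j) + th i * (D j R + r j) + (D i R + r i) * th j +
    (tf Θ i j + D i (th j) * (cst (1 / ((m : ℝ) - 1)) * U) + sg S i j + t i j)

variable {U R Θ : ScriFun m} {r S : Fin m → ScriFun m} {t : Fin m → Fin m → ScriFun m}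

lemma sum_th_memTensor (hr : IsVec r) (hS : IsVec S) (ht : IsTen t) (j : Fin m) :
    ∑ i, th i * memTensor U R Θ r S t i j = -U * th j + (D j R + r j) := by
  have h : ∀ i, th i * memTensor U R Θ r S t i j = th i * (th i * (-U * th j)) +
      th i * (th i * (D j R + r j)) + th j * (th i * D i R + th i * r i) +
      (th i * tf Θ i j + th i * (D i (th j) * (cst (1 / ((m : ℝ) - 1)) * U)) +
        th i * sg S i j + th i * t i j) := fun i => by rw [memTensor]; ring
  simp only [h, Finset.sum_add_distrib, sum_th_mul_th, ← Finset.mul_sum, sum_th_D, hr.tangent,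
    sum_th_tf, sum_th_mul_q, sum_th_sg hS.tangent, ht.tangent]
  ring

lemma sum_D_memTensor (hm : 2 ≤ m) (hr : IsVec r) (hS : IsVec S) (ht : IsTen t) (j : Fin m) :
    ∑ i, D i (memTensor U R Θ r S t i j) =
      -cst ((m : ℝ) - 1) * (U * th j) + cst m * (D j R + r j) + th j * lap R +
      (cst (((m : ℝ) - 2) / ((m : ℝ) - 1)) * D j (lap Θ + cst ((m : ℝ) - 1) * Θ) +
        cst (1 / ((m : ℝ) - 1)) * D j U - th j * U
        + cst (1 / 2) * (lap (S j) + cst ((m : ℝ) - 1) * S j)) := by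
  have h1 : (m : ℝ) - 1 ≠ 0 := by
    have : (2 : ℝ) ≤ m := by exact_mod_cast hm
    linarith
  have h : ∀ i, D i (memTensor U R Θ r S t i j) =
      -(th j * (th i * D i U)) - U * (D i (th i) * th j + th i * D i (th j))
      + D i (th i) * (D j R + r j) + th i * D i (D j R + r j)
      + (D i (D i R) + D i (r i)) * th j + D i (th j) * (D i R + r i)
      + (D i (tf Θ i j) + D i (D i (th j) * (cst (1 / ((m : ℝ) - 1)) * U)) + D i (sg S i j)
      + D i (t i j)) := fun i => by
    rw [memTensor]
    simp only [map_add, map_neg, Derivation.leibniz, smul_eq_mul]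
    ring
  simp only [h, Finset.sum_add_distrib, Finset.sum_sub_distrib, Finset.sum_neg_distrib,
    ← Finset.mul_sum, ← Finset.sum_mul, sum_th_D, sum_D_th', ← lap_apply, hr.div,
    sum_D_tf hm, sum_D_q_mul, sum_D_sg hS, ht.div]
  rw [sum_D_th_mul j fun i => D i R + r i]
  simp only [mul_add, Finset.sum_add_distrib, sum_th_D, hr.tangent]
  simp only [Derivation.leibniz, D_cst, smul_eq_mul, mul_zero, add_zero]
  refine ext_sphere fun u θ _ => ?_
  simp
  field_simp
  ring

/-- The constraint on the memory tensor that the Einstein equation implies. -/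
def constraint (E : Fin m → Fin m → ScriFun m) (j : Fin m) : ScriFun m :=
  lap (∑ i, th i * E i j) +
    cst ((m : ℝ) - 3) * (∑ i, D i (E i j) - cst ((m : ℝ) - 1) * ∑ i, th i * E i j)

/-- The part of the constraint that comes from the vector fields. -/
def vecConstraint (r S : Fin m → ScriFun m) (j : Fin m) : ScriFun m :=
  lap (r j) + cst ((m : ℝ) - 3) * (r j + cst (1 / 2) * (lap (S j) + cst ((m : ℝ) - 1) * S j))

/-- The operator respects the decomposition: a radial part, a gradient part and a divergence-free
tangent part come out separately. The tensor `t` is annihilated, being tangent and divergence-free.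
-/
lemma constraint_memTensor (hm : 2 ≤ m) (hr : IsVec r) (hS : IsVec S) (ht : IsTen t)
    (j : Fin m) :
    constraint (memTensor U R Θ r S t) j =
      th j * (-lap U + 2 * U + cst ((m : ℝ) - 5) * lap R) +
      D j (-(2 * U) + lap R + cst ((m : ℝ) - 3) * (2 * R +
        cst (((m : ℝ) - 2) / ((m : ℝ) - 1)) * (lap Θ + cst ((m : ℝ) - 1) * Θ) +
        cst (1 / ((m : ℝ) - 1)) * U)) + vecConstraint r S j := by
  rw [constraint, sum_th_memTensor hr hS ht, sum_D_memTensor hm hr hS ht, vecConstraint]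
  have e : -U * th j + (D j R + r j) = -(th j * U) + D j R + r j := by ring
  rw [e, map_add, map_add, map_neg, lap_th_mul, lap_D]
  have e2 : D j (2 : ScriFun m) = 0 := D_cst j 2
  simp only [map_add, map_neg, Derivation.leibniz, smul_eq_mul, D_cst, e2]
  refine ext_sphere fun u θ _ => ?_
  simp [two_apply]
  ring

end

end NullMemory

namespace NullMemory

noncomputable section

variable {m : ℕ} [NeZero m]

open ScriFun

/-! ### Consequences of the constraint on the memory tensor -/

/-- Symmetric, trace-free tangent tensor fields. -/
structure IsSTF (P : Fin m → Fin m → ScriFun m) : Prop where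
  symm : ∀ i j, P i j = P j i
  tangent : ∀ j, ∑ i, th i * P i j = 0
  trace : ∑ i, P i i = 0

/-- The contraction of two tensor fields. -/
def dot₂ (P Q : Fin m → Fin m → ScriFun m) : ScriFun m := ∑ j, ∑ i, P i j * Q i j

/-- The contraction of two vector fields. -/
def dot (v w : Fin m → ScriFun m) : ScriFun m := ∑ j, v j * w j

lemma dot₂_add (P Q Q' : Fin m → Fin m → ScriFun m) :
    dot₂ P (fun i j => Q i j + Q' i j) = dot₂ P Q + dot₂ P Q' := by
  simp [dot₂, mul_add, Finset.sum_add_distrib]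

lemma dot₂_mul_left (a : ScriFun m) (P Q : Fin m → Fin m → ScriFun m) :
    dot₂ P (fun i j => a * Q i j) = a * dot₂ P Q := by
  simp only [dot₂, Finset.mul_sum]
  exact Finset.sum_congr rfl fun i _ => Finset.sum_congr rfl fun j _ => by ring

lemma dot_add (v w w' : Fin m → ScriFun m) :
    dot v (fun i => w i + w' i) = dot v w + dot v w' := by
  simp [dot, mul_add, Finset.sum_add_distrib]

lemma dot_mul_left (a : ScriFun m) (v w : Fin m → ScriFun m) :
    dot v (fun i => a * w i) = a * dot v w := by
  simp only [dot, Finset.mul_sum]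
  exact Finset.sum_congr rfl fun i _ => by ring

lemma dot₂_comm (P Q : Fin m → Fin m → ScriFun m) : dot₂ P Q = dot₂ Q P := by
  simp only [dot₂, mul_comm]

lemma dot₂_transpose {P : Fin m → Fin m → ScriFun m} (hP : IsSTF P)
    (Q : Fin m → Fin m → ScriFun m) : dot₂ P (fun i j => Q j i) = dot₂ P Q := by
  rw [dot₂, Finset.sum_comm]
  exact Finset.sum_congr rfl fun i _ => Finset.sum_congr rfl fun j _ => by rw [hP.symm]

lemma dot₂_th {P : Fin m → Fin m → ScriFun m} (hP : IsSTF P) (x : Fin m → ScriFun m) :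
    dot₂ P (fun i j => th i * x j) = 0 := by
  refine Finset.sum_eq_zero fun j _ => ?_
  have : ∀ i, P i j * (th i * x j) = th i * P i j * x j := fun i => by ring
  simp only [this, ← Finset.sum_mul, hP.tangent, zero_mul]

lemma dot₂_th' {P : Fin m → Fin m → ScriFun m} (hP : IsSTF P) (x : Fin m → ScriFun m) :
    dot₂ P (fun i j => th j * x i) = 0 := by
  rw [← dot₂_th hP x]
  exact dot₂_transpose hP fun i j => th i * x j

lemma dot₂_q {P : Fin m → Fin m → ScriFun m} (hP : IsSTF P) (x : ScriFun m) :
    dot₂ P (fun i j => D i (th j) * x) = 0 := by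
  have h : (fun i j => D i (th j) * x) = fun i j => kd i j * x + th i * (-th j * x) := by
    funext i j
    rw [D_th']
    ring
  rw [h, dot₂_add, dot₂_th hP fun j => -th j * x, add_zero]
  have : ∀ j i, P i j * (kd i j * x) = kd i j * (P i j * x) := fun j i => by ring
  simp only [dot₂, this, sum_kd_mul, ← Finset.sum_mul, hP.trace, zero_mul]

lemma dot₂_hs {P : Fin m → Fin m → ScriFun m} (hP : IsSTF P) (f : ScriFun m) :
    dot₂ P (hs f) = dot₂ P fun i j => D i (D j f) := by
  have h : hs f = fun i j => D i (D j f) + th j * D i f := rfl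
  rw [h, dot₂_add, dot₂_th' hP, add_zero]

lemma dot₂_tf {P : Fin m → Fin m → ScriFun m} (hP : IsSTF P) (f : ScriFun m) :
    dot₂ P (tf f) = dot₂ P fun i j => D i (D j f) := by
  have h : tf f = fun i j => hs f i j + D i (th j) * -(cst (1 / ((m : ℝ) - 1)) * lap f) := by
    funext i j
    rw [tf]
    ring
  rw [h, dot₂_add, dot₂_q hP, add_zero]
  exact dot₂_hs hP f

lemma dot₂_sg {P : Fin m → Fin m → ScriFun m} (hP : IsSTF P) (v : Fin m → ScriFun m) :
    dot₂ P (sg v) = dot₂ P fun i j => D i (v j) := by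
  have h : sg v = fun i j => cst (1 / 2) * (D i (v j) + th j * v i + D j (v i) + th i * v j) := rfl
  rw [h, dot₂_mul_left, dot₂_add, dot₂_add, dot₂_add, dot₂_th' hP, dot₂_th hP,
    dot₂_transpose hP fun i j => D i (v j)]
  linear_combination (dot₂ P fun i j => D i (v j)) * half_mul_two (m := m)

/-- The components at Coulombic order of the symmetrized gradient of a covector field. -/
def gaugeTensor (Jt : ScriFun m) (J : Fin m → ScriFun m) (i j : Fin m) : ScriFun m :=
  cst (1 / 2) * (D i (J j) - cst ((m : ℝ) - 3) * (th i * J j)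
    - th i * (cst ((m : ℝ) - 3) * (th j * Jt) - D j Jt)
    + (D j (J i) - cst ((m : ℝ) - 3) * (th j * J i)
    - th j * (cst ((m : ℝ) - 3) * (th i * Jt) - D i Jt)))

/-- Every term with a factor `th i` or `th j` contracts to zero against a tangent tensor, and
symmetry merges the two remaining derivatives. -/
lemma dot₂_gaugeTensor {P : Fin m → Fin m → ScriFun m} (hP : IsSTF P) (Jt : ScriFun m)
    (J : Fin m → ScriFun m) :
    dot₂ P (gaugeTensor Jt J) = dot₂ P fun i j => D i (J j) := by
  set x : Fin m → ScriFun m := fun j =>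
    -(cst ((m : ℝ) - 3) * J j) - (cst ((m : ℝ) - 3) * (th j * Jt) - D j Jt) with hx
  have h : gaugeTensor Jt J = fun i j => cst (1 / 2) *
      (D i (J j) + D j (J i) + th i * x j + th j * x i) := by
    funext i j
    rw [gaugeTensor]
    ring
  rw [h, dot₂_mul_left, dot₂_add, dot₂_add, dot₂_add, dot₂_th' hP, dot₂_th hP,
    dot₂_transpose hP fun i j => D i (J j)]
  linear_combination (dot₂ P fun i j => D i (J j)) * half_mul_two (m := m)

variable {U R Θ : ScriFun m} {r S : Fin m → ScriFun m} {t : Fin m → Fin m → ScriFun m}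

lemma dot₂_memTensor {P : Fin m → Fin m → ScriFun m} (hP : IsSTF P) :
    dot₂ P (memTensor U R Θ r S t) =
      (dot₂ P fun i j => D i (D j Θ + S j)) + dot₂ P t := by
  have h : memTensor U R Θ r S t = fun i j => th i * (-U * th j + (D j R + r j)) +
      th j * (D i R + r i) + tf Θ i j + D i (th j) * (cst (1 / ((m : ℝ) - 1)) * U) + sg S i j
      + t i j := by
    funext i j
    rw [memTensor]
    ring
  have h2 : (fun i j => D i (D j Θ + S j)) = fun i j => D i (D j Θ) + D i (S j) := by
    funext i j
    rw [map_add]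
  rw [h, dot₂_add, dot₂_add, dot₂_add, dot₂_add, dot₂_add, dot₂_th' hP,
    dot₂_th hP fun j => -U * th j + (D j R + r j), dot₂_q hP, h2, dot₂_add, ← dot₂_tf hP,
    ← dot₂_sg hP]
  ring

lemma sphereInt_div (v : Fin m → ScriFun m) :
    sphereInt (∑ j, D j (v j)) = ((m : ℝ) - 1) * sphereInt (∑ j, th j * v j) := by
  simp only [map_sum, sphereInt_D, Finset.mul_sum]

/-- Divergence-free fields are orthogonal to gradients; tangency removes the mean curvature term of
the integration by parts. -/
lemma sphereInt_dot_D {v : Fin m → ScriFun m} (hv : IsVec v) (f : ScriFun m) :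
    sphereInt (dot v fun j => D j f) = 0 := by
  have h := sphereInt_div fun j => v j * f
  have e1 : ∑ j, D j (v j * f) = dot v fun j => D j f := by
    simp only [Derivation.leibniz, smul_eq_mul, Finset.sum_add_distrib, ← Finset.mul_sum, hv.div]
    simp [dot]
  have e2 : ∑ j, th j * (v j * f) = 0 := by
    simp only [← mul_assoc, ← Finset.sum_mul, hv.tangent, zero_mul]
  rw [e1, e2, map_zero, mul_zero] at h
  exact h

lemma dot_th {v : Fin m → ScriFun m} (hv : ∑ i, th i * v i = 0) (x : ScriFun m) :
    dot v (fun j => th j * x) = 0 := by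
  have : ∀ j, v j * (th j * x) = th j * v j * x := fun j => by ring
  simp only [dot, this, ← Finset.sum_mul, hv, zero_mul]

/-- Apply the divergence theorem to the vector `P y`. It is tangent because `P` is, so no mean
curvature term remains, whether or not `y` is tangent. -/
lemma sphereInt_dot₂_D {P : Fin m → Fin m → ScriFun m} (hP : IsSTF P) (y : Fin m → ScriFun m) :
    sphereInt (dot₂ P fun i j => D i (y j)) = -sphereInt (dot (fun j => ∑ i, D i (P i j)) y) := by
  have h := sphereInt_div fun i => ∑ j, P i j * y j
  have e1 : ∑ i, D i (∑ j, P i j * y j) =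
      (dot₂ P fun i j => D i (y j)) + dot (fun j => ∑ i, D i (P i j)) y := by
    simp only [map_sum, Derivation.leibniz, smul_eq_mul, dot₂, dot]
    rw [Finset.sum_comm, ← Finset.sum_add_distrib]
    refine Finset.sum_congr rfl fun j _ => ?_
    rw [Finset.sum_add_distrib, Finset.sum_mul]
    congr 1
    exact Finset.sum_congr rfl fun i _ => by ring
  have e2 : ∑ i, th i * ∑ j, P i j * y j = 0 := by
    simp only [Finset.mul_sum]
    rw [Finset.sum_comm]
    refine Finset.sum_eq_zero fun j _ => ?_
    simp only [← mul_assoc, ← Finset.sum_mul, hP.tangent, zero_mul]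
  rw [e1, e2, map_zero, mul_zero, map_add] at h
  linarith

lemma isSTF_tf (hm : 2 ≤ m) (f : ScriFun m) : IsSTF (tf f) :=
  ⟨tf_comm f, sum_th_tf f, sum_tf hm f⟩

lemma isSTF_sg {v : Fin m → ScriFun m} (hv : IsVec v) : IsSTF (sg v) :=
  ⟨sg_comm v, sum_th_sg hv.tangent, sum_sg hv⟩

lemma IsTen.isSTF (ht : IsTen t) : IsSTF t := ⟨ht.symm, ht.tangent, ht.trace⟩

lemma sphereInt_dot₂_ten (ht : IsTen t) (y : Fin m → ScriFun m) :
    sphereInt (dot₂ t fun i j => D i (y j)) = 0 := by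
  rw [sphereInt_dot₂_D ht.isSTF]
  simp [dot, ht.div]

lemma eq_zero_of_sphereInt_dot₂ {P : Fin m → Fin m → ScriFun m} (hu : ∀ i j, dU (P i j) = 0)
    (h : sphereInt (dot₂ P P) = 0) (i j : Fin m) : P i j = 0 := by
  rw [dot₂, ← Finset.sum_product' (f := fun j i => P i j * P i j)] at h
  exact eq_zero_of_sphereInt_sum (c := fun x : Fin m × Fin m => P x.2 x.1)
    (fun x _ => hu x.2 x.1) h (j, i) (Finset.mem_product.2 ⟨Finset.mem_univ _, Finset.mem_univ _⟩)

/-- Tensor memory is not the symmetrized gradient of a covector field. -/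
lemma ten_eq_zero_of_gauge (ht : IsTen t) {Jt : ScriFun m} {J : Fin m → ScriFun m}
    (h : ∀ i j, sphereInt (t i j * memTensor U R Θ r S t i j) =
      sphereInt (t i j * gaugeTensor Jt J i j)) (i j : Fin m) : t i j = 0 := by
  refine eq_zero_of_sphereInt_dot₂ ht.stationary ?_ i j
  have h1 : sphereInt (dot₂ t (memTensor U R Θ r S t)) = sphereInt (dot₂ t (gaugeTensor Jt J)) := by
    simp only [dot₂, map_sum, h]
  -- Against the divergence-free `t`, the contributions of `Θ`, `S` and the gauge field integrate to
  -- zero, leaving the square norm of `t`.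
  rw [dot₂_memTensor ht.isSTF, dot₂_gaugeTensor ht.isSTF, map_add, sphereInt_dot₂_ten ht,
    sphereInt_dot₂_ten ht, zero_add] at h1
  exact h1

/-- The field is `(lap v + (m - 1) v) / 2`, and `lap` preserves tangency and vanishing divergence on
such fields. It is needed as a test field for the radial-angular components. -/
lemma isVec_div_sg {v : Fin m → ScriFun m} (hv : IsVec v) :
    IsVec fun j => ∑ i, D i (sg v i j) := by
  have h1 := sum_th_mul_lap v
  rw [hv.tangent, hv.div] at h1
  have h2 := sum_D_lap v
  rw [h1, hv.div] at h2
  simp only [map_zero, mul_zero, add_zero, sub_zero] at h1 h2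
  refine ⟨?_, ?_, fun i => ?_⟩
  · have : ∀ j, th j * (cst (1 / 2) * (lap (v j) + cst ((m : ℝ) - 1) * v j)) =
      cst (1 / 2) * (th j * lap (v j) + cst ((m : ℝ) - 1) * (th j * v j)) := fun j => by ring
    simp only [sum_D_sg hv, this, ← Finset.mul_sum, Finset.sum_add_distrib, h1, hv.tangent]
    ring
  · simp only [sum_D_sg hv, Derivation.leibniz, D_cst, map_add, smul_eq_mul, mul_zero, add_zero,
      ← Finset.mul_sum, Finset.sum_add_distrib, h2, hv.div]
  · simp [sum_D_sg hv, dU_lap, hv.stationary]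

lemma sphereInt_cst_mul (a : ℝ) (c : ScriFun m) : sphereInt (cst a * c) = a * sphereInt c := by
  rw [show cst a * c = a • c from (Algebra.smul_def a c).symm, map_smul, smul_eq_mul]

/-- If vector memory is the symmetrized gradient of a covector field, then a combination of its
potentials is a Killing field. -/
lemma sg_eq_zero_of_gauge (hm : 3 ≤ m) (hr : IsVec r) (hS : IsVec S) (ht : IsTen t)
    {Jt : ScriFun m} {J : Fin m → ScriFun m}
    (h : ∀ (c : ScriFun m) i j, sphereInt (c * memTensor U R Θ r S t i j) =
      sphereInt (c * gaugeTensor Jt J i j)) (i j : Fin m) :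
    sg (fun j => S j + cst (2 / ((m : ℝ) - 2)) * r j) i j = 0 := by
  have hm2 : (m : ℝ) - 2 ≠ 0 := by
    have : (3 : ℝ) ≤ m := by exact_mod_cast hm
    linarith
  -- If `J` denotes the spatial gauge coefficients, the angular components identify `S` with `J`,
  -- and the radial-angular ones identify `r` with `-(m - 2)/2` times `J`, both after testing with
  -- `y` below. The coefficient is chosen so that `J` cancels.
  set V : Fin m → ScriFun m := fun j => S j + cst (2 / ((m : ℝ) - 2)) * r j with hV
  have hVv : IsVec V := by
    refine ⟨?_, ?_, fun i => ?_⟩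
    · have : ∀ j, th j * V j = th j * S j + cst (2 / ((m : ℝ) - 2)) * (th j * r j) := fun j => by
        rw [hV]; ring
      simp only [this, Finset.sum_add_distrib, ← Finset.mul_sum, hS.tangent, hr.tangent]
      ring
    · simp only [hV, map_add, Derivation.leibniz, D_cst, smul_eq_mul, mul_zero, add_zero,
        Finset.sum_add_distrib, ← Finset.mul_sum, hS.div, hr.div]
    · simp [hV, hS.stationary, hr.stationary]
  refine eq_zero_of_sphereInt_dot₂ (P := sg V) (fun i j => ?_) ?_ i j
  · simp [sg, dU_D, hVv.stationary, dU_th]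
  have hP := isSTF_sg hVv
  set y : Fin m → ScriFun m := fun j => ∑ i, D i (sg V i j) with hy
  have hyv : IsVec y := isVec_div_sg hVv
  -- Testing the angular components against the deformation tensor of `V` and integrating by parts
  -- compares `S` with `J`.
  have h1 : sphereInt (dot₂ (sg V) (memTensor U R Θ r S t)) =
      sphereInt (dot₂ (sg V) (gaugeTensor Jt J)) := by
    simp only [dot₂, map_sum, h]
  have h2 : sphereInt (dot₂ (sg V) t) = 0 := by
    rw [dot₂_comm, dot₂_sg ht.isSTF, sphereInt_dot₂_ten ht]
  rw [dot₂_memTensor hP, dot₂_gaugeTensor hP, map_add, h2, sphereInt_dot₂_D hP,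
    sphereInt_dot₂_D hP, add_zero, dot_add, map_add, sphereInt_dot_D hyv, zero_add] at h1
  -- Testing the radial-angular components against `y` compares `r` with `J`; gradients and radial
  -- terms drop out because `y` is tangent and divergence-free.
  have h3 : sphereInt (dot y fun j => ∑ i, th i * memTensor U R Θ r S t i j) =
      sphereInt (dot y fun j => ∑ i, th i * gaugeTensor Jt J i j) := by
    simp only [dot, Finset.mul_sum, map_sum]
    refine Finset.sum_congr rfl fun j _ => Finset.sum_congr rfl fun i _ => ?_
    rw [← mul_assoc, h, mul_assoc]
  have h4 : ∀ j, ∑ i, th i * gaugeTensor Jt J i j = cst (1 / 2) * (cst (-((m : ℝ) - 2)) * J j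
      + (D j (Jt + ∑ i, th i * J i) +
        th j * (∑ i, th i * J i - cst ((m : ℝ) - 3) * (∑ i, th i * J i)
          - cst ((m : ℝ) - 3) * (2 * Jt)))) := by
    intro j
    have e : ∀ i, th i * gaugeTensor Jt J i j = cst (1 / 2) * (th i * D i (J j) -
        cst ((m : ℝ) - 3) * (th i * (th i * J j)) - cst ((m : ℝ) - 3) * (th i * (th i * (th j * Jt)))
        + th i * (th i * D j Jt) + th i * D j (J i) - cst ((m : ℝ) - 3) * th j * (th i * J i)
        - cst ((m : ℝ) - 3) * (th i * (th i * (th j * Jt))) + th j * (th i * D i Jt)) := by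
      intro i
      rw [gaugeTensor]
      ring
    have e2 : ∑ i, th i * D j (J i) =
        D j (∑ i, th i * J i) - (J j - th j * ∑ i, th i * J i) := by
      rw [← sum_D_th_mul' j J, map_sum, ← Finset.sum_sub_distrib]
      refine Finset.sum_congr rfl fun i _ => ?_
      rw [Derivation.leibniz]
      simp only [smul_eq_mul]
      ring
    simp only [e, ← Finset.mul_sum, Finset.sum_add_distrib, Finset.sum_sub_distrib, sum_th_D,
      sum_th_mul_th, e2, map_add]
    have : (cst (-((m : ℝ) - 2)) : ScriFun m) = -(cst ((m : ℝ) - 3) + 1) := by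
      rw [← cst_add_one, show (m : ℝ) - 2 = ((m : ℝ) - 3) + 1 by ring]
      exact map_neg _ _
    rw [this]
    ring
  have h5 : ∀ j, ∑ i, th i * memTensor U R Θ r S t i j = th j * -U + (D j R + r j) := by
    intro j
    rw [sum_th_memTensor hr hS ht]
    ring
  simp only [h4, h5] at h3
  rw [dot_add, dot_add, dot_mul_left, dot_add, dot_add, dot_mul_left, dot_th hyv.tangent,
    dot_th hyv.tangent] at h3
  rw [zero_add, add_zero, sphereInt_cst_mul, sphereInt.map_add, sphereInt.map_add,
    sphereInt_dot_D hyv, sphereInt_dot_D hyv, sphereInt_cst_mul, zero_add, add_zero] at h3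
  have h6 : sphereInt (dot₂ (sg V) (sg V)) = -sphereInt (dot y V) := by
    rw [dot₂_sg hP, sphereInt_dot₂_D hP]
  rw [h6, hV, dot_add, dot_mul_left, map_add, sphereInt_cst_mul, h3]
  have h7 : sphereInt (dot y S) = sphereInt (dot y J) := by
    have := neg_injective h1
    exact this
  rw [h7]
  field_simp
  ring

/-- The potential of vector memory vanishes if the combination of the potentials that enters the
symmetrized gradient is a Killing field. -/
lemma vec_eq_zero_of_constraint (hm : 3 ≤ m) (hr : IsVec r) (hS : IsVec S) (ht : IsTen t)
    (hc : ∀ j, constraint (memTensor U R Θ r S t) j = 0)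
    (hk : ∀ i j, sg (fun j => S j + cst (2 / ((m : ℝ) - 2)) * r j) i j = 0) (j : Fin m) :
    r j = 0 := by
  have hm3 : (3 : ℝ) ≤ m := by exact_mod_cast hm
  have hm2 : (m : ℝ) - 2 ≠ 0 := by linarith
  have h1 : sphereInt (dot r fun j => constraint (memTensor U R Θ r S t) j) = 0 := by
    simp [dot, hc]
  simp only [constraint_memTensor (by omega) hr hS ht] at h1
  rw [dot_add, dot_add, dot_th hr.tangent, map_add, map_add, sphereInt_dot_D hr, map_zero,
    zero_add, zero_add] at h1
  -- The divergence of the Killing condition eliminates `S` in favour of `r`.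
  have h2 : ∀ j, lap (S j) + cst ((m : ℝ) - 1) * S j =
      -cst (2 / ((m : ℝ) - 2)) * (lap (r j) + cst ((m : ℝ) - 1) * r j) := by
    intro j
    have e : ∀ i j, sg (fun j => S j + cst (2 / ((m : ℝ) - 2)) * r j) i j =
        sg S i j + cst (2 / ((m : ℝ) - 2)) * sg r i j := by
      intro i j
      simp only [sg, map_add, Derivation.leibniz, D_cst, smul_eq_mul]
      ring
    have h3 : ∑ i, D i (sg S i j) = -cst (2 / ((m : ℝ) - 2)) * ∑ i, D i (sg r i j) := by
      rw [Finset.mul_sum]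
      refine Finset.sum_congr rfl fun i _ => ?_
      have h4 : sg S i j = -cst (2 / ((m : ℝ) - 2)) * sg r i j := by
        have := hk i j
        rw [e] at this
        linear_combination this
      rw [h4, Derivation.leibniz, map_neg, D_cst]
      simp
    rw [sum_D_sg hS, sum_D_sg hr] at h3
    linear_combination (2 : ScriFun m) * h3 - (lap (S j) + cst ((m : ℝ) - 1) * S j +
      cst (2 / ((m : ℝ) - 2)) * (lap (r j) + cst ((m : ℝ) - 1) * r j)) * half_mul_two (m := m)
  -- The result is `(lap r - (m - 3) r) / (m - 2)`, a non-positive operator since `m` is at least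
  -- `3`.
  have h3 : vecConstraint r S = fun j => cst (1 / ((m : ℝ) - 2)) * lap (r j) +
      cst (-((m : ℝ) - 3) / ((m : ℝ) - 2)) * r j := by
    funext j
    rw [vecConstraint, h2]
    refine ext_sphere fun u θ _ => ?_
    simp
    field_simp
    ring
  rw [h3, dot_add, dot_mul_left,
    dot_mul_left, map_add, sphereInt_cst_mul, sphereInt_cst_mul] at h1
  have h4 : sphereInt (dot r fun j => lap (r j)) = -sphereInt (∑ j, ∑ i, D i (r j) * D i (r j)) := by
    have h5 : ∀ j, sphereInt (r j * lap (r j)) = -sphereInt (∑ i, D i (r j) * D i (r j)) := by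
      intro j
      have h6 := sphereInt_div fun i => r j * D i (r j)
      have e : ∑ i, th i * (r j * D i (r j)) = 0 := sum_th_mul_D _ _
      rw [e] at h6
      simp only [Derivation.leibniz, smul_eq_mul, Finset.sum_add_distrib, ← Finset.mul_sum,
        ← lap_apply, map_add, map_zero, mul_zero] at h6
      linarith
    rw [dot, map_sum, map_sum, ← Finset.sum_neg_distrib]
    exact Finset.sum_congr rfl fun j _ => h5 j
  have h5 : 0 ≤ sphereInt (∑ j, ∑ i, D i (r j) * D i (r j)) := by
    simp only [map_sum]
    exact Finset.sum_nonneg fun _ _ => Finset.sum_nonneg fun _ _ => sphereInt_nonneg _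
  have h6 : 0 ≤ sphereInt (dot r r) := by
    simp only [dot, map_sum]
    exact Finset.sum_nonneg fun _ _ => sphereInt_nonneg _
  have h7 : sphereInt (dot₂ (fun i j => D i (r j)) fun i j => D i (r j)) = 0 := by
    change sphereInt (∑ j, ∑ i, D i (r j) * D i (r j)) = 0
    rw [h4] at h1
    have h8 : sphereInt (∑ j, ∑ i, D i (r j) * D i (r j)) =
        -((m : ℝ) - 3) * sphereInt (dot r r) := by
      field_simp at h1
      linarith
    have : 0 ≤ ((m : ℝ) - 3) * sphereInt (dot r r) := mul_nonneg (by linarith) h6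
    linarith
  have h8 := eq_zero_of_sphereInt_dot₂ (P := fun i j => D i (r j))
    (fun i j => by rw [dU_D, hr.stationary, map_zero]) h7
  -- For `m = 3` the zeroth order term is absent, so only `D i (r j) = 0` is known; differentiated
  -- tangency then still gives `r = 0`.
  have h9 := sum_th_mul_D_of_tangent hr.tangent j
  simp only [h8, mul_zero, Finset.sum_const_zero] at h9
  exact neg_eq_zero.1 h9.symm

/-- The trace-free Hessian of a combination of the potentials of scalar memory vanishes. -/
lemma tf_eq_zero_of_constraint (hm : 3 ≤ m) (hr : IsVec r) (hS : IsVec S) (ht : IsTen t)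
    (hU : dU U = 0) (hR : dU R = 0) (hΘ : dU Θ = 0)
    (hc : ∀ j, constraint (memTensor U R Θ r S t) j = 0) (i j : Fin m) :
    tf (U - cst (2 * ((m : ℝ) - 3)) * R - cst (((m : ℝ) - 3) * ((m : ℝ) - 2)) * Θ) i j = 0 := by
  have hm3 : (3 : ℝ) ≤ m := by exact_mod_cast hm
  have hm1 : (m : ℝ) - 1 ≠ 0 := by linarith
  have hm' : 2 ≤ m := by omega
  set F := U - cst (2 * ((m : ℝ) - 3)) * R - cst (((m : ℝ) - 3) * ((m : ℝ) - 2)) * Θ with hF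
  set α := -lap U + 2 * U + cst ((m : ℝ) - 5) * lap R with hα
  set β := -(2 * U) + lap R + cst ((m : ℝ) - 3) * (2 * R +
        cst (((m : ℝ) - 2) / ((m : ℝ) - 1)) * (lap Θ + cst ((m : ℝ) - 1) * Θ) +
        cst (1 / ((m : ℝ) - 1)) * U) with hβ
  have hX : ∀ j, th j * α + D j β + vecConstraint r S j = 0 := fun j => by
    rw [← constraint_memTensor hm' hr hS ht, hc]
  have hvS := isVec_div_sg hS
  simp only [sum_D_sg hS] at hvS
  have hlr1 := sum_th_mul_lap r
  have hlr2 := sum_D_lap r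
  rw [hr.tangent, hr.div, map_zero] at hlr1
  simp only [mul_zero, add_zero, sub_zero] at hlr1
  rw [hlr1, hr.div, map_zero] at hlr2
  simp only [mul_zero, add_zero, sub_zero] at hlr2
  have hv1 : ∑ j, th j * vecConstraint r S j = 0 := by
    have : ∀ j, th j * vecConstraint r S j = th j * lap (r j) + cst ((m : ℝ) - 3) * (th j * r j +
        th j * (cst (1 / 2) * (lap (S j) + cst ((m : ℝ) - 1) * S j))) := fun j => by
      rw [vecConstraint]; ring
    simp only [this, Finset.sum_add_distrib, ← Finset.mul_sum, hlr1, hr.tangent, hvS.tangent]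
    ring
  have hv2 : ∑ j, D j (vecConstraint r S j) = 0 := by
    have : ∀ j, D j (vecConstraint r S j) = D j (lap (r j)) + cst ((m : ℝ) - 3) * (D j (r j) +
        D j (cst (1 / 2) * (lap (S j) + cst ((m : ℝ) - 1) * S j))) := fun j => by
      rw [vecConstraint, map_add, Derivation.leibniz, D_cst]; simp
    simp only [this, Finset.sum_add_distrib, ← Finset.mul_sum, hlr2, hr.div, hvS.div]
    ring
  -- The radial component of the constraint; its tangential divergence then makes `β` harmonic,
  -- because the vector part is tangent and divergence-free.
  have h1 : α = 0 := by
    have : ∑ j, th j * (th j * α + D j β + vecConstraint r S j) = 0 := by simp [hX]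
    simp only [mul_add, Finset.sum_add_distrib, sum_th_mul_th, sum_th_D, hv1, add_zero] at this
    exact this
  have h2 : lap β = 0 := by
    have : ∑ j, D j (th j * α + D j β + vecConstraint r S j) = 0 := by simp [hX]
    simp only [map_add, Finset.sum_add_distrib, h1, mul_zero, map_zero, Finset.sum_const_zero,
      ← lap_apply, hv2] at this
    simpa using this
  -- The coefficients in `F` are chosen so that, with `lap U` eliminated by `α = 0`, this
  -- combination is a multiple of `β`.
  have h3 : lap F + cst ((m : ℝ) - 1) * F = -cst ((m : ℝ) - 1) * β := by
    have e : lap F = lap U - cst (2 * ((m : ℝ) - 3)) * lap R -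
        cst (((m : ℝ) - 3) * ((m : ℝ) - 2)) * lap Θ := by
      rw [hF, map_sub, map_sub, lap_cst_mul, lap_cst_mul]
    have h1' : lap U = 2 * U + cst ((m : ℝ) - 5) * lap R := by linear_combination -h1 + hα
    rw [e, h1', hF, hβ]
    refine ext_sphere fun u θ _ => ?_
    simp [two_apply]
    field_simp
    ring
  have hST := isSTF_tf hm' F
  refine eq_zero_of_sphereInt_dot₂ (fun i j => ?_) ?_ i j
  · simp [tf, hs, dU_D, dU_lap, dU_th, hF, hU, hR, hΘ]
  have h4 : dot (fun j => ∑ i, D i (tf F i j)) (fun j => D j F) =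
      cst (-((m : ℝ) - 2)) * ∑ j, D j β * D j F := by
    simp only [dot, sum_D_tf hm', h3, Finset.mul_sum]
    refine Finset.sum_congr rfl fun j _ => ?_
    simp only [Derivation.leibniz, map_neg, D_cst, smul_eq_mul]
    refine ext_sphere fun u θ _ => ?_
    simp
    field_simp
    ring
  -- Integration by parts moves the derivative onto the harmonic `β`. Since the divergence of `tf F`
  -- is a multiple of the gradient of `β`, the square norm of `tf F` integrates to zero.
  have h5 : sphereInt (∑ j, D j β * D j F) = 0 := by
    have h6 := sphereInt_div fun j => F * D j β
    have e : ∑ j, th j * (F * D j β) = 0 := sum_th_mul_D _ _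
    rw [e] at h6
    simp only [Derivation.leibniz, smul_eq_mul, Finset.sum_add_distrib, ← Finset.mul_sum,
      ← lap_apply, h2] at h6
    simpa using h6
  rw [dot₂_tf hST, sphereInt_dot₂_D hST, h4, sphereInt_cst_mul, h5]
  ring

end

end NullMemory

namespace NullMemory

noncomputable section

variable {m : ℕ}

/-! ### The linearized Einstein equation with commuting formal derivatives -/

/-- The diagonal entries of the Minkowski metric. -/
def eps : Fin (m + 1) → ℝ := Fin.cons (-1) fun _ => 1

@[simp] lemma eps_zero : eps (m := m) 0 = -1 := rfl
@[simp] lemma eps_succ (i : Fin m) : eps i.succ = 1 := rfl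

section Formal

variable {M : Type*} [AddCommGroup M] [Module ℝ M] (d : Fin (m + 1) → Module.End ℝ M)

/-- Commuting derivatives. -/
def Commuting : Prop := ∀ μ ν x, d μ (d ν x) = d ν (d μ x)

/-- The wave operator. -/
def box : Module.End ℝ M := ∑ l, eps l • (d l * d l)

lemma box_apply (x : M) : box d x = ∑ l, eps l • d l (d l x) := by simp [box]

/-- The linearized Ricci tensor. -/
def linRic (h : Fin (m + 1) → Fin (m + 1) → M) (μ ν : Fin (m + 1)) : M :=
  (1 / 2 : ℝ) • ∑ l, eps l • (d l (d ν (h l μ)) + d l (d μ (h l ν)) - d l (d l (h ν μ))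
    - d ν (d μ (h l l)))

/-- The part of the linearized Riemann tensor with two time indices, up to a factor. -/
def tidal (h : Fin (m + 1) → Fin (m + 1) → M) (μ ν : Fin (m + 1)) : M :=
  d 0 (d 0 (h μ ν)) + d μ (d ν (h 0 0)) - d 0 (d μ (h 0 ν)) - d 0 (d ν (h 0 μ))

/-- The divergence of the trace-reversed metric. -/
def gaugeDiv (h : Fin (m + 1) → Fin (m + 1) → M) (μ : Fin (m + 1)) : M :=
  ∑ l, eps l • d l (h l μ) - (1 / 2 : ℝ) • d μ (∑ l, eps l • h l l)

variable {d} {h : Fin (m + 1) → Fin (m + 1) → M}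

/-- Isolating the de Donder divergence exhibits the linearized Ricci tensor as minus half the wave
operator plus a pure gauge term. -/
lemma linRic_eq (hd : Commuting d) (μ ν : Fin (m + 1)) :
    linRic d h μ ν =
      (1 / 2 : ℝ) • (d ν (gaugeDiv d h μ) + d μ (gaugeDiv d h ν) - box d (h ν μ)) := by
  rw [linRic, gaugeDiv, gaugeDiv, box_apply]
  congr 1
  simp only [map_sub, map_sum, map_smul, smul_add, smul_sub, Finset.sum_add_distrib,
    Finset.sum_sub_distrib, Finset.smul_sum]
  have e1 : ∀ l, d ν (d l (h l μ)) = d l (d ν (h l μ)) := fun l => hd _ _ _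
  have e2 : ∀ l, d μ (d l (h l ν)) = d l (d μ (h l ν)) := fun l => hd _ _ _
  have e3 : ∀ l, d μ (d ν (h l l)) = d ν (d μ (h l l)) := fun l => hd _ _ _
  simp only [e1, e2, e3]
  have e4 : ∑ l, eps l • d ν (d μ (h l l)) = ∑ l, (1 / 2 : ℝ) • eps l • d ν (d μ (h l l)) +
      ∑ l, (1 / 2 : ℝ) • eps l • d ν (d μ (h l l)) := by
    rw [← Finset.sum_add_distrib]
    refine Finset.sum_congr rfl fun l _ => ?_
    module
  rw [e4]
  abel

lemma box_comm (hd : Commuting d) (μ : Fin (m + 1)) (x : M) :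
    d μ (box d x) = box d (d μ x) := by
  simp only [box_apply, map_sum, map_smul]
  refine Finset.sum_congr rfl fun l _ => ?_
  rw [hd μ l, hd μ l]

lemma linRic_symm (hd : Commuting d) (hh : ∀ μ ν, h μ ν = h ν μ)
    (μ ν : Fin (m + 1)) : linRic d h μ ν = linRic d h ν μ := by
  rw [linRic_eq hd, linRic_eq hd, hh μ ν, add_comm (d ν _)]

/-- The tidal operator commutes with the wave operator and annihilates symmetrized gradients, so
only the wave part of `linRic_eq` contributes. -/
lemma tidal_linRic (hd : Commuting d) (hh : ∀ μ ν, h μ ν = h ν μ)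
    (μ ν : Fin (m + 1)) :
    box d (tidal d h μ ν) = (-2 : ℝ) • tidal d (linRic d h) μ ν := by
  simp only [tidal, linRic_eq hd, map_smul, map_add, map_sub, box_comm hd]
  rw [hh ν μ, hh ν 0, hh μ 0]
  have hd' : ∀ μ ν x, d μ (d ν x) = d ν (d μ x) := hd
  simp only [hd']
  module

lemma sum_eps (x : Fin (m + 1) → M) : ∑ l, eps l • x l = -x 0 + ∑ i : Fin m, x i.succ := by
  rw [Fin.sum_univ_succ]
  simp

lemma box_eq (x : M) : box d x = -d 0 (d 0 x) + ∑ i : Fin m, d i.succ (d i.succ x) := by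
  rw [box_apply, sum_eps]

/-- A contracted Bianchi identity: the spatial divergence of the tidal tensor involves the metric
only through its linearized Ricci tensor. -/
lemma div_tidal (hd : Commuting d) (hh : ∀ μ ν, h μ ν = h ν μ)
    (j : Fin m) :
    ∑ i : Fin m, d i.succ (tidal d h i.succ j.succ) =
      (2 : ℝ) • (d 0 (linRic d h 0 j.succ) - d j.succ (linRic d h 0 0)) := by
  simp only [linRic_eq hd, gaugeDiv, sum_eps, tidal, map_smul, map_add, map_sub, map_neg, box_eq,
    map_sum, Finset.sum_add_distrib, Finset.sum_sub_distrib]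
  rw [hh 0 j.succ]
  have e2 : ∀ i : Fin m, d i.succ (d 0 (d 0 (h i.succ j.succ))) =
      d 0 (d 0 (d i.succ (h i.succ j.succ))) := fun i => by rw [hd _ 0, hd _ 0]
  have e3 : ∀ i : Fin m, d i.succ (d 0 (d i.succ (h j.succ 0))) =
      d 0 (d i.succ (d i.succ (h j.succ 0))) := fun i => by rw [hd _ 0]
  have e4 : ∀ i : Fin m, d i.succ (d 0 (d j.succ (h 0 i.succ))) =
      d 0 (d j.succ (d i.succ (h i.succ 0))) := fun i => by
    rw [hd _ 0, hd _ j.succ, hh 0]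
  have e6 : ∀ i : Fin m, d i.succ (d j.succ (h 0 0)) = d j.succ (d i.succ (h 0 0)) :=
    fun i => hd _ _ _
  have e7 : ∀ x, d j.succ (d 0 x) = d 0 (d j.succ x) := fun x => hd _ _ _
  simp only [e6, e2, e3, e4, e7]
  have e8 : ∀ i : Fin m, d i.succ (d j.succ (d i.succ (h 0 0))) =
      d j.succ (d i.succ (d i.succ (h 0 0))) := fun i => hd _ _ _
  simp only [e8]
  module

/-- In the form of `linRic_eq`, the divergence and half the gradient of the trace differ by
commutators of derivatives and by the definition of the de Donder divergence. -/
lemma bianchi_linRic (hd : Commuting d) (hh : ∀ μ ν, h μ ν = h ν μ)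
    (ν : Fin (m + 1)) :
    ∑ l, eps l • d l (linRic d h l ν) = (1 / 2 : ℝ) • d ν (∑ l, eps l • linRic d h l l) := by
  have h1 : ∑ l, eps l • d l (linRic d h l ν) = (1 / 2 : ℝ) • (d ν (∑ l, eps l • d l (gaugeDiv d h l))
      + box d (gaugeDiv d h ν) - box d (∑ l, eps l • d l (h l ν))) := by
    conv_rhs => rw [box_apply d (gaugeDiv d h ν)]
    simp only [linRic_eq hd, map_sum, map_smul, Finset.smul_sum, ← Finset.sum_add_distrib,
      ← Finset.sum_sub_distrib, map_add, map_sub]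
    refine Finset.sum_congr rfl fun l _ => ?_
    rw [hd ν l, hh ν l, box_comm hd]
    module
  have h2 : ∑ l, eps l • linRic d h l l =
      ∑ l, eps l • d l (gaugeDiv d h l) - (1 / 2 : ℝ) • box d (∑ l, eps l • h l l) := by
    simp only [linRic_eq hd, map_sum, map_smul, Finset.smul_sum, ← Finset.sum_sub_distrib]
    refine Finset.sum_congr rfl fun l _ => ?_
    module
  have h3 : gaugeDiv d h ν = ∑ l, eps l • d l (h l ν) - (1 / 2 : ℝ) • d ν (∑ l, eps l • h l l) := rfl
  have h4 : box d (gaugeDiv d h ν) = box d (∑ l, eps l • d l (h l ν)) -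
      (1 / 2 : ℝ) • d ν (box d (∑ l, eps l • h l l)) := by
    rw [h3, map_sub, map_smul, box_comm hd]
  rw [h1, h2, h4, map_sub, map_smul]
  module

end Formal

/-! ### The quadratic part of the Ricci tensor at leading order -/

section Quadratic

variable (L : Fin (m + 1) → ℝ) (H H₁ H₂ : Fin (m + 1) → Fin (m + 1) → ℝ)

/-- Christoffel symbols of the first kind at leading order, up to a factor. -/
def chr (σ μ ν : Fin (m + 1)) : ℝ := L μ * H₁ σ ν + L ν * H₁ σ μ - L σ * H₁ μ ν

/-- The derivative of the Christoffel symbol at second order. -/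
def quadDChr (l ρ μ ν : Fin (m + 1)) : ℝ :=
  1 / 2 * ∑ σ, (-(eps ρ * eps σ * (L l * H₁ ρ σ)) * chr L H₁ σ μ ν -
    eps ρ * eps σ * H ρ σ * (L l * chr L H₂ σ μ ν))

/-- The quadratic part of the Ricci tensor at leading order. -/
def quadRic (μ ν : Fin (m + 1)) : ℝ :=
  ∑ l, (quadDChr L H H₁ H₂ l l ν μ - quadDChr L H H₁ H₂ ν l l μ + ∑ σ,
    ((1 / 2 * (eps l * chr L H₁ l l σ)) * (1 / 2 * (eps σ * chr L H₁ σ ν μ)) -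
      (1 / 2 * (eps l * chr L H₁ l ν σ)) * (1 / 2 * (eps σ * chr L H₁ σ l μ))))

/-- The component of the metric perturbation along the null direction. -/
def nullComp (H : Fin (m + 1) → Fin (m + 1) → ℝ) : ℝ :=
  ∑ l, ∑ σ, eps l * eps σ * L l * L σ * H l σ

/-- The auxiliary covector in the quadratic part of the Ricci tensor. -/
def quadVec (μ : Fin (m + 1)) : ℝ :=
  -(1 / 2) * (∑ l, ∑ σ, eps l * eps σ * H l σ * L l * H₂ σ μ) +
    1 / 2 * (1 / 2 * (∑ l, ∑ σ, eps l * eps σ * H l σ * H₂ l σ) +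
      1 / 4 * (∑ l, ∑ σ, eps l * eps σ * H₁ l σ * H₁ l σ) - 1 / 8 * (∑ l, eps l * H₁ l l) ^ 2) * L μ

variable {L H H₁ H₂}

lemma sum_swap_eq_zero {f : Fin (m + 1) → Fin (m + 1) → ℝ} (hf : ∀ a b, f a b = -f b a) :
    ∑ a, ∑ b, f a b = 0 := by
  have h : ∑ a, ∑ b, f a b = -∑ a, ∑ b, f a b := by
    conv_lhs => rw [Finset.sum_comm]
    simp only [← Finset.sum_neg_distrib]
    exact Finset.sum_congr rfl fun a _ => Finset.sum_congr rfl fun b _ => hf b a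
  linarith

/-- At leading order every derivative points along `L`, so the quadratic Ricci tensor is algebraic.
Contractions of `L` with itself vanish and those with `H₁` reduce to its trace by the gauge
condition. What survives without a free factor of `L` is the null component of `H` times `H₂`. -/
lemma quadRic_eq (hL : ∑ l, eps l * L l * L l = 0) (hH : ∀ a b, H a b = H b a)
    (hH₁ : ∀ a b, H₁ a b = H₁ b a) (hH₂ : ∀ a b, H₂ a b = H₂ b a)
    (hg : ∀ b, ∑ l, eps l * L l * H₁ l b = 1 / 2 * (L b * ∑ l, eps l * H₁ l l))
    (μ ν : Fin (m + 1)) :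
    quadRic L H H₁ H₂ μ ν = 1 / 2 * nullComp L H * H₂ μ ν +
      (L μ * quadVec L H H₁ H₂ ν + L ν * quadVec L H H₁ H₂ μ) := by
  set T := ∑ l, eps l * H₁ l l with hT
  have hchr : ∀ μ ν, ∑ σ, eps σ * L σ * chr L H₁ σ ν μ = L ν * L μ * T := by
    intro μ ν
    have : ∀ σ, eps σ * L σ * chr L H₁ σ ν μ = L ν * (eps σ * L σ * H₁ σ μ) +
        L μ * (eps σ * L σ * H₁ σ ν) - (eps σ * L σ * L σ) * H₁ ν μ := fun σ => by rw [chr]; ring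
    simp only [this, Finset.sum_add_distrib, Finset.sum_sub_distrib, ← Finset.mul_sum,
      ← Finset.sum_mul, hg, hL]
    ring
  have t1 : ∑ l, ∑ σ, eps l * eps σ * (L l * H₁ l σ) * chr L H₁ σ ν μ = 1 / 2 * L ν * L μ * T ^ 2 := by
    rw [Finset.sum_comm]
    have : ∀ σ, ∑ l, eps l * eps σ * (L l * H₁ l σ) * chr L H₁ σ ν μ =
        1 / 2 * T * (eps σ * L σ * chr L H₁ σ ν μ) := by
      intro σ
      have e : ∀ l, eps l * eps σ * (L l * H₁ l σ) * chr L H₁ σ ν μ =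
        (eps l * L l * H₁ l σ) * (eps σ * chr L H₁ σ ν μ) := fun l => by ring
      simp only [e, ← Finset.sum_mul, hg]
      ring
    simp only [this, ← Finset.mul_sum, hchr]
    ring
  have t2 : ∑ l, ∑ σ, eps l * eps σ * H l σ * (L l * chr L H₂ σ ν μ) =
      L ν * (∑ l, ∑ σ, eps l * eps σ * H l σ * L l * H₂ σ μ) +
      L μ * (∑ l, ∑ σ, eps l * eps σ * H l σ * L l * H₂ σ ν) - nullComp L H * H₂ ν μ := by
    simp only [nullComp, Finset.mul_sum, Finset.sum_mul, ← Finset.sum_add_distrib,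
      ← Finset.sum_sub_distrib]
    refine Finset.sum_congr rfl fun l _ => Finset.sum_congr rfl fun σ _ => ?_
    rw [chr]
    ring
  have t3 : ∀ K K' : Fin (m + 1) → Fin (m + 1) → ℝ, (∀ a b, K a b = K b a) →
      (∀ a b, K' a b = K' b a) →
      ∑ l, ∑ σ, eps l * eps σ * K l σ * (L ν * chr L K' σ l μ) =
        L ν * L μ * ∑ l, ∑ σ, eps l * eps σ * K l σ * K' l σ := by
    intro K K' hK hK'
    -- The two terms of `chr` that do not carry `L μ` are antisymmetric in the summed indices.
    have e := sum_swap_eq_zero (f := fun l σ => L ν * (eps l * eps σ * K l σ *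
      (L l * K' σ μ - L σ * K' l μ))) fun l σ => by rw [hK l σ]; ring
    rw [← sub_zero (∑ l, ∑ σ, _), ← e]
    simp only [Finset.mul_sum, ← Finset.sum_sub_distrib]
    refine Finset.sum_congr rfl fun l _ => Finset.sum_congr rfl fun σ _ => ?_
    rw [chr, hK' σ l]
    ring
  have t5 : ∑ l, ∑ σ, (1 / 2 * (eps l * chr L H₁ l l σ)) * (1 / 2 * (eps σ * chr L H₁ σ ν μ)) =
      1 / 4 * L ν * L μ * T ^ 2 := by
    rw [Finset.sum_comm]
    have : ∀ σ, ∑ l, (1 / 2 * (eps l * chr L H₁ l l σ)) * (1 / 2 * (eps σ * chr L H₁ σ ν μ)) =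
        1 / 4 * T * (eps σ * L σ * chr L H₁ σ ν μ) := by
      intro σ
      have e : ∀ l, (1 / 2 * (eps l * chr L H₁ l l σ)) * (1 / 2 * (eps σ * chr L H₁ σ ν μ)) =
        (eps l * H₁ l l) * (1 / 4 * (eps σ * L σ * chr L H₁ σ ν μ)) := fun l => by
          rw [chr]; ring
      simp only [e, ← Finset.sum_mul]
      ring
    simp only [this, ← Finset.mul_sum, hchr]
    ring
  have t6 : ∑ l, ∑ σ, (1 / 2 * (eps l * chr L H₁ l ν σ)) * (1 / 2 * (eps σ * chr L H₁ σ l μ)) =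
      1 / 4 * L ν * L μ * ((∑ l, ∑ σ, eps l * eps σ * H₁ l σ * H₁ l σ) + 1 / 2 * T ^ 2) := by
    have e1 := sum_swap_eq_zero (f := fun l σ => L ν * (eps l * eps σ * H₁ l σ *
      (L l * H₁ σ μ - L σ * H₁ l μ))) fun l σ => by rw [hH₁ l σ]; ring
    have e2 := sum_swap_eq_zero (f := fun l σ => L μ * (eps l * eps σ * H₁ l σ *
      (L σ * H₁ l ν - L l * H₁ σ ν))) fun l σ => by rw [hH₁ l σ]; ring
    have e3 : ∑ l, ∑ σ, (eps l * L l * H₁ l ν) * (eps σ * L σ * H₁ σ μ) =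
        1 / 4 * L ν * L μ * T ^ 2 := by
      rw [← Finset.sum_mul_sum, hg, hg]
      ring
    have e4 : ∑ l, ∑ σ, (eps l * H₁ l ν * H₁ l μ) * (eps σ * L σ * L σ) = 0 := by
      rw [← Finset.sum_mul_sum, hL, mul_zero]
    have e5 : ∑ l, ∑ σ, (eps l * L l * L l) * (eps σ * H₁ σ ν * H₁ σ μ) = 0 := by
      rw [← Finset.sum_mul_sum, hL, zero_mul]
    have e6 : ∑ l, ∑ σ, (eps l * L l * H₁ l μ) * (eps σ * L σ * H₁ σ ν) =
        1 / 4 * L ν * L μ * T ^ 2 := by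
      rw [← Finset.sum_mul_sum, hg, hg]
      ring
    have e7 : ∑ l, ∑ σ, (1 / 2 * (eps l * chr L H₁ l ν σ)) * (1 / 2 * (eps σ * chr L H₁ σ l μ)) =
        1 / 4 * (∑ l, ∑ σ, L ν * (eps l * eps σ * H₁ l σ * (L l * H₁ σ μ - L σ * H₁ l μ))) +
        1 / 4 * (∑ l, ∑ σ, L μ * (eps l * eps σ * H₁ l σ * (L σ * H₁ l ν - L l * H₁ σ ν))) +
        1 / 4 * L ν * L μ * (∑ l, ∑ σ, eps l * eps σ * H₁ l σ * H₁ l σ) +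
        1 / 4 * (∑ l, ∑ σ, (eps l * L l * H₁ l ν) * (eps σ * L σ * H₁ σ μ)) -
        1 / 4 * (∑ l, ∑ σ, (eps l * H₁ l ν * H₁ l μ) * (eps σ * L σ * L σ)) -
        1 / 4 * (∑ l, ∑ σ, (eps l * L l * L l) * (eps σ * H₁ σ ν * H₁ σ μ)) +
        1 / 4 * (∑ l, ∑ σ, (eps l * L l * H₁ l μ) * (eps σ * L σ * H₁ σ ν)) := by
      simp only [Finset.mul_sum, ← Finset.sum_add_distrib, ← Finset.sum_sub_distrib]
      refine Finset.sum_congr rfl fun l _ => Finset.sum_congr rfl fun σ _ => ?_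
      rw [chr, chr, hH₁ ν σ, hH₁ σ l]
      ring
    rw [e7, e1, e2, e3, e4, e5, e6]
    ring
  have q : quadRic L H H₁ H₂ μ ν =
      -(1 / 2) * (∑ l, ∑ σ, eps l * eps σ * (L l * H₁ l σ) * chr L H₁ σ ν μ) -
      1 / 2 * (∑ l, ∑ σ, eps l * eps σ * H l σ * (L l * chr L H₂ σ ν μ)) +
      1 / 2 * (∑ l, ∑ σ, eps l * eps σ * H₁ l σ * (L ν * chr L H₁ σ l μ)) +
      1 / 2 * (∑ l, ∑ σ, eps l * eps σ * H l σ * (L ν * chr L H₂ σ l μ)) +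
      (∑ l, ∑ σ, (1 / 2 * (eps l * chr L H₁ l l σ)) * (1 / 2 * (eps σ * chr L H₁ σ ν μ))) -
      ∑ l, ∑ σ, (1 / 2 * (eps l * chr L H₁ l ν σ)) * (1 / 2 * (eps σ * chr L H₁ σ l μ)) := by
    simp only [quadRic, quadDChr, Finset.mul_sum, ← Finset.sum_add_distrib,
      ← Finset.sum_sub_distrib]
    refine Finset.sum_congr rfl fun l _ => Finset.sum_congr rfl fun σ _ => ?_
    ring
  rw [q, t1, t2, t3 H₁ H₁ hH₁ hH₁, t3 H H₂ hH hH₂, t5, t6, quadVec, quadVec, hH₂ ν μ, ← hT]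
  ring

end Quadratic

end

end NullMemory

namespace NullMemory

noncomputable section

variable {m : ℕ} [NeZero m]

open ScriFun

/-! ### Coefficients of the linearized Einstein equation -/

lemma dC_commuting : Commuting (dC (m := m)) := by
  intro μ ν x
  exact dC_comm μ ν x

/-- The coefficients of the linearized Ricci tensor. -/
def ricC (h : Fin (m + 1) → Fin (m + 1) → ℤ → ScriFun m) :
    Fin (m + 1) → Fin (m + 1) → ℤ → ScriFun m := linRic dC h

/-- The coefficients of the part of the linearized Riemann tensor with two time indices. -/
def tidC (h : Fin (m + 1) → Fin (m + 1) → ℤ → ScriFun m) :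
    Fin (m + 1) → Fin (m + 1) → ℤ → ScriFun m := tidal dC h

/-- The coefficients of the wave operator. -/
def boxC : Module.End ℝ (ℤ → ScriFun m) := box dC

section

variable (h : Fin (m + 1) → Fin (m + 1) → ℤ → ScriFun m)

lemma ricC_apply (μ ν : Fin (m + 1)) (k : ℤ) :
    ricC h μ ν k = (1 / 2 : ℝ) • (∑ l, eps l • (dC l (dC ν (h l μ)) k +
        dC l (dC μ (h l ν)) k - dC l (dC l (h ν μ)) k - dC ν (dC μ (h l l)) k)) := by
  rw [ricC, linRic]
  simp

lemma tidC_apply (μ ν : Fin (m + 1)) (k : ℤ) :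
    tidC h μ ν k = dC 0 (dC 0 (h μ ν)) k + dC μ (dC ν (h 0 0)) k - dC 0 (dC μ (h 0 ν)) k -
      dC 0 (dC ν (h 0 μ)) k := rfl

lemma boxC_apply (c : ℤ → ScriFun m) (k : ℤ) :
    boxC c k = -dC 0 (dC 0 c) k + ∑ i : Fin m, dC i.succ (dC i.succ c) k := by
  rw [boxC, box_eq]
  simp

variable {h}

lemma ricC_symm (hh : ∀ μ ν, h μ ν = h ν μ) (μ ν : Fin (m + 1)) : ricC h μ ν = ricC h ν μ :=
  linRic_symm dC_commuting hh μ ν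

lemma boxC_tidC (hh : ∀ μ ν, h μ ν = h ν μ) (μ ν : Fin (m + 1)) :
    boxC (tidC h μ ν) = (-2 : ℝ) • tidC (ricC h) μ ν :=
  tidal_linRic dC_commuting hh μ ν

lemma div_tidC (hh : ∀ μ ν, h μ ν = h ν μ) (j : Fin m) :
    ∑ i : Fin m, dC i.succ (tidC h i.succ j.succ) =
      (2 : ℝ) • (dC 0 (ricC h 0 j.succ) - dC j.succ (ricC h 0 0)) :=
  div_tidal dC_commuting hh j

lemma bianchi_ricC (hh : ∀ μ ν, h μ ν = h ν μ) (ν : Fin (m + 1)) :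
    ∑ l, eps l • dC l (ricC h l ν) = (1 / 2 : ℝ) • dC ν (∑ l, eps l • ricC h l l) :=
  bianchi_linRic dC_commuting hh ν

end


lemma dC_eq_zero_of_lt {c : ℤ → ScriFun m} {k : ℤ} (hc : ∀ j < k, c j = 0) (μ : Fin (m + 1)) :
    ∀ j < k, dC μ c j = 0 := by
  intro j hj
  rw [dC_apply, hc j hj, hc (j - 2) (by omega)]
  simp

lemma dC_lead {c : ℤ → ScriFun m} {k : ℤ} (hc : ∀ j < k, c j = 0) (μ : Fin (m + 1)) :
    dC μ c k = Lc μ * dU (c k) := by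
  rw [dC_apply, hc (k - 2) (by omega)]
  simp

lemma dC_dC_lead {c : ℤ → ScriFun m} {k : ℤ} (hc : ∀ j < k, c j = 0) (μ ν : Fin (m + 1)) :
    dC μ (dC ν c) k = Lc μ * (Lc ν * dU (dU (c k))) := by
  rw [dC_lead (dC_eq_zero_of_lt hc ν), dC_lead hc, Derivation.leibniz, dU_Lc]
  simp

lemma sum_eps_Lc : ∑ l, eps l • (Lc l * Lc l) = (0 : ScriFun m) := by
  rw [sum_eps]
  have : ∀ i : Fin m, (-th i * -th i : ScriFun m) = th i * th i := fun i => by ring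
  simp only [Lc_zero, Lc_succ, this, sum_th_th]
  ring

lemma sum_eps_Lc_apply (u : ℝ) (θ : Space m) :
    ∑ l, eps l * Lc l (u, θ) * Lc l (u, θ) = 0 := by
  have := congrArg (fun c : ScriFun m => c (u, θ)) (sum_eps_Lc (m := m))
  simpa [mul_assoc] using this

/-- A bounded solution of `f'' = 0` with vanishing velocity at early times is constant. -/
lemma dU_eq_zero_of_dU_dU {c : ScriFun m} (h : dU (dU c) = 0)
    (hc : ∀ θ : Space m, ‖θ‖ = 1 → Tendsto (fun u => dU c (u, θ)) atBot (𝓝 0)) : dU c = 0 := by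
  refine ext_sphere fun u θ hθ => ?_
  have : (fun v => dU c (v, θ)) = fun _ => dU c (u, θ) := funext fun v => apply_of_dU h v u θ
  have h2 := hc θ hθ
  rw [this] at h2
  exact tendsto_nhds_unique tendsto_const_nhds h2

variable {h : Fin (m + 1) → Fin (m + 1) → ℤ → ScriFun m}

/-- The leading order gauge condition that follows from the linearized Einstein equation. -/
lemma leading_gauge {k : ℤ} (hlow : ∀ μ ν, ∀ j < k, h μ ν j = 0)
    (hR : ∀ μ ν, ricC h μ ν k = 0)
    (hst : ∀ μ ν, ∀ θ : Space m, ‖θ‖ = 1 → Tendsto (fun u => dU (h μ ν k) (u, θ)) atBot (𝓝 0))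
    (ν : Fin (m + 1)) :
    ∑ l, eps l • (Lc l * dU (h l ν k)) = (1 / 2 : ℝ) • (Lc ν * ∑ l, eps l • dU (h l l k)) := by
  set Z : Fin (m + 1) → ScriFun m := fun ν =>
    ∑ l, eps l • (Lc l * h l ν k) - (1 / 2 : ℝ) • (Lc ν * ∑ l, eps l • h l l k) with hZ
  have hZ1 : ∀ ν, dU (Z ν) =
      ∑ l, eps l • (Lc l * dU (h l ν k)) - (1 / 2 : ℝ) • (Lc ν * ∑ l, eps l • dU (h l l k)) := by
    intro ν
    simp only [hZ, map_sub, map_sum, Derivation.map_smul, Derivation.leibniz, dU_Lc, smul_eq_mul,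
      mul_zero, add_zero]
  have hZ2 : ∀ ν, dU (dU (Z ν)) = ∑ l, eps l • (Lc l * dU (dU (h l ν k))) -
      (1 / 2 : ℝ) • (Lc ν * ∑ l, eps l • dU (dU (h l l k))) := by
    intro ν
    rw [hZ1]
    simp only [map_sub, map_sum, Derivation.map_smul, Derivation.leibniz, dU_Lc, smul_eq_mul,
      mul_zero, add_zero]
  -- At leading order the wave term carries the square of the null covector `L`; the rest of the
  -- Ricci tensor is the symmetrized product of `L` with the second `u`-derivative of `Z`.
  have hR' : ∀ μ ν, Lc μ * dU (dU (Z ν)) + Lc ν * dU (dU (Z μ)) = 0 := by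
    intro μ ν
    have h1 := hR μ ν
    rw [ricC_apply] at h1
    simp only [dC_dC_lead (hlow _ _)] at h1
    have e0 := sum_eps_Lc (m := m)
    have h3 : ∑ l, eps l • (Lc l * (Lc ν * dU (dU (h l μ k))) + Lc l * (Lc μ * dU (dU (h l ν k)))
        - Lc l * (Lc l * dU (dU (h ν μ k))) - Lc ν * (Lc μ * dU (dU (h l l k)))) =
        Lc μ * dU (dU (Z ν)) + Lc ν * dU (dU (Z μ)) -
          (∑ l, eps l • (Lc l * Lc l)) * dU (dU (h ν μ k)) := by
      simp only [hZ2, smul_add, smul_sub, Finset.sum_add_distrib, Finset.sum_sub_distrib, mul_sub,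
        Finset.mul_sum, Finset.sum_mul, mul_smul_comm, smul_mul_assoc, Finset.smul_sum]
      have e1 : ∀ l, Lc μ * (Lc ν * dU (dU (h l l k))) = Lc ν * (Lc μ * dU (dU (h l l k))) :=
        fun l => by ring
      have e2 : ∀ l, Lc l * (Lc ν * dU (dU (h l μ k))) = Lc ν * (Lc l * dU (dU (h l μ k))) :=
        fun l => by ring
      have e3 : ∀ l, Lc l * (Lc μ * dU (dU (h l ν k))) = Lc μ * (Lc l * dU (dU (h l ν k))) :=
        fun l => by ring
      simp only [e1, e2, e3, mul_assoc]
      have e4 : ∑ l, eps l • (Lc ν * (Lc μ * dU (dU (h l l k)))) =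
          ∑ l, (1 / 2 : ℝ) • eps l • (Lc ν * (Lc μ * dU (dU (h l l k)))) +
          ∑ l, (1 / 2 : ℝ) • eps l • (Lc ν * (Lc μ * dU (dU (h l l k)))) := by
        rw [← Finset.sum_add_distrib]
        refine Finset.sum_congr rfl fun l _ => ?_
        module
      rw [e4]
      abel
    rw [h3, e0, zero_mul, sub_zero] at h1
    exact (smul_eq_zero.1 h1).resolve_left (by norm_num)
  -- Since `L 0 = 1`, the `00` component gives `Z 0`, and the `0ν` component then gives the others.
  have hZ0 : dU (dU (Z 0)) = 0 := by
    have := hR' 0 0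
    simp only [Lc_zero, one_mul] at this
    refine ext_sphere fun u θ _ => ?_
    have h5 := congrArg (fun c : ScriFun m => c (u, θ)) this
    simp only [ScriFun.add_apply, ScriFun.zero_apply] at h5 ⊢
    linarith
  have hZν : dU (dU (Z ν)) = 0 := by
    have := hR' 0 ν
    simpa [hZ0] using this
  have hfin : dU (Z ν) = 0 := by
    refine dU_eq_zero_of_dU_dU hZν fun θ hθ => ?_
    rw [hZ1]
    simp only [ScriFun.sub_apply, ScriFun.sum_apply, ScriFun.smul_apply, ScriFun.mul_apply]
    have hLc : ∀ l u, (Lc l : ScriFun m) (u, θ) = Lc l (0, θ) := fun l u =>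
      apply_of_dU (dU_Lc l) u 0 θ
    simp only [hLc]
    have t1 : ∀ ν, Tendsto (fun u => ∑ l, eps l * (Lc l (0, θ) * dU (h l ν k) (u, θ))) atBot (𝓝 0) := by
      intro ν
      have := tendsto_finsetSum (Finset.univ) fun (l : Fin (m + 1)) _ =>
        ((hst l ν θ hθ).const_mul ((Lc l : ScriFun m) (0, θ))).const_mul (eps l)
      simpa using this
    have t2 : Tendsto (fun u => ∑ l, eps l * dU (h l l k) (u, θ)) atBot (𝓝 0) := by
      have := tendsto_finsetSum (Finset.univ) fun (l : Fin (m + 1)) _ =>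
        (hst l l θ hθ).const_mul (eps l)
      simpa using this
    have := (t1 ν).sub ((t2.const_mul ((Lc ν : ScriFun m) (0, θ))).const_mul (1 / 2 : ℝ))
    simpa using this
  rw [hZ1] at hfin
  exact sub_eq_zero.1 hfin

/-- The wave operator on an expansion. -/
lemma box_coeff (c : ℤ → ScriFun m) (k : ℤ) :
    boxC c k = cst ((k : ℝ) - 2 - ((m : ℝ) - 1)) * dU (c (k - 2)) + (lap (c (k - 4)) +
      cst (((k : ℝ) - 4) / 2 * (((k : ℝ) - 4) / 2 + 2 - m)) * c (k - 4)) := by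
  rw [boxC_apply]
  simp only [dC_apply]
  simp only [Lc_zero, one_mul, Dx_zero, nc_zero, zero_mul, smul_zero, sub_zero,
    Derivation.coe_zero, Pi.zero_apply, add_zero, Lc_succ, Dx_succ, nc_succ]
  rw [show k - 2 - 2 = k - 4 by ring]
  -- Summed over `i`, the terms `dU (dU (c k))` cancel the time derivatives because `L` is null.
  -- What remains is first order in `u`, with a coefficient that vanishes at the radiative order `k
  -- - 2 = m - 1`.
  have e : ∀ i : Fin m, -th i * dU (-th i * dU (c k) + (D i (c (k - 2)) -
        (((k : ℝ) - 2) / 2) • (th i * c (k - 2)))) +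
      (D i (-th i * dU (c (k - 2)) + (D i (c (k - 4)) -
        ((((k - 2 : ℤ) : ℝ) - 2) / 2) • (th i * c (k - 4)))) -
        (((k : ℝ) - 2) / 2) • (th i * (-th i * dU (c (k - 2)) + (D i (c (k - 4)) -
          ((((k - 2 : ℤ) : ℝ) - 2) / 2) • (th i * c (k - 4)))))) =
      th i * (th i * dU (dU (c k))) - 2 * (th i * D i (dU (c (k - 2)))) +
      cst ((k : ℝ) - 2) * (th i * (th i * dU (c (k - 2)))) - D i (th i) * dU (c (k - 2)) +
      D i (D i (c (k - 4))) - cst ((k : ℝ) - 3) * (th i * D i (c (k - 4))) -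
      cst (((k : ℝ) - 4) / 2) * (D i (th i) * c (k - 4)) +
      cst (((k : ℝ) - 2) / 2 * (((k : ℝ) - 4) / 2)) * (th i * (th i * c (k - 4))) := by
    intro i
    simp only [map_add, map_sub, map_neg, Derivation.leibniz, Derivation.map_smul, smul_eq_mul,
      dU_th, dU_D]
    refine ext_sphere fun u θ _ => ?_
    simp [two_apply]
    ring
  simp only [e, Finset.sum_add_distrib, Finset.sum_sub_distrib, ← Finset.mul_sum, sum_th_mul_th,
    sum_th_D, ← Finset.sum_mul, sum_D_th', ← lap_apply]
  refine ext_sphere fun u θ _ => ?_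
  simp
  ring

/-- The divergence of an expansion. -/
lemma div_coeff (c : Fin m → ℤ → ScriFun m) (k : ℤ) :
    ∑ i : Fin m, dC i.succ (c i) k = -∑ i, th i * dU (c i k) +
      (∑ i, D i (c i (k - 2)) - cst (((k : ℝ) - 2) / 2) * ∑ i, th i * c i (k - 2)) := by
  have e : ∀ i : Fin m, (-th i * dU (c i k) : ScriFun m) = -(th i * dU (c i k)) := fun i => by ring
  simp only [dC_apply, Lc_succ, Dx_succ, nc_succ, Finset.sum_add_distrib, Finset.sum_sub_distrib,
    e, Finset.sum_neg_distrib, Finset.mul_sum, cst, Algebra.smul_def]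

/-- Elimination of the order below Coulombic from the divergence and the wave equation. -/
lemma dU_constraint {E f s : Fin m → Fin m → ScriFun m} (j : Fin m)
    (hA : -∑ i, th i * dU (E i j) + (∑ i, D i (f i j) - cst ((m : ℝ) - 3) * ∑ i, th i * f i j) = 0)
    (hB : ∀ i, cst ((m : ℝ) - 3) * dU (E i j) + (lap (f i j) - cst ((m : ℝ) - 3) * f i j) = s i j) :
    dU (constraint E j) = ∑ i, D i (s i j) - cst ((m : ℝ) - 1) * ∑ i, th i * s i j := by
  have c3 : (cst ((m : ℝ) - 1) : ScriFun m) = cst ((m : ℝ) - 3) + 2 := by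
    rw [← cst_add_ofNat, show (m : ℝ) - 1 = ((m : ℝ) - 3) + 2 by ring]
  have d1 := dU_cst (m := m) ((m : ℝ) - 3)
  have d2 := fun i => D_cst (m := m) i ((m : ℝ) - 3)
  have d3 := fun x => lap_cst_mul (m := m) ((m : ℝ) - 3) x
  have l1 := fun i => lap_th_mul (m := m) i (f i j)
  have l2 := fun i => lap_D (m := m) i (f i j)
  -- Here `E` stands for Coulombic order and `f` for the order below it. The divergence identity
  -- `hA` gives the radial contraction of `E` in terms of `f`, the wave equation `hB` gives all of
  -- `E`.
  have h2 : ∑ i, th i * dU (E i j) =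
      ∑ i, D i (f i j) - cst ((m : ℝ) - 3) * ∑ i, th i * f i j := by
    linear_combination -hA
  unfold constraint
  rw [c3] at l1 ⊢
  generalize (cst ((m : ℝ) - 3) : ScriFun m) = a at *
  have h1 : dU (lap (∑ i, th i * E i j) + a * (∑ i, D i (E i j) - (a + 2) * ∑ i, th i * E i j)) =
      lap (∑ i, th i * dU (E i j)) + a * (∑ i, D i (dU (E i j)) - (a + 2) * ∑ i, th i * dU (E i j)) := by
    have e0 : dU (∑ i, th i * E i j) = ∑ i, th i * dU (E i j) := by
      rw [map_sum]
      refine Finset.sum_congr rfl fun i _ => ?_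
      rw [Derivation.leibniz, dU_th, smul_zero, add_zero, smul_eq_mul]
    have e1 : dU (∑ i, D i (E i j)) = ∑ i, D i (dU (E i j)) := by
      rw [map_sum]
      exact Finset.sum_congr rfl fun i _ => dU_D _ _
    have e2 : dU (a + 2 : ScriFun m) = 0 := by
      rw [map_add, d1, zero_add]
      exact dU_cst 2
    rw [map_add, dU_lap, e0, Derivation.leibniz, d1, map_sub, e1, Derivation.leibniz, e2, e0]
    simp only [smul_eq_mul]
    ring
  have h3 : lap (∑ i, th i * dU (E i j)) = ∑ i, D i (lap (f i j)) - 2 * ∑ i, th i * lap (f i j) +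
      a * ∑ i, D i (f i j) - a * (∑ i, th i * lap (f i j) +
        2 * ∑ i, D i (f i j) - (a + 2) * ∑ i, th i * f i j) := by
    rw [h2, map_sub, d3, map_sum, map_sum]
    simp only [l1, l2, Finset.sum_add_distrib, Finset.sum_sub_distrib, Finset.mul_sum]
  have h4 : ∑ i, D i (s i j) = a * ∑ i, D i (dU (E i j)) +
      (∑ i, D i (lap (f i j)) - a * ∑ i, D i (f i j)) := by
    simp only [← hB, map_add, map_sub, Derivation.leibniz, d2, smul_eq_mul,
      mul_zero, add_zero, Finset.sum_add_distrib, Finset.sum_sub_distrib, Finset.mul_sum]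
  have h5 : ∑ i, th i * s i j = a * ∑ i, th i * dU (E i j) +
      (∑ i, th i * lap (f i j) - a * ∑ i, th i * f i j) := by
    simp only [← hB, Finset.mul_sum, ← Finset.sum_add_distrib, ← Finset.sum_sub_distrib]
    exact Finset.sum_congr rfl fun i _ => by ring
  -- The second derivatives and multiples of `f` cancel identically in this combination; this
  -- cancellation determines the form of `constraint`.
  rw [h1, h3, h4, h5]
  ring

/-- The projection of a tensor that annihilates gauge perturbations. -/
def gaugeProj (K : Fin (m + 1) → Fin (m + 1) → ScriFun m) (μ ν : Fin (m + 1)) : ScriFun m :=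
  K μ ν + Lc μ * Lc ν * K 0 0 - Lc μ * K 0 ν - Lc ν * K 0 μ

/-- The component of a perturbation along the null direction. -/
def nullPart (K : Fin (m + 1) → Fin (m + 1) → ScriFun m) : ScriFun m :=
  ∑ l, ∑ σ, (eps l * eps σ) • (Lc l * Lc σ * K l σ)

lemma dU_gaugeProj (K : Fin (m + 1) → Fin (m + 1) → ScriFun m) (μ ν : Fin (m + 1)) :
    dU (gaugeProj K μ ν) = gaugeProj (fun a b => dU (K a b)) μ ν := by
  simp only [gaugeProj, map_add, map_sub, Derivation.leibniz, dU_Lc, smul_eq_mul, mul_zero,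
    add_zero]

/-- The leading term of each derivative is `L ∂_u`, so the tidal operator reduces to two
`u`-derivatives of the projection that kills symmetrized products with `L`. -/
lemma tidal_lead {K : Fin (m + 1) → Fin (m + 1) → ℤ → ScriFun m} {k : ℤ}
    (hK : ∀ μ ν, ∀ j < k, K μ ν j = 0) (μ ν : Fin (m + 1)) :
    tidC K μ ν k = dU (dU (gaugeProj (fun a b => K a b k) μ ν)) := by
  rw [dU_gaugeProj, dU_gaugeProj]
  simp only [tidC_apply, dC_dC_lead (hK _ _), gaugeProj, Lc_zero, one_mul,
    mul_assoc]

lemma tidal_eq_zero_of_lt {K : Fin (m + 1) → Fin (m + 1) → ℤ → ScriFun m} {k : ℤ}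
    (hK : ∀ μ ν, ∀ j < k, K μ ν j = 0) (μ ν : Fin (m + 1)) : ∀ j < k, tidC K μ ν j = 0 := by
  intro j hj
  simp only [tidC_apply,
    dC_eq_zero_of_lt (dC_eq_zero_of_lt (hK _ _) _) _ j hj]
  simp

/-- The potential of the nonlinear source of the constraint. -/
def sourcePotential (H : Fin (m + 1) → Fin (m + 1) → ScriFun m) (j : Fin m) : ScriFun m :=
  ∑ i : Fin m, D i (nullPart H * gaugeProj (fun a b => dU (H a b)) i.succ j.succ) -
    cst ((m : ℝ) - 1) * ∑ i : Fin m, th i *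
      (nullPart H * gaugeProj (fun a b => dU (H a b)) i.succ j.succ)

/-- The Ricci source of the divergence identity starts one power of `1/r` beyond Coulombic order, so
at Coulombic order the identity is homogeneous. -/
lemma div_tidal_coeff (hh : ∀ μ ν, h μ ν = h ν μ)
    (hR : ∀ μ ν, ∀ k < 2 * ((m : ℤ) - 1), ricC h μ ν k = 0) (j : Fin m) :
    -∑ i : Fin m, th i * dU (tidC h i.succ j.succ (2 * ((m : ℤ) - 2))) +
      (∑ i : Fin m, D i (tidC h i.succ j.succ (2 * ((m : ℤ) - 3))) - cst ((m : ℝ) - 3) *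
        ∑ i : Fin m, th i * tidC h i.succ j.succ (2 * ((m : ℤ) - 3))) = 0 := by
  have h0 := div_tidC hh j
  have h2 : dC 0 (ricC h 0 j.succ) (2 * ((m : ℤ) - 2)) = 0 :=
    dC_eq_zero_of_lt (c := ricC h 0 j.succ) (hR 0 j.succ) 0 _ (by omega)
  have h3 : dC j.succ (ricC h 0 0) (2 * ((m : ℤ) - 2)) = 0 :=
    dC_eq_zero_of_lt (c := ricC h 0 0) (hR 0 0) j.succ _ (by omega)
  generalize dC 0 (ricC h 0 j.succ) = a at h0 h2
  generalize dC j.succ (ricC h 0 0) = b at h0 h3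
  change ∑ i : Fin m, dC i.succ ((fun i : Fin m => tidC h i.succ j.succ) i) = _ at h0
  generalize hc : (fun i : Fin m => tidC h i.succ j.succ) = c at h0
  have hc' : ∀ i k, tidC h i.succ j.succ k = c i k := fun i k => by rw [← hc]
  simp only [hc']
  have h1 := congrFun h0 (2 * ((m : ℤ) - 2))
  rw [Finset.sum_apply, Pi.smul_apply, Pi.sub_apply, h2, h3, sub_zero, smul_zero, div_coeff,
    show 2 * ((m : ℤ) - 2) - 2 = 2 * ((m : ℤ) - 3) by ring,
    show (((2 * ((m : ℤ) - 2) : ℤ) : ℝ) - 2) / 2 = (m : ℝ) - 3 by push_cast; ring] at h1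
  exact h1

/-- The constraint at Coulombic order that follows from the Einstein equation. -/
lemma dU_constraint_tidal (hh : ∀ μ ν, h μ ν = h ν μ)
    (hR : ∀ μ ν, ∀ k < 2 * ((m : ℤ) - 1), ricC h μ ν k = 0)
    (H : Fin (m + 1) → Fin (m + 1) → ScriFun m) (hn : dU (nullPart H) = 0)
    (hQ : ∀ i j : Fin m, gaugeProj (fun a b => ricC h a b (2 * ((m : ℤ) - 1))) i.succ j.succ =
      (-(1 / 2) : ℝ) • (nullPart H * gaugeProj (fun a b => dU (dU (H a b))) i.succ j.succ))
    (j : Fin m) :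
    dU (constraint (fun i j => tidC h i.succ j.succ (2 * ((m : ℤ) - 2))) j) =
      dU (dU (dU (sourcePotential H j))) := by
  -- As the null part is stationary, it passes through `dU` and the source is an exact third
  -- derivative.
  have hs : ∀ i j : Fin m, dU (dU (dU (nullPart H * gaugeProj (fun a b => dU (H a b)) i.succ j.succ)))
      = nullPart H * dU (dU (gaugeProj (fun a b => dU (dU (H a b))) i.succ j.succ)) := by
    intro i j
    simp only [Derivation.leibniz, hn, smul_eq_mul, mul_zero, add_zero, dU_gaugeProj]
  have hB : ∀ i : Fin m, cst ((m : ℝ) - 3) * dU (tidC h i.succ j.succ (2 * ((m : ℤ) - 2))) +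
      (lap (tidC h i.succ j.succ (2 * ((m : ℤ) - 3))) -
        cst ((m : ℝ) - 3) * tidC h i.succ j.succ (2 * ((m : ℤ) - 3))) =
      dU (dU (dU (nullPart H * gaugeProj (fun a b => dU (H a b)) i.succ j.succ))) := by
    intro i
    have h0 := boxC_tidC hh i.succ j.succ
    have hl : tidC (ricC h) i.succ j.succ (2 * ((m : ℤ) - 1)) =
        dU (dU (gaugeProj (fun a b => ricC h a b (2 * ((m : ℤ) - 1))) i.succ j.succ)) :=
      tidal_lead hR i.succ j.succ
    rw [hQ i j] at hl
    generalize tidC (ricC h) i.succ j.succ = a at h0 hl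
    generalize tidC h i.succ j.succ = b at h0 ⊢
    have h1 := congrFun h0 (2 * ((m : ℤ) - 1))
    rw [Pi.smul_apply, hl, box_coeff,
      show 2 * ((m : ℤ) - 1) - 2 = 2 * ((m : ℤ) - 2) by ring,
      show 2 * ((m : ℤ) - 1) - 4 = 2 * ((m : ℤ) - 3) by ring,
      show ((2 * ((m : ℤ) - 1) : ℤ) : ℝ) - 2 - ((m : ℝ) - 1) = (m : ℝ) - 3 by push_cast; ring,
      show (((2 * ((m : ℤ) - 1) : ℤ) : ℝ) - 4) / 2 * ((((2 * ((m : ℤ) - 1) : ℤ) : ℝ) - 4) / 2 + 2 - m)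
        = -((m : ℝ) - 3) by push_cast; ring] at h1
    have h2 : (-2 : ℝ) • dU (dU ((-(1 / 2) : ℝ) • (nullPart H *
        gaugeProj (fun a b => dU (dU (H a b))) i.succ j.succ))) =
        nullPart H * dU (dU (gaugeProj (fun a b => dU (dU (H a b))) i.succ j.succ)) := by
      simp only [Derivation.map_smul, Derivation.leibniz, hn, smul_eq_mul, mul_zero, add_zero,
        smul_smul]
      norm_num
    rw [hs, ← h2, ← h1, show (cst (-((m : ℝ) - 3)) : ScriFun m) = -cst ((m : ℝ) - 3) from map_neg _ _]
    ring
  have h1 := dU_constraint (E := fun i j => tidC h i.succ j.succ (2 * ((m : ℤ) - 2)))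
    (f := fun i j => tidC h i.succ j.succ (2 * ((m : ℤ) - 3)))
    (s := fun i j => dU (dU (dU (nullPart H * gaugeProj (fun a b => dU (H a b)) i.succ j.succ))))
    j (div_tidal_coeff hh hR j) hB
  rw [h1, sourcePotential]
  have e1 : ∀ x : ScriFun m, dU (cst ((m : ℝ) - 1) * x) = cst ((m : ℝ) - 1) * dU x := by
    intro x
    rw [Derivation.leibniz, dU_cst, smul_zero, add_zero, smul_eq_mul]
  have e2 : ∀ (i : Fin m) (x : ScriFun m), dU (th i * x) = th i * dU x := by
    intro i x
    rw [Derivation.leibniz, dU_th, smul_zero, add_zero, smul_eq_mul]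
  simp only [map_sub (dU (m := m)), map_sum, e1, e2, dU_D]

end

end NullMemory

namespace NullMemory

noncomputable section

/-! ### The stress-energy at null infinity -/

section Matter

variable {m : ℕ} {L : Fin (m + 1) → ℝ} {τ : Fin (m + 1) → Fin (m + 1) → ℝ}

/-- The dominant energy condition in Minkowski spacetime. -/
def FlatDominantEnergy (τ : Fin (m + 1) → Fin (m + 1) → ℝ) : Prop :=
  ∀ v : Fin (m + 1) → ℝ, ∑ a, eps a * v a * v a < 0 →
    ∑ a, eps a * (∑ b, τ a b * v b) * (∑ b, τ a b * v b) ≤ 0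

/-- A causal covector orthogonal to a null covector is proportional to it. -/
lemma eq_smul_of_causal (hL0 : L 0 = 1) (hL : ∑ l, eps l * L l * L l = 0)
    {w : Fin (m + 1) → ℝ} (h1 : ∑ l, eps l * L l * w l = 0) (h2 : ∑ a, eps a * w a * w a ≤ 0)
    (a : Fin (m + 1)) : w a = w 0 * L a := by
  rw [Fin.sum_univ_succ] at hL h1 h2
  simp only [eps_zero, eps_succ, hL0, one_mul] at hL h1 h2
  -- The spatial part of `w` has norm at most `|w 0|` and inner product `w 0` with the unit vector
  -- underlying `L`: the equality case of Cauchy–Schwarz.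
  have h3 : ∑ i : Fin m, (w i.succ - w 0 * L i.succ) ^ 2 =
      ∑ i : Fin m, w i.succ * w i.succ - 2 * w 0 * ∑ i : Fin m, L i.succ * w i.succ +
        w 0 ^ 2 * ∑ i : Fin m, L i.succ * L i.succ := by
    simp only [Finset.mul_sum, ← Finset.sum_sub_distrib, ← Finset.sum_add_distrib]
    exact Finset.sum_congr rfl fun i _ => by ring
  have h4 : ∑ i : Fin m, (w i.succ - w 0 * L i.succ) ^ 2 ≤ 0 := by
    rw [h3, show ∑ i : Fin m, L i.succ * w i.succ = w 0 by linarith,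
      show ∑ i : Fin m, L i.succ * L i.succ = 1 by linarith]
    linarith
  refine Fin.cases (by rw [hL0, mul_one]) (fun i => ?_) a
  have h5 := (Finset.sum_eq_zero_iff_of_nonneg fun i _ => sq_nonneg (w i.succ - w 0 * L i.succ)).1
    (le_antisymm h4 (Finset.sum_nonneg fun i _ => sq_nonneg _)) i (Finset.mem_univ i)
  nlinarith [pow_eq_zero_iff (two_ne_zero) |>.1 h5]

/-- Transverse matter that obeys the dominant energy condition is null dust. -/
lemma null_dust (hL0 : L 0 = 1) (hL : ∑ l, eps l * L l * L l = 0) (hτ : ∀ a b, τ a b = τ b a)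
    (hT : ∀ b, ∑ l, eps l * L l * τ l b = 0) (hE : FlatDominantEnergy τ) (a b : Fin (m + 1)) :
    τ a b = τ 0 0 * L a * L b := by
  have key : ∀ v : Fin (m + 1) → ℝ, ∑ a, eps a * v a * v a < 0 → ∀ a,
      ∑ b, τ a b * v b = (∑ b, τ 0 b * v b) * L a := by
    intro v hv a
    refine eq_smul_of_causal hL0 hL (w := fun a => ∑ b, τ a b * v b) ?_ (hE v hv) a
    simp only [Finset.mul_sum]
    rw [Finset.sum_comm]
    have : ∀ b, ∑ l, eps l * L l * (τ l b * v b) = (∑ l, eps l * L l * τ l b) * v b := by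
      intro b
      rw [Finset.sum_mul]
      exact Finset.sum_congr rfl fun l _ => by ring
    simp [this, hT]
  have h0 : ∀ a, τ a 0 = τ 0 0 * L a := by
    intro a
    have := key (Pi.single 0 1) (by
      rw [Fin.sum_univ_succ]
      simp [Fin.succ_ne_zero]) a
    simpa [Pi.single_apply] using this
  refine Fin.cases ?_ (fun i => ?_) b
  · rw [h0, hL0, mul_one]
  -- The energy condition only sees timelike vectors. The time axis and its tilts by one half,
  -- timelike because `1/4 < 1`, span all directions.
  · have h1 := key (Pi.single 0 1 + Pi.single i.succ (1 / 2)) (by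
      rw [Fin.sum_univ_succ]
      have : ∀ j : Fin m, eps (m := m) j.succ *
          (Pi.single 0 1 + Pi.single i.succ (1 / 2) : Fin (m + 1) → ℝ) j.succ *
          (Pi.single 0 1 + Pi.single i.succ (1 / 2) : Fin (m + 1) → ℝ) j.succ =
          if j = i then 1 / 4 else 0 := by
        intro j
        by_cases hj : j = i
        · subst hj
          simp [Fin.succ_ne_zero]
          norm_num
        · simp [Fin.succ_ne_zero, hj]
      rw [Finset.sum_congr rfl fun j _ => this j]
      simp [(Fin.succ_ne_zero i).symm]
      norm_num) a
    have h2 : ∀ a, ∑ b, τ a b * (Pi.single 0 1 + Pi.single i.succ (1 / 2) : Fin (m + 1) → ℝ) b =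
        τ a 0 + τ a i.succ * (1 / 2) := by
      intro a
      simp only [Pi.add_apply, mul_add, Finset.sum_add_distrib]
      simp [Pi.single_apply]
    rw [h2, h2, h0 a, hτ 0 i.succ, h0 i.succ] at h1
    linarith

end Matter

section Linear

variable {m : ℕ} {L : Fin (m + 1) → ℝ} {H H₁ H₂ : Fin (m + 1) → Fin (m + 1) → ℝ}

lemma quadRic_symm (hL : ∑ l, eps l * L l * L l = 0) (hH : ∀ a b, H a b = H b a)
    (hH₁ : ∀ a b, H₁ a b = H₁ b a) (hH₂ : ∀ a b, H₂ a b = H₂ b a)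
    (hg : ∀ b, ∑ l, eps l * L l * H₁ l b = 1 / 2 * (L b * ∑ l, eps l * H₁ l l))
    (μ ν : Fin (m + 1)) : quadRic L H H₁ H₂ μ ν = quadRic L H H₁ H₂ ν μ := by
  rw [quadRic_eq hL hH hH₁ hH₂ hg, quadRic_eq hL hH hH₁ hH₂ hg, hH₂ μ ν]
  ring

/-- The quadratic part of the Ricci tensor satisfies the leading order contracted Bianchi
identity. -/
lemma quadRic_transverse (hL : ∑ l, eps l * L l * L l = 0) (hH : ∀ a b, H a b = H b a)
    (hH₁ : ∀ a b, H₁ a b = H₁ b a) (hH₂ : ∀ a b, H₂ a b = H₂ b a)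
    (hg : ∀ b, ∑ l, eps l * L l * H₁ l b = 1 / 2 * (L b * ∑ l, eps l * H₁ l l))
    (hg₂ : ∀ b, ∑ l, eps l * L l * H₂ l b = 1 / 2 * (L b * ∑ l, eps l * H₂ l l))
    (b : Fin (m + 1)) :
    ∑ l, eps l * L l * quadRic L H H₁ H₂ l b =
      1 / 2 * (L b * ∑ l, eps l * quadRic L H H₁ H₂ l l) := by
  simp only [quadRic_eq hL hH hH₁ hH₂ hg]
  set q := quadVec L H H₁ H₂
  set n := nullComp L H
  have e1 : ∑ l, eps l * L l * (1 / 2 * n * H₂ l b + (L l * q b + L b * q l)) =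
      1 / 2 * n * (∑ l, eps l * L l * H₂ l b) + q b * (∑ l, eps l * L l * L l) +
        L b * ∑ l, eps l * L l * q l := by
    simp only [Finset.mul_sum, ← Finset.sum_add_distrib]
    exact Finset.sum_congr rfl fun i _ => by ring
  have e2 : ∑ l, eps l * (1 / 2 * n * H₂ l l + (L l * q l + L l * q l)) =
      1 / 2 * n * (∑ l, eps l * H₂ l l) + 2 * ∑ l, eps l * L l * q l := by
    simp only [Finset.mul_sum, ← Finset.sum_add_distrib]
    exact Finset.sum_congr rfl fun i _ => by ring
  rw [e1, e2, hg₂, hL]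
  ring

/-- The projection of a tensor that annihilates gauge perturbations, pointwise. -/
def gaugePart (L : Fin (m + 1) → ℝ) (K : Fin (m + 1) → Fin (m + 1) → ℝ) (μ ν : Fin (m + 1)) : ℝ :=
  K μ ν + L μ * L ν * K 0 0 - L μ * K 0 ν - L ν * K 0 μ

/-- Because `L 0 = 1`, the projection removes all terms of the form `L μ * q ν + L ν * q μ` in
`quadRic_eq`. -/
lemma gaugePart_quadRic (hL0 : L 0 = 1) (hL : ∑ l, eps l * L l * L l = 0) (hH : ∀ a b, H a b = H b a)
    (hH₁ : ∀ a b, H₁ a b = H₁ b a) (hH₂ : ∀ a b, H₂ a b = H₂ b a)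
    (hg : ∀ b, ∑ l, eps l * L l * H₁ l b = 1 / 2 * (L b * ∑ l, eps l * H₁ l l))
    (μ ν : Fin (m + 1)) :
    gaugePart L (quadRic L H H₁ H₂) μ ν = 1 / 2 * (nullComp L H * gaugePart L H₂ μ ν) := by
  simp only [gaugePart, quadRic_eq hL hH hH₁ hH₂ hg, hL0]
  ring

end Linear

/-! ### The constraint on the memory -/

variable {m : ℕ} [NeZero m]

open ScriFun

/-- Values of tensor coefficients. -/
def val (H : Fin (m + 1) → Fin (m + 1) → ScriFun m) (p : ℝ × Space m) (a b : Fin (m + 1)) : ℝ :=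
  H a b p

lemma gaugeProj_apply (K : Fin (m + 1) → Fin (m + 1) → ScriFun m) (μ ν : Fin (m + 1))
    (p : ℝ × Space m) :
    gaugeProj K μ ν p = gaugePart (fun l => Lc l p) (val K p) μ ν := by
  simp only [gaugeProj, gaugePart, ScriFun.sub_apply, ScriFun.add_apply, ScriFun.mul_apply, val]

lemma nullPart_apply (K : Fin (m + 1) → Fin (m + 1) → ScriFun m) (p : ℝ × Space m) :
    nullPart K p = nullComp (fun l => Lc l p) (val K p) := by
  simp only [nullPart, nullComp, ScriFun.sum_apply, ScriFun.smul_apply, ScriFun.mul_apply, val]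
  exact Finset.sum_congr rfl fun l _ => Finset.sum_congr rfl fun s _ => by ring

/-- The null component is stationary in the leading order gauge. -/
lemma dU_nullPart {H : Fin (m + 1) → Fin (m + 1) → ScriFun m}
    (hg : ∀ ν, ∑ l, eps l • (Lc l * dU (H l ν)) =
      (1 / 2 : ℝ) • (Lc ν * ∑ l, eps l • dU (H l l))) : dU (nullPart H) = 0 := by
  have vg : ∀ p b, ∑ l, eps l * Lc l p * val (fun a b => dU (H a b)) p l b =
      1 / 2 * (Lc b p * ∑ l, eps l * val (fun a b => dU (H a b)) p l l) := by
    intro p b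
    have := congrArg (fun c : ScriFun m => c p) (hg b)
    simp only [ScriFun.sum_apply, ScriFun.smul_apply, ScriFun.mul_apply] at this
    simpa only [val, mul_assoc] using this
  refine ext_sphere fun u θ _ => ?_
  have e1 : dU (nullPart H) = nullPart (fun a b => dU (H a b)) := by
    simp only [nullPart, map_sum, Derivation.map_smul, Derivation.leibniz, dU_Lc, smul_eq_mul,
      mul_zero, add_zero]
  rw [e1, nullPart_apply, nullComp, Finset.sum_comm]
  have e2 : ∀ s, ∑ l, eps l * eps s * Lc l (u, θ) * Lc s (u, θ) *
      val (fun a b => dU (H a b)) (u, θ) l s =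
      (1 / 2 * ∑ l, eps l * val (fun a b => dU (H a b)) (u, θ) l l) *
        (eps s * Lc s (u, θ) * Lc s (u, θ)) := by
    intro s
    have : ∀ l, eps l * eps s * Lc l (u, θ) * Lc s (u, θ) *
        val (fun a b => dU (H a b)) (u, θ) l s = (eps s * Lc s (u, θ)) *
          (eps l * Lc l (u, θ) * val (fun a b => dU (H a b)) (u, θ) l s) := fun l => by ring
    rw [Finset.sum_congr rfl fun l _ => this l, ← Finset.mul_sum, vg]
    ring
  rw [Finset.sum_congr rfl fun s _ => e2 s, ← Finset.mul_sum, sum_eps_Lc_apply, mul_zero]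
  rfl

/-- The constraint at Coulombic order, for the coefficients of a solution of the full Einstein
equation. -/
theorem dU_constraint_of_einstein (hm : 3 ≤ m) {h : Fin (m + 1) → Fin (m + 1) → ℤ → ScriFun m}
    {H : Fin (m + 1) → Fin (m + 1) → ScriFun m} (hH : ∀ a b, H a b = h a b ((m : ℤ) - 1))
    {τ : Fin (m + 1) → Fin (m + 1) → ℝ → Space m → ℝ}
    (hh : ∀ μ ν, h μ ν = h ν μ) (hlow : ∀ μ ν, ∀ j < (m : ℤ) - 1, h μ ν j = 0)
    (hR : ∀ μ ν, ∀ k < 2 * ((m : ℤ) - 1), ricC h μ ν k = 0)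
    (hst : ∀ μ ν, ∀ θ : Space m, ‖θ‖ = 1 → Tendsto (fun u => dU (H μ ν) (u, θ)) atBot (𝓝 0))
    (hK : ∀ μ ν u, ∀ θ : Space m, ‖θ‖ = 1 → ricC h μ ν (2 * ((m : ℤ) - 1)) (u, θ) =
      8 * Real.pi * (τ μ ν u θ - minkowski m μ ν * (∑ l, eps l * τ l l u θ) / ((m : ℝ) - 1)) -
        quadRic (fun l => Lc l (u, θ)) (val H (u, θ)) (val (fun a b => dU (H a b)) (u, θ))
          (val (fun a b => dU (dU (H a b))) (u, θ)) μ ν)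
    (hτ : ∀ μ ν, ∀ θ : Space m, ‖θ‖ = 1 → Tendsto (fun u => τ μ ν u θ) atBot (𝓝 0))
    (hE : ∀ u, ∀ θ : Space m, ‖θ‖ = 1 → FlatDominantEnergy fun a b => τ a b u θ) (j : Fin m) :
    dU (constraint (fun i j => tidC h i.succ j.succ (2 * ((m : ℤ) - 2))) j) =
      dU (dU (dU (sourcePotential H j))) := by
  have hm1 : ((m : ℝ) - 1) ≠ 0 := by
    have : (3 : ℝ) ≤ m := by exact_mod_cast hm
    linarith
  have hsym : ∀ a b, H a b = H b a := fun a b => by rw [hH, hH, hh]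
  have hg := leading_gauge (k := (m : ℤ) - 1) hlow (fun μ ν => hR μ ν _ (by omega))
    (fun μ ν θ hθ => by rw [← hH]; exact hst μ ν θ hθ)
  simp only [← hH] at hg
  have hg₂ : ∀ ν, ∑ l, eps l • (Lc l * dU (dU (H l ν))) =
      (1 / 2 : ℝ) • (Lc ν * ∑ l, eps l • dU (dU (H l l))) := by
    intro ν
    have := congrArg dU (hg ν)
    simpa only [map_sum, Derivation.map_smul, Derivation.leibniz, dU_Lc, smul_eq_mul, mul_zero,
      add_zero] using this
  have vg : ∀ p b, ∑ l, eps l * Lc l p * val (fun a b => dU (H a b)) p l b =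
      1 / 2 * (Lc b p * ∑ l, eps l * val (fun a b => dU (H a b)) p l l) := by
    intro p b
    have := congrArg (fun c : ScriFun m => c p) (hg b)
    simp only [ScriFun.sum_apply, ScriFun.smul_apply, ScriFun.mul_apply] at this
    simpa only [val, mul_assoc] using this
  have vg₂ : ∀ p b, ∑ l, eps l * Lc l p * val (fun a b => dU (dU (H a b))) p l b =
      1 / 2 * (Lc b p * ∑ l, eps l * val (fun a b => dU (dU (H a b))) p l l) := by
    intro p b
    have := congrArg (fun c : ScriFun m => c p) (hg₂ b)
    simp only [ScriFun.sum_apply, ScriFun.smul_apply, ScriFun.mul_apply] at this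
    simpa only [val, mul_assoc] using this
  have hn := dU_nullPart hg
  set K : Fin (m + 1) → Fin (m + 1) → ScriFun m := fun a b => ricC h a b (2 * ((m : ℤ) - 1)) with hKdef
  have vs : ∀ p a b, val H p a b = val H p b a := fun p a b => by rw [val, val, hsym]
  have vs₁ : ∀ p a b, val (fun a b => dU (H a b)) p a b = val (fun a b => dU (H a b)) p b a :=
    fun p a b => by rw [val, val, hsym]
  have vs₂ : ∀ p a b, val (fun a b => dU (dU (H a b))) p a b =
      val (fun a b => dU (dU (H a b))) p b a := fun p a b => by rw [val, val, hsym]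
  -- The stress coefficient inherits symmetry from the Ricci coefficient, the Minkowski metric and
  -- the quadratic term.
  have hτs : ∀ u, ∀ θ : Space m, ‖θ‖ = 1 → ∀ a b, τ a b u θ = τ b a u θ := by
    intro u θ hθ a b
    have h1 := hK a b u θ hθ
    have h2 := hK b a u θ hθ
    have h3 := quadRic_symm (sum_eps_Lc_apply u θ) (vs (u, θ)) (vs₁ (u, θ)) (vs₂ (u, θ)) (vg (u, θ)) a b
    have h4 : minkowski m a b = minkowski m b a := by
      rw [minkowski, Matrix.diagonal_apply, Matrix.diagonal_apply]
      by_cases hab : a = b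
      · subst hab; rfl
      · rw [if_neg hab, if_neg (Ne.symm hab)]
    rw [ricC_symm hh a b, h2, h3, h4] at h1
    have h5 : 8 * Real.pi * (τ a b u θ - τ b a u θ) = 0 := by linarith
    have h6 := (mul_eq_zero.1 h5).resolve_left (by positivity)
    linarith
  -- The contraction of `L` with the trace-reversed leading Ricci coefficient. The linearized
  -- Bianchi identity makes it stationary; by the Einstein equation it is `8π` times the contraction
  -- of `L` with the stress, the quadratic part dropping out by `quadRic_transverse`.
  set Y : Fin (m + 1) → ScriFun m := fun ν =>
    ∑ l, eps l • (Lc l * K l ν) - (1 / 2 : ℝ) • (Lc ν * ∑ l, eps l • K l l) with hY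
  have hYU : ∀ ν, dU (Y ν) = 0 := by
    intro ν
    have h1 := congrFun (bianchi_ricC hh ν) (2 * ((m : ℤ) - 1))
    rw [Finset.sum_apply] at h1
    simp only [Pi.smul_apply] at h1
    have h2 : ∀ l, dC l (ricC h l ν) (2 * ((m : ℤ) - 1)) = Lc l * dU (K l ν) :=
      fun l => dC_lead (c := ricC h l ν) (hR l ν) l
    have h3 : dC ν (∑ l, eps l • ricC h l l) (2 * ((m : ℤ) - 1)) =
        Lc ν * dU (∑ l, eps l • K l l) := by
      have := dC_lead (c := ∑ l, eps l • ricC h l l) (k := 2 * ((m : ℤ) - 1)) (fun j hj => by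
        rw [Finset.sum_apply]
        simp [hR _ _ j hj]) ν
      rw [this, Finset.sum_apply]
      simp only [Pi.smul_apply, hKdef]
    simp only [h2, h3] at h1
    simp only [hY, map_sub, map_sum, Derivation.map_smul, Derivation.leibniz, dU_Lc, smul_eq_mul,
      mul_zero, add_zero]
    rw [h1, map_sum]
    simp only [Derivation.map_smul]
    exact sub_self _
  have hmk : ∀ b (x : Fin (m + 1) → ℝ), ∑ l, eps l * x l * minkowski m l b = x b := by
    intro b x
    have : ∀ l, eps l * x l * minkowski m l b = if l = b then x b else 0 := by
      intro l
      rw [minkowski, Matrix.diagonal_apply]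
      split_ifs with hl
      · subst hl
        refine Fin.cases ?_ (fun i => ?_) l <;> simp
      · simp
    simp [this]
  have hmt : ∑ l, eps l * minkowski m l l = (m : ℝ) + 1 := by
    have : ∀ l, eps l * minkowski m l l = 1 := by
      intro l
      rw [minkowski, Matrix.diagonal_apply_eq]
      refine Fin.cases ?_ (fun i => ?_) l <;> simp
    simp [this]
  have hYv : ∀ ν u, ∀ θ : Space m, ‖θ‖ = 1 →
      Y ν (u, θ) = 8 * Real.pi * ∑ l, eps l * Lc l (u, θ) * τ l ν u θ := by
    intro ν u θ hθ
    have h1 : Y ν (u, θ) = ∑ l, eps l * Lc l (u, θ) * K l ν (u, θ) -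
        1 / 2 * (Lc ν (u, θ) * ∑ l, eps l * K l l (u, θ)) := by
      simp only [hY, ScriFun.sub_apply, ScriFun.sum_apply, ScriFun.smul_apply, ScriFun.mul_apply,
        mul_assoc]
    have h2 := quadRic_transverse (sum_eps_Lc_apply u θ) (vs (u, θ)) (vs₁ (u, θ)) (vs₂ (u, θ))
      (vg (u, θ)) (vg₂ (u, θ)) ν
    rw [h1]
    simp only [hKdef, hK _ _ u θ hθ]
    set t := ∑ l, eps l * τ l l u θ
    set Q := quadRic (fun l => Lc l (u, θ)) (val H (u, θ)) (val (fun a b => dU (H a b)) (u, θ))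
      (val (fun a b => dU (dU (H a b))) (u, θ))
    have e1 : ∑ l, eps l * Lc l (u, θ) * (8 * Real.pi * (τ l ν u θ - minkowski m l ν * t /
        ((m : ℝ) - 1)) - Q l ν) = 8 * Real.pi * (∑ l, eps l * Lc l (u, θ) * τ l ν u θ) -
        8 * Real.pi * t / ((m : ℝ) - 1) * (∑ l, eps l * Lc l (u, θ) * minkowski m l ν) -
        ∑ l, eps l * Lc l (u, θ) * Q l ν := by
      simp only [Finset.mul_sum, ← Finset.sum_sub_distrib]
      exact Finset.sum_congr rfl fun l _ => by ring
    have e2 : ∀ s : ℝ, ∑ l, eps l * (8 * Real.pi * (τ l l u θ - minkowski m l l * s /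
        ((m : ℝ) - 1)) - Q l l) = 8 * Real.pi * (∑ l, eps l * τ l l u θ) -
        8 * Real.pi * s / ((m : ℝ) - 1) * (∑ l, eps l * minkowski m l l) - ∑ l, eps l * Q l l := by
      intro s
      simp only [Finset.mul_sum, ← Finset.sum_sub_distrib]
      exact Finset.sum_congr rfl fun l _ => by ring
    rw [e1, e2 t, h2, hmk ν, hmt, show ∑ l, eps l * τ l l u θ = t from rfl]
    field_simp
    ring
  -- A stationary quantity that tends to zero at early times vanishes, so the stress is transverse.
  have hT : ∀ u, ∀ θ : Space m, ‖θ‖ = 1 → ∀ ν, ∑ l, eps l * Lc l (u, θ) * τ l ν u θ = 0 := by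
    intro u θ hθ ν
    have h1 : Tendsto (fun v => Y ν (v, θ)) atBot (𝓝 0) := by
      have hLc : ∀ l u, (Lc l : ScriFun m) (u, θ) = Lc l (0, θ) := fun l u =>
        apply_of_dU (dU_Lc l) u 0 θ
      simp only [hYv ν _ θ hθ, hLc]
      have := (tendsto_finsetSum Finset.univ fun (l : Fin (m + 1)) _ =>
        (hτ l ν θ hθ).const_mul (eps l * (Lc l : ScriFun m) (0, θ))).const_mul (8 * Real.pi)
      simpa using this
    have h2 : (fun v => Y ν (v, θ)) = fun _ => Y ν (u, θ) :=
      funext fun v => apply_of_dU (hYU ν) v u θ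
    rw [h2] at h1
    have h3 := tendsto_nhds_unique tendsto_const_nhds h1
    rw [hYv ν u θ hθ] at h3
    exact (mul_eq_zero.1 h3).resolve_left (by positivity)
  refine dU_constraint_tidal hh hR H hn (fun i j => ext_sphere fun u θ hθ => ?_) j
  have h1 := null_dust (L := fun l => Lc l (u, θ)) rfl (sum_eps_Lc_apply u θ) (hτs u θ hθ)
    (hT u θ hθ) (hE u θ hθ)
  -- Null dust is trace-free, so trace reversal does nothing, and its `L L` form is annihilated by
  -- the projection.
  have h2 : ∑ l, eps l * τ l l u θ = 0 := by
    have : ∀ l, eps l * τ l l u θ = τ 0 0 u θ * (eps l * Lc l (u, θ) * Lc l (u, θ)) := fun l => by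
      rw [h1 l l]; ring
    rw [Finset.sum_congr rfl fun l _ => this l, ← Finset.mul_sum, sum_eps_Lc_apply, mul_zero]
  have h3 := gaugePart_quadRic (L := fun l => Lc l (u, θ)) rfl (sum_eps_Lc_apply u θ) (vs (u, θ))
    (vs₁ (u, θ)) (vs₂ (u, θ)) (vg (u, θ)) i.succ j.succ
  rw [ScriFun.smul_apply, ScriFun.mul_apply, gaugeProj_apply, gaugeProj_apply, nullPart_apply]
  have h4 : ∀ a b, val (fun a b => ricC h a b (2 * ((m : ℤ) - 1))) (u, θ) a b =
      8 * Real.pi * (τ 0 0 u θ * Lc a (u, θ) * Lc b (u, θ)) -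
        quadRic (fun l => Lc l (u, θ)) (val H (u, θ)) (val (fun a b => dU (H a b)) (u, θ))
          (val (fun a b => dU (dU (H a b))) (u, θ)) a b := by
    intro a b
    rw [val, hK a b u θ hθ, h2, h1 a b]
    ring
  rw [gaugePart] at h3 ⊢
  simp only [h4]
  have h5 : (Lc 0 : ScriFun m) (u, θ) = 1 := rfl
  rw [h5]
  linear_combination -h3

end

end NullMemory

namespace NullMemory

noncomputable section

/-! ### Expansions along a ray -/

/-- `F ∼ ∑_k r^{-k/2} a_k` as `r → ∞`. -/
def RayExp (F : ℝ → ℝ) (a : ℤ → ℝ) : Prop :=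
  ∃ k₀ : ℤ, (∀ k < k₀, a k = 0) ∧ ∀ N : ℤ,
    (fun r => F r - ∑ k ∈ Finset.Icc k₀ N, r ^ (-(k : ℝ) / 2) * a k) =O[atTop]
      fun r : ℝ => r ^ (-((N : ℝ) + 1) / 2)

lemma sum_Icc_eq {a : ℤ → ℝ} {k₀ k₁ N : ℤ} (h : k₁ ≤ k₀) (ha : ∀ k < k₀, a k = 0) (r : ℝ) :
    ∑ k ∈ Finset.Icc k₁ N, r ^ (-(k : ℝ) / 2) * a k =
      ∑ k ∈ Finset.Icc k₀ N, r ^ (-(k : ℝ) / 2) * a k := by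
  symm
  refine Finset.sum_subset (Finset.Icc_subset_Icc_left h) fun k hk hk' => ?_
  rw [Finset.mem_Icc] at hk hk'
  rw [ha k (by omega), mul_zero]

lemma isBigO_rpow_of_le {a b : ℝ} (h : a ≤ b) :
    (fun r : ℝ => r ^ a) =O[atTop] fun r : ℝ => r ^ b := by
  refine IsBigO.of_bound 1 ?_
  filter_upwards [eventually_ge_atTop 1] with r hr
  rw [one_mul, Real.norm_of_nonneg (by positivity), Real.norm_of_nonneg (by positivity)]
  exact Real.rpow_le_rpow_of_exponent_le hr h

lemma isBigO_one_of_nonpos {a : ℝ} (h : a ≤ 0) :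
    (fun r : ℝ => r ^ a) =O[atTop] fun _ => (1 : ℝ) := by
  simpa using isBigO_rpow_of_le h

lemma isBigO_sum_Icc (a : ℤ → ℝ) (N M : ℤ) :
    (fun r => ∑ k ∈ Finset.Icc (N + 1) M, r ^ (-(k : ℝ) / 2) * a k) =O[atTop]
      fun r : ℝ => r ^ (-((N : ℝ) + 1) / 2) := by
  refine IsBigO.fun_sum fun k hk => ?_
  rw [Finset.mem_Icc] at hk
  have : ((N : ℝ) + 1) ≤ k := by exact_mod_cast hk.1
  have h1 := (isBigO_rpow_of_le (show -(k : ℝ) / 2 ≤ -((N : ℝ) + 1) / 2 by linarith)).const_mul_left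
    (a k)
  simpa only [mul_comm] using h1

lemma sum_Icc_split (a : ℤ → ℝ) {k₀ N M : ℤ} (h : N ≤ M) (h0 : k₀ ≤ N + 1) (r : ℝ) :
    ∑ k ∈ Finset.Icc k₀ M, r ^ (-(k : ℝ) / 2) * a k =
      ∑ k ∈ Finset.Icc k₀ N, r ^ (-(k : ℝ) / 2) * a k +
        ∑ k ∈ Finset.Icc (N + 1) M, r ^ (-(k : ℝ) / 2) * a k := by
  rw [← Finset.sum_union]
  · congr 1
    ext k
    simp only [Finset.mem_union, Finset.mem_Icc]
    omega
  · rw [Finset.disjoint_left]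
    intro k hk hk'
    rw [Finset.mem_Icc] at hk hk'
    omega

/-- It suffices to know the expansion with some terms beyond the error. -/
lemma rayExp_of_isBigO {F : ℝ → ℝ} {a : ℤ → ℝ} {k₀ : ℤ} (h0 : ∀ k < k₀, a k = 0) (s : ℤ) (hs : 0 ≤ s)
    (h : ∀ N : ℤ, k₀ ≤ N → ∃ b : ℤ → ℝ, (∀ k ≤ N, b k = a k) ∧
      (fun r => F r - ∑ k ∈ Finset.Icc k₀ (N + s), r ^ (-(k : ℝ) / 2) * b k) =O[atTop]
      fun r : ℝ => r ^ (-((N : ℝ) + 1) / 2)) : RayExp F a := by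
  have key : ∀ N : ℤ, k₀ ≤ N → (fun r => F r - ∑ k ∈ Finset.Icc k₀ N, r ^ (-(k : ℝ) / 2) * a k)
      =O[atTop] fun r : ℝ => r ^ (-((N : ℝ) + 1) / 2) := by
    intro N hN
    obtain ⟨b, hb, hF⟩ := h N hN
    have h1 := hF.add (isBigO_sum_Icc b N (N + s))
    refine h1.congr_left fun r => ?_
    rw [sum_Icc_split b (show N ≤ N + s by omega) (by omega)]
    have : ∑ k ∈ Finset.Icc k₀ N, r ^ (-(k : ℝ) / 2) * b k =
        ∑ k ∈ Finset.Icc k₀ N, r ^ (-(k : ℝ) / 2) * a k :=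
      Finset.sum_congr rfl fun k hk => by rw [hb k (Finset.mem_Icc.1 hk).2]
    rw [this]
    ring
  refine ⟨k₀, h0, fun N => ?_⟩
  by_cases hN : k₀ ≤ N
  · exact key N hN
  · have h1 := (key k₀ le_rfl).trans (isBigO_rpow_of_le
      (show -((k₀ : ℝ) + 1) / 2 ≤ -((N : ℝ) + 1) / 2 by
        have : (N : ℝ) ≤ k₀ := by exact_mod_cast (le_of_not_ge hN)
        linarith))
    have h2 := (isBigO_rpow_of_le (show -(k₀ : ℝ) / 2 ≤ -((N : ℝ) + 1) / 2 by
        have : (N : ℝ) + 1 ≤ k₀ := by exact_mod_cast (by omega : N + 1 ≤ k₀)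
        linarith)).const_mul_left (a k₀)
    refine (h1.add h2).congr_left fun r => ?_
    rw [Finset.Icc_self, Finset.sum_singleton, Finset.Icc_eq_empty hN, Finset.sum_empty]
    ring

namespace RayExp

variable {F G : ℝ → ℝ} {a b : ℤ → ℝ}

lemma exists_le (h : RayExp F a) (K : ℤ) : ∃ k₀ ≤ K, (∀ k < k₀, a k = 0) ∧ ∀ N : ℤ,
    (fun r => F r - ∑ k ∈ Finset.Icc k₀ N, r ^ (-(k : ℝ) / 2) * a k) =O[atTop]
      fun r : ℝ => r ^ (-((N : ℝ) + 1) / 2) := by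
  obtain ⟨k₀, h0, hF⟩ := h
  refine ⟨min k₀ K, min_le_right _ _, fun k hk => h0 k (lt_of_lt_of_le hk (min_le_left _ _)),
    fun N => (hF N).congr_left fun r => ?_⟩
  rw [sum_Icc_eq (min_le_left _ _) h0]

lemma add (h : RayExp F a) (h' : RayExp G b) : RayExp (fun r => F r + G r) fun k => a k + b k := by
  obtain ⟨k₀, h0, hF⟩ := h
  obtain ⟨k₁, hk, h1, hG⟩ := h'.exists_le k₀
  refine ⟨k₁, fun k hk' => by simp only [h0 k (by omega), h1 k hk', add_zero], fun N => ?_⟩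
  refine ((hF N).add (hG N)).congr_left fun r => ?_
  rw [← sum_Icc_eq hk h0]
  simp only [mul_add, Finset.sum_add_distrib]
  ring

lemma const_mul (h : RayExp F a) (s : ℝ) : RayExp (fun r => s * F r) fun k => s * a k := by
  obtain ⟨k₀, h0, hF⟩ := h
  refine ⟨k₀, fun k hk' => by simp only [h0 k (by omega), mul_zero], fun N => ?_⟩
  refine ((hF N).const_mul_left s).congr_left fun r => ?_
  simp only [mul_sub, Finset.mul_sum]
  congr 1
  exact Finset.sum_congr rfl fun k _ => by ring

lemma sub (h : RayExp F a) (h' : RayExp G b) : RayExp (fun r => F r - G r) fun k => a k - b k := by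
  have := h.add (h'.const_mul (-1))
  simpa [sub_eq_add_neg] using this

lemma zero : RayExp (fun _ => 0) fun _ => 0 :=
  ⟨0, fun _ _ => rfl, fun N => by simpa using isBigO_zero _ _⟩

lemma sum {ι : Type*} (s : Finset ι) {F : ι → ℝ → ℝ} {a : ι → ℤ → ℝ} (h : ∀ i, RayExp (F i) (a i)) :
    RayExp (fun r => ∑ i ∈ s, F i r) fun k => ∑ i ∈ s, a i k := by
  classical
  induction s using Finset.induction_on with
  | empty => simpa using zero
  | insert i s hi ih =>
    simp only [Finset.sum_insert hi]
    exact (h i).add ih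

lemma congr (h : RayExp F a) (hFG : F =ᶠ[atTop] G) : RayExp G a := by
  obtain ⟨k₀, h0, hF⟩ := h
  exact ⟨k₀, h0, fun N => (hF N).congr' (hFG.mono fun r hr => by simp only [hr]) .rfl⟩

lemma tendsto (h : RayExp F a) {K : ℤ} (hK : ∀ j < K, a j = 0) :
    Tendsto (fun r => r ^ ((K : ℝ) / 2) * F r) atTop (𝓝 (a K)) := by
  obtain ⟨k₀, hk, h0, hF⟩ := h.exists_le K
  have h1 : ∀ r : ℝ, ∑ k ∈ Finset.Icc k₀ K, r ^ (-(k : ℝ) / 2) * a k = r ^ (-(K : ℝ) / 2) * a K := by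
    intro r
    refine Finset.sum_eq_single K (fun k hk' hne => ?_) fun h => ?_
    · rw [hK k (lt_of_le_of_ne (Finset.mem_Icc.1 hk').2 hne), mul_zero]
    · exact absurd (Finset.mem_Icc.2 ⟨hk, le_rfl⟩) h
  have h2 := (isBigO_refl (fun r : ℝ => r ^ ((K : ℝ) / 2)) atTop).mul (hF K)
  have h3 : Tendsto (fun r : ℝ => r ^ ((K : ℝ) / 2) * (F r - ∑ k ∈ Finset.Icc k₀ K,
      r ^ (-(k : ℝ) / 2) * a k)) atTop (𝓝 0) := by
    refine h2.trans_tendsto ?_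
    refine Tendsto.congr' ?_ (tendsto_rpow_neg_atTop (show (0 : ℝ) < 1 / 2 by norm_num))
    filter_upwards [eventually_gt_atTop 0] with r hr
    rw [← Real.rpow_add hr]
    congr 1
    ring
  have h4 := h3.add (tendsto_const_nhds (x := a K))
  rw [zero_add] at h4
  refine h4.congr' ?_
  filter_upwards [eventually_gt_atTop 0] with r hr
  rw [h1, mul_sub, ← mul_assoc, ← Real.rpow_add hr,
    show (K : ℝ) / 2 + -(K : ℝ) / 2 = 0 by ring, Real.rpow_zero]
  ring

/-- A nonzero slower coefficient would make the rescaled function diverge, so by induction from the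
first index all slower ones vanish. Limits along rays thus suffice to read off coefficients, without
expanding the nonlinear curvature. -/
lemma coeff_of_tendsto (h : RayExp F a) {K : ℤ} {ρ : ℝ}
    (hF : Tendsto (fun r => r ^ ((K : ℝ) / 2) * F r) atTop (𝓝 ρ)) :
    (∀ j < K, a j = 0) ∧ a K = ρ := by
  have h1 : ∀ j < K, a j = 0 := by
    obtain ⟨k₀, h0, -⟩ := id h
    have key : ∀ n : ℕ, ∀ j < K, j < k₀ + n → a j = 0 := by
      intro n
      induction n with
      | zero => exact fun j _ hj => h0 j (by simpa using hj)
      | succ n ih =>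
        intro j hj hj'
        by_cases hn : j < k₀ + n
        · exact ih j hj hn
        have h2 := h.tendsto (K := j) fun i hi => ih i (by omega) (by push_cast at hj'; omega)
        have h3 : Tendsto (fun r : ℝ => r ^ (-(((K : ℝ) - j) / 2)) * (r ^ ((K : ℝ) / 2) * F r)) atTop
            (𝓝 (0 * ρ)) := by
          refine (tendsto_rpow_neg_atTop ?_).mul hF
          have : (j : ℝ) < K := by exact_mod_cast hj
          linarith
        rw [zero_mul] at h3
        refine tendsto_nhds_unique h2 (h3.congr' ?_)
        filter_upwards [eventually_gt_atTop 0] with r hr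
        rw [← mul_assoc, ← Real.rpow_add hr]
        congr 2
        ring
    exact fun j hj => key (j - k₀ + 1).toNat j hj (by omega)
  exact ⟨h1, tendsto_nhds_unique (h.tendsto h1) hF⟩

lemma unique (h : RayExp F a) (h' : RayExp F b) : a = b := by
  have h1 := h.sub h'
  simp only [sub_self] at h1
  funext k
  have h2 := (h1.coeff_of_tendsto (K := k) (ρ := 0) (by simp)).2
  linarith

end RayExp

/-! ### Finite expansions -/

variable {m : ℕ}

lemma pd_sum {ι : Type*} (s : Finset ι) {f : ι → Event m → ℝ} {X : Event m}
    (hf : ∀ i ∈ s, DifferentiableAt ℝ (f i) X) (μ : Fin (m + 1)) :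
    pd μ (fun Y => ∑ i ∈ s, f i Y) X = ∑ i ∈ s, pd μ (f i) X := by
  unfold pd
  rw [fderiv_fun_sum hf]
  simp

lemma pd_congr {f g : Event m → ℝ} {X : Event m} (h : f =ᶠ[𝓝 X] g) (μ : Fin (m + 1)) :
    pd μ f X = pd μ g X := by
  unfold pd
  rw [h.fderiv_eq]

variable [NeZero m]

open ScriFun

lemma contDiffAt_sum_term (c : ℤ → ScriFun m) (s : Finset ℤ) {X : Event m} (hX : sp X ≠ 0) :
    ContDiffAt ℝ ∞ (fun Y => ∑ k ∈ s, term k (c k) Y) X :=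
  ContDiffAt.sum fun k _ => contDiffAt_term k (c k) hX

/-- The parts of the derivative that gain a power of `1/r` are reindexed by `k + 2`, which is why
the range grows by two at the top. -/
lemma pd_sum_term {c : ℤ → ScriFun m} {A B : ℤ} (hc : ∀ k, k ∉ Finset.Icc A B → c k = 0)
    (μ : Fin (m + 1)) {X : Event m} (hX : sp X ≠ 0) :
    pd μ (fun Y => ∑ k ∈ Finset.Icc A B, term k (c k) Y) X =
      ∑ k ∈ Finset.Icc A (B + 2), term k (dC μ c k) X := by
  rw [pd_sum _ fun k _ => (contDiffAt_term k (c k) hX).differentiableAt (by norm_num)]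
  simp only [pd_term _ _ _ hX, Finset.sum_add_distrib, dC_apply, term_add, Pi.add_apply]
  congr 1
  · refine Finset.sum_subset (Finset.Icc_subset_Icc_right (by omega)) fun k _ hk => ?_
    rw [hc k hk]
    simp [term]
  · have h1 : ∑ k ∈ Finset.Icc A B, term (k + 2) (Dx μ (c k) - ((k : ℝ) / 2) • (nc μ * c k)) X =
        ∑ k ∈ Finset.Icc (A + 2) (B + 2),
          term k (Dx μ (c (k - 2)) - (((k : ℝ) - 2) / 2) • (nc μ * c (k - 2))) X := by
      rw [← Finset.map_add_right_Icc, Finset.sum_map]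
      refine Finset.sum_congr rfl fun k _ => ?_
      simp
    rw [h1]
    refine Finset.sum_subset (Finset.Icc_subset_Icc_left (by omega)) fun k hk hk' => ?_
    rw [Finset.mem_Icc] at hk hk'
    rw [hc (k - 2) (by rw [Finset.mem_Icc]; omega)]
    simp [term]

lemma pd_pd_sum_term {c : ℤ → ScriFun m} {A B : ℤ} (hc : ∀ k, k ∉ Finset.Icc A B → c k = 0)
    (μ ν : Fin (m + 1)) {X : Event m} (hX : sp X ≠ 0) :
    pd ν (pd μ (fun Y => ∑ k ∈ Finset.Icc A B, term k (c k) Y)) X =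
      ∑ k ∈ Finset.Icc A (B + 4), term k (dC ν (dC μ c) k) X := by
  have h1 : pd μ (fun Y => ∑ k ∈ Finset.Icc A B, term k (c k) Y) =ᶠ[𝓝 X]
      fun Y => ∑ k ∈ Finset.Icc A (B + 2), term k (dC μ c k) Y := by
    filter_upwards [isOpen_sp_ne.mem_nhds hX] with Y hY
    exact pd_sum_term hc μ hY
  rw [pd_congr h1, pd_sum_term (fun k hk => ?_) ν hX, show B + 2 + 2 = B + 4 by ring]
  rw [Finset.mem_Icc] at hk
  rw [dC_apply, hc k (by rw [Finset.mem_Icc]; omega), hc (k - 2) (by rw [Finset.mem_Icc]; omega)]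
  simp

end

end NullMemory

namespace NullMemory

noncomputable section

/-! ### Bounds on full derivatives from bounds on slices -/

lemma two_le_infty : (2 : WithTop ℕ∞) ≤ ∞ := 
  show ((2 : ℕ∞) : WithTop ℕ∞) ≤ ((⊤ : ℕ∞) : WithTop ℕ∞) from WithTop.coe_le_coe.2 le_top

section Slices

variable {E : Type*} [NormedAddCommGroup E] [NormedSpace ℝ E] {Ψ : E × ℝ → ℝ} {p : E} {g : ℝ → ℝ}

lemma fderiv_slice_left {r : ℝ} (h : DifferentiableAt ℝ Ψ (p, r)) (e : E) :
    fderiv ℝ (fun p' => Ψ (p', r)) p e = fderiv ℝ Ψ (p, r) (e, 0) := by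
  have := HasFDerivAt.comp p (g := Ψ) (f := fun p' => (p', r)) h.hasFDerivAt
    (hasFDerivAt_prodMk_left p r)
  rw [show (fun p' => Ψ (p', r)) = Ψ ∘ fun p' => (p', r) from rfl, this.fderiv]
  simp

lemma deriv_slice_right {r : ℝ} (h : DifferentiableAt ℝ Ψ (p, r)) :
    deriv (fun s => Ψ (p, s)) r = fderiv ℝ Ψ (p, r) (0, 1) := by
  have := HasFDerivAt.comp r (g := Ψ) (f := fun s => (p, s)) h.hasFDerivAt
    (hasFDerivAt_prodMk_right p r)
  rw [show (fun s => Ψ (p, s)) = Ψ ∘ fun s => (p, s) from rfl, ← fderiv_apply_one_eq_deriv,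
    this.fderiv]
  simp

lemma prod_decomp (w : E × ℝ) : w = (w.1, 0) + w.2 • ((0, 1) : E × ℝ) := by
  ext <;> simp

/-- An expansion controls derivatives in `(u, θ)` at fixed `r` and in `r` at a fixed point,
separately. A total derivative in any direction splits into the two. -/
lemma isBigO_fderiv (hs : ∀ᶠ r in atTop, ContDiffAt ℝ ∞ Ψ (p, r))
    (hO : ∀ a b : ℕ, (fun r : ℝ => iteratedFDeriv ℝ a
      (fun p => iteratedDeriv b (fun s => Ψ (p, s)) r) p) =O[atTop] g) (w : E × ℝ) :
    (fun r => fderiv ℝ Ψ (p, r) w) =O[atTop] g := by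
  have h1 : ∀ e : E, (fun r => fderiv ℝ Ψ (p, r) (e, 0)) =O[atTop] g := by
    intro e
    have h := (hO 1 0).norm_left
    refine IsBigO.trans ?_ h
    refine IsBigO.of_bound ‖e‖ ?_
    filter_upwards [hs] with r hr
    rw [← fderiv_slice_left (hr.differentiableAt (by norm_num)), norm_norm, norm_iteratedFDeriv_one,
      mul_comm]
    simpa using ContinuousLinearMap.le_opNorm (fderiv ℝ (fun p' => Ψ (p', r)) p) e
  have h2 : (fun r => fderiv ℝ Ψ (p, r) (0, 1)) =O[atTop] g := by
    have h := (hO 0 1).norm_left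
    refine IsBigO.of_norm_left (h.congr' ?_ .rfl)
    filter_upwards [hs] with r hr
    rw [norm_iteratedFDeriv_zero, iteratedDeriv_one,
      deriv_slice_right (hr.differentiableAt (by norm_num))]
  refine ((h1 w.1).add (h2.const_mul_left w.2)).congr_left fun r => ?_
  conv_rhs => rw [prod_decomp w, map_add, map_smul, smul_eq_mul]

lemma isBigO_fderiv_fderiv (hs : ∀ᶠ r in atTop, ContDiffAt ℝ ∞ Ψ (p, r))
    (hO : ∀ a b : ℕ, (fun r : ℝ => iteratedFDeriv ℝ a
      (fun p => iteratedDeriv b (fun s => Ψ (p, s)) r) p) =O[atTop] g) (w w' : E × ℝ) :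
    (fun r => fderiv ℝ (fun q => fderiv ℝ Ψ q w) (p, r) w') =O[atTop] g := by
  have hd : ∀ q, ContDiffAt ℝ ∞ Ψ q → DifferentiableAt ℝ (fderiv ℝ Ψ) q := fun q hq =>
    (hq.fderiv_right (m := 1) (by norm_num; exact two_le_infty)).differentiableAt (by norm_num)
  have hw : ∀ q, ContDiffAt ℝ ∞ Ψ q → ∀ w, DifferentiableAt ℝ (fun q => fderiv ℝ Ψ q w) q :=
    fun q hq w => (hd q hq).clm_apply (differentiableAt_const w)
  have hf : ∀ q, ContDiffAt ℝ ∞ Ψ q → ∀ w w', fderiv ℝ (fun q => fderiv ℝ Ψ q w) q w' =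
      fderiv ℝ (fderiv ℝ Ψ) q w' w := by
    intro q hq w w'
    rw [fderiv_clm_apply (hd q hq) (differentiableAt_const w)]
    simp
  have hev : ∀ q, ContDiffAt ℝ ∞ Ψ q → ∀ᶠ q' in 𝓝 q, DifferentiableAt ℝ Ψ q' := fun q hq =>
    ((hq.of_le (show (1 : WithTop ℕ∞) ≤ ∞ by norm_num)).eventually (by simp)).mono
      fun q' h => h.differentiableAt (by norm_num)
  have h11 : ∀ e e' : E, (fun r => fderiv ℝ (fderiv ℝ Ψ) (p, r) (e', 0) (e, 0)) =O[atTop] g := by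
    intro e e'
    refine IsBigO.trans ?_ (hO 2 0).norm_left
    refine IsBigO.of_bound (‖e'‖ * ‖e‖) ?_
    filter_upwards [hs] with r hr
    have e1 : (fun p' => fderiv ℝ Ψ (p', r) (e, 0)) =ᶠ[𝓝 p]
        fun p' => fderiv ℝ (fun p' => Ψ (p', r)) p' e := by
      have := (hev _ hr)
      have h3 : Tendsto (fun p' : E => (p', r)) (𝓝 p) (𝓝 (p, r)) :=
        (continuous_id.prodMk continuous_const).continuousAt
      filter_upwards [h3.eventually this] with p' hp'
      exact (fderiv_slice_left hp' e).symm
    have hsl : ContDiffAt ℝ ∞ (fun p' => Ψ (p', r)) p :=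
      hr.comp p (contDiffAt_id.prodMk contDiffAt_const)
    have e2 : DifferentiableAt ℝ (fderiv ℝ fun p' => Ψ (p', r)) p :=
      (hsl.fderiv_right (m := 1) (by norm_num; exact two_le_infty)).differentiableAt (by norm_num)
    rw [← hf _ hr, ← fderiv_slice_left (Ψ := fun q => fderiv ℝ Ψ q (e, 0)) (hw _ hr _), e1.fderiv_eq,
      fderiv_clm_apply e2 (differentiableAt_const e)]
    simp only [iteratedDeriv_zero, norm_norm]
    have h4 := (iteratedFDeriv ℝ 2 (fun p' => Ψ (p', r)) p).le_opNorm ![e', e]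
    rw [iteratedFDeriv_two_apply] at h4
    simp only [Matrix.cons_val_zero, Matrix.cons_val_one, Fin.prod_univ_two] at h4
    simpa [mul_comm] using h4
  have h21 : ∀ e' : E, (fun r => fderiv ℝ (fderiv ℝ Ψ) (p, r) (e', 0) (0, 1)) =O[atTop] g := by
    intro e'
    refine IsBigO.trans ?_ (hO 1 1).norm_left
    refine IsBigO.of_bound ‖e'‖ ?_
    filter_upwards [hs] with r hr
    have e1 : (fun p' => fderiv ℝ Ψ (p', r) (0, 1)) =ᶠ[𝓝 p]
        fun p' => iteratedDeriv 1 (fun s => Ψ (p', s)) r := by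
      have := (hev _ hr)
      have h3 : Tendsto (fun p' : E => (p', r)) (𝓝 p) (𝓝 (p, r)) :=
        (continuous_id.prodMk continuous_const).continuousAt
      filter_upwards [h3.eventually this] with p' hp'
      rw [iteratedDeriv_one, deriv_slice_right hp']
    rw [← hf _ hr, ← fderiv_slice_left (Ψ := fun q => fderiv ℝ Ψ q (0, 1)) (hw _ hr _), e1.fderiv_eq,
      norm_norm, norm_iteratedFDeriv_one, mul_comm]
    exact ContinuousLinearMap.le_opNorm _ e'
  -- The hypotheses bound the mixed derivative in one order only; symmetry of the second derivative
  -- gives the other.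
  have h12 : ∀ e : E, (fun r => fderiv ℝ (fderiv ℝ Ψ) (p, r) (0, 1) (e, 0)) =O[atTop] g := by
    intro e
    refine (h21 e).congr' ?_ .rfl
    filter_upwards [hs] with r hr
    exact (hr.isSymmSndFDerivAt (by simpa using two_le_infty)).eq _ _
  have h22 : (fun r => fderiv ℝ (fderiv ℝ Ψ) (p, r) (0, 1) (0, 1)) =O[atTop] g := by
    refine IsBigO.of_norm_left ((hO 0 2).norm_left.congr' ?_ .rfl)
    filter_upwards [hs] with r hr
    have e1 : (fun s => fderiv ℝ Ψ (p, s) (0, 1)) =ᶠ[𝓝 r] deriv fun s => Ψ (p, s) := by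
      have := (hev _ hr)
      have h3 : Tendsto (fun s : ℝ => (p, s)) (𝓝 r) (𝓝 (p, r)) :=
        (continuous_const.prodMk continuous_id).continuousAt
      filter_upwards [h3.eventually this] with s hs
      exact (deriv_slice_right hs).symm
    rw [norm_iteratedFDeriv_zero, iteratedDeriv_succ, iteratedDeriv_one, ← hf _ hr,
      ← deriv_slice_right (Ψ := fun q => fderiv ℝ Ψ q (0, 1)) (hw _ hr _), e1.deriv_eq]
  have := ((h11 w.1 w'.1).add ((h21 w'.1).const_mul_left w.2)).add
    (((h12 w.1).const_mul_left w'.2).add (h22.const_mul_left (w'.2 * w.2)))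
  refine this.congr' ?_ .rfl
  filter_upwards [hs] with r hr
  rw [hf _ hr]
  conv_rhs => rw [prod_decomp w, prod_decomp w']
  simp only [map_add, map_smul, smul_eq_mul, _root_.add_apply, _root_.smul_apply]
  ring

end Slices

/-! ### Derivatives of the remainder -/

variable {m : ℕ}

lemma pd_add {f g : Event m → ℝ} {X : Event m} (hf : DifferentiableAt ℝ f X)
    (hg : DifferentiableAt ℝ g X) (μ : Fin (m + 1)) :
    pd μ (fun Y => f Y + g Y) X = pd μ f X + pd μ g X := by
  unfold pd
  rw [fderiv_fun_add hf hg]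
  rfl

lemma pd_mul {f g : Event m → ℝ} {X : Event m} (hf : DifferentiableAt ℝ f X)
    (hg : DifferentiableAt ℝ g X) (μ : Fin (m + 1)) :
    pd μ (fun Y => f Y * g Y) X = f X * pd μ g X + pd μ f X * g X := by
  unfold pd
  rw [fderiv_fun_mul hf hg]
  simp [mul_comm]

lemma pd_const_mul {g : Event m → ℝ} {X : Event m} (a : ℝ) (hg : DifferentiableAt ℝ g X)
    (μ : Fin (m + 1)) : pd μ (fun Y => a * g Y) X = a * pd μ g X := by
  unfold pd
  rw [fderiv_const_mul hg]
  simp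

/-- Retarded time, rescaled position, and radius. -/
def bondi (r : ℝ) (X : Event m) : (ℝ × Space m) × ℝ := ((X 0 - ‖sp X‖, r⁻¹ • sp X), ‖sp X‖)

lemma bondi_event (u : ℝ) {r : ℝ} (hr : 0 < r) {θ : Space m} (hθ : ‖θ‖ = 1) :
    bondi r (event u r θ) = ((u, θ), r) := by
  rw [bondi, norm_sp_event u hr.le hθ, sp_event, smul_smul, inv_mul_cancel₀ hr.ne', one_smul]
  simp

lemma contDiffAt_bondi (r : ℝ) {X : Event m} (hX : sp X ≠ 0) : ContDiffAt ℝ ∞ (bondi r) X := by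
  have hn : ContDiffAt ℝ ∞ (fun Y : Event m => ‖sp Y‖) X :=
    (contDiffAt_norm ℝ hX).comp X sp.contDiff.contDiffAt
  have h0 : ContDiffAt ℝ ∞ (fun Y : Event m => Y 0) X :=
    (ContinuousLinearMap.proj (R := ℝ) (φ := fun _ : Fin (m + 1) => ℝ) 0).contDiff.contDiffAt
  exact ((h0.sub hn).prodMk (sp.contDiff.contDiffAt.const_smul _)).prodMk hn

variable [NeZero m]

open ScriFun

lemma th_apply_of_ne {y : Space m} (hy : y ≠ 0) (u : ℝ) (i : Fin m) :
    (th i : ScriFun m) (u, y) = dir y i := by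
  change pt y i = _
  rw [pt_of_ne hy]

/-- The fixed scale `r` in `bondi` sends the ray point of radius `r` to a unit direction, where the
remainder bounds are available. The angular derivative then carries the explicit factor `r⁻¹`. -/
lemma pd_comp_bondi {g : (ℝ × Space m) × ℝ → ℝ} (r : ℝ) {X : Event m} (hX : sp X ≠ 0)
    (hg : DifferentiableAt ℝ g (bondi r X)) (μ : Fin (m + 1)) :
    pd μ (fun Y => g (bondi r Y)) X =
      term 0 (Lc μ) X * fderiv ℝ g (bondi r X) ((1, 0), 0) +
      r⁻¹ * fderiv ℝ g (bondi r X) ((0, sp (Pi.single μ 1)), 0) +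
      term 0 (nc μ) X * fderiv ℝ g (bondi r X) (0, 1) := by
  have h1 : HasFDerivAt (fun Y : Event m => ‖sp Y‖) ((innerSL ℝ (dir (sp X))).comp sp) X :=
    HasFDerivAt.comp X (g := fun y : Space m => ‖y‖) (hasFDerivAt_norm_of_ne hX) sp.hasFDerivAt
  have h0 : HasFDerivAt (fun Y : Event m => Y 0)
      (ContinuousLinearMap.proj (R := ℝ) (φ := fun _ : Fin (m + 1) => ℝ) 0) X :=
    (ContinuousLinearMap.proj (R := ℝ) (φ := fun _ : Fin (m + 1) => ℝ) 0).hasFDerivAt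
  have h2 : HasFDerivAt (bondi r) _ X :=
    ((h0.sub h1).prodMk (sp.hasFDerivAt.const_smul r⁻¹)).prodMk h1
  have h3 := HasFDerivAt.comp X hg.hasFDerivAt h2
  unfold pd
  rw [show (fun Y => g (bondi r Y)) = g ∘ bondi r from rfl, h3.fderiv]
  have h4 : ∀ (a b : ℝ) (y : Space m), fderiv ℝ g (bondi r X) ((a, r⁻¹ • y), b) =
      a * fderiv ℝ g (bondi r X) ((1, 0), 0) + r⁻¹ * fderiv ℝ g (bondi r X) ((0, y), 0) +
      b * fderiv ℝ g (bondi r X) (0, 1) := by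
    intro a b y
    simp only [← smul_eq_mul, ← map_smul, ← map_add]
    congr 1
    ext <;> simp
  rw [ContinuousLinearMap.comp_apply]
  have e1 : ∀ v : Event m, (((ContinuousLinearMap.proj (R := ℝ) (φ := fun _ : Fin (m + 1) => ℝ) 0 -
      (innerSL ℝ (dir (sp X))).comp sp).prod (r⁻¹ • sp)).prod ((innerSL ℝ (dir (sp X))).comp sp)) v =
      ((v 0 - inner ℝ (dir (sp X)) (sp v), r⁻¹ • sp v), inner ℝ (dir (sp X)) (sp v)) := fun v => rfl
  rw [e1, h4]
  have e2 : term 0 (Lc μ) X = (Pi.single μ 1 : Event m) 0 -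
      inner ℝ (dir (sp X)) (sp (Pi.single μ 1 : Event m)) := by
    rw [term]
    refine Fin.cases ?_ (fun i => ?_) μ
    · simp [sp_single_zero]
    · rw [sp_single_succ, Lc_succ, ScriFun.neg_apply, th_apply_of_ne hX]
      simp [EuclideanSpace.inner_single_right, Fin.succ_ne_zero]
  have e3 : term 0 (nc μ) X = inner ℝ (dir (sp X)) (sp (Pi.single μ 1 : Event m)) := by
    rw [term]
    refine Fin.cases ?_ (fun i => ?_) μ
    · simp [sp_single_zero]
    · rw [sp_single_succ, nc_succ, th_apply_of_ne hX]
      simp [EuclideanSpace.inner_single_right]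
  rw [e2, e3]


variable {f : Event m → ℝ} {c : ℤ → ℝ → Space m → ℝ}

/-- The remainder as a function of Bondi coordinates. -/
def remFun (f : Event m → ℝ) (c : ℤ → ℝ → Space m → ℝ) (k₀ N : ℤ) (q : (ℝ × Space m) × ℝ) : ℝ :=
  remainder f c k₀ N q.1.1 q.2 q.1.2

omit [NeZero m] in
lemma contDiffAt_remFun {Ω : Set (Event m)} (hΩ : IsOpen Ω) (hf : ContDiffOn ℝ ∞ f Ω)
    (hc : ∀ k, SmoothCoeff (c k)) (k₀ N : ℤ) {u r : ℝ} {θ : Space m} (hr : 0 < r) (hθ : ‖θ‖ = 1)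
    (hX : event u r θ ∈ Ω) : ContDiffAt ℝ ∞ (remFun f c k₀ N) ((u, θ), r) := by
  have hθ0 : θ ≠ 0 := by
    rintro rfl
    simp at hθ
  have hdir : dir θ = θ := by simp [dir, hθ]
  have h1 : ContDiffAt ℝ ∞ (fun q : (ℝ × Space m) × ℝ => q.1.1) ((u, θ), r) :=
    contDiffAt_fst.fst
  have h2 : ContDiffAt ℝ ∞ (fun q : (ℝ × Space m) × ℝ => dir q.1.2) ((u, θ), r) :=
    ContDiffAt.comp ((u, θ), r) (g := dir) (f := fun q : (ℝ × Space m) × ℝ => q.1.2)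
      (contDiffOn_dir.contDiffAt (isOpen_ne.mem_nhds hθ0)) contDiffAt_fst.snd
  have h3 : ContDiffAt ℝ ∞ (fun q : (ℝ × Space m) × ℝ => q.2) ((u, θ), r) := contDiffAt_snd
  have h4 : ContDiffAt ℝ ∞ (fun q : (ℝ × Space m) × ℝ => event q.1.1 q.2 (dir q.1.2))
      ((u, θ), r) := by
    rw [contDiffAt_pi]
    intro μ
    refine Fin.cases ?_ (fun i => ?_) μ
    · exact h1.add h3
    · exact h3.mul ((EuclideanSpace.proj (𝕜 := ℝ) i).contDiff.contDiffAt.comp _ h2)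
  have h5 : ContDiffAt ℝ ∞ (fun q : (ℝ × Space m) × ℝ => f (event q.1.1 q.2 (dir q.1.2)))
      ((u, θ), r) :=
    ContDiffAt.comp ((u, θ), r) (g := f) (hf.contDiffAt (by
      rw [hdir]
      exact hΩ.mem_nhds hX)) h4
  refine h5.sub (ContDiffAt.sum fun k _ => (h3.rpow_const_of_ne hr.ne').mul ?_)
  exact ContDiffAt.comp ((u, θ), r) (g := fun p : ℝ × Space m => c k p.1 (dir p.2))
    (f := fun q : (ℝ × Space m) × ℝ => q.1)
    ((hc k).contDiffAt (isOpen_punctured.mem_nhds hθ0)) contDiffAt_fst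

/-- The coefficients of an expansion. -/
def coeffs (hf : HasExpansion f c) (k : ℤ) : ScriFun m := ofCoeff (c k) (hf.2.1 k)

lemma coeffs_apply (hf : HasExpansion f c) (k : ℤ) (u : ℝ) {θ : Space m} (hθ : ‖θ‖ = 1) :
    coeffs hf k (u, θ) = c k u θ := ofCoeff_apply _ _ u hθ

lemma eq_remFun_add (hf : HasExpansion f c) (k₀ N : ℤ) {r : ℝ} (hr : 0 < r) {X : Event m}
    (hX : sp X ≠ 0) : f X = remFun f c k₀ N (bondi r X) +
      ∑ k ∈ Finset.Icc k₀ N, term k (coeffs hf k) X := by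
  have h1 : dir (r⁻¹ • sp X) = dir (sp X) := dir_smul (inv_pos.2 hr) _
  have h2 : ∀ k, term k (coeffs hf k) X =
      ‖sp X‖ ^ (-(k : ℝ) / 2) * c k (X 0 - ‖sp X‖) (dir (sp X)) := by
    intro k
    rw [term, ← apply_pt, pt_of_ne hX, coeffs_apply hf _ _ (norm_dir hX)]
  simp only [remFun, remainder, bondi, h1, event_of_sp X hX, h2]
  ring

/-- Expansions may be differentiated termwise. -/
theorem HasExpansion.rayExp (hf : HasExpansion f c) (u : ℝ) {θ : Space m} (hθ : ‖θ‖ = 1) :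
    RayExp (fun r => f (event u r θ)) (fun k => coeffs hf k (u, θ)) ∧
    (∀ μ, RayExp (fun r => pd μ f (event u r θ)) fun k => dC μ (coeffs hf) k (u, θ)) ∧
    ∀ μ ν, RayExp (fun r => pd ν (pd μ f) (event u r θ))
      fun k => dC ν (dC μ (coeffs hf)) k (u, θ) := by
  obtain ⟨⟨Ω, hΩ, hfΩ⟩, hc, k₀, h0, hO⟩ := id hf
  have hz : ∀ k < k₀, coeffs hf k = 0 := fun k hk => ext_sphere fun v y hy => by
    rw [coeffs_apply hf k v hy, h0 k hk v y (mem_unitSphere.2 hy)]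
    rfl
  have hdz : ∀ μ, ∀ k < k₀, dC μ (coeffs hf) k = 0 := fun μ => dC_eq_zero_of_lt hz μ
  have hddz : ∀ μ ν, ∀ k < k₀, dC ν (dC μ (coeffs hf)) k = 0 := fun μ ν =>
    dC_eq_zero_of_lt (hdz μ) ν
  -- Truncation gives a finite sum that can be differentiated exactly. The coefficients of its
  -- derivatives depend only on nearby lower indices, so up to `N` they agree with those of the full
  -- sequence.
  set cN : ℤ → ℤ → ScriFun m := fun N k => if k ∈ Finset.Icc k₀ N then coeffs hf k else 0 with hcN
  have hcN0 : ∀ N k, k ∉ Finset.Icc k₀ N → cN N k = 0 := fun N k hk => if_neg hk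
  have hcN1 : ∀ N k, k ≤ N → cN N k = coeffs hf k := by
    intro N k hk
    by_cases h : k₀ ≤ k
    · exact if_pos (Finset.mem_Icc.2 ⟨h, hk⟩)
    · rw [hz k (by omega)]
      exact if_neg fun h' => h (Finset.mem_Icc.1 h').1
  have hdN1 : ∀ μ N k, k ≤ N → dC μ (cN N) k = dC μ (coeffs hf) k := by
    intro μ N k hk
    rw [dC_apply, dC_apply, hcN1 N k hk, hcN1 N (k - 2) (by omega)]
  have hddN1 : ∀ μ ν N k, k ≤ N → dC ν (dC μ (cN N)) k = dC ν (dC μ (coeffs hf)) k := by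
    intro μ ν N k hk
    rw [dC_apply ν (dC μ (cN N)) k, dC_apply ν (dC μ (coeffs hf)) k, hdN1 μ N k hk, hdN1 μ N (k - 2) (by omega)]
  set S : ℤ → Event m → ℝ := fun N X => ∑ k ∈ Finset.Icc k₀ N, term k (cN N k) X with hS
  have hfS : ∀ N {r : ℝ}, 0 < r → ∀ {X : Event m}, sp X ≠ 0 →
      f X = remFun f c k₀ N (bondi r X) + S N X := by
    intro N r hr X hX
    rw [eq_remFun_add hf k₀ N hr hX]
    congr 1
    exact Finset.sum_congr rfl fun k hk => by rw [hcN1 N k (Finset.mem_Icc.1 hk).2]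
  have hsm : ∀ N, ∀ᶠ r in atTop, ContDiffAt ℝ ∞ (remFun f c k₀ N) ((u, θ), r) := by
    intro N
    filter_upwards [hΩ.2 u θ (mem_unitSphere.2 hθ), eventually_gt_atTop 0] with r hr hr0
    exact contDiffAt_remFun hΩ.1 hfΩ hc k₀ N hr0 hθ hr
  -- The improved decay under radial derivatives is discarded, since every order `N` is available.
  have hO' : ∀ N (a b : ℕ), (fun r : ℝ => iteratedFDeriv ℝ a
      (fun p => iteratedDeriv b (fun s => remFun f c k₀ N (p, s)) r) (u, θ)) =O[atTop]
      fun r : ℝ => r ^ (-((N : ℝ) + 1) / 2) := by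
    intro N a b
    refine (hO N a b u θ (mem_unitSphere.2 hθ)).trans (isBigO_rpow_of_le ?_)
    have : (0 : ℝ) ≤ b := b.cast_nonneg
    linarith
  have hinv : (fun r : ℝ => r⁻¹) =O[atTop] fun _ => (1 : ℝ) := by
    refine (isBigO_one_of_nonpos (show (-1 : ℝ) ≤ 0 by norm_num)).congr' ?_ .rfl
    filter_upwards [eventually_gt_atTop 0] with r hr
    rw [Real.rpow_neg_one]
  have hterm : ∀ (c : ScriFun m), (fun r : ℝ => term 0 c (event u r θ)) =O[atTop]
      fun _ => (1 : ℝ) := by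
    intro c
    refine (isBigO_const_const (c (u, θ)) one_ne_zero atTop).congr' ?_ .rfl
    filter_upwards [eventually_gt_atTop 0] with r hr
    rw [term_event 0 c u hr hθ]
    simp
  have hdterm : ∀ (c : ScriFun m), dU c = 0 → ∀ ν, (fun r : ℝ => pd ν (term 0 c) (event u r θ))
      =O[atTop] fun _ => (1 : ℝ) := by
    intro c hc ν
    refine (hinv.const_mul_left ((Dx ν c) (u, θ))).congr' ?_ .rfl
    filter_upwards [eventually_gt_atTop 0] with r hr
    rw [pd_term 0 c ν (sp_event_ne_zero u hr hθ), hc, term_event _ _ u hr hθ, term_event _ _ u hr hθ]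
    simp [Real.rpow_neg_one, mul_comm]
  -- the remainder and its derivatives
  have hb : ∀ {r : ℝ}, 0 < r → bondi r (event u r θ) = ((u, θ), r) := fun hr => bondi_event u hr hθ
  have mul1 : ∀ {F G : ℝ → ℝ} {g : ℝ → ℝ}, F =O[atTop] (fun _ => (1 : ℝ)) → G =O[atTop] g →
      (fun r => F r * G r) =O[atTop] g := fun hF hG => by simpa using hF.mul hG
  have hR0 : ∀ N, (fun r => remFun f c k₀ N (bondi r (event u r θ))) =O[atTop]
      fun r : ℝ => r ^ (-((N : ℝ) + 1) / 2) := by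
    intro N
    refine IsBigO.of_norm_left ((hO' N 0 0).norm_left.congr' ?_ .rfl)
    filter_upwards [eventually_gt_atTop 0] with r hr
    rw [norm_iteratedFDeriv_zero, iteratedDeriv_zero, hb hr]
  have hR1 : ∀ N μ, (fun r => pd μ (fun Y => remFun f c k₀ N (bondi r Y)) (event u r θ)) =O[atTop]
      fun r : ℝ => r ^ (-((N : ℝ) + 1) / 2) := by
    intro N μ
    have hw := isBigO_fderiv (hsm N) (hO' N)
    have := ((mul1 (hterm (Lc μ)) (hw ((1, 0), 0))).add
      (mul1 hinv (hw ((0, sp (Pi.single μ 1)), 0)))).add (mul1 (hterm (nc μ)) (hw (0, 1)))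
    refine this.congr' ?_ .rfl
    filter_upwards [hsm N, eventually_gt_atTop 0] with r hr hr0
    have hX := sp_event_ne_zero u hr0 hθ
    rw [pd_comp_bondi r hX (by rw [hb hr0]; exact hr.differentiableAt (by norm_num)), hb hr0]
  have hR2 : ∀ N μ ν, (fun r => pd ν (pd μ fun Y => remFun f c k₀ N (bondi r Y)) (event u r θ))
      =O[atTop] fun r : ℝ => r ^ (-((N : ℝ) + 1) / 2) := by
    intro N μ ν
    have hw := isBigO_fderiv (hsm N) (hO' N)
    have hww := isBigO_fderiv_fderiv (hsm N) (hO' N)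
    have hpd : ∀ w, (fun r => pd ν (fun Y => fderiv ℝ (remFun f c k₀ N) (bondi r Y) w) (event u r θ))
        =O[atTop] fun r : ℝ => r ^ (-((N : ℝ) + 1) / 2) := by
      intro w
      have := ((mul1 (hterm (Lc ν)) (hww w ((1, 0), 0))).add
        (mul1 hinv (hww w ((0, sp (Pi.single ν 1)), 0)))).add (mul1 (hterm (nc ν)) (hww w (0, 1)))
      refine this.congr' ?_ .rfl
      filter_upwards [hsm N, eventually_gt_atTop 0] with r hr hr0
      have hX := sp_event_ne_zero u hr0 hθ
      have hd : DifferentiableAt ℝ (fun q => fderiv ℝ (remFun f c k₀ N) q w) ((u, θ), r) :=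
        ((hr.fderiv_right (m := 1) (by norm_num; exact two_le_infty)).differentiableAt
          (by norm_num)).clm_apply (differentiableAt_const w)
      rw [pd_comp_bondi (g := fun q => fderiv ℝ (remFun f c k₀ N) q w) r hX
        (by rw [hb hr0]; exact hd), hb hr0]
    have t1 := (mul1 (hterm (Lc μ)) (hpd ((1, 0), 0))).add
      (mul1 (hdterm (Lc μ) (dU_Lc μ) ν) (hw ((1, 0), 0)))
    have t2 := mul1 hinv (hpd ((0, sp (Pi.single μ 1)), 0))
    have t3 := (mul1 (hterm (nc μ)) (hpd (0, 1))).add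
      (mul1 (hdterm (nc μ) (dU_nc μ) ν) (hw (0, 1)))
    refine ((t1.add t2).add t3).congr' ?_ .rfl
    filter_upwards [hsm N, eventually_gt_atTop 0] with r hr hr0
    have hX := sp_event_ne_zero u hr0 hθ
    have hev : ∀ᶠ Y in 𝓝 (event u r θ), sp Y ≠ 0 ∧
        DifferentiableAt ℝ (remFun f c k₀ N) (bondi r Y) := by
      have h0 : ∀ᶠ Y in 𝓝 (event u r θ), sp Y ≠ 0 := isOpen_sp_ne.mem_nhds hX
      refine h0.and ?_
      have h1 : ContDiffAt ℝ 1 (remFun f c k₀ N) (bondi r (event u r θ)) := by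
        rw [hb hr0]
        exact hr.of_le (by norm_num)
      exact ((contDiffAt_bondi r hX).continuousAt.eventually (h1.eventually (by simp))).mono
        fun Y hY => hY.differentiableAt (by norm_num)
    have hd : ∀ w, DifferentiableAt ℝ (fun Y => fderiv ℝ (remFun f c k₀ N) (bondi r Y) w)
        (event u r θ) := by
      intro w
      have hd : DifferentiableAt ℝ (fun q => fderiv ℝ (remFun f c k₀ N) q w)
          (bondi r (event u r θ)) := by
        rw [hb hr0]
        exact ((hr.fderiv_right (m := 1) (by norm_num; exact two_le_infty)).differentiableAt
          (by norm_num)).clm_apply (differentiableAt_const w)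
      exact DifferentiableAt.comp (g := fun q => fderiv ℝ (remFun f c k₀ N) q w) _ hd
        ((contDiffAt_bondi r hX).differentiableAt (by norm_num))
    have hdt : ∀ c : ScriFun m, DifferentiableAt ℝ (term 0 c) (event u r θ) := fun c =>
      (contDiffAt_term 0 c hX).differentiableAt (by norm_num)
    have e1 : pd μ (fun Y => remFun f c k₀ N (bondi r Y)) =ᶠ[𝓝 (event u r θ)] fun Y =>
        term 0 (Lc μ) Y * fderiv ℝ (remFun f c k₀ N) (bondi r Y) ((1, 0), 0) +
        r⁻¹ * fderiv ℝ (remFun f c k₀ N) (bondi r Y) ((0, sp (Pi.single μ 1)), 0) +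
        term 0 (nc μ) Y * fderiv ℝ (remFun f c k₀ N) (bondi r Y) (0, 1) :=
      hev.mono fun Y hY => pd_comp_bondi r hY.1 hY.2 μ
    rw [pd_congr e1, pd_add (((hdt _).fun_mul (hd _)).fun_add ((hd _).const_mul _))
      ((hdt _).fun_mul (hd _)), pd_add ((hdt _).fun_mul (hd _)) ((hd _).const_mul _), pd_mul (hdt _) (hd _),
      pd_mul (hdt _) (hd _), pd_const_mul _ (hd _), hb hr0]
  -- conclusion
  have hSval : ∀ (b : ℤ → ScriFun m) (A B : ℤ) {r : ℝ}, 0 < r →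
      ∑ k ∈ Finset.Icc A B, term k (b k) (event u r θ) =
        ∑ k ∈ Finset.Icc A B, r ^ (-(k : ℝ) / 2) * b k (u, θ) := by
    intro b A B r hr
    exact Finset.sum_congr rfl fun k _ => term_event k _ u hr hθ
  have hRs : ∀ N {r : ℝ}, 0 < r → ContDiffAt ℝ ∞ (remFun f c k₀ N) ((u, θ), r) →
      ContDiffAt ℝ ∞ (fun Y => remFun f c k₀ N (bondi r Y)) (event u r θ) := by
    intro N r hr0 hr
    exact ContDiffAt.comp (g := remFun f c k₀ N) (event u r θ) (by rw [hb hr0]; exact hr)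
      (contDiffAt_bondi r (sp_event_ne_zero u hr0 hθ))
  have hpdS : ∀ {g : Event m → ℝ} {X : Event m} (μ : Fin (m + 1)), ContDiffAt ℝ ∞ g X →
      DifferentiableAt ℝ (pd μ g) X := by
    intro g X μ hg
    exact ((hg.fderiv_right (m := 1) (by norm_num; exact two_le_infty)).differentiableAt
      (by norm_num)).clm_apply (differentiableAt_const _)
  -- The slack `0`, `2`, `4` is the number of orders beyond `N` produced by differentiating the
  -- truncation zero, one or two times; these terms are absorbed in the error.
  refine ⟨rayExp_of_isBigO (fun k hk => by rw [hz k hk]; rfl) 0 le_rfl fun N _ =>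
      ⟨fun k => cN N k (u, θ), fun k hk => by simp only [hcN1 N k hk], ?_⟩,
    fun μ => rayExp_of_isBigO (fun k hk => by rw [hdz μ k hk]; rfl) 2 (by norm_num) fun N _ =>
      ⟨fun k => dC μ (cN N) k (u, θ), fun k hk => by simp only [hdN1 μ N k hk], ?_⟩,
    fun μ ν => rayExp_of_isBigO (fun k hk => by rw [hddz μ ν k hk]; rfl) 4 (by norm_num) fun N _ =>
      ⟨fun k => dC ν (dC μ (cN N)) k (u, θ), fun k hk => by simp only [hddN1 μ ν N k hk], ?_⟩⟩
  · refine (hR0 N).congr' ?_ .rfl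
    filter_upwards [eventually_gt_atTop 0] with r hr
    rw [add_zero, hfS N hr (sp_event_ne_zero u hr hθ), ← hSval (cN N) _ _ hr]
    simp only [hS]
    ring
  · refine (hR1 N μ).congr' ?_ .rfl
    filter_upwards [hsm N, eventually_gt_atTop 0] with r hr hr0
    have hX := sp_event_ne_zero u hr0 hθ
    have e1 : f =ᶠ[𝓝 (event u r θ)] fun Y => remFun f c k₀ N (bondi r Y) + S N Y := by
      filter_upwards [isOpen_sp_ne.mem_nhds hX] with Y hY
      exact hfS N hr0 hY
    rw [pd_congr e1, pd_add ((hRs N hr0 hr).differentiableAt (by norm_num))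
      ((contDiffAt_sum_term (cN N) _ hX).differentiableAt (by norm_num)),
      pd_sum_term (hcN0 N) μ hX, hSval _ _ _ hr0]
    ring
  · refine (hR2 N μ ν).congr' ?_ .rfl
    filter_upwards [hsm N, eventually_gt_atTop 0] with r hr hr0
    have hX := sp_event_ne_zero u hr0 hθ
    have e1 : f =ᶠ[𝓝 (event u r θ)] fun Y => remFun f c k₀ N (bondi r Y) + S N Y := by
      filter_upwards [isOpen_sp_ne.mem_nhds hX] with Y hY
      exact hfS N hr0 hY
    have e2 : pd μ f =ᶠ[𝓝 (event u r θ)] fun Y =>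
        pd μ (fun Y => remFun f c k₀ N (bondi r Y)) Y + pd μ (S N) Y := by
      have hev : ∀ᶠ Y in 𝓝 (event u r θ),
          DifferentiableAt ℝ (fun Y => remFun f c k₀ N (bondi r Y)) Y :=
        (((hRs N hr0 hr).of_le (show (1 : WithTop ℕ∞) ≤ ∞ by norm_num)).eventually (by simp)).mono
          fun Y hY => hY.differentiableAt (by norm_num)
      filter_upwards [e1.eventuallyEq_nhds, hev, isOpen_sp_ne.mem_nhds hX] with Y h1 h2 h3
      rw [pd_congr h1, pd_add h2 ((contDiffAt_sum_term (cN N) _ h3).differentiableAt (by norm_num))]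
    rw [pd_congr e2, pd_add (hpdS μ (hRs N hr0 hr)) (hpdS μ (contDiffAt_sum_term (cN N) _ hX)),
      pd_pd_sum_term (hcN0 N) μ ν hX, hSval _ _ _ hr0]
    ring

end

end NullMemory

namespace NullMemory

noncomputable section

variable {m : ℕ}

/-! ### The inverse metric -/

section Inverse

variable {n : ℕ} {E : Type*} [NormedAddCommGroup E] [NormedSpace ℝ E]
  {M : E → Matrix (Fin n) (Fin n) ℝ} {X : E}

lemma contDiffAt_det (hM : ∀ i j, ContDiffAt ℝ ∞ (fun Y => M Y i j) X) :
    ContDiffAt ℝ ∞ (fun Y => (M Y).det) X := by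
  simp only [Matrix.det_apply]
  exact ContDiffAt.sum fun σ _ => (contDiffAt_prod fun i _ => hM _ _).const_smul _

lemma contDiffAt_adjugate (hM : ∀ i j, ContDiffAt ℝ ∞ (fun Y => M Y i j) X) (i j : Fin n) :
    ContDiffAt ℝ ∞ (fun Y => (M Y).adjugate i j) X := by
  simp only [Matrix.adjugate_apply]
  refine contDiffAt_det fun a b => ?_
  by_cases h : a = j
  · subst h
    simp only [Matrix.updateRow_self]
    exact contDiffAt_const
  · simp only [Matrix.updateRow_ne h]
    exact hM a b

lemma contDiffAt_inv_entry (hM : ∀ i j, ContDiffAt ℝ ∞ (fun Y => M Y i j) X)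
    (hdet : (M X).det ≠ 0) (i j : Fin n) : ContDiffAt ℝ ∞ (fun Y => (M Y)⁻¹ i j) X := by
  simp only [Matrix.inv_def, Matrix.smul_apply, Ring.inverse_eq_inv', smul_eq_mul]
  exact ((contDiffAt_det hM).inv hdet).mul (contDiffAt_adjugate hM i j)

end Inverse

lemma minkowski_mul_self : minkowski m * minkowski m = 1 := by
  rw [minkowski, Matrix.diagonal_mul_diagonal, ← Matrix.diagonal_one]
  congr 1
  funext i
  refine Fin.cases ?_ (fun i => ?_) i <;> simp

lemma minkowski_apply (a b : Fin (m + 1)) : minkowski m a b = if a = b then eps a else 0 := by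
  rw [minkowski, Matrix.diagonal_apply]
  rfl

lemma minkowski_inv : (minkowski m)⁻¹ = minkowski m :=
  Matrix.inv_eq_right_inv minkowski_mul_self

lemma sum_minkowski (a b : Fin (m + 1)) (K : Fin (m + 1) → Fin (m + 1) → ℝ) :
    ∑ c, ∑ e, minkowski m a c * K c e * minkowski m e b = eps a * eps b * K a b := by
  have h1 : ∀ c e, minkowski m a c * K c e * minkowski m e b =
      if e = b then (if a = c then eps a * K c e * eps e else 0) else 0 := by
    intro c e
    rw [minkowski_apply, minkowski_apply]
    split_ifs <;> simp
  simp only [h1, Finset.sum_ite_eq', Finset.sum_ite_eq, Finset.mem_univ, if_true]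
  ring

lemma sum_minkowski_single (a : Fin (m + 1)) (x : Fin (m + 1) → ℝ) :
    ∑ c, minkowski m a c * x c = eps a * x a := by
  simp [minkowski_apply]

lemma IsLorentzian.det_ne_zero {A : Matrix (Fin (m + 1)) (Fin (m + 1)) ℝ} (h : IsLorentzian A) :
    A.det ≠ 0 := by
  obtain ⟨P, hP, rfl⟩ := h
  have h1 := congrArg Matrix.det (minkowski_mul_self (m := m))
  rw [Matrix.det_mul, Matrix.det_one] at h1
  rw [Matrix.det_mul, Matrix.det_mul, Matrix.det_transpose]
  have h2 : (minkowski m).det ≠ 0 := left_ne_zero_of_mul_eq_one h1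
  exact mul_ne_zero (mul_ne_zero hP.ne_zero h2) hP.ne_zero

/-! ### Derivatives of the connection -/

/-- A smooth nondegenerate metric on an open set. -/
structure IsSmoothMetric (Ω : Set (Event m)) (g : TensorField m) : Prop where
  isOpen : IsOpen Ω
  smooth : ∀ μ ν, ContDiffOn ℝ ∞ (fun X => g X μ ν) Ω
  det_ne_zero : ∀ X ∈ Ω, (g X).det ≠ 0

/-- Twice the Christoffel symbols of the first kind. -/
def chris (g : TensorField m) (σ μ ν : Fin (m + 1)) (X : Event m) : ℝ :=
  pd μ (fun Y => g Y σ ν) X + pd ν (fun Y => g Y σ μ) X - pd σ (fun Y => g Y μ ν) X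

lemma pd_sub {f g : Event m → ℝ} {X : Event m} (hf : DifferentiableAt ℝ f X)
    (hg : DifferentiableAt ℝ g X) (μ : Fin (m + 1)) :
    pd μ (fun Y => f Y - g Y) X = pd μ f X - pd μ g X := by
  unfold pd
  rw [fderiv_fun_sub hf hg]
  rfl

lemma pd_sub_const (f : Event m → ℝ) (a : ℝ) (μ : Fin (m + 1)) :
    pd μ (fun Y => f Y - a) = pd μ f := by
  funext X
  unfold pd
  rw [fderiv_sub_const]

lemma contDiffAt_pd {f : Event m → ℝ} {X : Event m} (hf : ContDiffAt ℝ ∞ f X) (μ : Fin (m + 1)) :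
    ContDiffAt ℝ ∞ (pd μ f) X :=
  (hf.fderiv_right (m := ∞) (by simp)).clm_apply contDiffAt_const

namespace IsSmoothMetric

variable {Ω : Set (Event m)} {g : TensorField m} (hg : IsSmoothMetric Ω g)

include hg

lemma contDiffAt {X : Event m} (hX : X ∈ Ω) (μ ν : Fin (m + 1)) :
    ContDiffAt ℝ ∞ (fun X => g X μ ν) X :=
  (hg.smooth μ ν).contDiffAt (hg.isOpen.mem_nhds hX)

lemma contDiffAt_inv {X : Event m} (hX : X ∈ Ω) (μ ν : Fin (m + 1)) :
    ContDiffAt ℝ ∞ (fun X => (g X)⁻¹ μ ν) X :=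
  contDiffAt_inv_entry (fun i j => hg.contDiffAt hX i j) (hg.det_ne_zero X hX) μ ν

lemma isUnit_det {X : Event m} (hX : X ∈ Ω) : IsUnit (g X).det :=
  isUnit_iff_ne_zero.2 (hg.det_ne_zero X hX)

/-- Differentiate the product of the inverse metric with the metric, which is the identity near `X`.
-/
lemma pd_inv {X : Event m} (hX : X ∈ Ω) (l ρ σ : Fin (m + 1)) :
    pd l (fun Y => (g Y)⁻¹ ρ σ) X =
      -∑ a, ∑ b, (g X)⁻¹ ρ a * pd l (fun Y => g Y a b) X * (g X)⁻¹ b σ := by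
  set D : Matrix (Fin (m + 1)) (Fin (m + 1)) ℝ := Matrix.of fun a b => pd l (fun Y => (g Y)⁻¹ a b) X
  set P : Matrix (Fin (m + 1)) (Fin (m + 1)) ℝ := Matrix.of fun a b => pd l (fun Y => g Y a b) X
  have h1 : D * g X + (g X)⁻¹ * P = 0 := by
    ext a c
    have h2 : (fun Y => ∑ b, (g Y)⁻¹ a b * g Y b c) =ᶠ[𝓝 X] fun _ =>
        (1 : Matrix (Fin (m + 1)) (Fin (m + 1)) ℝ) a c := by
      filter_upwards [hg.isOpen.mem_nhds hX] with Y hY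
      rw [← Matrix.mul_apply, Matrix.nonsing_inv_mul _ (hg.isUnit_det hY)]
    have h3 := pd_congr h2 l
    have h4 : ∀ b, DifferentiableAt ℝ (fun Y => (g Y)⁻¹ a b) X := fun b =>
      (hg.contDiffAt_inv hX a b).differentiableAt (by norm_num)
    have h5 : ∀ b, DifferentiableAt ℝ (fun Y => g Y b c) X := fun b =>
      (hg.contDiffAt hX b c).differentiableAt (by norm_num)
    rw [pd_sum _ fun b _ => (h4 b).fun_mul (h5 b)] at h3
    simp only [fun b => pd_mul (h4 b) (h5 b) l] at h3
    have h6 : pd l (fun _ : Event m => (1 : Matrix (Fin (m + 1)) (Fin (m + 1)) ℝ) a c) X = 0 := by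
      simp [pd]
    rw [h6, Finset.sum_add_distrib] at h3
    rw [Matrix.add_apply, Matrix.mul_apply, Matrix.mul_apply, Matrix.zero_apply, add_comm]
    exact h3
  have h2 : D = -((g X)⁻¹ * P * (g X)⁻¹) := by
    have h3 : D * g X = -((g X)⁻¹ * P) := eq_neg_of_add_eq_zero_left h1
    calc D = D * g X * (g X)⁻¹ := by
          rw [Matrix.mul_assoc, Matrix.mul_nonsing_inv _ (hg.isUnit_det hX), Matrix.mul_one]
      _ = _ := by rw [h3, Matrix.neg_mul]
  have h3 := congrFun (congrFun h2 ρ) σ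
  rw [Matrix.neg_apply, Matrix.mul_apply] at h3
  simp only [Matrix.mul_apply, Finset.sum_mul] at h3
  rw [Finset.sum_comm] at h3
  exact h3

lemma contDiffAt_chris {X : Event m} (hX : X ∈ Ω) (σ μ ν : Fin (m + 1)) :
    ContDiffAt ℝ ∞ (chris g σ μ ν) X :=
  ((contDiffAt_pd (hg.contDiffAt hX σ ν) μ).add (contDiffAt_pd (hg.contDiffAt hX σ μ) ν)).sub
    (contDiffAt_pd (hg.contDiffAt hX μ ν) σ)

lemma pd_chris {X : Event m} (hX : X ∈ Ω) (l σ μ ν : Fin (m + 1)) :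
    pd l (chris g σ μ ν) X = pd l (pd μ fun Y => g Y σ ν) X + pd l (pd ν fun Y => g Y σ μ) X -
      pd l (pd σ fun Y => g Y μ ν) X := by
  have h : ∀ a b c, DifferentiableAt ℝ (pd a fun Y => g Y b c) X := fun a b c =>
    (contDiffAt_pd (hg.contDiffAt hX b c) a).differentiableAt (by norm_num)
  have h1 : chris g σ μ ν = fun Y => (pd μ (fun Y => g Y σ ν) Y + pd ν (fun Y => g Y σ μ) Y) -
      pd σ (fun Y => g Y μ ν) Y := rfl
  rw [h1, pd_sub ((h _ _ _).fun_add (h _ _ _)) (h _ _ _), pd_add (h _ _ _) (h _ _ _)]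

lemma pd_christoffel {X : Event m} (hX : X ∈ Ω) (l ρ μ ν : Fin (m + 1)) :
    pd l (christoffel g ρ μ ν) X = 1 / 2 * ∑ σ, ((g X)⁻¹ ρ σ * pd l (chris g σ μ ν) X +
      pd l (fun Y => (g Y)⁻¹ ρ σ) X * chris g σ μ ν X) := by
  have h1 : christoffel g ρ μ ν = fun Y => 1 / 2 * ∑ σ, (g Y)⁻¹ ρ σ * chris g σ μ ν Y := rfl
  have h2 : ∀ σ, DifferentiableAt ℝ (fun Y => (g Y)⁻¹ ρ σ) X := fun σ =>
    (hg.contDiffAt_inv hX ρ σ).differentiableAt (by norm_num)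
  have h3 : ∀ σ, DifferentiableAt ℝ (chris g σ μ ν) X := fun σ =>
    (hg.contDiffAt_chris hX σ μ ν).differentiableAt (by norm_num)
  rw [h1, pd_const_mul _ (DifferentiableAt.fun_sum fun σ _ => (h2 σ).fun_mul (h3 σ)),
    pd_sum _ fun σ _ => (h2 σ).fun_mul (h3 σ)]
  simp only [fun σ => pd_mul (h2 σ) (h3 σ) l]

end IsSmoothMetric

/-! ### The curvature near null infinity -/

/-- The leading order behaviour of a metric and of its derivatives along a ray. -/
structure RayLimits (g : TensorField m) (s : ℝ → ℝ) (X : ℝ → Event m) (L : Fin (m + 1) → ℝ)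
    (H H₁ H₂ : Fin (m + 1) → Fin (m + 1) → ℝ) : Prop where
  scale : Tendsto s atTop atTop
  zeroth : ∀ a b, Tendsto (fun r => s r * (g (X r) a b - minkowski m a b)) atTop (𝓝 (H a b))
  first : ∀ μ a b, Tendsto (fun r => s r * pd μ (fun Y => g Y a b) (X r)) atTop
    (𝓝 (L μ * H₁ a b))
  second : ∀ l μ a b, Tendsto (fun r => s r * pd l (pd μ fun Y => g Y a b) (X r)) atTop
    (𝓝 (L l * (L μ * H₂ a b)))

namespace RayLimits

variable {Ω : Set (Event m)} {g : TensorField m} {s : ℝ → ℝ} {X : ℝ → Event m}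
  {L : Fin (m + 1) → ℝ} {H H₁ H₂ : Fin (m + 1) → Fin (m + 1) → ℝ}

/-- Dividing by the scale. -/
lemma tendsto_of_scale {s : ℝ → ℝ} (hs : Tendsto s atTop atTop) {F : ℝ → ℝ} {a : ℝ}
    (h : Tendsto (fun r => s r * F r) atTop (𝓝 a)) : Tendsto F atTop (𝓝 0) := by
  have h1 := (tendsto_inv_atTop_zero.comp hs).mul h
  rw [zero_mul] at h1
  refine h1.congr' ?_
  filter_upwards [hs.eventually_gt_atTop 0] with r hr
  simp only [Function.comp_apply]
  field_simp

variable (hL : RayLimits g s X L H H₁ H₂) (hg : IsSmoothMetric Ω g) (hX : ∀ᶠ r in atTop, X r ∈ Ω)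

include hL

lemma metric (a b : Fin (m + 1)) :
    Tendsto (fun r => g (X r) a b) atTop (𝓝 (minkowski m a b)) := by
  have := (tendsto_of_scale hL.scale (hL.zeroth a b)).add_const (minkowski m a b)
  simpa using this

lemma inverse (a b : Fin (m + 1)) :
    Tendsto (fun r => (g (X r))⁻¹ a b) atTop (𝓝 (minkowski m a b)) := by
  have h1 : Tendsto (fun r => g (X r)) atTop (𝓝 (minkowski m)) :=
    tendsto_pi_nhds.2 fun a => tendsto_pi_nhds.2 fun b => hL.metric a b
  have h0 : (minkowski m).det ≠ 0 := by
    have h1 := congrArg Matrix.det (minkowski_mul_self (m := m))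
    rw [Matrix.det_mul, Matrix.det_one] at h1
    exact left_ne_zero_of_mul_eq_one h1
  have h2 : Tendsto (fun r => (g (X r)).det⁻¹ * (g (X r)).adjugate a b) atTop
      (𝓝 ((minkowski m).det⁻¹ * (minkowski m).adjugate a b)) := by
    have c1 : Continuous fun A : Matrix (Fin (m + 1)) (Fin (m + 1)) ℝ => A.det :=
      continuous_id.matrix_det
    have c2 : Continuous fun A : Matrix (Fin (m + 1)) (Fin (m + 1)) ℝ => A.adjugate a b :=
      (continuous_id.matrix_adjugate).matrix_elem a b
    exact (((c1.tendsto _).comp h1).inv₀ h0).mul ((c2.tendsto _).comp h1)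
  have h3 : ∀ A : Matrix (Fin (m + 1)) (Fin (m + 1)) ℝ, A⁻¹ a b = A.det⁻¹ * A.adjugate a b := by
    intro A
    rw [Matrix.inv_def, Matrix.smul_apply, Ring.inverse_eq_inv', smul_eq_mul]
  simp only [h3]
  rw [← h3, minkowski_inv] at h2
  exact h2

/-- Uses the resolvent identity `g⁻¹ - η = -g⁻¹ (g - η) η`, with `η` its own inverse. -/
lemma inverse_sub (hg : IsSmoothMetric Ω g) (hX : ∀ᶠ r in atTop, X r ∈ Ω) (a b : Fin (m + 1)) :
    Tendsto (fun r => s r * ((g (X r))⁻¹ a b - minkowski m a b)) atTop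
      (𝓝 (-(eps a * eps b * H a b))) := by
  have h1 : Tendsto (fun r => -∑ c, ∑ e, (g (X r))⁻¹ a c * (s r * (g (X r) c e - minkowski m c e)) *
      minkowski m e b) atTop (𝓝 (-(eps a * eps b * H a b))) := by
    rw [← sum_minkowski]
    exact (tendsto_finsetSum _ fun c _ => tendsto_finsetSum _ fun e _ =>
      ((hL.inverse a c).mul (hL.zeroth c e)).mul_const _).neg
  refine h1.congr' ?_
  filter_upwards [hX] with r hr
  have h2 : (g (X r))⁻¹ - minkowski m = -((g (X r))⁻¹ * (g (X r) - minkowski m) * minkowski m) := by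
    rw [Matrix.mul_sub, Matrix.nonsing_inv_mul _ (hg.isUnit_det hr), Matrix.sub_mul, Matrix.one_mul,
      Matrix.mul_assoc, minkowski_mul_self, Matrix.mul_one, neg_sub]
  have h3 := congrFun (congrFun h2 a) b
  rw [Matrix.sub_apply] at h3
  rw [h3, Matrix.neg_apply, Matrix.mul_apply]
  simp only [Matrix.mul_apply, Finset.sum_mul, Finset.mul_sum, mul_neg, Matrix.sub_apply]
  rw [Finset.sum_comm]
  congr 1
  exact Finset.sum_congr rfl fun c _ => Finset.sum_congr rfl fun e _ => by ring

lemma inverse_deriv (hg : IsSmoothMetric Ω g) (hX : ∀ᶠ r in atTop, X r ∈ Ω)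
    (l a b : Fin (m + 1)) :
    Tendsto (fun r => s r * pd l (fun Y => (g Y)⁻¹ a b) (X r)) atTop
      (𝓝 (-(eps a * eps b * (L l * H₁ a b)))) := by
  have h1 : Tendsto (fun r => -∑ c, ∑ e, (g (X r))⁻¹ a c * (s r * pd l (fun Y => g Y c e) (X r)) *
      (g (X r))⁻¹ e b) atTop (𝓝 (-(eps a * eps b * (L l * H₁ a b)))) := by
    rw [← sum_minkowski a b fun c e => L l * H₁ c e]
    exact (tendsto_finsetSum _ fun c _ => tendsto_finsetSum _ fun e _ =>
      ((hL.inverse a c).mul (hL.first l c e)).mul (hL.inverse e b)).neg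
  refine h1.congr' ?_
  filter_upwards [hX] with r hr
  rw [hg.pd_inv hr]
  simp only [Finset.mul_sum, mul_neg]
  congr 1
  exact Finset.sum_congr rfl fun c _ => Finset.sum_congr rfl fun e _ => by ring

lemma chris_limit (σ μ ν : Fin (m + 1)) :
    Tendsto (fun r => s r * chris g σ μ ν (X r)) atTop (𝓝 (chr L H₁ σ μ ν)) := by
  refine (((hL.first μ σ ν).add (hL.first ν σ μ)).sub (hL.first σ μ ν)).congr fun r => ?_
  rw [chris]
  ring

lemma chris_deriv (hg : IsSmoothMetric Ω g) (hX : ∀ᶠ r in atTop, X r ∈ Ω)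
    (l σ μ ν : Fin (m + 1)) :
    Tendsto (fun r => s r * pd l (chris g σ μ ν) (X r)) atTop (𝓝 (L l * chr L H₂ σ μ ν)) := by
  have h1 := ((hL.second l μ σ ν).add (hL.second l ν σ μ)).sub (hL.second l σ μ ν)
  have h2 : L l * (L μ * H₂ σ ν) + L l * (L ν * H₂ σ μ) - L l * (L σ * H₂ μ ν) =
      L l * chr L H₂ σ μ ν := by
    rw [chr]
    ring
  rw [h2] at h1
  refine h1.congr' ?_
  filter_upwards [hX] with r hr
  rw [hg.pd_chris hr]
  ring

lemma christoffel_limit (ρ μ ν : Fin (m + 1)) :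
    Tendsto (fun r => s r * christoffel g ρ μ ν (X r)) atTop
      (𝓝 (1 / 2 * (eps ρ * chr L H₁ ρ μ ν))) := by
  rw [← sum_minkowski_single ρ fun σ => chr L H₁ σ μ ν]
  refine ((tendsto_finsetSum Finset.univ fun σ _ =>
    (hL.inverse ρ σ).mul (hL.chris_limit σ μ ν)).const_mul (1 / 2)).congr fun r => ?_
  rw [show christoffel g ρ μ ν (X r) = 1 / 2 * ∑ σ, (g (X r))⁻¹ ρ σ * chris g σ μ ν (X r) from rfl]
  simp only [Finset.mul_sum]
  exact Finset.sum_congr rfl fun c _ => by ring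

/-- The part linear in the perturbation is subtracted exactly. What remains are products of two
small factors, each with a limit at scale `s`, hence the weight `s * s`. -/
lemma christoffel_deriv (hg : IsSmoothMetric Ω g) (hX : ∀ᶠ r in atTop, X r ∈ Ω)
    (l ρ μ ν : Fin (m + 1)) :
    Tendsto (fun r => s r * s r * (pd l (christoffel g ρ μ ν) (X r) -
      1 / 2 * (eps ρ * pd l (chris g ρ μ ν) (X r)))) atTop (𝓝 (quadDChr L H H₁ H₂ l ρ μ ν)) := by
  have h1 := (tendsto_finsetSum Finset.univ fun σ _ =>
    ((hL.inverse_deriv hg hX l ρ σ).mul (hL.chris_limit σ μ ν)).add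
      ((hL.inverse_sub hg hX ρ σ).mul (hL.chris_deriv hg hX l σ μ ν))).const_mul (1 / 2)
  have h2 : 1 / 2 * ∑ σ, (-(eps ρ * eps σ * (L l * H₁ ρ σ)) * chr L H₁ σ μ ν +
      -(eps ρ * eps σ * H ρ σ) * (L l * chr L H₂ σ μ ν)) = quadDChr L H H₁ H₂ l ρ μ ν := by
    rw [quadDChr]
    congr 1
    exact Finset.sum_congr rfl fun σ _ => by ring
  rw [h2] at h1
  refine h1.congr' ?_
  filter_upwards [hX] with r hr
  rw [hg.pd_christoffel hr, ← sum_minkowski_single ρ fun σ => pd l (chris g σ μ ν) (X r)]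
  rw [← mul_sub, ← Finset.sum_sub_distrib]
  simp only [Finset.mul_sum]
  exact Finset.sum_congr rfl fun c _ => by ring

/-- The limit of the nonlinear part of the Riemann tensor. -/
lemma riemannUp_limit (hg : IsSmoothMetric Ω g) (hX : ∀ᶠ r in atTop, X r ∈ Ω)
    (ρ σ μ ν : Fin (m + 1)) :
    Tendsto (fun r => s r * s r * (riemannUp g ρ σ μ ν (X r) -
      1 / 2 * (eps ρ * (pd μ (chris g ρ ν σ) (X r) - pd ν (chris g ρ μ σ) (X r))))) atTop
      (𝓝 (quadDChr L H H₁ H₂ μ ρ ν σ - quadDChr L H H₁ H₂ ν ρ μ σ + ∑ l,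
        ((1 / 2 * (eps ρ * chr L H₁ ρ μ l)) * (1 / 2 * (eps l * chr L H₁ l ν σ)) -
        (1 / 2 * (eps ρ * chr L H₁ ρ ν l)) * (1 / 2 * (eps l * chr L H₁ l μ σ))))) := by
  have h1 := ((hL.christoffel_deriv hg hX μ ρ ν σ).sub (hL.christoffel_deriv hg hX ν ρ μ σ)).add
    (tendsto_finsetSum Finset.univ fun l _ =>
      ((hL.christoffel_limit ρ μ l).mul (hL.christoffel_limit l ν σ)).sub
      ((hL.christoffel_limit ρ ν l).mul (hL.christoffel_limit l μ σ)))
  refine h1.congr fun r => ?_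
  rw [riemannUp]
  have : ∑ l, (s r * christoffel g ρ μ l (X r) * (s r * christoffel g l ν σ (X r)) -
      s r * christoffel g ρ ν l (X r) * (s r * christoffel g l μ σ (X r))) = s r * s r *
      ∑ l, (christoffel g ρ μ l (X r) * christoffel g l ν σ (X r) -
      christoffel g ρ ν l (X r) * christoffel g l μ σ (X r)) := by
    rw [Finset.mul_sum]
    exact Finset.sum_congr rfl fun l _ => by ring
  rw [this]
  ring

/-- The limit of the nonlinear part of the Ricci tensor. -/
lemma ricci_limit (hg : IsSmoothMetric Ω g) (hX : ∀ᶠ r in atTop, X r ∈ Ω) (μ ν : Fin (m + 1)) :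
    Tendsto (fun r => s r * s r * (ricci g μ ν (X r) -
      ∑ l, 1 / 2 * (eps l * (pd l (chris g l ν μ) (X r) - pd ν (chris g l l μ) (X r))))) atTop
      (𝓝 (quadRic L H H₁ H₂ μ ν)) := by
  refine (tendsto_finsetSum Finset.univ fun l _ => hL.riemannUp_limit hg hX l μ l ν).congr
    fun r => ?_
  rw [ricci, ← Finset.mul_sum, ← Finset.sum_sub_distrib]

end RayLimits

end

end NullMemory

namespace NullMemory

noncomputable section

variable {m : ℕ}

/-! ### Consequences of the Einstein equation near null infinity -/

lemma IsLorentzian.symm {A : Matrix (Fin (m + 1)) (Fin (m + 1)) ℝ} (h : IsLorentzian A)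
    (a b : Fin (m + 1)) : A a b = A b a := by
  obtain ⟨P, -, rfl⟩ := h
  have h1 : (P.transpose * minkowski m * P).transpose = P.transpose * minkowski m * P := by
    rw [Matrix.transpose_mul, Matrix.transpose_mul, Matrix.transpose_transpose, minkowski,
      Matrix.diagonal_transpose, Matrix.mul_assoc]
  exact congrFun (congrFun h1 b) a

/-- Pointwise convergence. -/
lemma TendstoSmoothly.tendsto {ι : Type*} {F : ι → Space m → ℝ} {l : Filter ι} {f : Space m → ℝ}
    (h : TendstoSmoothly F l f) {θ : Space m} (hθ : ‖θ‖ = 1) :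
    Tendsto (fun s => F s θ) l (𝓝 (f θ)) := by
  have h1 := (h.2 0).tendsto_at (mem_unitSphere.2 hθ)
  have h2 := ((ContinuousMultilinearMap.apply ℝ (fun _ : Fin 0 => Space m) ℝ 0).continuous.tendsto
    _).comp h1
  have hdir : dir θ = θ := by simp [dir, hθ]
  simpa [Function.comp_def, radialExt, hdir] using h2

namespace IsRadiatingSpacetime

variable {Ω : Set (Event m)} {g T : TensorField m} {h τ : TensorCoeff m}
  (hst : IsRadiatingSpacetime Ω g T h τ)

include hst

lemma isSmoothMetric : IsSmoothMetric Ω g :=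
  ⟨hst.nbhd.1, hst.smooth, fun X hX => (hst.lorentzian X hX).det_ne_zero⟩

/-- Trace reversal of the Einstein equation in dimension `m + 1`; the trace of the metric with its
inverse is `m + 1`, whence the denominator `m - 1`. -/
lemma ricci_eq (hm : 3 ≤ m) {X : Event m} (hX : X ∈ Ω) (μ ν : Fin (m + 1)) :
    ricci g μ ν X = 8 * Real.pi * (T X μ ν -
      g X μ ν * (∑ a, ∑ b, (g X)⁻¹ a b * T X a b) / ((m : ℝ) - 1)) := by
  have hm1 : ((m : ℝ) - 1) ≠ 0 := by
    have : (3 : ℝ) ≤ m := by exact_mod_cast hm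
    linarith
  have h1 : ∑ a, ∑ b, (g X)⁻¹ a b * g X a b = (m : ℝ) + 1 := by
    have h2 := Matrix.nonsing_inv_mul _ (hst.isSmoothMetric.isUnit_det hX)
    have h3 := congrArg Matrix.trace h2
    rw [Matrix.trace_one, Matrix.trace] at h3
    simp only [Matrix.diag_apply, Matrix.mul_apply, Fintype.card_fin, Nat.cast_add,
      Nat.cast_one] at h3
    rw [← h3]
    exact Finset.sum_congr rfl fun a _ => Finset.sum_congr rfl fun b _ => by
      rw [(hst.lorentzian X hX).symm a b]
  have h2 : scalarCurvature g X - 1 / 2 * scalarCurvature g X * ((m : ℝ) + 1) =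
      8 * Real.pi * ∑ a, ∑ b, (g X)⁻¹ a b * T X a b := by
    conv_lhs => rw [← h1]; lhs; rw [scalarCurvature]
    simp only [Finset.mul_sum, ← Finset.sum_sub_distrib]
    refine Finset.sum_congr rfl fun a _ => Finset.sum_congr rfl fun b _ => ?_
    have := hst.einstein X hX a b
    rw [einsteinTensor] at this
    linear_combination (g X)⁻¹ a b * this
  have h3 : scalarCurvature g X = -(16 * Real.pi * ∑ a, ∑ b, (g X)⁻¹ a b * T X a b) /
      ((m : ℝ) - 1) := by
    rw [eq_div_iff hm1]
    linarith
  have h4 := hst.einstein X hX μ ν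
  rw [einsteinTensor, h3] at h4
  linear_combination h4

variable [NeZero m]

open ScriFun

/-- The coefficients of the metric perturbation. -/
def coeff (a b : Fin (m + 1)) (k : ℤ) : ScriFun m := coeffs (hst.metric_expansion a b) k

lemma coeff_apply (a b : Fin (m + 1)) (k : ℤ) (u : ℝ) {θ : Space m} (hθ : ‖θ‖ = 1) :
    hst.coeff a b k (u, θ) = h a b k u θ := coeffs_apply _ _ _ hθ

/-- The metric is symmetric near null infinity, and coefficients along a ray are unique. -/
lemma coeff_symm (a b : Fin (m + 1)) : hst.coeff a b = hst.coeff b a := by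
  funext k
  refine ext_sphere fun u θ hθ => ?_
  have h1 := ((hst.metric_expansion a b).rayExp u hθ).1
  have h2 := ((hst.metric_expansion b a).rayExp u hθ).1
  refine congrFun (h1.unique (h2.congr ?_)) k
  filter_upwards [hst.nbhd.2 u θ (mem_unitSphere.2 hθ)] with r hr
  rw [(hst.lorentzian _ hr).symm, minkowski_apply, minkowski_apply]
  by_cases hab : a = b
  · rw [hab]
  · rw [if_neg hab, if_neg (Ne.symm hab)]

lemma coeff_eq_zero (hm : 3 ≤ m) (a b : Fin (m + 1)) (k : ℤ) (hk : k < (m : ℤ) - 1) :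
    hst.coeff a b k = 0 := by
  refine ext_sphere fun u θ hθ => ?_
  rw [hst.coeff_apply _ _ _ _ hθ]
  refine hst.metric_ansatz a b k ?_ u θ (mem_unitSphere.2 hθ)
  unfold InAnsatz coulombic
  omega

lemma tendsto_dU_coeff (a b : Fin (m + 1)) {k : ℤ} (hk : k ≤ coulombic m) {θ : Space m}
    (hθ : ‖θ‖ = 1) : Tendsto (fun u => dU (hst.coeff a b k) (u, θ)) atBot (𝓝 0) ∧
      Tendsto (fun u => dU (hst.coeff a b k) (u, θ)) atTop (𝓝 0) := by
  have h1 : ∀ u, dU (hst.coeff a b k) (u, θ) = deriv (fun s => h a b k s θ) u := by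
    intro u
    rw [← (hasDerivAt_dU (hst.coeff a b k) u θ).deriv]
    simp only [hst.coeff_apply _ _ _ _ hθ]
  simp only [h1]
  exact ⟨(hst.stationary_early a b k hk).tendsto hθ, (hst.stationary_late a b k hk).tendsto hθ⟩

lemma pd_pd_rayExp (l ν a b : Fin (m + 1)) (u : ℝ) {θ : Space m} (hθ : ‖θ‖ = 1) :
    RayExp (fun r => pd l (pd ν fun Y => g Y a b) (event u r θ))
      fun k => dC l (dC ν (hst.coeff a b)) k (u, θ) := by
  have := ((hst.metric_expansion a b).rayExp u hθ).2.2 ν l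
  rwa [pd_sub_const] at this

omit hst [NeZero m] in
lemma scale_eq (r : ℝ) : r ^ ((((m : ℤ) - 1 : ℤ) : ℝ) / 2) = r ^ (((m : ℝ) - 1) / 2) := by
  push_cast
  rfl

lemma rayLimits (hm : 3 ≤ m) (u : ℝ) {θ : Space m} (hθ : ‖θ‖ = 1) :
    RayLimits g (fun r => r ^ (((m : ℝ) - 1) / 2)) (fun r => event u r θ) (fun l => Lc l (u, θ))
      (val (fun a b => hst.coeff a b ((m : ℤ) - 1)) (u, θ))
      (val (fun a b => dU (hst.coeff a b ((m : ℤ) - 1))) (u, θ))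
      (val (fun a b => dU (dU (hst.coeff a b ((m : ℤ) - 1)))) (u, θ)) where
  scale := by
    refine tendsto_rpow_atTop ?_
    have : (3 : ℝ) ≤ m := by exact_mod_cast hm
    linarith
  zeroth a b := by
    have := ((hst.metric_expansion a b).rayExp u hθ).1.tendsto (K := (m : ℤ) - 1) fun j hj => by
      rw [show coeffs (hst.metric_expansion a b) j = hst.coeff a b j from rfl,
        hst.coeff_eq_zero hm a b j hj]
      rfl
    simp only [scale_eq] at this
    exact this
  first μ a b := by
    have h0 := dC_eq_zero_of_lt (hst.coeff_eq_zero hm a b) μ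
    have := (((hst.metric_expansion a b).rayExp u hθ).2.1 μ).tendsto (K := (m : ℤ) - 1) fun j hj => by
      rw [show coeffs (hst.metric_expansion a b) = hst.coeff a b from rfl, h0 j hj]
      rfl
    rw [show coeffs (hst.metric_expansion a b) = hst.coeff a b from rfl,
      dC_lead (hst.coeff_eq_zero hm a b), pd_sub_const] at this
    simp only [scale_eq] at this
    exact this
  second l μ a b := by
    have h0 := dC_eq_zero_of_lt (dC_eq_zero_of_lt (hst.coeff_eq_zero hm a b) μ) l
    have := (hst.pd_pd_rayExp l μ a b u hθ).tendsto (K := (m : ℤ) - 1) fun j hj => by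
      rw [h0 j hj]
      rfl
    rw [dC_dC_lead (hst.coeff_eq_zero hm a b)] at this
    simp only [scale_eq] at this
    exact this

omit hst [NeZero m] in
lemma scale_mul_scale {r : ℝ} (hr : 0 < r) : r ^ (((m : ℝ) - 1) / 2) * r ^ (((m : ℝ) - 1) / 2) =
    r ^ (((2 * ((m : ℤ) - 1) : ℤ) : ℝ) / 2) := by
  rw [← Real.rpow_add hr]
  congr 1
  push_cast
  ring

lemma stress_limit (a b : Fin (m + 1)) (u : ℝ) {θ : Space m} (hθ : ‖θ‖ = 1) :
    Tendsto (fun r => r ^ (((m : ℝ) - 1) / 2) * r ^ (((m : ℝ) - 1) / 2) * T (event u r θ) a b) atTop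
      (𝓝 (τ a b (2 * ((m : ℤ) - 1)) u θ)) := by
  have h1 := ((hst.stress_expansion a b).rayExp u hθ).1.tendsto (K := 2 * ((m : ℤ) - 1))
    fun j hj => by
      rw [coeffs_apply _ _ _ hθ, hst.stress_ansatz a b j hj u θ (mem_unitSphere.2 hθ)]
  rw [coeffs_apply _ _ _ hθ] at h1
  refine h1.congr' ?_
  filter_upwards [eventually_gt_atTop 0] with r hr
  rw [scale_mul_scale hr]

lemma ricci_limit (hm : 3 ≤ m) (μ ν : Fin (m + 1)) (u : ℝ) {θ : Space m} (hθ : ‖θ‖ = 1) :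
    Tendsto (fun r => r ^ (((m : ℝ) - 1) / 2) * r ^ (((m : ℝ) - 1) / 2) * ricci g μ ν (event u r θ))
      atTop (𝓝 (8 * Real.pi * (τ μ ν (2 * ((m : ℤ) - 1)) u θ - minkowski m μ ν *
        (∑ l, eps l * τ l l (2 * ((m : ℤ) - 1)) u θ) / ((m : ℝ) - 1)))) := by
  have hL := hst.rayLimits hm u hθ
  have h1 := tendsto_finsetSum Finset.univ fun (a : Fin (m + 1)) _ =>
    tendsto_finsetSum Finset.univ fun (b : Fin (m + 1)) _ =>
      (hL.inverse a b).mul (hst.stress_limit a b u hθ)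
  simp only [sum_minkowski_single] at h1
  have h2 := ((hst.stress_limit μ ν u hθ).sub
    (((hL.metric μ ν).mul h1).div_const ((m : ℝ) - 1))).const_mul (8 * Real.pi)
  refine h2.congr' ?_
  filter_upwards [hst.nbhd.2 u θ (mem_unitSphere.2 hθ)] with r hr
  rw [hst.ricci_eq hm hr]
  have : ∀ s : ℝ, ∑ a, ∑ b, (g (event u r θ))⁻¹ a b * (s * T (event u r θ) a b) =
      s * ∑ a, ∑ b, (g (event u r θ))⁻¹ a b * T (event u r θ) a b := by
    intro s
    simp only [Finset.mul_sum]
    exact Finset.sum_congr rfl fun a _ => Finset.sum_congr rfl fun b _ => by ring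
  rw [this]
  ring

/-- The linear part of the Ricci tensor is the full tensor, known from the stress, minus the
quadratic part. Both have limits at order `d - 2`, so `coeff_of_tendsto` yields vanishing below that
order and the value at it. -/
lemma ricC_coeff (hm : 3 ≤ m) (μ ν : Fin (m + 1)) (u : ℝ) {θ : Space m} (hθ : ‖θ‖ = 1) :
    (∀ k < 2 * ((m : ℤ) - 1), ricC hst.coeff μ ν k (u, θ) = 0) ∧
    ricC hst.coeff μ ν (2 * ((m : ℤ) - 1)) (u, θ) =
      8 * Real.pi * (τ μ ν (2 * ((m : ℤ) - 1)) u θ - minkowski m μ ν *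
        (∑ l, eps l * τ l l (2 * ((m : ℤ) - 1)) u θ) / ((m : ℝ) - 1)) -
      quadRic (fun l => Lc l (u, θ)) (val (fun a b => hst.coeff a b ((m : ℤ) - 1)) (u, θ))
        (val (fun a b => dU (hst.coeff a b ((m : ℤ) - 1))) (u, θ))
        (val (fun a b => dU (dU (hst.coeff a b ((m : ℤ) - 1)))) (u, θ)) μ ν := by
  have hΩ := hst.nbhd.2 u θ (mem_unitSphere.2 hθ)
  have hD := fun l ν a b => hst.pd_pd_rayExp l ν a b u hθ
  have h1 : RayExp (fun r => ∑ l, 1 / 2 * (eps l * (pd l (chris g l ν μ) (event u r θ) -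
      pd ν (chris g l l μ) (event u r θ)))) fun k => ricC hst.coeff μ ν k (u, θ) := by
    have h2 := RayExp.sum Finset.univ fun l : Fin (m + 1) =>
      (((((hD l ν l μ).add (hD l μ l ν)).sub (hD l l ν μ)).sub (hD ν μ l l)).const_mul
        (eps l)).const_mul (1 / 2)
    have h3 : (fun k => ricC hst.coeff μ ν k (u, θ)) = fun k => ∑ l, 1 / 2 * (eps l *
        (dC l (dC ν (hst.coeff l μ)) k (u, θ) + dC l (dC μ (hst.coeff l ν)) k (u, θ) -
          dC l (dC l (hst.coeff ν μ)) k (u, θ) - dC ν (dC μ (hst.coeff l l)) k (u, θ))) := by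
      funext k
      rw [ricC_apply, ScriFun.smul_apply, ScriFun.sum_apply, Finset.mul_sum]
      simp only [ScriFun.smul_apply, ScriFun.sub_apply, ScriFun.add_apply]
    rw [h3]
    refine h2.congr ?_
    filter_upwards [hΩ] with r hr
    refine Finset.sum_congr rfl fun l _ => ?_
    rw [hst.isSmoothMetric.pd_chris hr, hst.isSmoothMetric.pd_chris hr]
    ring
  have h4 := (hst.ricci_limit hm μ ν u hθ).sub
    ((hst.rayLimits hm u hθ).ricci_limit hst.isSmoothMetric hΩ μ ν)
  refine h1.coeff_of_tendsto (h4.congr' ?_)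
  filter_upwards [eventually_gt_atTop 0] with r hr
  rw [← scale_mul_scale hr]
  ring

/-- A vector timelike for the flat metric is eventually timelike for `g` along the ray, and the
closed inequality passes to the limit of the rescaled stress. -/
lemma flatDominantEnergy (hm : 3 ≤ m) (u : ℝ) {θ : Space m} (hθ : ‖θ‖ = 1) :
    FlatDominantEnergy fun a b => τ a b (2 * ((m : ℤ) - 1)) u θ := by
  intro v hv
  have hL := hst.rayLimits hm u hθ
  have hg : ∀ (G : ℝ → Matrix (Fin (m + 1)) (Fin (m + 1)) ℝ) (w : ℝ → Fin (m + 1) → ℝ)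
      (w₀ : Fin (m + 1) → ℝ), (∀ a b, Tendsto (fun r => G r a b) atTop (𝓝 (minkowski m a b))) →
      (∀ a, Tendsto (fun r => w r a) atTop (𝓝 (w₀ a))) →
      Tendsto (fun r => w r ⬝ᵥ (G r).mulVec (w r)) atTop (𝓝 (∑ a, eps a * w₀ a * w₀ a)) := by
    intro G w w₀ hG hw
    have h1 := tendsto_finsetSum Finset.univ fun (a : Fin (m + 1)) _ => (hw a).mul
      (tendsto_finsetSum Finset.univ fun (b : Fin (m + 1)) _ => (hG a b).mul (hw b))
    simp only [sum_minkowski_single] at h1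
    have h2 : ∑ a, eps a * w₀ a * w₀ a = ∑ a, w₀ a * (eps a * w₀ a) :=
      Finset.sum_congr rfl fun a _ => by ring
    rw [h2]
    exact h1
  have h1 := hg (fun r => g (event u r θ)) (fun _ => v) v (fun a b => hL.metric a b)
    fun a => tendsto_const_nhds
  set s : ℝ → ℝ := fun r => r ^ (((m : ℝ) - 1) / 2) * r ^ (((m : ℝ) - 1) / 2) with hs
  have h2 := hg (fun r => (g (event u r θ))⁻¹) (fun r => s r • (T (event u r θ)).mulVec v)
    (fun a => ∑ b, τ a b (2 * ((m : ℤ) - 1)) u θ * v b) (fun a b => hL.inverse a b) fun a => by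
      refine (tendsto_finsetSum Finset.univ fun (b : Fin (m + 1)) _ =>
        (hst.stress_limit a b u hθ).mul_const (v b)).congr fun r => ?_
      simp only [Pi.smul_apply, Matrix.mulVec, dotProduct, smul_eq_mul, Finset.mul_sum, hs]
      exact Finset.sum_congr rfl fun b _ => by ring
  refine le_of_tendsto h2 ?_
  filter_upwards [h1.eventually_lt_const hv, hst.nbhd.2 u θ (mem_unitSphere.2 hθ)] with r hr hr'
  have h3 := (hst.dominantEnergy _ hr' v hr).2
  rw [Matrix.mulVec_smul, dotProduct_smul, smul_dotProduct, smul_smul]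
  exact mul_nonpos_of_nonneg_of_nonpos (mul_self_nonneg _) h3

lemma dU_nullPart_coeff (hm : 3 ≤ m) :
    dU (nullPart fun a b => hst.coeff a b ((m : ℤ) - 1)) = 0 :=
  dU_nullPart (leading_gauge (hst.coeff_eq_zero hm)
    (fun μ ν => ext_sphere fun u _ hθ => (hst.ricC_coeff hm μ ν u hθ).1 _ (by omega))
    fun μ ν _ hθ => (hst.tendsto_dU_coeff μ ν (by unfold coulombic; omega) hθ).1)

/-- The constraint on the Coulombic order tidal tensor. -/
theorem dU_constraint_tidC (hm : 3 ≤ m) (j : Fin m) :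
    dU (constraint (fun i j => tidC hst.coeff i.succ j.succ (2 * ((m : ℤ) - 2))) j) =
      dU (dU (dU (sourcePotential (fun a b => hst.coeff a b ((m : ℤ) - 1)) j))) :=
  dU_constraint_of_einstein hm (τ := fun a b => τ a b (2 * ((m : ℤ) - 1))) (fun _ _ => rfl)
    hst.coeff_symm (hst.coeff_eq_zero hm)
    (fun μ ν k hk => ext_sphere fun u _ hθ => (hst.ricC_coeff hm μ ν u hθ).1 k hk)
    (fun μ ν _ hθ => (hst.tendsto_dU_coeff μ ν (by unfold coulombic; omega) hθ).1)
    (fun μ ν u _ hθ => (hst.ricC_coeff hm μ ν u hθ).2)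
    (fun μ ν θ hθ => hst.stress_early μ ν θ (mem_unitSphere.2 hθ))
    (fun u _ hθ => hst.flatDominantEnergy hm u hθ) j

/-- The Coulombic order Weyl tensor is the linearized one. -/
theorem weyl_coeff (hm : 3 ≤ m) (μ ν : Fin (m + 1)) {c : ℤ → ℝ → Space m → ℝ}
    (hc : HasExpansion (electricWeyl g μ ν) c) (u : ℝ) {θ : Space m} (hθ : ‖θ‖ = 1) :
    c (coulombic m) u θ = -(1 / 2) * tidC hst.coeff μ ν (coulombic m) (u, θ) := by
  have hΩ := hst.nbhd.2 u θ (mem_unitSphere.2 hθ)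
  have hg := hst.isSmoothMetric
  have hL := hst.rayLimits hm u hθ
  have hD := fun l ν a b => hst.pd_pd_rayExp l ν a b u hθ
  have h1 := (hc.rayExp u hθ).1.add
    ((((((hD 0 0 μ ν).add (hD μ ν 0 0)).sub (hD 0 μ 0 ν)).sub (hD 0 ν 0 μ))).const_mul (1 / 2))
  set s : ℝ → ℝ := fun r => r ^ (((m : ℝ) - 1) / 2) with hs
  set lin : Fin (m + 1) → ℝ → ℝ := fun l r => 1 / 2 * (eps l * (pd 0 (chris g l μ ν) (event u r θ) -
    pd μ (chris g l 0 ν) (event u r θ))) with hlin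
  obtain ⟨A, hA⟩ : ∃ A, Tendsto (fun r => s r * s r * (riemann g 0 ν 0 μ (event u r θ) -
      ∑ l, minkowski m 0 l * lin l r)) atTop (𝓝 A) := by
    refine ⟨_, (((tendsto_finsetSum Finset.univ fun (l : Fin (m + 1)) _ =>
      (hL.metric 0 l).mul (hL.riemannUp_limit hg hΩ l ν 0 μ)).add
      (tendsto_finsetSum Finset.univ fun (l : Fin (m + 1)) _ => (hL.zeroth 0 l).mul
        (((hL.chris_deriv hg hΩ 0 l μ ν).sub (hL.chris_deriv hg hΩ μ l 0 ν)).const_mul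
          (1 / 2 * eps l))))).congr fun r => ?_⟩
    rw [riemann, ← Finset.sum_sub_distrib, ← Finset.sum_add_distrib, Finset.mul_sum]
    refine Finset.sum_congr rfl fun l _ => ?_
    simp only [hs, hlin]
    ring
  have hRic := fun a b => hst.ricci_limit hm a b u hθ
  have hgR := fun a b c e => (hL.metric a b).mul (hRic c e)
  have hS := tendsto_finsetSum Finset.univ fun (a : Fin (m + 1)) _ =>
    tendsto_finsetSum Finset.univ fun (b : Fin (m + 1)) _ => (hL.inverse a b).mul (hRic a b)
  have hgg := ((hL.metric 0 0).mul (hL.metric ν μ)).sub ((hL.metric 0 μ).mul (hL.metric ν 0))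
  have hW := (hA.sub (((((hgR 0 0 ν μ).sub (hgR 0 μ ν 0)).sub (hgR ν 0 0 μ)).add
    (hgR ν μ 0 0)).const_mul (1 / ((m : ℝ) - 1)))).add
    ((hS.div_const ((m : ℝ) * ((m : ℝ) - 1))).mul hgg)
  -- The quadratic part of the Riemann tensor and all Ricci terms in the Weyl tensor are of order `d
  -- - 2`. One power of `1/r` is to spare, so they do not reach Coulombic order.
  have h0 := (tendsto_rpow_neg_atTop (show (0 : ℝ) < 1 by norm_num)).mul hW
  rw [zero_mul] at h0
  have h2 := (h1.coeff_of_tendsto (K := coulombic m) (ρ := 0) (h0.congr' ?_)).2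
  · rw [coeffs_apply _ _ _ hθ] at h2
    rw [tidC_apply]
    simp only [ScriFun.sub_apply, ScriFun.add_apply]
    linarith
  · filter_upwards [hΩ, eventually_gt_atTop 0] with r hr hr0
    have e1 : r ^ (((coulombic m : ℤ) : ℝ) / 2) = r ^ (-1 : ℝ) * (s r * s r) := by
      rw [hs, ← Real.rpow_add hr0, ← Real.rpow_add hr0]
      congr 1
      unfold coulombic
      push_cast
      ring
    have e2 : ∑ l, minkowski m 0 l * lin l r = -(1 / 2) *
        (pd 0 (pd 0 fun Y => g Y μ ν) (event u r θ) + pd μ (pd ν fun Y => g Y 0 0) (event u r θ) -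
          pd 0 (pd μ fun Y => g Y 0 ν) (event u r θ) -
          pd 0 (pd ν fun Y => g Y 0 μ) (event u r θ)) := by
      rw [sum_minkowski_single, hlin]
      simp only [hg.pd_chris hr, eps_zero]
      ring
    have e3 : ∀ t : ℝ, ∑ a, ∑ b, (g (event u r θ))⁻¹ a b * (t * ricci g a b (event u r θ)) =
        t * scalarCurvature g (event u r θ) := by
      intro t
      simp only [scalarCurvature, Finset.mul_sum]
      exact Finset.sum_congr rfl fun a _ => Finset.sum_congr rfl fun b _ => by ring
    rw [e1, e2, e3, electricWeyl, weyl]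
    simp only [hs]
    ring

end IsRadiatingSpacetime

end

end NullMemory

/-! ### Primitives in retarded time, time slices, and convergence with derivatives on the sphere -/

namespace NullMemory

noncomputable section

variable {m : ℕ}

section Parametric

variable {E : Type} [NormedAddCommGroup E] [NormedSpace ℝ E] [LocallyCompactSpace E]

lemma hasFDerivAt_parametric_integral {G : Type} [NormedAddCommGroup G] [NormedSpace ℝ G]
    {U : Set E} (hU : IsOpen U) {F : E × ℝ → G} (hF : ContDiffOn ℝ 1 F (U ×ˢ Set.univ))
    {x : E} (hx : x ∈ U) :
    HasFDerivAt (fun x => ∫ t in (0 : ℝ)..1, F (x, t))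
      (∫ t in (0 : ℝ)..1, (fderiv ℝ F (x, t)).comp (ContinuousLinearMap.inl ℝ E ℝ)) x := by
  have hO : IsOpen (U ×ˢ (Set.univ : Set ℝ)) := hU.prod isOpen_univ
  have hd : ContinuousOn (fun p => (fderiv ℝ F p).comp (ContinuousLinearMap.inl ℝ E ℝ))
      (U ×ˢ Set.univ) :=
    ((hF.continuousOn_fderiv_of_isOpen hO le_rfl)).clm_comp continuousOn_const
  have hslice : ∀ y ∈ U, ∀ {H : Type} [TopologicalSpace H] (f : E × ℝ → H),
      ContinuousOn f (U ×ˢ Set.univ) → Continuous fun t => f (y, t) := fun y hy H _ f hf =>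
    hf.comp_continuous (by fun_prop) fun t => ⟨hy, trivial⟩
  obtain ⟨K, hK, hxK, hKU⟩ := exists_compact_subset hU hx
  obtain ⟨C, hC⟩ := (hK.prod (isCompact_Icc (a := (0 : ℝ)) (b := 1))).exists_bound_of_continuousOn
    (hd.mono (Set.prod_mono hKU (Set.subset_univ _)))
  refine (intervalIntegral.hasFDerivAt_integral_of_dominated_of_fderiv_le
    (F' := fun x t => (fderiv ℝ F (x, t)).comp (ContinuousLinearMap.inl ℝ E ℝ))
    (bound := fun _ => C) (mem_interior_iff_mem_nhds.1 hxK) ?_ ?_ ?_ ?_ ?_ ?_)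
  · filter_upwards [hU.mem_nhds hx] with y hy
    exact (hslice y hy F hF.continuousOn).aestronglyMeasurable
  · exact (hslice x hx F hF.continuousOn).intervalIntegrable _ _
  · exact (hslice x hx _ hd).aestronglyMeasurable
  · refine Eventually.of_forall fun t ht y hy => hC (y, t) ⟨hy, ?_⟩
    rw [Set.uIoc_of_le zero_le_one] at ht
    exact ⟨ht.1.le, ht.2⟩
  · exact intervalIntegrable_const
  · refine Eventually.of_forall fun t _ y hy => ?_
    have h1 : HasFDerivAt F (fderiv ℝ F (y, t)) (y, t) :=
      ((hF.contDiffAt (hO.mem_nhds ⟨hKU hy, trivial⟩)).differentiableAt one_ne_zero).hasFDerivAt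
    exact h1.comp y (hasFDerivAt_prodMk_left y t)

lemma contDiffOn_parametric_integral {U : Set E} (hU : IsOpen U) (n : ℕ) :
    ∀ {G : Type} [NormedAddCommGroup G] [NormedSpace ℝ G] {F : E × ℝ → G},
      ContDiffOn ℝ ∞ F (U ×ˢ Set.univ) →
      ContDiffOn ℝ n (fun x => ∫ t in (0 : ℝ)..1, F (x, t)) U := by
  have hO : IsOpen (U ×ˢ (Set.univ : Set ℝ)) := hU.prod isOpen_univ
  have h1 : (1 : WithTop ℕ∞) ≤ ∞ := by exact_mod_cast le_top
  induction n with
  | zero =>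
    intro G _ _ F hF
    rw [Nat.cast_zero, contDiffOn_zero]
    exact fun x hx => (hasFDerivAt_parametric_integral hU (hF.of_le h1)
      hx).continuousAt.continuousWithinAt
  | succ n ih =>
    intro G _ _ F hF
    rw [Nat.cast_succ, contDiffOn_succ_iff_fderiv_of_isOpen hU]
    refine ⟨fun x hx => (hasFDerivAt_parametric_integral hU (hF.of_le h1)
      hx).differentiableAt.differentiableWithinAt, by simp, ?_⟩
    refine (ih (F := fun p => (fderiv ℝ F p).comp (ContinuousLinearMap.inl ℝ E ℝ))
      ((hF.fderiv_of_isOpen hO (by simp)).clm_comp contDiffOn_const)).congr fun x hx => ?_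
    exact (hasFDerivAt_parametric_integral hU (hF.of_le h1) hx).fderiv

end Parametric

variable [NeZero m]

open ScriFun

/-- The primitive in retarded time. -/
def primU (c : ScriFun m) : ScriFun m :=
  -- The integral from `0` to `u` is rescaled to the fixed interval `[0, 1]`, so that joint
  -- smoothness in `(u, y)` follows by differentiating under the integral.
  ⟨fun p => ∫ t in (0 : ℝ)..1, p.1 * c (t * p.1, p.2), fun u y => by simp only [apply_pt], by
    rw [contDiffOn_infty]
    intro n
    refine contDiffOn_parametric_integral isOpen_punctured n
      (F := fun q : (ℝ × Space m) × ℝ => q.1.1 * c (q.2 * q.1.1, q.1.2)) ?_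
    refine ContDiffOn.mul (by fun_prop) ?_
    exact (ScriFun.contDiffOn c).comp (by fun_prop) fun q hq => hq.1⟩

lemma primU_apply (c : ScriFun m) (u : ℝ) (y : Space m) :
    primU c (u, y) = ∫ s in (0 : ℝ)..u, c (s, y) := by
  change ∫ t in (0 : ℝ)..1, u * c (t * u, y) = _
  rw [intervalIntegral.integral_const_mul,
    intervalIntegral.mul_integral_comp_mul_right (f := fun s => c (s, y)) u, zero_mul, one_mul]

lemma continuous_slice (c : ScriFun m) (y : Space m) : Continuous fun s => c (s, y) :=
  continuous_iff_continuousAt.2 fun u => (hasDerivAt_dU c u y).continuousAt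

lemma integral_eq_primU (c : ScriFun m) (a b : ℝ) (y : Space m) :
    ∫ s in a..b, c (s, y) = primU c (b, y) - primU c (a, y) := by
  rw [primU_apply, primU_apply]
  exact (intervalIntegral.integral_interval_sub_left
    ((continuous_slice c y).intervalIntegrable _ _)
    ((continuous_slice c y).intervalIntegrable _ _)).symm

lemma dU_primU (c : ScriFun m) : dU (primU c) = c := by
  refine ext_sphere fun u θ _ => (hasDerivAt_dU (primU c) u θ).unique ?_
  simp only [primU_apply]
  exact (continuous_slice c θ).integral_hasStrictDerivAt 0 u |>.hasDerivAt

/-- The restriction to a fixed retarded time. -/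
def sec (u : ℝ) : ScriFun m →ₐ[ℝ] ScriFun m where
  toFun c := ⟨fun p => c (u, p.2), fun _ y => apply_pt c u y,
    (ScriFun.contDiffOn c).comp (by fun_prop) fun _ hp => hp⟩
  map_one' := rfl
  map_mul' _ _ := rfl
  map_zero' := rfl
  map_add' _ _ := rfl
  commutes' _ := rfl

lemma sec_apply (u : ℝ) (c : ScriFun m) (p : ℝ × Space m) : sec u c p = c (u, p.2) := rfl

lemma D_eq_fderiv_slice (c : ScriFun m) (k : Fin m) (u : ℝ) {y : Space m} (hy : y ≠ 0) :
    D k c (u, y) = ‖y‖ * fderiv ℝ (fun y => c (u, y)) y (EuclideanSpace.single k 1) := by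
  have h1 := ((ScriFun.differentiableAt c (p := (u, y)) hy).hasFDerivAt.comp y
    (hasFDerivAt_prodMk_right u y)).fderiv
  have h2 : fderiv ℝ (fun y => c (u, y)) y (EuclideanSpace.single k 1) =
      fderiv ℝ c (u, y) (0, EuclideanSpace.single k 1) := by
    change fderiv ℝ ((c : ℝ × Space m → ℝ) ∘ Prod.mk u) y _ = _
    rw [h1]
    rfl
  rw [h2, D, along_eq _ _ _ hy, show (((0 : ℝ), EuclideanSpace.single k 1) : ℝ × Space m).1 = 0
    from rfl, show ((0 : ℝ), ‖y‖ • (EuclideanSpace.single k 1 : Space m)) =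
    ‖y‖ • (0, EuclideanSpace.single k 1) by simp, map_smul, smul_eq_mul]

lemma D_sec (k : Fin m) (u : ℝ) (c : ScriFun m) : D k (sec u c) = sec u (D k c) := by
  refine ext_sphere fun v θ hθ => ?_
  have h0 := ne_zero_of_norm_one hθ
  rw [D_eq_fderiv_slice _ _ _ h0, sec_apply, D_eq_fderiv_slice _ _ _ h0]
  rfl

lemma radialExt_eventuallyEq {f : Space m → ℝ} {c : ScriFun m} {u : ℝ}
    (h : ∀ θ : Space m, ‖θ‖ = 1 → f θ = c (u, θ)) {y : Space m} (hy : y ≠ 0) :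
    radialExt f =ᶠ[𝓝 y] fun y => c (u, y) := by
  filter_upwards [isOpen_ne.mem_nhds hy] with z hz
  rw [radialExt, h _ (norm_dir hz), ← pt_of_ne hz, apply_pt]

lemma D_eq_spatialDeriv {f : Space m → ℝ} {c : ScriFun m} {u : ℝ}
    (h : ∀ θ : Space m, ‖θ‖ = 1 → f θ = c (u, θ)) (k : Fin m) {θ : Space m} (hθ : ‖θ‖ = 1) :
    D k c (u, θ) = spatialDeriv k (radialExt f) θ := by
  rw [D_eq_fderiv_slice _ _ _ (ne_zero_of_norm_one hθ), hθ, one_mul, spatialDeriv,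
    (radialExt_eventuallyEq h (ne_zero_of_norm_one hθ)).fderiv_eq]

/-- The first summand comes from differentiating the weight `‖y‖` that relates `D k` to a flat
derivative. It lets the flat derivatives in `TendstoSmoothly` control iterated angular ones. -/
lemma D_D_eq {f : Space m → ℝ} {c : ScriFun m} {u : ℝ}
    (h : ∀ θ : Space m, ‖θ‖ = 1 → f θ = c (u, θ)) (k l : Fin m) {θ : Space m} (hθ : ‖θ‖ = 1) :
    D l (D k c) (u, θ) = θ l * spatialDeriv k (radialExt f) θ +
      fderiv ℝ (fderiv ℝ (radialExt f)) θ (EuclideanSpace.single l 1)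
        (EuclideanSpace.single k 1) := by
  have h0 := ne_zero_of_norm_one hθ
  have h1 : (fun y => D k c (u, y)) =ᶠ[𝓝 θ] fun y =>
      ‖y‖ * fderiv ℝ (radialExt f) y (EuclideanSpace.single k 1) := by
    filter_upwards [isOpen_ne.mem_nhds h0] with y hy
    rw [D_eq_fderiv_slice _ _ _ hy, (radialExt_eventuallyEq h hy).fderiv_eq]
  have h2 : ContDiffAt ℝ ∞ (radialExt f) θ :=
    (((ScriFun.contDiffAt c (p := (u, θ)) h0).comp θ
      (by fun_prop : ContDiffAt ℝ ∞ (Prod.mk u) θ))).congr_of_eventuallyEq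
      (radialExt_eventuallyEq h h0)
  have h3 : DifferentiableAt ℝ (fderiv ℝ (radialExt f)) θ :=
    (h2.fderiv_right (m := 1) (by rw [one_add_one_eq_two]; exact two_le_infty)).differentiableAt one_ne_zero
  have h4 := (hasFDerivAt_norm_of_norm_one hθ).mul
    (h3.hasFDerivAt.clm_apply (hasFDerivAt_const (EuclideanSpace.single k (1 : ℝ)) θ))
  rw [D_eq_fderiv_slice _ _ _ h0, hθ, one_mul, h1.fderiv_eq]
  erw [h4.fderiv]
  simp [hθ, spatialDeriv, EuclideanSpace.inner_single_right]
  ring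

/-- Pointwise convergence on the sphere together with the derivatives up to order `n`. -/
def TendstoSphere {ι : Type*} (l : Filter ι) : ℕ → (ι → ScriFun m) → ScriFun m → Prop
  | 0, c, e => ∀ θ : Space m, ‖θ‖ = 1 → Tendsto (fun s => c s (0, θ)) l (𝓝 (e (0, θ)))
  | n + 1, c, e => TendstoSphere l n c e ∧ ∀ k, TendstoSphere l n (fun s => D k (c s)) (D k e)

namespace TendstoSphere

variable {ι : Type*} {l : Filter ι} {n : ℕ} {c c' : ι → ScriFun m} {e e' : ScriFun m}

lemma zeroth : ∀ {n : ℕ}, TendstoSphere l n c e → ∀ θ : Space m, ‖θ‖ = 1 →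
    Tendsto (fun s => c s (0, θ)) l (𝓝 (e (0, θ)))
  | 0, h => h
  | _ + 1, h => zeroth h.1

lemma add : ∀ {n : ℕ} {c c' : ι → ScriFun m} {e e' : ScriFun m}, TendstoSphere l n c e →
    TendstoSphere l n c' e' → TendstoSphere l n (fun s => c s + c' s) (e + e')
  | 0, _, _, _, _, h, h' => fun θ hθ => (h θ hθ).add (h' θ hθ)
  | _ + 1, _, _, _, _, h, h' => ⟨h.1.add h'.1, fun k => by
      simpa only [map_add] using (h.2 k).add (h'.2 k)⟩

lemma mul_left : ∀ {n : ℕ} (a : ScriFun m) {c : ι → ScriFun m} {e : ScriFun m},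
    TendstoSphere l n c e → TendstoSphere l n (fun s => a * c s) (a * e)
  | 0, a, _, _, h => fun θ hθ => (h θ hθ).const_mul (a (0, θ))
  | _ + 1, a, _, _, h => ⟨mul_left a h.1, fun k => by
      have h1 := (mul_left a (h.2 k)).add (mul_left (D k a) h.1)
      simpa only [Derivation.leibniz, smul_eq_mul, mul_comm (D k a)] using h1⟩

lemma zero : ∀ {n : ℕ}, TendstoSphere l n (fun _ : ι => (0 : ScriFun m)) 0
  | 0 => fun _ _ => tendsto_const_nhds
  | _ + 1 => ⟨zero, fun k => by simpa only [map_zero] using zero⟩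

lemma sum {κ : Type*} (s : Finset κ) {c : κ → ι → ScriFun m} {e : κ → ScriFun m}
    (h : ∀ k ∈ s, TendstoSphere l n (c k) (e k)) :
    TendstoSphere l n (fun i => ∑ k ∈ s, c k i) (∑ k ∈ s, e k) := by
  classical
  induction s using Finset.induction_on with
  | empty => simpa using zero
  | insert a s ha ih =>
    simp only [Finset.sum_insert ha]
    exact (h a (Finset.mem_insert_self a s)).add
      (ih fun k hk => h k (Finset.mem_insert_of_mem hk))

end TendstoSphere

/-- Two angular derivatives are kept because `constraint` is a second order operator. -/
lemma TendstoSmoothly.tendstoSphere {ι : Type*} {F : ι → Space m → ℝ} {l : Filter ι}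
    {f : Space m → ℝ} (h : TendstoSmoothly F l f) {c : ι → ScriFun m} {e : ScriFun m}
    (hc : ∀ s, ∀ θ : Space m, ‖θ‖ = 1 → F s θ = c s (0, θ))
    (he : ∀ θ : Space m, ‖θ‖ = 1 → f θ = e (0, θ)) : TendstoSphere l 2 c e := by
  have h0 : ∀ θ : Space m, ‖θ‖ = 1 → Tendsto (fun s => c s (0, θ)) l (𝓝 (e (0, θ))) := by
    intro θ hθ
    simpa only [hc _ θ hθ, he θ hθ] using h.tendsto hθ
  have h1 : ∀ k, ∀ θ : Space m, ‖θ‖ = 1 →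
      Tendsto (fun s => spatialDeriv k (radialExt (F s)) θ) l
        (𝓝 (spatialDeriv k (radialExt f) θ)) := by
    intro k θ hθ
    have h1 := (h.2 1).tendsto_at (mem_unitSphere.2 hθ)
    have h2 := ((ContinuousMultilinearMap.apply ℝ (fun _ : Fin 1 => Space m) ℝ
      ![EuclideanSpace.single k 1]).continuous.tendsto _).comp h1
    simpa [Function.comp_def, iteratedFDeriv_one_apply, spatialDeriv] using h2
  have h2 : ∀ k j, ∀ θ : Space m, ‖θ‖ = 1 →
      Tendsto (fun s => fderiv ℝ (fderiv ℝ (radialExt (F s))) θ (EuclideanSpace.single j 1)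
        (EuclideanSpace.single k 1)) l
        (𝓝 (fderiv ℝ (fderiv ℝ (radialExt f)) θ (EuclideanSpace.single j 1)
        (EuclideanSpace.single k 1))) := by
    intro k j θ hθ
    have h1 := (h.2 2).tendsto_at (mem_unitSphere.2 hθ)
    have h2 := ((ContinuousMultilinearMap.apply ℝ (fun _ : Fin 2 => Space m) ℝ
      ![EuclideanSpace.single j 1, EuclideanSpace.single k 1]).continuous.tendsto _).comp h1
    simpa [Function.comp_def, iteratedFDeriv_two_apply] using h2
  have d1 : ∀ k, ∀ θ : Space m, ‖θ‖ = 1 →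
      Tendsto (fun s => D k (c s) (0, θ)) l (𝓝 (D k e (0, θ))) := by
    intro k θ hθ
    simpa only [D_eq_spatialDeriv (hc _) k hθ, D_eq_spatialDeriv he k hθ] using h1 k θ hθ
  refine ⟨⟨h0, d1⟩, fun k => ⟨d1 k, fun j θ hθ => ?_⟩⟩
  simpa only [D_D_eq (hc _) k j hθ, D_D_eq he k j hθ] using
    ((h1 k θ hθ).const_mul (θ j)).add (h2 k j θ hθ)

lemma TendstoSphere.constraint {ι : Type*} {l : Filter ι} {c : ι → Fin m → Fin m → ScriFun m}
    {e : Fin m → Fin m → ScriFun m} (h : ∀ i j, TendstoSphere l 2 (fun s => c s i j) (e i j))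
    (j : Fin m) : TendstoSphere l 0 (fun s => constraint (c s) j) (constraint e j) := by
  have h1 : TendstoSphere l 2 (fun s => ∑ i, th i * c s i j) (∑ i, th i * e i j) :=
    TendstoSphere.sum _ fun i _ => TendstoSphere.mul_left (th i) (h i j)
  have h2 : TendstoSphere l 0 (fun s => lap (∑ i, th i * c s i j)) (lap (∑ i, th i * e i j)) := by
    simp only [lap_apply]
    exact TendstoSphere.sum _ fun k _ => (h1.2 k).2 k
  have h3 : TendstoSphere l 0 (fun s => ∑ i, D i (c s i j)) (∑ i, D i (e i j)) :=
    TendstoSphere.sum _ fun i _ => ((h i j).2 i).1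
  have h4 := h2.add (TendstoSphere.mul_left (cst ((m : ℝ) - 3))
    (h3.add (TendstoSphere.mul_left (-cst ((m : ℝ) - 1)) h1.1.1)))
  have e2 : ∀ x y z w v : ScriFun m, x + y * (z + -w * v) = x + y * (z - w * v) :=
    fun x y z w v => by ring
  simpa only [NullMemory.constraint, e2] using h4

end

end NullMemory

/-! ### The field equations satisfied by the memory tensor -/

namespace NullMemory

noncomputable section

variable {m : ℕ} [NeZero m]

open ScriFun

/-- A quadratic polynomial whose increments converge is constant. -/
lemma limit_increment_eq_zero {G : ScriFun m} (hG : dU (dU (dU G)) = 0) {θ : Space m} {ℓ : ℝ}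
    (h : Tendsto (fun p : ℝ × ℝ => G (p.1, θ) - G (p.2, θ)) (atBot ×ˢ atTop) (𝓝 ℓ)) : ℓ = 0 := by
  obtain ⟨K, b, a, hq⟩ : ∃ K b a : ℝ, ∀ u, G (u, θ) = K * u * u + b * u + a := by
    refine ⟨dU (dU G) (0, θ) / 2, dU G (0, θ), G (0, θ), fun u => ?_⟩
    have hK : ∀ u, dU (dU G) (u, θ) = dU (dU G) (0, θ) := fun u => apply_of_dU hG u 0 θ
    set K := dU (dU G) (0, θ)
    have h1 : ∀ u, dU G (u, θ) = dU G (0, θ) + K * u := by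
      intro u
      have h2 := is_const_of_deriv_eq_zero (f := fun u => dU G (u, θ) - K * u)
        (fun u => ((hasDerivAt_dU (dU G) u θ).sub ((hasDerivAt_id u).const_mul K)).differentiableAt)
        (fun u => by
          refine ((hasDerivAt_dU (dU G) u θ).sub ((hasDerivAt_id u).const_mul K)).deriv.trans ?_
          rw [hK]
          ring) u 0
      simp only [mul_zero, sub_zero] at h2
      linarith
    have hd : ∀ u, HasDerivAt (fun u => G (u, θ) - (K / 2 * (u * u) + dU G (0, θ) * u)) 0 u := by
      intro u
      have := (hasDerivAt_dU G u θ).sub ((((hasDerivAt_id u).mul (hasDerivAt_id u)).const_mul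
        (K / 2)).add ((hasDerivAt_id u).const_mul (dU G (0, θ))))
      refine this.congr_deriv ?_
      simp only [id]
      rw [h1]
      ring
    have h2 := is_const_of_deriv_eq_zero (fun u => (hd u).differentiableAt)
      (fun u => (hd u).deriv) u 0
    simp only [mul_zero, add_zero, sub_zero] at h2
    linarith
  -- Any pair of paths to the two ends yields the same limit, so the offset `s` is free. A second
  -- difference in `s` isolates the quadratic coefficient and a first difference the linear one.
  have hlim : ∀ s : ℝ, Tendsto (fun u : ℝ => G (-u, θ) - G (u + s, θ)) atTop (𝓝 ℓ) := fun s =>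
    h.comp (tendsto_neg_atTop_atBot.prodMk (tendsto_atTop_add_const_right _ s tendsto_id))
  have hconst : ∀ (f : ℝ → ℝ) (x y : ℝ), (∀ u, f u = x) → Tendsto f atTop (𝓝 y) → x = y :=
    fun f x y hf ht => tendsto_nhds_unique (tendsto_const_nhds.congr fun u => (hf u).symm) ht
  have hK := hconst _ (-2 * K) _ (fun u => by
    simp only [hq]
    ring) (((hlim 2).sub ((hlim 1).const_mul 2)).add (hlim 0))
  have hK0 : K = 0 := by linarith
  have hb := hconst _ (-b) _ (fun u => by
    simp only [hq, hK0]
    ring) ((hlim 1).sub (hlim 0))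
  have hb0 : b = 0 := by linarith
  exact (hconst _ 0 _ (fun u => by
    simp only [hq, hK0, hb0]
    ring) (hlim 0)).symm

lemma sec_th (u : ℝ) (i : Fin m) : sec u (th i) = th i := rfl

lemma sec_cst (u : ℝ) (a : ℝ) : sec u (cst a : ScriFun m) = cst a := rfl

lemma sec_Lc (u : ℝ) (l : Fin (m + 1)) : sec u (Lc l : ScriFun m) = Lc l := by
  refine Fin.cases rfl (fun i => rfl) l

lemma sec_constraint (u : ℝ) (E : Fin m → Fin m → ScriFun m) (j : Fin m) :
    constraint (fun i j => sec u (E i j)) j = sec u (constraint E j) := by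
  simp only [constraint, lap_apply, map_add, map_sum, map_mul, map_sub, ← D_sec, sec_th, sec_cst]

lemma constraint_sub (E E' : Fin m → Fin m → ScriFun m) (j : Fin m) :
    constraint (fun i j => E i j - E' i j) j = constraint E j - constraint E' j := by
  simp only [constraint, mul_sub, Finset.sum_sub_distrib, map_sub]
  ring

lemma constraint_cst_mul (a : ℝ) (E : Fin m → Fin m → ScriFun m) (j : Fin m) :
    constraint (fun i j => cst a * E i j) j = cst a * constraint E j := by
  have h1 : ∀ x y : ScriFun m, x * (cst a * y) = cst a * (x * y) := fun x y => by ring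
  simp only [constraint, h1, ← Finset.mul_sum, lap_cst_mul, Derivation.leibniz, D_cst, smul_eq_mul,
    mul_zero, add_zero]
  ring

lemma dU_constraint_apply (E : Fin m → Fin m → ScriFun m) (j : Fin m) :
    dU (constraint E j) = constraint (fun i j => dU (E i j)) j := by
  simp only [constraint]
  have h1 := dU_cst (m := m) ((m : ℝ) - 3)
  have h2 := dU_cst (m := m) ((m : ℝ) - 1)
  generalize (cst ((m : ℝ) - 3) : ScriFun m) = a at h1 ⊢
  generalize (cst ((m : ℝ) - 1) : ScriFun m) = b at h2 ⊢
  simp only [map_add, map_sub, map_sum, Derivation.leibniz, dU_lap, dU_D, dU_th, h1, h2,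
    smul_eq_mul, mul_zero, add_zero]

namespace IsRadiatingSpacetime

variable {Ω : Set (Event m)} {g T : TensorField m} {h τ : TensorCoeff m}
  (hst : IsRadiatingSpacetime Ω g T h τ)

include hst

lemma tendstoSphere_dU_coeff {l : Filter ℝ} (hl : l = atBot ∨ l = atTop) (a b : Fin (m + 1)) {k : ℤ}
    (hk : k ≤ coulombic m) : TendstoSphere l 2 (fun u => sec u (dU (hst.coeff a b k))) 0 := by
  have h1 : ∀ u, ∀ θ : Space m, ‖θ‖ = 1 →
      deriv (fun s => h a b k s θ) u = sec u (dU (hst.coeff a b k)) (0, θ) := by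
    intro u θ hθ
    rw [sec_apply, ← (hasDerivAt_dU (hst.coeff a b k) u θ).deriv]
    simp only [hst.coeff_apply _ _ _ _ hθ]
  rcases hl with rfl | rfl
  · exact (hst.stationary_early a b k hk).tendstoSphere h1 fun _ _ => rfl
  · exact (hst.stationary_late a b k hk).tendstoSphere h1 fun _ _ => rfl

/-- The potential is built from the stationary null part times `∂_u h` at radiative order, with at
most one angular derivative. As `∂_u h` tends to zero smoothly on the sphere at both ends, so does
the potential. -/
lemma tendsto_sourcePotential (hm : 3 ≤ m) {l : Filter ℝ} (hl : l = atBot ∨ l = atTop) (j : Fin m)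
    {θ : Space m} (hθ : ‖θ‖ = 1) :
    Tendsto (fun u => sourcePotential (fun a b => hst.coeff a b ((m : ℤ) - 1)) j (u, θ)) l (𝓝 0) := by
  set N := nullPart fun a b => hst.coeff a b ((m : ℤ) - 1) with hN
  have hsN : ∀ u, sec u N = sec 0 N := fun u => ext_sphere fun v θ _ =>
    apply_of_dU (hst.dU_nullPart_coeff hm) u 0 θ
  set Q : Fin m → ScriFun m := fun i =>
    gaugeProj (fun a b => dU (hst.coeff a b ((m : ℤ) - 1))) i.succ j.succ with hQ
  have hc := fun a b => hst.tendstoSphere_dU_coeff hl a b (k := (m : ℤ) - 1)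
    (by unfold coulombic; omega)
  have h1 : ∀ i, TendstoSphere l 2 (fun u => sec u (N * Q i)) 0 := by
    intro i
    have h2 := (((hc i.succ j.succ).add ((hc 0 0).mul_left (Lc i.succ * Lc j.succ))).add
      ((hc 0 j.succ).mul_left (-Lc i.succ))).add ((hc 0 i.succ).mul_left (-Lc j.succ))
    have h3 := h2.mul_left (sec 0 N)
    have e : ∀ a b c d x y z : ScriFun m, z * (a + x * y * b + -x * c + -y * d) =
      z * (a + x * y * b - x * c - y * d) := fun a b c d x y z => by ring
    simpa only [mul_zero, add_zero, hQ, gaugeProj, map_mul, map_add, map_sub, sec_Lc, hsN, e]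
      using h3
  have h2 : TendstoSphere l 0 (fun u => ∑ i, D i (sec u (N * Q i))) (∑ i : Fin m, D i 0) :=
    TendstoSphere.sum _ fun i _ => ((h1 i).2 i).1
  have h3 : TendstoSphere l 0 (fun u => ∑ i, th i * sec u (N * Q i)) (∑ i : Fin m, th i * 0) :=
    TendstoSphere.sum _ fun i _ => (h1 i).1.1.mul_left (th i)
  have h4 := h2.add (h3.mul_left (-cst ((m : ℝ) - 1))) θ hθ
  simp only [map_zero, mul_zero, Finset.sum_const_zero, add_zero] at h4
  refine h4.congr fun u => ?_
  have e : ∑ i, D i (sec u (N * Q i)) + -cst ((m : ℝ) - 1) * ∑ i, th i * sec u (N * Q i) =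
      sec u (sourcePotential (fun a b => hst.coeff a b ((m : ℤ) - 1)) j) := by
    have e1 : ∀ x y z : ScriFun m, x + -y * z = x - y * z := fun x y z => by ring
    simp only [e1, sourcePotential, ← hN, map_sub, map_sum, map_mul, sec_th, sec_cst, ← D_sec]
    rfl
  rw [e]
  rfl

/-- The memory tensor as a limit of differences of a double primitive of the Weyl tensor. -/
lemma exists_double_primitive (hm : 3 ≤ m)
    {Δ : Space m → Matrix (Fin (m + 1)) (Fin (m + 1)) ℝ} (hΔ : IsMemoryTensor g Δ)
    {M : Fin m → Fin m → ScriFun m}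
    (hM : ∀ i j, ∀ θ : Space m, ‖θ‖ = 1 → Δ θ i.succ j.succ = M i j (0, θ)) :
    ∃ F : Fin m → Fin m → ScriFun m,
      (∀ i j, dU (dU (F i j)) = cst (-(1 / 2)) * tidC hst.coeff i.succ j.succ (coulombic m)) ∧
      ∀ i j, TendstoSphere (atBot ×ˢ atTop)
        2 (fun p : ℝ × ℝ => sec p.1 (F i j) - sec p.2 (F i j)) (M i j) := by
  obtain ⟨c, V, hc, hV, hΔ⟩ := hΔ
  set e : Fin m → Fin m → ScriFun m := fun i j =>
    cst (-(1 / 2)) * tidC hst.coeff i.succ j.succ (coulombic m) with he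
  have hce : ∀ i j u, ∀ θ : Space m, ‖θ‖ = 1 →
      c i.succ j.succ (coulombic m) u θ = e i j (u, θ) := fun i j u θ hθ =>
    hst.weyl_coeff hm i.succ j.succ (hc _ _) u hθ
  -- The inner integral from `-∞` differs from the primitive based at `u = 0` by its value at `0`, a
  -- smooth function on the sphere.
  set v : Fin m → Fin m → ScriFun m := fun i j => ofSphere _ (hV i.succ j.succ 0).1 with hv
  have hVe : ∀ i j u, ∀ θ : Space m, ‖θ‖ = 1 →
      V i.succ j.succ u θ = primU (e i j) (u, θ) + v i j (u, θ) := by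
    intro i j u θ hθ
    have h1 := (hV i.succ j.succ u).tendsto hθ
    have h2 := (hV i.succ j.succ 0).tendsto hθ
    simp only [hce i j _ θ hθ, integral_eq_primU] at h1 h2
    have h3 := h1.sub h2
    have h4 := tendsto_nhds_unique h3 (tendsto_const_nhds.congr fun a => by
      rw [sub_sub_sub_cancel_right])
    have h5 : primU (e i j) (0, θ) = 0 := by
      rw [primU_apply, intervalIntegral.integral_same]
    rw [hv, ofSphere_apply _ _ _ hθ]
    linarith
  refine ⟨fun i j => primU (primU (e i j) + v i j), fun i j => ?_, fun i j => ?_⟩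
  · rw [dU_primU, map_add, dU_primU, hv, dU_ofSphere, add_zero]
  · refine (hΔ i.succ j.succ).tendstoSphere (fun p θ hθ => ?_) (hM i j)
    simp only [hVe i j _ θ hθ]
    rw [ScriFun.sub_apply, sec_apply, sec_apply]
    have := integral_eq_primU (primU (e i j) + v i j) p.1 p.2 θ
    simp only [ScriFun.add_apply] at this
    rw [this]
    ring

/-- The constraint on the memory tensor. -/
theorem constraint_memory (hm : 3 ≤ m)
    {Δ : Space m → Matrix (Fin (m + 1)) (Fin (m + 1)) ℝ} (hΔ : IsMemoryTensor g Δ)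
    {M : Fin m → Fin m → ScriFun m} (hMu : ∀ i j, dU (M i j) = 0)
    (hM : ∀ i j, ∀ θ : Space m, ‖θ‖ = 1 → Δ θ i.succ j.succ = M i j (0, θ)) (j : Fin m) :
    constraint M j = 0 := by
  obtain ⟨F, hF, hlim⟩ := hst.exists_double_primitive hm hΔ hM
  have hu : dU (constraint M j) = 0 := by
    rw [dU_constraint_apply]
    simp [constraint, hMu]
  refine ext_sphere fun u θ hθ => ?_
  rw [apply_of_dU hu u 0 θ]
  set P := sourcePotential (fun a b => hst.coeff a b ((m : ℤ) - 1)) j with hP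
  have h1 := TendstoSphere.constraint hlim j θ hθ
  simp only [constraint_sub, sec_constraint] at h1
  -- The third `u`-derivative of `constraint F` is `-1/2` times that of the source potential, the
  -- factor coming from the Weyl coefficient. Adding half the potential cancels it, and its
  -- increments tend to zero, so the limit is still the constraint on the memory.
  refine limit_increment_eq_zero (G := constraint F j + cst (1 / 2) * P) (θ := θ) ?_ ?_
  · have e1 : dU (dU (dU (constraint F j))) = cst (-(1 / 2)) * dU (dU (dU P)) := by
      rw [dU_constraint_apply, dU_constraint_apply]
      simp only [hF]
      rw [constraint_cst_mul, Derivation.leibniz, dU_cst, smul_zero, add_zero, smul_eq_mul]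
      exact congrArg _ (hst.dU_constraint_tidC hm j)
    have e2 : ∀ x : ScriFun m, dU (cst (1 / 2) * x) = cst (1 / 2) * dU x := fun x => by
      rw [Derivation.leibniz, dU_cst, smul_zero, add_zero, smul_eq_mul]
    simp only [Derivation.map_add, e2]
    rw [e1, ← add_mul, ← map_add]
    norm_num
  · have h2 := (((hst.tendsto_sourcePotential hm (Or.inl rfl) j hθ).comp
      (tendsto_fst (f := atBot) (g := (atTop : Filter ℝ)))).sub
      ((hst.tendsto_sourcePotential hm (Or.inr rfl) j hθ).comp
      (tendsto_snd (f := (atBot : Filter ℝ)) (g := atTop)))).const_mul (1 / 2)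
    rw [sub_zero, mul_zero] at h2
    have h3 := h1.add h2
    rw [add_zero] at h3
    refine h3.congr fun p => ?_
    simp only [ScriFun.sub_apply, ScriFun.add_apply, ScriFun.mul_apply, sec_apply, Function.comp,
      ← hP]
    have : ∀ q, (cst (1 / 2) : ScriFun m) q = 1 / 2 := fun q => rfl
    rw [this, this]
    ring

/-- In four spacetime dimensions, the memory tensor is tangential. -/
theorem tangential_memory (hm : m = 3)
    {Δ : Space m → Matrix (Fin (m + 1)) (Fin (m + 1)) ℝ} (hΔ : IsMemoryTensor g Δ)
    {M : Fin m → Fin m → ScriFun m} (hMu : ∀ i j, dU (M i j) = 0)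
    (hM : ∀ i j, ∀ θ : Space m, ‖θ‖ = 1 → Δ θ i.succ j.succ = M i j (0, θ)) (j : Fin m) :
    ∑ i, th i * M i j = 0 := by
  obtain ⟨F, hF, hlim⟩ := hst.exists_double_primitive hm.ge hΔ hM
  have hu : dU (∑ i, th i * M i j) = 0 := by
    simp [Derivation.leibniz, hMu, dU_th]
  refine ext_sphere fun u θ hθ => ?_
  rw [apply_of_dU hu u 0 θ]
  have h1 : TendstoSphere (atBot ×ˢ atTop) 0 (fun p : ℝ × ℝ => ∑ i, th i *
      (sec p.1 (F i j) - sec p.2 (F i j))) (∑ i, th i * M i j) :=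
    TendstoSphere.sum _ fun i _ => (hlim i j).1.1.mul_left (th i)
  refine limit_increment_eq_zero (G := ∑ i, th i * F i j) (θ := θ) ?_ ((h1 θ hθ).congr fun p => ?_)
  · have h2 := div_tidal_coeff hst.coeff_symm
      (fun μ ν k hk => ext_sphere fun u _ hθ => (hst.ricC_coeff hm.ge μ ν u hθ).1 k hk) j
    -- For `m = 3` this index is `0`, below the first order `m - 1 = 2` of the perturbation. The
    -- divergence identity then concerns the Coulombic coefficient alone.
    have h3 : ∀ i : Fin m, tidC hst.coeff i.succ j.succ (2 * ((m : ℤ) - 3)) = 0 := fun i =>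
      tidal_eq_zero_of_lt (hst.coeff_eq_zero hm.ge) _ _ _ (by omega)
    simp only [h3, map_zero, mul_zero, Finset.sum_const_zero, sub_zero, add_zero] at h2
    have h4 : ∀ x y : ScriFun m, x * (cst (-(1 / 2)) * y) = cst (-(1 / 2)) * (x * y) :=
      fun x y => by ring
    simp only [map_sum, Derivation.leibniz, dU_th, smul_eq_mul, mul_zero, add_zero, hF, dU_cst, h4,
      ← Finset.mul_sum]
    rw [neg_eq_zero] at h2
    exact (congrArg _ h2).trans (mul_zero _)
  · simp only [ScriFun.sum_apply, ScriFun.mul_apply, ScriFun.sub_apply, sec_apply, mul_sub,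
      Finset.sum_sub_distrib]
    simp only [th_apply _ _ hθ]

end IsRadiatingSpacetime

end

end NullMemory

namespace NullMemory

noncomputable section

variable {m : ℕ} [NeZero m]

open ScriFun

/-! ### Tensor calculus on the sphere in the ring of functions -/

lemma cst_apply (a : ℝ) (p : ℝ × Space m) : (cst a : ScriFun m) p = a := rfl

lemma D_th_apply (i j : Fin m) (u : ℝ) {θ : Space m} (hθ : ‖θ‖ = 1) :
    D i (th j) (u, θ) = sphereMetric θ i j := by
  rw [D_th, ScriFun.sub_apply, ScriFun.mul_apply, algebraMap_apply', th_apply _ _ hθ,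
    th_apply _ _ hθ, sphereMetric]

lemma gradS_eq {f : Space m → ℝ} {c : ScriFun m} {u : ℝ}
    (h : ∀ θ : Space m, ‖θ‖ = 1 → f θ = c (u, θ)) {θ : Space m} (hθ : ‖θ‖ = 1) (i : Fin m) :
    gradS f θ i = D i c (u, θ) := (D_eq_spatialDeriv h i hθ).symm

/-- The tangential projector is `D j (th k)`, and differentiated tangency evaluates the normal part
that it removes. -/
lemma covDerivS_eq {v : Space m → Fin m → ℝ} {c : Fin m → ScriFun m} {u : ℝ}
    (h : ∀ k, ∀ θ : Space m, ‖θ‖ = 1 → v θ k = c k (u, θ)) (hc : ∑ k, th k * c k = 0)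
    {θ : Space m} (hθ : ‖θ‖ = 1) (i j : Fin m) :
    covDerivS v θ i j = (D i (c j) + th j * c i) (u, θ) := by
  have h1 := sum_D_th_mul' j fun k => D i (c k)
  rw [sum_th_mul_D_of_tangent hc, show D i (c j) - th j * -c i = D i (c j) + th j * c i by ring] at h1
  rw [← h1, ScriFun.sum_apply, covDerivS]
  refine Finset.sum_congr rfl fun k _ => ?_
  rw [ScriFun.mul_apply, D_th_apply _ _ _ hθ, D_eq_spatialDeriv (h k) i hθ]

lemma hessS_eq {f : Space m → ℝ} {c : ScriFun m} {u : ℝ}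
    (h : ∀ θ : Space m, ‖θ‖ = 1 → f θ = c (u, θ)) {θ : Space m} (hθ : ‖θ‖ = 1) (i j : Fin m) :
    hessS f θ i j = hs c i j (u, θ) :=
  covDerivS_eq (fun k _ hθ => gradS_eq h hθ k) (sum_th_D c) hθ i j

lemma laplacianS_eq {f : Space m → ℝ} {c : ScriFun m} {u : ℝ}
    (h : ∀ θ : Space m, ‖θ‖ = 1 → f θ = c (u, θ)) {θ : Space m} (hθ : ‖θ‖ = 1) :
    laplacianS f θ = lap c (u, θ) := by
  rw [← sum_hs, ScriFun.sum_apply]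
  exact Finset.sum_congr rfl fun i _ => hessS_eq h hθ i i

lemma traceFreeHessS_eq {f : Space m → ℝ} {c : ScriFun m} {u : ℝ}
    (h : ∀ θ : Space m, ‖θ‖ = 1 → f θ = c (u, θ)) {θ : Space m} (hθ : ‖θ‖ = 1) (i j : Fin m) :
    traceFreeHessS f θ i j = tf c i j (u, θ) := by
  rw [traceFreeHessS, hessS_eq h hθ, laplacianS_eq h hθ, tf, ScriFun.sub_apply, ScriFun.mul_apply,
    ScriFun.mul_apply, D_th_apply _ _ _ hθ, cst_apply]
  ring

lemma symCovDerivS_eq {v : Space m → Fin m → ℝ} {c : Fin m → ScriFun m} {u : ℝ}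
    (h : ∀ k, ∀ θ : Space m, ‖θ‖ = 1 → v θ k = c k (u, θ)) (hc : ∑ k, th k * c k = 0)
    {θ : Space m} (hθ : ‖θ‖ = 1) (i j : Fin m) :
    symCovDerivS v θ i j = sg c i j (u, θ) := by
  rw [symCovDerivS, covDerivS_eq h hc hθ, covDerivS_eq h hc hθ, sg, ScriFun.mul_apply, cst_apply]
  simp only [ScriFun.add_apply]
  ring

section VectorTensor

variable {v : Space m → Fin m → ℝ} {t : Space m → Fin m → Fin m → ℝ}

/-- The components of a vector field. -/
def IsVectorType.comp (hv : IsVectorType v) (i : Fin m) : ScriFun m := ofSphere _ (hv.smooth i)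

lemma IsVectorType.comp_apply (hv : IsVectorType v) (i : Fin m) (u : ℝ) {θ : Space m}
    (hθ : ‖θ‖ = 1) : hv.comp i (u, θ) = v θ i := ofSphere_apply _ _ _ hθ

lemma IsVectorType.isVec (hv : IsVectorType v) : IsVec hv.comp := by
  have h1 : ∑ i, th i * hv.comp i = 0 := by
    refine ext_sphere fun u θ hθ => ?_
    simp only [ScriFun.sum_apply, ScriFun.mul_apply, th_apply _ _ hθ, hv.comp_apply _ _ hθ]
    exact hv.tangent θ (mem_unitSphere.2 hθ)
  refine ⟨h1, ext_sphere fun u θ hθ => ?_, fun i => dU_ofSphere _ _⟩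
  have h2 : divS v θ = (∑ i, (D i (hv.comp i) + th i * hv.comp i)) (u, θ) := by
    rw [ScriFun.sum_apply]
    exact Finset.sum_congr rfl fun i _ =>
      covDerivS_eq (fun k _ hθ => (hv.comp_apply k u hθ).symm) h1 hθ i i
  rw [Finset.sum_add_distrib, h1, add_zero, hv.divergenceFree θ (mem_unitSphere.2 hθ)] at h2
  exact h2.symm

/-- The components of a tensor field. -/
def IsTensorType.comp (ht : IsTensorType t) (i j : Fin m) : ScriFun m :=
  ofSphere _ (ht.smooth i j)

lemma IsTensorType.comp_apply (ht : IsTensorType t) (i j : Fin m) (u : ℝ) {θ : Space m}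
    (hθ : ‖θ‖ = 1) : ht.comp i j (u, θ) = t θ i j := ofSphere_apply _ _ _ hθ

lemma IsTensorType.isTen (ht : IsTensorType t) : IsTen ht.comp := by
  have hs : ∀ i j, ht.comp i j = ht.comp j i := fun i j => ext_sphere fun u θ hθ => by
    rw [ht.comp_apply _ _ _ hθ, ht.comp_apply _ _ _ hθ, ht.symm θ (mem_unitSphere.2 hθ)]
  have h1 : ∀ j, ∑ i, th i * ht.comp i j = 0 := by
    refine fun j => ext_sphere fun u θ hθ => ?_
    simp only [ScriFun.sum_apply, ScriFun.mul_apply, th_apply _ _ hθ, ht.comp_apply _ _ _ hθ]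
    exact ht.tangent θ (mem_unitSphere.2 hθ) j
  have h0 : ∑ i, ht.comp i i = 0 := by
    refine ext_sphere fun u θ hθ => ?_
    simp only [ScriFun.sum_apply, ht.comp_apply _ _ _ hθ]
    exact ht.traceFree θ (mem_unitSphere.2 hθ)
  refine ⟨hs, h1, h0, fun j => ext_sphere fun u θ hθ => ?_, fun i j => dU_ofSphere _ _⟩
  have h2 : divS₂ t θ j =
      (∑ i, ∑ a, D i (th a) * ∑ b, D j (th b) * D i (ht.comp a b)) (u, θ) := by
    simp only [ScriFun.sum_apply, ScriFun.mul_apply, D_th_apply _ _ _ hθ, divS₂, covDerivS₂,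
      Finset.mul_sum]
    refine Finset.sum_congr rfl fun i _ => Finset.sum_congr rfl fun a _ =>
      Finset.sum_congr rfl fun b _ => ?_
    rw [D_eq_spatialDeriv (fun θ hθ => (ht.comp_apply a b u hθ).symm) i hθ]
    ring
  have h3 : ∀ i a, ∑ b, D j (th b) * D i (ht.comp a b) =
      D i (ht.comp a j) + th j * ht.comp a i := by
    intro i a
    have h4 : ∑ b, th b * ht.comp a b = 0 := by
      simp only [hs a]
      exact h1 a
    rw [sum_D_th_mul' j fun b => D i (ht.comp a b), sum_th_mul_D_of_tangent h4]
    ring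
  simp only [h3] at h2
  rw [Finset.sum_comm] at h2
  have h5 : ∀ a, ∑ i, D i (th a) * (D i (ht.comp a j) + th j * ht.comp a i) =
      D a (ht.comp a j) + th j * ht.comp a a := by
    intro a
    rw [sum_D_th_mul a fun i => D i (ht.comp a j) + th j * ht.comp a i]
    have h6 : ∀ i, th i * (D i (ht.comp a j) + th j * ht.comp a i) =
        th i * D i (ht.comp a j) + th j * (th i * ht.comp i a) := fun i => by
      rw [hs a i]
      ring
    simp only [h6, Finset.sum_add_distrib, sum_th_D, ← Finset.mul_sum, h1]
    ring
  simp only [h5, Finset.sum_add_distrib, ← Finset.mul_sum, h0, mul_zero, add_zero] at h2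
  rw [ht.divergenceFree θ (mem_unitSphere.2 hθ)] at h2
  exact h2.symm

end VectorTensor

/-! ### The decomposition of memory -/

omit [NeZero m] in
lemma assemble_zero_left (a : Space m → ℝ) (b : Space m → Fin m → ℝ)
    (t : Space m → Fin m → Fin m → ℝ) (θ : Space m) (ν : Fin (m + 1)) :
    assemble a b t θ 0 ν = 0 := rfl

omit [NeZero m] in
lemma assemble_zero_right (a : Space m → ℝ) (b : Space m → Fin m → ℝ)
    (t : Space m → Fin m → Fin m → ℝ) (θ : Space m) (μ : Fin (m + 1)) :
    assemble a b t θ μ 0 = 0 := by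
  refine Fin.cases rfl (fun i => rfl) μ

omit [NeZero m] in
lemma assemble_succ (a : Space m → ℝ) (b : Space m → Fin m → ℝ)
    (t : Space m → Fin m → Fin m → ℝ) (θ : Space m) (i j : Fin m) :
    assemble a b t θ i.succ j.succ = a θ * θ i * θ j + θ i * b θ j + b θ i * θ j + t θ i j := rfl

lemma memTensor_add (U R Θ : ScriFun m) (r S : Fin m → ScriFun m) (t : Fin m → Fin m → ScriFun m)
    (i j : Fin m) : memTensor U R Θ r S t i j = memTensor U R Θ 0 0 0 i j +
      memTensor 0 0 0 r S 0 i j + memTensor 0 0 0 0 0 t i j := by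
  simp only [memTensor, tf, hs, sg, Pi.zero_apply, map_zero, mul_zero, add_zero, zero_add,
    sub_zero]
  ring

lemma scalarMemory_eq {U R Θ : Space m → ℝ} (hU : SmoothOnSphere U) (hR : SmoothOnSphere R)
    (hΘ : SmoothOnSphere Θ) (u : ℝ) {θ : Space m} (hθ : ‖θ‖ = 1) (i j : Fin m) :
    scalarMemory U R Θ θ i.succ j.succ =
      memTensor (ofSphere U hU) (ofSphere R hR) (ofSphere Θ hΘ) 0 0 0 i j (u, θ) := by
  simp only [memTensor, ScriFun.add_apply, ScriFun.mul_apply, D_th_apply _ _ _ hθ, cst_apply,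
    th_apply _ _ hθ, ofSphere_apply _ _ _ hθ, scalarMemory, assemble_succ, Pi.zero_apply, sg,
    map_zero, mul_zero, add_zero, ScriFun.neg_apply,
    gradS_eq (fun θ hθ => (ofSphere_apply R hR u hθ).symm) hθ,
    traceFreeHessS_eq (fun θ hθ => (ofSphere_apply Θ hΘ u hθ).symm) hθ]
  ring

lemma vectorMemory_eq {r S : Space m → Fin m → ℝ} (hr : IsVectorType r) (hS : IsVectorType S)
    (u : ℝ) {θ : Space m} (hθ : ‖θ‖ = 1) (i j : Fin m) :
    vectorMemory r S θ i.succ j.succ = memTensor 0 0 0 hr.comp hS.comp 0 i j (u, θ) := by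
  simp only [memTensor, tf, hs, ScriFun.add_apply, ScriFun.mul_apply,
    th_apply _ _ hθ, hr.comp_apply _ _ hθ, vectorMemory, assemble_succ, Pi.zero_apply,
    map_zero, mul_zero, add_zero, zero_add, sub_zero, ScriFun.zero_apply, ScriFun.neg_apply,
    symCovDerivS_eq (fun k _ hθ => (hS.comp_apply k u hθ).symm) hS.isVec.tangent hθ]
  ring

lemma tensorMemory_eq {t : Space m → Fin m → Fin m → ℝ} (ht : IsTensorType t)
    (u : ℝ) {θ : Space m} (hθ : ‖θ‖ = 1) (i j : Fin m) :
    tensorMemory t θ i.succ j.succ = memTensor 0 0 0 0 0 ht.comp i j (u, θ) := by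
  simp only [memTensor, tf, hs, sg, ScriFun.add_apply, ScriFun.mul_apply,
    ht.comp_apply _ _ _ hθ, tensorMemory, assemble_succ, Pi.zero_apply,
    map_zero, mul_zero, add_zero, zero_add, sub_zero, ScriFun.zero_apply, ScriFun.neg_apply]
  ring

section Decomposition

variable {Δ : Space m → Matrix (Fin (m + 1)) (Fin (m + 1)) ℝ} {U R Θ : Space m → ℝ}
  {r S : Space m → Fin m → ℝ} {t : Space m → Fin m → Fin m → ℝ}
  (hd : IsMemoryDecomposition Δ U R Θ r S t)

include hd

lemma IsMemoryDecomposition.apply_succ (u : ℝ) {θ : Space m} (hθ : ‖θ‖ = 1) (i j : Fin m) :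
    Δ θ i.succ j.succ = memTensor (ofSphere U hd.smooth_U) (ofSphere R hd.smooth_R)
      (ofSphere Θ hd.smooth_Θ) hd.vector_R.comp hd.vector_S.comp hd.tensor_S.comp i j (u, θ) := by
  rw [hd.eq_sum θ (mem_unitSphere.2 hθ), memTensor_add, Matrix.add_apply, Matrix.add_apply,
    scalarMemory_eq hd.smooth_U hd.smooth_R hd.smooth_Θ u hθ,
    vectorMemory_eq hd.vector_R hd.vector_S u hθ, tensorMemory_eq hd.tensor_S u hθ]
  rfl

omit [NeZero m] in
lemma IsMemoryDecomposition.apply_zero {θ : Space m} (hθ : ‖θ‖ = 1) (ν : Fin (m + 1)) :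
    Δ θ 0 ν = 0 := by
  rw [hd.eq_sum θ (mem_unitSphere.2 hθ), Matrix.add_apply, Matrix.add_apply]
  simp [scalarMemory, vectorMemory, tensorMemory, assemble_zero_left]

end Decomposition

end

end NullMemory

namespace NullMemory

noncomputable section

variable {m : ℕ} [NeZero m]

open ScriFun

/-! ### Vector and tensor memory are not diffeomorphisms -/

/-- A covector field with an expansion whose symmetrized gradient at Coulombic order has no time
components. -/
lemma exists_eq_gaugeTensor {ξ : CovectorField m} (hξ : HasCovectorExpansion ξ)
    {A : Space m → Matrix (Fin (m + 1)) (Fin (m + 1)) ℝ} (hA : CoulombicGradEq ξ A)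
    (hA0 : ∀ θ : Space m, ‖θ‖ = 1 → ∀ ν, A θ 0 ν = 0) {M : Fin m → Fin m → ScriFun m}
    (hM : ∀ i j u, ∀ θ : Space m, ‖θ‖ = 1 → A θ i.succ j.succ = M i j (u, θ)) :
    ∃ (Jt : ScriFun m) (J : Fin m → ScriFun m), ∀ i j, M i j = gaugeTensor Jt J i j := by
  choose c hc using hξ
  set X : Fin (m + 1) → ℤ → ScriFun m := fun μ => coeffs (hc μ) with hX
  have h1 : ∀ μ ν u, ∀ θ : Space m, ‖θ‖ = 1 →
      A θ μ ν = (cst (1 / 2) * (dC μ (X ν) (coulombic m) + dC ν (X μ) (coulombic m)) :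
        ScriFun m) (u, θ) := by
    intro μ ν u θ hθ
    obtain ⟨e, he, heA⟩ := hA μ ν
    have h2 := (((hc ν).rayExp u hθ).2.1 μ).add (((hc μ).rayExp u hθ).2.1 ν)
    have h3 := h2.const_mul (1 / 2)
    have h4 := congrFun ((he.rayExp u hθ).1.unique (h3.congr (Eventually.of_forall fun r => by
      simp only [symGrad, Matrix.of_apply]
      ring))) (coulombic m)
    rw [coeffs_apply _ _ _ hθ, heA u θ (mem_unitSphere.2 hθ)] at h4
    rw [h4]
    rfl
  have hk : (((coulombic m : ℤ) : ℝ) - 2) / 2 = (m : ℝ) - 3 := by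
    unfold coulombic
    push_cast
    ring
  have hd : ∀ μ (x : ℤ → ScriFun m), dC μ x (coulombic m) = Lc μ * dU (x (coulombic m)) +
      (Dx μ (x (coulombic m - 2)) - cst ((m : ℝ) - 3) * (nc μ * x (coulombic m - 2))) := by
    intro μ x
    rw [dC_apply, hk, Algebra.smul_def]
  have h00 : dU (X 0 (coulombic m)) = 0 := by
    refine ext_sphere fun u θ hθ => ?_
    have h2 := h1 0 0 u θ hθ
    rw [hA0 θ hθ, hd] at h2
    have e0 : Dx (0 : Fin (m + 1)) (X 0 (coulombic m - 2)) = 0 := rfl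
    have e1 : (nc 0 : ScriFun m) = 0 := rfl
    have e2 : (Lc 0 : ScriFun m) = 1 := rfl
    rw [e0, e1, e2] at h2
    simp only [ScriFun.mul_apply, ScriFun.add_apply, ScriFun.sub_apply, cst_apply,
      ScriFun.zero_apply, ScriFun.one_apply] at h2
    rw [ScriFun.zero_apply]
    linarith
  -- The absence of time components fixes the `u`-derivative of the Coulombic coefficients by the
  -- order `d - 4` ones. After substitution the spatial components involve only the latter.
  have h0i : ∀ i : Fin m, dU (X i.succ (coulombic m)) =
      cst ((m : ℝ) - 3) * (th i * X 0 (coulombic m - 2)) - D i (X 0 (coulombic m - 2)) := by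
    intro i
    refine ext_sphere fun u θ hθ => ?_
    have h2 := h1 0 i.succ u θ hθ
    rw [hA0 θ hθ, hd, hd, h00] at h2
    have e0 : Dx (0 : Fin (m + 1)) (X i.succ (coulombic m - 2)) = 0 := rfl
    have e1 : (nc 0 : ScriFun m) = 0 := rfl
    have e2 : (Lc 0 : ScriFun m) = 1 := rfl
    have e3 : Dx i.succ (X 0 (coulombic m - 2)) = D i (X 0 (coulombic m - 2)) := rfl
    have e4 : (nc i.succ : ScriFun m) = th i := rfl
    rw [e0, e1, e2, e3, e4] at h2
    simp only [ScriFun.mul_apply, ScriFun.add_apply, ScriFun.sub_apply, cst_apply,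
      ScriFun.zero_apply, ScriFun.one_apply] at h2 ⊢
    linarith
  refine ⟨X 0 (coulombic m - 2), fun j => X j.succ (coulombic m - 2), fun i j =>
    ext_sphere fun u θ hθ => ?_⟩
  rw [← hM i j u θ hθ, h1 i.succ j.succ u θ hθ, hd, hd, h0i, h0i]
  have e3 : ∀ (i : Fin m) (x : ScriFun m), Dx i.succ x = D i x := fun _ _ => rfl
  have e4 : ∀ i : Fin m, (nc i.succ : ScriFun m) = th i := fun _ => rfl
  have e5 : ∀ i : Fin m, (Lc i.succ : ScriFun m) = -th i := fun _ => rfl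
  rw [e3, e3, e4, e4, e5, e5, gaugeTensor]
  refine congrArg (fun x : ScriFun m => x (u, θ)) ?_
  ring

lemma vectorMemory_eq_zero {r S : Space m → Fin m → ℝ} (hr : IsVectorType r) (hS : IsVectorType S)
    (hr0 : ∀ j, hr.comp j = 0) (hS0 : ∀ i j, sg hS.comp i j = 0) {θ : Space m} (hθ : ‖θ‖ = 1) :
    vectorMemory r S θ = 0 := by
  ext μ ν
  refine Fin.cases (assemble_zero_left _ _ _ _ _) (fun i => ?_) μ
  refine Fin.cases (assemble_zero_right _ _ _ _ _) (fun j => ?_) ν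
  rw [vectorMemory_eq hr hS 0 hθ]
  have : memTensor 0 0 0 hr.comp hS.comp 0 i j = 0 := by
    simp only [memTensor, tf, hs, hr0, hS0, Pi.zero_apply, map_zero, mul_zero, add_zero,
      sub_zero]
    ring
  rw [this]
  rfl

lemma tensorMemory_eq_zero {t : Space m → Fin m → Fin m → ℝ} (ht : IsTensorType t)
    (ht0 : ∀ i j, ht.comp i j = 0) {θ : Space m} (hθ : ‖θ‖ = 1) : tensorMemory t θ = 0 := by
  ext μ ν
  refine Fin.cases (assemble_zero_left _ _ _ _ _) (fun i => ?_) μ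
  refine Fin.cases (assemble_zero_right _ _ _ _ _) (fun j => ?_) ν
  rw [tensorMemory_eq ht 0 hθ]
  have : memTensor 0 0 0 0 0 ht.comp i j = 0 := by
    simp only [memTensor, tf, hs, sg, ht0, Pi.zero_apply, map_zero, mul_zero, add_zero,
      sub_zero]
    ring
  rw [this]
  rfl

lemma isTen_zero : IsTen (0 : Fin m → Fin m → ScriFun m) :=
  ⟨by simp, by simp, by simp, by simp, by simp⟩

section Decomposition

variable {Δ : Space m → Matrix (Fin (m + 1)) (Fin (m + 1)) ℝ} {U R Θ : Space m → ℝ}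
  {r S : Space m → Fin m → ℝ} {t : Space m → Fin m → Fin m → ℝ}
  (hd : IsMemoryDecomposition Δ U R Θ r S t) {ξ : CovectorField m} (hξ : HasCovectorExpansion ξ)

include hd hξ

/-- In either case the gauge assumption shows that the combination of the potentials is Killing. The
constraint for the full memory then determines the vector potentials, because its vector part
decouples from the scalar and tensor parts. -/
theorem vector_memory_not_gauge (hm : 3 ≤ m)
    (hc : ∀ j, constraint (memTensor (ofSphere U hd.smooth_U) (ofSphere R hd.smooth_R)
      (ofSphere Θ hd.smooth_Θ) hd.vector_R.comp hd.vector_S.comp hd.tensor_S.comp) j = 0)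
    (h : CoulombicGradEq ξ Δ ∨ CoulombicGradEq ξ (vectorMemory r S)) {θ : Space m} (hθ : ‖θ‖ = 1) :
    vectorMemory r S θ = 0 := by
  have hk : ∀ i j, sg (fun j => hd.vector_S.comp j + cst (2 / ((m : ℝ) - 2)) * hd.vector_R.comp j)
      i j = 0 := by
    rcases h with h | h
    · obtain ⟨Jt, J, hJ⟩ := exists_eq_gaugeTensor hξ h (fun θ hθ => hd.apply_zero hθ)
        (fun i j u θ hθ => hd.apply_succ u hθ i j)
      exact sg_eq_zero_of_gauge hm hd.vector_R.isVec hd.vector_S.isVec hd.tensor_S.isTen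
        fun c i j => by rw [hJ]
    · obtain ⟨Jt, J, hJ⟩ := exists_eq_gaugeTensor hξ h (fun θ _ => assemble_zero_left _ _ _ θ)
        (fun i j u θ hθ => vectorMemory_eq hd.vector_R hd.vector_S u hθ i j)
      exact sg_eq_zero_of_gauge hm hd.vector_R.isVec hd.vector_S.isVec isTen_zero
        fun c i j => by rw [hJ]
  have hr := vec_eq_zero_of_constraint hm hd.vector_R.isVec hd.vector_S.isVec hd.tensor_S.isTen hc hk
  refine vectorMemory_eq_zero hd.vector_R hd.vector_S hr (fun i j => ?_) hθ
  have := hk i j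
  simp only [hr, mul_zero, add_zero] at this
  exact this

/-- Orthogonality on the sphere suffices here; no field equation enters. -/
theorem tensor_memory_not_gauge (h : CoulombicGradEq ξ Δ ∨ CoulombicGradEq ξ (tensorMemory t))
    {θ : Space m} (hθ : ‖θ‖ = 1) : tensorMemory t θ = 0 := by
  refine tensorMemory_eq_zero hd.tensor_S (fun i j => ?_) hθ
  rcases h with h | h
  · obtain ⟨Jt, J, hJ⟩ := exists_eq_gaugeTensor hξ h (fun θ hθ => hd.apply_zero hθ)
      (fun i j u θ hθ => hd.apply_succ u hθ i j)
    exact ten_eq_zero_of_gauge hd.tensor_S.isTen (fun i j => by rw [hJ]) i j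
  · obtain ⟨Jt, J, hJ⟩ := exists_eq_gaugeTensor hξ h (fun θ _ => assemble_zero_left _ _ _ θ)
      (fun i j u θ hθ => tensorMemory_eq hd.tensor_S u hθ i j)
    exact ten_eq_zero_of_gauge hd.tensor_S.isTen (fun i j => by rw [hJ]) i j

end Decomposition

end

end NullMemory

namespace NullMemory

noncomputable section

variable {m : ℕ}

/-! ### Finite expansions -/

lemma iteratedDeriv_sum_rpow (s : Finset ℤ) (c : ℤ → ℝ) (b : ℕ) {r : ℝ} (hr : 0 < r) :
    iteratedDeriv b (fun x : ℝ => ∑ k ∈ s, c k * x ^ (-(k : ℝ) / 2)) r =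
      ∑ k ∈ s, (descPochhammer ℝ b).eval (-(k : ℝ) / 2) * r ^ (-(k : ℝ) / 2 - b) * c k := by
  rw [iteratedDeriv_eq_iteratedFDeriv, iteratedFDeriv_fun_sum_apply fun k _ =>
    contDiffAt_const.mul (Real.contDiffAt_rpow_const_of_ne hr.ne'),
    _root_.sum_apply]
  refine Finset.sum_congr rfl fun k _ => ?_
  rw [← iteratedDeriv_eq_iteratedFDeriv, iteratedDeriv_const_mul_field, iteratedDeriv_eq_iterate,
    Real.iter_deriv_rpow_const]
  ring

lemma isScriNbhd_sp_ne : IsScriNbhd {X : Event m | sp X ≠ 0} := by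
  refine ⟨isOpen_sp_ne, fun u θ hθ => ?_⟩
  filter_upwards [eventually_gt_atTop 0] with r hr
  exact sp_event_ne_zero u hr (mem_unitSphere.1 hθ)

variable [NeZero m]

open ScriFun

lemma apply_dir (c : ScriFun m) (u : ℝ) {y : Space m} (hy : y ≠ 0) : c (u, dir y) = c (u, y) := by
  rw [← pt_of_ne hy, apply_pt]

/-- A finite sum is its own expansion: each remainder is a finite tail of explicit powers, whose
derivatives are computed exactly. -/
lemma hasExpansion_of_sum {f : Event m → ℝ} {c : ℤ → ScriFun m} {A B : ℤ}
    (hc : ∀ k, k ∉ Finset.Icc A B → c k = 0)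
    (hf : ∀ X, sp X ≠ 0 → f X = ∑ k ∈ Finset.Icc A B, term k (c k) X) :
    HasExpansion f fun k u θ => c k (u, θ) := by
  refine ⟨⟨_, isScriNbhd_sp_ne, fun X hX => ?_⟩, fun k => ?_, A, fun k hk u θ _ => ?_, ?_⟩
  · refine ((contDiffAt_sum_term c (Finset.Icc A B) hX).congr_of_eventuallyEq
      ?_).contDiffWithinAt
    filter_upwards [isOpen_sp_ne.mem_nhds hX] with Y hY using hf Y hY
  · exact (ScriFun.contDiffOn (c k)).congr fun p hp => apply_dir _ _ hp
  · exact congrArg (fun e : ScriFun m => e (u, θ)) (hc k (by rw [Finset.mem_Icc]; omega))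
  · intro N a b u θ hθ
    rw [mem_unitSphere] at hθ
    have h0 := ne_zero_of_norm_one hθ
    set S := (Finset.Icc A B).filter fun k => ¬ k ≤ N with hS
    have hrem : ∀ (v s : ℝ) (y : Space m), 0 < s → y ≠ 0 →
        remainder f (fun k u θ => c k (u, θ)) A N v s y =
          ∑ k ∈ S, c k (v, y) * s ^ (-(k : ℝ) / 2) := by
      intro v s y hs hy
      rw [remainder, hf _ (sp_event_ne_zero v hs (norm_dir hy)),
        ← Finset.sum_filter_add_sum_filter_not (Finset.Icc A B) (fun k => k ≤ N)]
      have h1 : ∑ k ∈ Finset.Icc A B with k ≤ N, term k (c k) (event v s (dir y)) =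
          ∑ k ∈ Finset.Icc A N, s ^ (-(k : ℝ) / 2) * c k (v, dir y) := by
        simp only [term_event _ _ _ hs (norm_dir hy)]
        refine Finset.sum_subset (fun k hk => ?_) fun k hk hk' => ?_
        · rw [Finset.mem_filter, Finset.mem_Icc] at hk
          exact Finset.mem_Icc.2 ⟨hk.1.1, hk.2⟩
        · rw [hc k fun hk2 => hk' (Finset.mem_filter.2 ⟨hk2, (Finset.mem_Icc.1 hk).2⟩)]
          exact mul_zero _
      rw [h1, add_sub_cancel_left]
      refine Finset.sum_congr rfl fun k _ => ?_
      rw [term_event _ _ _ hs (norm_dir hy), apply_dir _ _ hy, mul_comm]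
    have hit : ∀ r : ℝ, 0 < r → iteratedFDeriv ℝ a (fun p : ℝ × Space m => iteratedDeriv b
        (fun s => remainder f (fun k u θ => c k (u, θ)) A N p.1 s p.2) r) (u, θ) =
        ∑ k ∈ S, ((descPochhammer ℝ b).eval (-(k : ℝ) / 2) * r ^ (-(k : ℝ) / 2 - b)) •
          iteratedFDeriv ℝ a (c k) (u, θ) := by
      intro r hr
      have h1 : (fun p : ℝ × Space m => iteratedDeriv b
          (fun s => remainder f (fun k u θ => c k (u, θ)) A N p.1 s p.2) r) =ᶠ[𝓝 (u, θ)]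
          fun p => ∑ k ∈ S,
            ((descPochhammer ℝ b).eval (-(k : ℝ) / 2) * r ^ (-(k : ℝ) / 2 - b)) • c k p := by
        filter_upwards [isOpen_punctured.mem_nhds h0] with p hp
        refine (Filter.EventuallyEq.iteratedDeriv_eq b ?_).trans
          (iteratedDeriv_sum_rpow S (fun k => c k p) b hr)
        filter_upwards [lt_mem_nhds hr] with s hs using hrem p.1 s p.2 hs hp
      have hsm : ∀ k, ContDiffAt ℝ a (c k) (u, θ) := fun k =>
        (ScriFun.contDiffAt (c k) (p := (u, θ)) h0).of_le (by exact_mod_cast le_top)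
      rw [(h1.iteratedFDeriv ℝ a).eq_of_nhds, iteratedFDeriv_fun_sum_apply (f := fun (k : ℤ) p =>
        ((descPochhammer ℝ b).eval (-(k : ℝ) / 2) * r ^ (-(k : ℝ) / 2 - b)) • c k p) fun k _ =>
        contDiffAt_const.fun_smul (hsm k)]
      exact Finset.sum_congr rfl fun k _ => iteratedFDeriv_const_smul_apply' (hsm k)
    refine IsBigO.congr' (f₁ := fun r => ∑ k ∈ S, ((descPochhammer ℝ b).eval (-(k : ℝ) / 2) *
      r ^ (-(k : ℝ) / 2 - b)) • iteratedFDeriv ℝ a (c k) (u, θ)) (IsBigO.fun_sum fun k hk => ?_)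
      ((eventually_gt_atTop 0).mono fun r hr => (hit r hr).symm) .rfl
    have hkN : ((N : ℝ) + 1) ≤ k := by
      rw [hS, Finset.mem_filter] at hk
      have : N + 1 ≤ k := by omega
      exact_mod_cast this
    have h2 := (isBigO_rpow_of_le (show -(k : ℝ) / 2 - b ≤ -((N : ℝ) + 1) / 2 - b by
      linarith)).const_mul_left ((descPochhammer ℝ b).eval (-(k : ℝ) / 2))
    have h3 := h2.smul (isBigO_const_const (iteratedFDeriv ℝ a (c k) (u, θ)) (one_ne_zero (α := ℝ))
      atTop)
    simpa only [smul_eq_mul, mul_one] using h3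

/-- Retarded time. -/
def uFun : ScriFun m := ⟨Prod.fst, fun _ _ => rfl, contDiffOn_fst⟩

lemma uFun_apply (u : ℝ) (y : Space m) : (uFun : ScriFun m) (u, y) = u := rfl

lemma dU_uFun : dU (uFun : ScriFun m) = 1 :=
  ext_sphere fun u θ _ => (hasDerivAt_dU uFun u θ).unique (hasDerivAt_id u)

end

end NullMemory

namespace NullMemory

noncomputable section

variable {m : ℕ} [NeZero m]

open ScriFun

/-! ### The diffeomorphism that generates scalar memory -/

/-- The leading coefficient of the covector field that generates scalar memory. -/
def gaugeLead (Jt a Ψ : ScriFun m) : Fin (m + 1) → ScriFun m :=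
  Fin.cons Jt fun j => a * th j + D j Ψ

/-- The coefficient of retarded time in the covector field that generates scalar memory. -/
def gaugeDrift (Jt : ScriFun m) : Fin (m + 1) → ScriFun m :=
  Fin.cons 0 fun j => cst ((m : ℝ) - 3) * (th j * Jt) - D j Jt

/-- The coefficients of the covector field that generates scalar memory. -/
def gaugeCoeff (Jt a Ψ : ScriFun m) (μ : Fin (m + 1)) (k : ℤ) : ScriFun m :=
  if k = coulombic m - 2 then gaugeLead Jt a Ψ μ
  else if k = coulombic m then uFun * gaugeDrift Jt μ else 0

/-- The covector field that generates scalar memory. -/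
def gaugeField (Jt a Ψ : ScriFun m) : CovectorField m := fun X μ =>
  ∑ k ∈ Finset.Icc (coulombic m - 2) (coulombic m), term k (gaugeCoeff Jt a Ψ μ k) X

/-- The coefficients of the symmetrized gradient. -/
def gradCoeff (Jt a Ψ : ScriFun m) (μ ν : Fin (m + 1)) (k : ℤ) : ScriFun m :=
  cst (1 / 2) * (dC μ (gaugeCoeff Jt a Ψ ν) k + dC ν (gaugeCoeff Jt a Ψ μ) k)

variable {Jt a Ψ : ScriFun m}

lemma gaugeCoeff_eq_zero (μ : Fin (m + 1)) {k : ℤ} (h1 : k ≠ coulombic m - 2)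
    (h2 : k ≠ coulombic m) : gaugeCoeff Jt a Ψ μ k = 0 := by
  rw [gaugeCoeff, if_neg h1, if_neg h2]

lemma gaugeCoeff_lead (μ : Fin (m + 1)) :
    gaugeCoeff Jt a Ψ μ (coulombic m - 2) = gaugeLead Jt a Ψ μ := if_pos rfl

lemma gaugeCoeff_coulombic (μ : Fin (m + 1)) :
    gaugeCoeff Jt a Ψ μ (coulombic m) = uFun * gaugeDrift Jt μ := by
  rw [gaugeCoeff, if_neg (by omega), if_pos rfl]

lemma gaugeCoeff_notMem (μ : Fin (m + 1)) :
    ∀ k, k ∉ Finset.Icc (coulombic m - 2) (coulombic m) → gaugeCoeff Jt a Ψ μ k = 0 := by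
  intro k hk
  rw [Finset.mem_Icc] at hk
  exact gaugeCoeff_eq_zero μ (by omega) (by omega)

lemma hasExpansion_gaugeField (μ : Fin (m + 1)) :
    HasExpansion (fun X => gaugeField Jt a Ψ X μ) fun k u θ => gaugeCoeff Jt a Ψ μ k (u, θ) :=
  hasExpansion_of_sum (gaugeCoeff_notMem μ) fun _ _ => rfl

section Stationary

variable (hJ : dU Jt = 0) (ha : dU a = 0) (hΨ : dU Ψ = 0)

include hJ ha hΨ in
lemma dU_gaugeLead (μ : Fin (m + 1)) : dU (gaugeLead Jt a Ψ μ) = 0 := by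
  refine Fin.cases hJ (fun j => ?_) μ
  change dU (a * th j + D j Ψ) = 0
  rw [map_add, Derivation.leibniz, dU_th, ha, dU_D, hΨ, map_zero, smul_zero, smul_zero]
  ring

include hJ in
lemma dU_gaugeDrift (μ : Fin (m + 1)) : dU (gaugeDrift Jt μ) = 0 := by
  refine Fin.cases (map_zero _) (fun j => ?_) μ
  change dU (cst ((m : ℝ) - 3) * (th j * Jt) - D j Jt) = 0
  have h := dU_cst (m := m) ((m : ℝ) - 3)
  generalize (cst ((m : ℝ) - 3) : ScriFun m) = x at h ⊢
  simp only [map_sub, Derivation.leibniz, dU_th, hJ, dU_D, map_zero, smul_zero, h]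
  ring

include hJ ha hΨ

/-- The stationary leading coefficient contributes nothing at its own order, and its gradient first
appears at Coulombic order. The Coulombic coefficient adds only that order and the next integer one.
-/
lemma dC_gaugeCoeff_eq_zero (μ ν : Fin (m + 1)) {k : ℤ} (h1 : k ≠ coulombic m)
    (h2 : k ≠ coulombic m + 2) : dC μ (gaugeCoeff Jt a Ψ ν) k = 0 := by
  rw [dC_apply, gaugeCoeff_eq_zero ν (k := k - 2) (by omega) (by omega)]
  have : dU (gaugeCoeff Jt a Ψ ν k) = 0 := by
    by_cases h3 : k = coulombic m - 2
    · rw [h3, gaugeCoeff_lead, dU_gaugeLead hJ ha hΨ]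
    · rw [gaugeCoeff_eq_zero ν h3 h1, map_zero]
  rw [this]
  simp

lemma gradCoeff_eq_zero (μ ν : Fin (m + 1)) {k : ℤ} (h1 : k ≠ coulombic m)
    (h2 : k ≠ coulombic m + 2) : gradCoeff Jt a Ψ μ ν k = 0 := by
  rw [gradCoeff, dC_gaugeCoeff_eq_zero hJ ha hΨ μ ν h1 h2, dC_gaugeCoeff_eq_zero hJ ha hΨ ν μ h1 h2,
    add_zero, mul_zero]

lemma hasExpansion_symGrad (μ ν : Fin (m + 1)) :
    HasExpansion (fun X => symGrad (gaugeField Jt a Ψ) X μ ν)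
      fun k u θ => gradCoeff Jt a Ψ μ ν k (u, θ) := by
  refine hasExpansion_of_sum (A := coulombic m - 2) (B := coulombic m + 2) (fun k hk => ?_)
    fun X hX => ?_
  · rw [Finset.mem_Icc] at hk
    exact gradCoeff_eq_zero hJ ha hΨ μ ν (by omega) (by omega)
  · have e : ∀ k, term k (gradCoeff Jt a Ψ μ ν k) X = 1 / 2 *
        (term k (dC μ (gaugeCoeff Jt a Ψ ν) k) X + term k (dC ν (gaugeCoeff Jt a Ψ μ) k) X) := by
      intro k
      rw [gradCoeff, ← Algebra.smul_def, term_smul, term_add]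
      rfl
    simp only [e, ← Finset.mul_sum, Finset.sum_add_distrib,
      ← pd_sum_term (gaugeCoeff_notMem _) _ hX]
    simp only [symGrad, gaugeField, Matrix.of_apply]
    ring

omit ha hΨ in
lemma dC_gaugeCoeff_coulombic (μ ν : Fin (m + 1)) :
    dC μ (gaugeCoeff Jt a Ψ ν) (coulombic m) = Lc μ * gaugeDrift Jt ν +
      (Dx μ (gaugeLead Jt a Ψ ν) - cst ((m : ℝ) - 3) * (nc μ * gaugeLead Jt a Ψ ν)) := by
  have hk : (((coulombic m : ℤ) : ℝ) - 2) / 2 = (m : ℝ) - 3 := by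
    unfold coulombic
    push_cast
    ring
  rw [dC_apply, gaugeCoeff_lead, gaugeCoeff_coulombic, hk, Algebra.smul_def, Derivation.leibniz,
    dU_uFun, dU_gaugeDrift hJ, smul_zero, zero_add, smul_eq_mul, mul_one]

omit ha hΨ in
-- The drift is exactly what makes the mixed time-space components cancel; it is forced by the same
-- equation as in `exists_eq_gaugeTensor`.
lemma gradCoeff_zero (ν : Fin (m + 1)) : gradCoeff Jt a Ψ 0 ν (coulombic m) = 0 := by
  rw [gradCoeff, dC_gaugeCoeff_coulombic hJ, dC_gaugeCoeff_coulombic hJ]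
  have e0 : ∀ x : ScriFun m, Dx (0 : Fin (m + 1)) x = 0 := fun _ => rfl
  have e1 : gaugeDrift Jt 0 = 0 := rfl
  rw [e0, e1, nc_zero, Lc_zero]
  refine Fin.cases ?_ (fun j => ?_) ν
  · rw [e0, e1, nc_zero]
    ring
  · have e2 : gaugeDrift Jt j.succ = cst ((m : ℝ) - 3) * (th j * Jt) - D j Jt := rfl
    have e3 : gaugeLead Jt a Ψ 0 = Jt := rfl
    rw [e2, e3, nc_succ, Dx_succ]
    ring

omit ha hΨ in
lemma gradCoeff_succ (i j : Fin m) : gradCoeff Jt a Ψ i.succ j.succ (coulombic m) =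
    gaugeTensor Jt (fun j => a * th j + D j Ψ) i j := by
  rw [gradCoeff, dC_gaugeCoeff_coulombic hJ, dC_gaugeCoeff_coulombic hJ, gaugeTensor]
  have e2 : ∀ j : Fin m, gaugeDrift Jt j.succ = cst ((m : ℝ) - 3) * (th j * Jt) - D j Jt :=
    fun _ => rfl
  have e3 : ∀ j : Fin m, gaugeLead Jt a Ψ j.succ = a * th j + D j Ψ := fun _ => rfl
  simp only [e2, e3, nc_succ, Dx_succ, Lc_succ]
  ring

omit hJ ha hΨ in
/-- The symmetrized gradient at Coulombic order is the scalar memory tensor. -/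
lemma gaugeTensor_eq_memTensor {U R Θ : ScriFun m}
    (h1 : cst ((m : ℝ) - 3) * (a + Jt) = U)
    (h2 : ∀ j, D j (a + Jt) - cst ((m : ℝ) - 2) * D j Ψ = 2 * D j R)
    (h3 : ∀ i j, tf Ψ i j = tf Θ i j)
    (h4 : a + cst (1 / ((m : ℝ) - 1)) * lap Ψ = cst (1 / ((m : ℝ) - 1)) * U) (i j : Fin m) :
    gaugeTensor Jt (fun j => a * th j + D j Ψ) i j = memTensor U R Θ 0 0 0 i j := by
  have hh : (cst (1 / 2) * 2 : ScriFun m) = 1 := half_mul_two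
  have e1 : cst ((m : ℝ) - 2) = (cst ((m : ℝ) - 3) : ScriFun m) + 1 := by
    rw [← cst_add_one]
    congr 1
    ring
  have e2 : memTensor U R Θ 0 0 0 i j = -U * (th i * th j) + th i * D j R + D i R * th j +
      (tf Ψ i j + D i (th j) * (cst (1 / ((m : ℝ) - 1)) * U)) := by
    simp only [memTensor, sg, Pi.zero_apply, map_zero, mul_zero, add_zero, h3]
  have e3 : D j (th i) = D i (th j) := by rw [D_th', D_th', kd_comm, mul_comm (th i)]
  have g2 := h2
  simp only [e1, map_add] at g2
  -- The hypotheses `h1` to `h4` match, in turn, the radial-radial, radial-angular, trace-free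
  -- angular and angular trace components.
  rw [e2, ← h4, tf, hs, gaugeTensor, ← h1]
  generalize (cst (1 / ((m : ℝ) - 1)) : ScriFun m) = q at *
  simp only [map_add, Derivation.leibniz, smul_eq_mul, e3, D_comm j i]
  generalize (cst ((m : ℝ) - 3) : ScriFun m) = x at *
  generalize (cst (1 / 2) : ScriFun m) = h at *
  linear_combination (h * th i) * g2 j + (h * th j) * g2 i +
    (a * D i (th j) - x * (a + Jt) * (th i * th j) + D i (D j Ψ) + th j * D i Ψ +
      th i * D j R + th j * D i R) * hh

end Stationary

end

end NullMemory

/-! ### The generating covector field: form, supertranslation, pure gauge -/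

namespace NullMemory

noncomputable section

variable {m : ℕ} [NeZero m]

open ScriFun

lemma smoothOnSphere_slice (c : ScriFun m) (u : ℝ) : SmoothOnSphere fun θ => c (u, θ) := by
  refine ((ScriFun.contDiffOn c).comp (contDiffOn_const.prodMk contDiffOn_id)
    fun _ hy => hy : ContDiffOn ℝ ∞ (fun y => c (u, y)) {y : Space m | y ≠ 0}).congr fun y hy => ?_
  exact apply_dir c u hy

variable {Jt a Ψ : ScriFun m} (hJ : dU Jt = 0) (ha : dU a = 0) (hΨ : dU Ψ = 0)

include hJ ha hΨ

lemma hasMemoryForm_gaugeField : HasMemoryForm (gaugeField Jt a Ψ) := by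
  refine ⟨fun μ θ => gaugeLead Jt a Ψ μ (0, θ), fun μ θ => gaugeDrift Jt μ (0, θ), fun μ =>
    ⟨smoothOnSphere_slice _ _, smoothOnSphere_slice _ _, _, hasExpansion_gaugeField μ,
      fun u θ hθ => ⟨fun k hk hk' => ?_, ?_, ?_⟩⟩⟩
  · rw [gaugeCoeff_eq_zero μ hk' hk.ne]
    rfl
  · rw [gaugeCoeff_lead]
    exact apply_of_dU (dU_gaugeLead hJ ha hΨ μ) u 0 θ
  · rw [gaugeCoeff_coulombic, ScriFun.mul_apply, uFun_apply]
    exact congrArg (u * ·) (apply_of_dU (dU_gaugeDrift hJ μ) u 0 θ)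

lemma slowGradVanishes_gaugeField : SlowGradVanishes (gaugeField Jt a Ψ) := fun μ ν =>
  ⟨_, hasExpansion_symGrad hJ ha hΨ μ ν, fun k hk u θ _ => by
    rw [gradCoeff_eq_zero hJ ha hΨ μ ν hk.ne (by omega)]
    rfl⟩

lemma coulombicGradEq_gaugeField {A : Space m → Matrix (Fin (m + 1)) (Fin (m + 1)) ℝ}
    (h0 : ∀ θ ν, A θ 0 ν = 0) (h0' : ∀ θ μ, A θ μ 0 = 0)
    (h : ∀ i j u, ∀ θ : Space m, ‖θ‖ = 1 →
      A θ i.succ j.succ = gaugeTensor Jt (fun j => a * th j + D j Ψ) i j (u, θ)) :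
    CoulombicGradEq (gaugeField Jt a Ψ) A := by
  refine fun μ ν => ⟨_, hasExpansion_symGrad hJ ha hΨ μ ν, fun u θ hθ => ?_⟩
  have hs : gradCoeff Jt a Ψ μ ν = gradCoeff Jt a Ψ ν μ := by
    funext k
    rw [gradCoeff, gradCoeff, add_comm]
  have hz : ∀ ν, gradCoeff Jt a Ψ 0 ν (coulombic m) (u, θ) = 0 := fun ν => by
    rw [gradCoeff_zero hJ]
    rfl
  cases μ using Fin.cases with
  | zero => rw [hz, h0]
  | succ i =>
    cases ν using Fin.cases with
    | zero => rw [hs, hz, h0']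
    | succ j => rw [gradCoeff_succ hJ, h i j u θ (mem_unitSphere.1 hθ)]

omit hJ ha hΨ in
lemma isSupertranslation_gaugeField (hm : m = 3) (h1 : a + Jt = Ψ)
    (h2 : a = -cst (1 / 2) * lap Ψ) (hΨ : dU Ψ = 0) : IsSupertranslation (gaugeField Jt a Ψ) := by
  have hc : coulombic m - 2 = 0 := by
    unfold coulombic
    omega
  -- The angular part of a supertranslation is minus the gradient of `α`, while here it is plus the
  -- gradient of `Ψ`; hence the sign. For `m = 3` the leading order is `0`, so leading coefficients
  -- are plain limits.
  refine ⟨fun θ => (-Ψ) (0, θ), smoothOnSphere_slice _ 0, fun u θ hθ => ?_⟩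
  rw [mem_unitSphere] at hθ
  have hlim : ∀ μ, Tendsto (fun r => gaugeField Jt a Ψ (event u r θ) μ) atTop
      (𝓝 (gaugeLead Jt a Ψ μ (u, θ))) := by
    intro μ
    have h3 := ((hasExpansion_gaugeField (Jt := Jt) (a := a) (Ψ := Ψ) μ).rayExp u hθ).1.tendsto
      (K := 0) fun j hj => by
        rw [coeffs_apply _ _ _ hθ, gaugeCoeff_eq_zero μ (by omega) (by omega)]
        rfl
    rw [coeffs_apply _ _ _ hθ, ← hc, gaugeCoeff_lead, hc] at h3
    simpa using h3
  have hu : ∀ c : ScriFun m, dU c = 0 → c (0, θ) = c (u, θ) := fun c h => apply_of_dU h 0 u θ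
  rw [laplacianS_eq (c := -Ψ) (fun _ _ => rfl) hθ, LinearMap.map_neg, ScriFun.neg_apply,
    hu (lap Ψ) (by rw [dU_lap, hΨ, map_zero])]
  change Tendsto _ _ (𝓝 (-Ψ (0, θ) + _)) ∧ _
  rw [hu Ψ hΨ]
  have ea : a (u, θ) = -(1 / 2) * lap Ψ (u, θ) := by
    conv_lhs => rw [h2]
    rfl
  have eJ : a (u, θ) + Jt (u, θ) = Ψ (u, θ) := by rw [← ScriFun.add_apply, h1]
  constructor
  · have h3 := (hlim 0).neg
    have e : -gaugeLead Jt a Ψ 0 (u, θ) = -Ψ (u, θ) + -lap Ψ (u, θ) / 2 := by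
      change -Jt (u, θ) = _
      linarith
    rwa [e] at h3
  · intro i
    have h3 := hlim i.succ
    have e : gaugeLead Jt a Ψ i.succ (u, θ) =
        -lap Ψ (u, θ) / 2 * θ i - gradS (fun θ => (-Ψ) (0, θ)) θ i := by
      rw [gradS_eq (c := -Ψ) (fun _ _ => rfl) hθ, Derivation.map_neg, ScriFun.neg_apply,
        hu (D i Ψ) (by rw [dU_D, hΨ, map_zero])]
      change a (u, θ) * th i (u, θ) + D i Ψ (u, θ) = _
      rw [th_apply _ _ hθ, ea]
      ring
    rwa [e] at h3

omit hJ ha hΨ [NeZero m] in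
/-- The products in the symplectic current decay too fast to contribute at null infinity. -/
lemma tendsto_symplectic_product (hm : 3 < m) {F G : ℝ → ℝ} {s t : ℝ}
    (hF : Tendsto (fun r => r ^ ((coulombic m : ℝ) / 2) * F r) atTop (𝓝 s))
    (hG : Tendsto (fun r => r ^ ((((m : ℤ) - 1 : ℤ) : ℝ) / 2) * G r) atTop (𝓝 t)) :
    Tendsto (fun r => r ^ (m - 1) * (F r * G r)) atTop (𝓝 0) := by
  have hm' : (3 : ℝ) < m := by exact_mod_cast hm
  have h1 := (tendsto_rpow_neg_atTop (show 0 < ((m : ℝ) - 3) / 2 by linarith)).mul (hF.mul hG)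
  rw [zero_mul] at h1
  refine h1.congr' ?_
  filter_upwards [eventually_gt_atTop 0] with r hr
  have e : r ^ (m - 1) = r ^ (-(((m : ℝ) - 3) / 2)) * (r ^ ((coulombic m : ℝ) / 2) *
      r ^ ((((m : ℤ) - 1 : ℤ) : ℝ) / 2)) := by
    rw [← Real.rpow_add hr, ← Real.rpow_add hr, ← Real.rpow_natCast, Nat.cast_sub (by omega)]
    congr 1
    unfold coulombic
    push_cast
    ring
  rw [e]
  ring

/-- The generated perturbation starts at Coulombic order, whereas a general one starts at the
radiative order. Each product in the current, times `r ^ (m - 1)`, is of order `r ^ (-(m - 3) / 2)`,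
so for `m > 3` the symplectic density vanishes pointwise. -/
lemma isPureGauge_gaugeField (hm : 3 < m) : IsPureGauge (gaugeField Jt a Ψ) := by
  refine ⟨⟨fun X μ ν => ?_, fun μ ν => ⟨_, hasExpansion_symGrad hJ ha hΨ μ ν,
    fun k hk u θ _ => ?_⟩⟩, fun γ hγ => ⟨fun _ _ => 0, fun u θ hθ => ?_,
    integrable_zero _ _ _, by simp⟩⟩
  · simp only [symGrad, Matrix.of_apply, add_comm]
  · rw [gradCoeff_eq_zero hJ ha hΨ μ ν (fun h => hk ?_) (fun h => hk ?_)]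
    · rfl
    · exact Or.inr ⟨h.ge, by rw [h, coulombic]; exact even_two_mul _⟩
    · exact Or.inr ⟨by omega, by
        rw [h, coulombic]
        exact (even_two_mul _).add even_two⟩
  · rw [mem_unitSphere] at hθ
    have hS := fun μ ν => (hasExpansion_symGrad hJ ha hΨ μ ν).rayExp u hθ
    have hS0 : ∀ μ ν, ∀ k < coulombic m, coeffs (hasExpansion_symGrad hJ ha hΨ μ ν) k = 0 :=
      fun μ ν k hk => ext_sphere fun v y hy => by
        rw [coeffs_apply _ _ _ hy, gradCoeff_eq_zero hJ ha hΨ μ ν hk.ne (by omega)]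
    choose c hc hcz using hγ.2
    have hG := fun μ ν => (hc μ ν).rayExp u hθ
    have hG0 : ∀ μ ν, ∀ k < (m : ℤ) - 1, coeffs (hc μ ν) k = 0 :=
      fun μ ν k hk => ext_sphere fun v y hy => by
        rw [coeffs_apply _ _ _ hy]
        refine hcz μ ν k ?_ v y (mem_unitSphere.2 hy)
        unfold InAnsatz coulombic
        omega
    have ev : ∀ {x : ScriFun m}, x = 0 → x (u, θ) = 0 := fun h => by rw [h]; rfl
    have s0 := fun b e => (hS b e).1.tendsto fun k hk => ev (hS0 b e k hk)
    have s1 := fun d b e => ((hS b e).2.1 d).tendsto fun k hk =>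
      ev (dC_eq_zero_of_lt (hS0 b e) d k hk)
    have g0 := fun b e => (hG b e).1.tendsto fun k hk => ev (hG0 b e k hk)
    have g1 := fun d b e => ((hG b e).2.1 d).tendsto fun k hk =>
      ev (dC_eq_zero_of_lt (hG0 b e) d k hk)
    have hlim := fun b c d e f => ((tendsto_symplectic_product hm (s1 d e f) (g0 b c)).sub
      (tendsto_symplectic_product hm (s0 b c) (g1 d e f))).const_mul (sympP (0 : Fin (m + 1)) b c d e f)
    have hsum := (tendsto_finsetSum Finset.univ fun b _ => tendsto_finsetSum Finset.univ fun c _ =>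
      tendsto_finsetSum Finset.univ fun d _ => tendsto_finsetSum Finset.univ fun e _ =>
      tendsto_finsetSum Finset.univ fun f _ => hlim b c d e f).const_mul (-(1 / (16 * Real.pi)))
    simp only [sub_zero, mul_zero, Finset.sum_const_zero] at hsum
    refine hsum.congr fun r => ?_
    have e1 : ∀ x y : ℝ, r ^ (m - 1) * -(x * y) = -x * (r ^ (m - 1) * y) := fun x y => by ring
    rw [sympCurrent, e1]
    simp only [Finset.mul_sum]
    refine Finset.sum_congr rfl fun b _ => Finset.sum_congr rfl fun c _ =>
      Finset.sum_congr rfl fun d _ => Finset.sum_congr rfl fun e _ =>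
      Finset.sum_congr rfl fun f _ => ?_
    ring

end

end NullMemory

/-! ### Solving for the generator of scalar memory -/

namespace NullMemory

noncomputable section

variable {m : ℕ} [NeZero m]

open ScriFun

variable {U R Θ : ScriFun m} {r S : Fin m → ScriFun m} {t : Fin m → Fin m → ScriFun m}

/-- Tangential memory has vanishing radial potentials. -/
lemma potentials_eq_zero (hR : dU R = 0) (hr : IsVec r) (hS : IsVec S) (ht : IsTen t)
    (h : ∀ j, ∑ i, th i * memTensor U R Θ r S t i j = 0) : U = 0 ∧ ∀ j, D j R = 0 := by
  simp only [sum_th_memTensor hr hS ht] at h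
  have hU : U = 0 := by
    have h1 : ∑ j, th j * (-U * th j + (D j R + r j)) = 0 := by simp [h]
    have h2 : ∀ j, th j * (-U * th j + (D j R + r j)) =
        th j * (th j * -U) + th j * D j R + th j * r j := fun j => by ring
    simp only [h2, Finset.sum_add_distrib, sum_th_mul_th, sum_th_D, hr.tangent, add_zero] at h1
    exact neg_eq_zero.1 h1
  -- With `U = 0` tangency reads `D R = -r`; a gradient equal to a divergence-free field has zero
  -- norm.
  refine ⟨hU, fun j => eq_zero_of_sphereInt_sum (s := Finset.univ) (c := fun j => D j R)
    (fun j _ => by rw [dU_D, hR, map_zero]) ?_ j (Finset.mem_univ j)⟩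
  have h3 : ∀ j, D j R * D j R = -(r j * D j R) := fun j => by
    have h4 := h j
    rw [hU] at h4
    linear_combination D j R * h4
  simp only [h3, Finset.sum_neg_distrib, map_neg]
  exact neg_eq_zero.2 (sphereInt_dot_D hr R)

lemma cst_zero : (cst 0 : ScriFun m) = 0 := ext_sphere fun _ _ _ => rfl

lemma cst_one : (cst 1 : ScriFun m) = 1 := ext_sphere fun _ _ _ => rfl

lemma cst_mul (x y : ℝ) : (cst (x * y) : ScriFun m) = cst x * cst y := ext_sphere fun _ _ _ => rfl

lemma cst_neg (x : ℝ) : (cst (-x) : ScriFun m) = -cst x := ext_sphere fun _ _ _ => rfl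

lemma tf_add (f g : ScriFun m) (i j : Fin m) : tf (f + g) i j = tf f i j + tf g i j := by
  simp only [tf, hs, map_add]
  ring

lemma tf_cst_mul (x : ℝ) (f : ScriFun m) (i j : Fin m) : tf (cst x * f) i j = cst x * tf f i j := by
  have h : ∀ i (g : ScriFun m), D i (cst x * g) = cst x * D i g := fun i g => by
    rw [Derivation.leibniz, D_cst, smul_zero, add_zero, smul_eq_mul]
  simp only [tf, hs, h, lap_cst_mul]
  ring

/-- The data of the covector field that generates scalar memory. -/
theorem exists_gauge_data (hm : 3 ≤ m) (hU : dU U = 0) (hR : dU R = 0) (hΘ : dU Θ = 0)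
    (hr : IsVec r) (hS : IsVec S) (ht : IsTen t)
    (hc : ∀ j, constraint (memTensor U R Θ r S t) j = 0)
    (h3 : m = 3 → ∀ j, ∑ i, th i * memTensor U R Θ r S t i j = 0) :
    ∃ Jt a Ψ : ScriFun m, dU Jt = 0 ∧ dU a = 0 ∧ dU Ψ = 0 ∧
      (∀ i j, gaugeTensor Jt (fun j => a * th j + D j Ψ) i j = memTensor U R Θ 0 0 0 i j) ∧
      (m = 3 → a + Jt = Ψ ∧ a = -cst (1 / 2) * lap Ψ) := by
  have hm' : (3 : ℝ) ≤ m := by exact_mod_cast hm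
  have hsc : ∀ (x : ℝ) (f : ScriFun m), dU f = 0 → dU (cst x * f) = 0 := fun x f hf => by
    rw [Derivation.leibniz, dU_cst, smul_zero, add_zero, hf, smul_zero]
  by_cases h : m = 3
  · have hmr : (m : ℝ) = 3 := by exact_mod_cast h
    obtain ⟨hU0, hR0⟩ := potentials_eq_zero hR hr hS ht (h3 h)
    have ha : dU (-cst (1 / 2) * lap Θ) = 0 := by
      rw [show -cst (1 / 2) * lap Θ = -(cst (1 / 2) * lap Θ) by ring, Derivation.map_neg,
        hsc _ _ (by rw [dU_lap, hΘ, map_zero]), neg_zero]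
    have e1 : -cst (1 / 2) * lap Θ + (Θ - -cst (1 / 2) * lap Θ) = Θ := by ring
    -- For `m = 3` the memory potentials `U` and `D R` vanish. The trace condition gives `a`, and
    -- the radial-angular condition is met by `a + Jt = Ψ`.
    refine ⟨Θ - -cst (1 / 2) * lap Θ, -cst (1 / 2) * lap Θ, Θ, by rw [map_sub, hΘ, ha, sub_zero], ha,
      hΘ, fun i j => gaugeTensor_eq_memTensor ?_ (fun j => ?_) (fun _ _ => rfl) ?_ i j,
      fun _ => ⟨e1, rfl⟩⟩
    · rw [hU0, show (m : ℝ) - 3 = 0 by rw [hmr]; norm_num, cst_zero, zero_mul]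
    · rw [e1, hR0, show (m : ℝ) - 2 = 1 by rw [hmr]; norm_num, cst_one]
      ring
    · rw [hU0, show 1 / ((m : ℝ) - 1) = 1 / 2 by rw [hmr]; norm_num]
      ring
  · have hm3 : (m : ℝ) - 3 ≠ 0 := by
      intro h0
      exact h (by exact_mod_cast (sub_eq_zero.1 h0))
    have hm2 : (m : ℝ) - 2 ≠ 0 := by linarith
    have hm1 : (m : ℝ) - 1 ≠ 0 := by linarith
    have htf := tf_eq_zero_of_constraint hm hr hS ht hU hR hΘ hc
    set x : ℝ := (m : ℝ) - 3 with hx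
    set y : ℝ := (m : ℝ) - 2 with hy
    set z : ℝ := (m : ℝ) - 1 with hz
    -- The radial-radial equation requires `a + Jt = U / x`, and the radial-angular one then gives
    -- `Ψ = (U / x - 2 R) / y`. The trace-free angular equation is not at our disposal: it is the
    -- constraint `htf`.
    set Ψ : ScriFun m := cst (1 / (x * y)) * U + cst (-(2 / y)) * R with hΨ
    have hΨu : dU Ψ = 0 := by rw [hΨ, map_add, hsc _ _ hU, hsc _ _ hR, add_zero]
    -- The angular trace fixes `a`; then `Jt` is what is left of `U / x`.
    set a : ScriFun m := cst (1 / z) * (U + cst (-1) * lap Ψ) with ha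
    have hau : dU a = 0 := by
      rw [ha]
      refine hsc _ _ ?_
      rw [map_add, hU, hsc _ _ (by rw [dU_lap, hΨu, map_zero]), add_zero]
    have hneg : (cst (-1) : ScriFun m) = -1 := by rw [cst_neg, cst_one]
    refine ⟨cst (1 / x) * U - a, a, Ψ, by rw [map_sub, hau, hsc _ _ hU, sub_zero], hau, hΨu,
      fun i j => gaugeTensor_eq_memTensor ?_ (fun j => ?_) (fun i j => ?_) ?_ i j,
      fun h' => absurd h' h⟩
    · rw [← hx, add_sub_cancel, ← mul_assoc, cst_mul_inv hm3, one_mul]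
    · have e1 : ∀ (s : ℝ) (f : ScriFun m), D j (cst s * f) = cst s * D j f := fun s f => by
        rw [Derivation.leibniz, D_cst, smul_zero, add_zero, smul_eq_mul]
      have e2 : (cst y * cst (1 / (x * y)) : ScriFun m) = cst (1 / x) := by
        rw [← cst_mul]
        congr 1
        field_simp
      have e3 : (cst y * cst (-(2 / y)) : ScriFun m) = -2 := by
        rw [← cst_mul, show y * -(2 / y) = -2 by field_simp, cst_neg]
        rfl
      rw [add_sub_cancel, ← hy, hΨ, map_add, e1, e1, e1]
      linear_combination -D j U * e2 - D j R * e3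
    · have h1 := htf i j
      -- The combination in the constraint is a nonzero multiple of `Ψ - Θ`, so the two trace-free
      -- Hessians agree.
      have e4 : U - cst (2 * x) * R - cst (x * y) * Θ =
          cst (x * y) * (Ψ + cst (-1) * Θ) := by
        have e5 : (cst (x * y) * cst (1 / (x * y)) : ScriFun m) = 1 :=
          cst_mul_inv (mul_ne_zero hm3 hm2)
        have e6 : (cst (x * y) * cst (-(2 / y)) : ScriFun m) = -cst (2 * x) := by
          rw [← cst_mul, show x * y * -(2 / y) = -(2 * x) by field_simp, cst_neg]
        rw [hΨ, hneg]
        linear_combination -U * e5 - R * e6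
      rw [e4, tf_cst_mul, tf_add, tf_cst_mul, hneg] at h1
      have e7 := congrArg (cst (1 / (x * y)) * ·) h1
      simp only [mul_zero, ← mul_assoc] at e7
      rw [mul_comm (cst (1 / (x * y))), cst_mul_inv (mul_ne_zero hm3 hm2)] at e7
      linear_combination e7
    · rw [← hz, ha, hneg]
      ring

section Decomposition

variable {Δ : Space m → Matrix (Fin (m + 1)) (Fin (m + 1)) ℝ}
  {U R Θ : Space m → ℝ} {r S : Space m → Fin m → ℝ} {t : Space m → Fin m → Fin m → ℝ}

lemma IsMemoryDecomposition.dU_memTensor (hd : IsMemoryDecomposition Δ U R Θ r S t)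
    (i j : Fin m) : dU (memTensor (ofSphere U hd.smooth_U) (ofSphere R hd.smooth_R)
      (ofSphere Θ hd.smooth_Θ) hd.vector_R.comp hd.vector_S.comp hd.tensor_S.comp i j) = 0 :=
  ext_sphere fun u θ hθ => by
    refine (hasDerivAt_dU _ u θ).unique ?_
    have : (fun s => memTensor (ofSphere U hd.smooth_U) (ofSphere R hd.smooth_R)
        (ofSphere Θ hd.smooth_Θ) hd.vector_R.comp hd.vector_S.comp hd.tensor_S.comp i j (s, θ)) =
        fun _ => Δ θ i.succ j.succ := funext fun s => (hd.apply_succ s hθ i j).symm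
    rw [this]
    exact hasDerivAt_const _ _

variable {Ω : Set (Event m)} {g T : TensorField m} {h τ : TensorCoeff m}

lemma IsMemoryDecomposition.constraint_memTensor (hd : IsMemoryDecomposition Δ U R Θ r S t)
    (hm : 3 ≤ m) (hst : IsRadiatingSpacetime Ω g T h τ) (hΔ : IsMemoryTensor g Δ) (j : Fin m) :
    constraint (memTensor (ofSphere U hd.smooth_U) (ofSphere R hd.smooth_R)
      (ofSphere Θ hd.smooth_Θ) hd.vector_R.comp hd.vector_S.comp hd.tensor_S.comp) j = 0 :=
  hst.constraint_memory hm hΔ hd.dU_memTensor (fun i j _ hθ => hd.apply_succ 0 hθ i j) j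

/-- The memory tensor of a spacetime with radiation determines a diffeomorphism that generates its
scalar part. -/
theorem exists_scalar_memory_gauge (hm : 3 ≤ m) (hst : IsRadiatingSpacetime Ω g T h τ)
    (hΔ : IsMemoryTensor g Δ) (hd : IsMemoryDecomposition Δ U R Θ r S t) :
    ∃ ξ : CovectorField m, HasMemoryForm ξ ∧ SlowGradVanishes ξ ∧
      CoulombicGradEq ξ (scalarMemory U R Θ) ∧
      (m = 3 → IsSupertranslation ξ) ∧ (3 < m → IsPureGauge ξ) := by
  obtain ⟨Jt, a, Ψ, hJ, ha, hΨ, hg, h3⟩ := exists_gauge_data hm (dU_ofSphere _ _)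
    (dU_ofSphere _ _) (dU_ofSphere _ _) hd.vector_R.isVec hd.vector_S.isVec hd.tensor_S.isTen
    (hd.constraint_memTensor hm hst hΔ) fun h => hst.tangential_memory h hΔ hd.dU_memTensor
      fun i j _ hθ => hd.apply_succ 0 hθ i j
  refine ⟨gaugeField Jt a Ψ, hasMemoryForm_gaugeField hJ ha hΨ, slowGradVanishes_gaugeField hJ ha hΨ,
    coulombicGradEq_gaugeField hJ ha hΨ (assemble_zero_left _ _ _) (assemble_zero_right _ _ _)
      fun i j u θ hθ => ?_,
    fun h => isSupertranslation_gaugeField h (h3 h).1 (h3 h).2 hΨ, isPureGauge_gaugeField hJ ha hΨ⟩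
  rw [hg, scalarMemory_eq hd.smooth_U hd.smooth_R hd.smooth_Θ u hθ]

end Decomposition

end

end NullMemory

/-! ### The main theorem -/

open NullMemory
theorem mainTheorem11 (m : ℕ) (hm : 3 ≤ m)
    (Ω : Set (Event m)) (g T : TensorField m) (h τ : TensorCoeff m)
    (hst : IsRadiatingSpacetime Ω g T h τ)
    (Δ : Space m → Matrix (Fin (m + 1)) (Fin (m + 1)) ℝ) (hΔ : IsMemoryTensor g Δ)
    (U R Θ : Space m → ℝ) (Rv Sv : Space m → Fin m → ℝ) (St : Space m → Fin m → Fin m → ℝ)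
    (hdec : IsMemoryDecomposition Δ U R Θ Rv Sv St) :
    (∃ ξ : CovectorField m, HasMemoryForm ξ ∧ SlowGradVanishes ξ ∧
      CoulombicGradEq ξ (scalarMemory U R Θ) ∧
      (m = 3 → IsSupertranslation ξ) ∧ (3 < m → IsPureGauge ξ)) ∧
    ∀ ξ : CovectorField m, HasCovectorExpansion ξ →
      ((∃ θ ∈ unitSphere m, vectorMemory Rv Sv θ ≠ 0) →
        ¬ CoulombicGradEq ξ Δ ∧ ¬ CoulombicGradEq ξ (vectorMemory Rv Sv)) ∧
      ((∃ θ ∈ unitSphere m, tensorMemory St θ ≠ 0) →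
        ¬ CoulombicGradEq ξ Δ ∧ ¬ CoulombicGradEq ξ (tensorMemory St)) := by
  have : NeZero m := ⟨by omega⟩
  have hc := hdec.constraint_memTensor hm hst hΔ
  refine ⟨exists_scalar_memory_gauge hm hst hΔ hdec, fun ξ hξ => ⟨?_, ?_⟩⟩
  · rintro ⟨θ, hθ, hne⟩
    exact ⟨fun h => hne (vector_memory_not_gauge hdec hξ hm hc (Or.inl h) (mem_unitSphere.1 hθ)),
      fun h => hne (vector_memory_not_gauge hdec hξ hm hc (Or.inr h) (mem_unitSphere.1 hθ))⟩
  · rintro ⟨θ, hθ, hne⟩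
    exact ⟨fun h => hne (tensor_memory_not_gauge hdec hξ (Or.inl h) (mem_unitSphere.1 hθ)),
      fun h => hne (tensor_memory_not_gauge hdec hξ (Or.inr h) (mem_unitSphere.1 hθ))⟩
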